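/- **Setting.** Let $(\mathscr V,\otimes,E)$ be a complete and cocomplete closed symmetric monoidal category, equipped with a strong monoidal functor $L\colon \mathbf{sSet}\to\mathscr V$ (for the cartesian product of simplicial sets) that has a right adjoint, and put $\Delta^n=L(\Delta[n])$. Let $\mathscr M$ be a complete and cocomplete $\mathscr V$-category, with tensors $K\odot X$ and cotensors $\{K,X\}$, and let $\mathscr D$ be a small $\mathscr V$-category. For a $\mathscr V$-category $\mathscr N$ write $\mathscr N_0$ for the underlying category and $\mathscr N^{\mathscr D}$ for the $\mathscr V$-category of $\mathscr V$-functors $\mathscr D\to\mathscr N$. For $\mathscr V$-functors $G\colon\mathscr D^{op}\to\mathscr V$ and $F\colon\mathscr D\to\mathscr M$ put $$G\odot_{\mathscr D}F=\operatorname{coeq}\Big(\coprod_{d,d'}(Gd'\otimes\mathscr D(d,d'))\odot Fd\rightrightarrows\coprod_d Gd\odot Fd\Big),$$ let $B_\bullet(G,\mathscr D,F)$ be the simplicial object with $$B_n(G,\mathscr D,F)=\coprod_{\alpha_0,\dots,\alpha_n\in\mathscr D}\big(G\alpha_n\otimes\mathscr D(\alpha_{n-1},\alpha_n)\otimes\cdots\otimes\mathscr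 D(\alpha_0,\alpha_1)\big)\odot F\alpha_0$$ (faces from composition in $\mathscr D$ and the actions on $G$ and $F$, degeneracies from the units), and let $B(G,\mathscr D,F)=\int^n\Delta^n\odot B_n(G,\mathscr D,F)$ be its geometric realization. There is a natural map $B(G,\mathscr D,F)\to G\odot_{\mathscr D}F$. Write $B(\mathscr D,\mathscr D,F)\in\mathscr M^{\mathscr D}$ for $e\mapsto B(\mathscr D(-,e),\mathscr D,F)$ and $B(G,\mathscr D,\mathscr D)\in\mathscr V^{\mathscr D^{op}}$ for $e\mapsto B(G,\mathscr D,\mathscr D(e,-))$. Dually, for $G\colon\mathscr D\to\mathscr V$ and $F\colon\mathscr D\to\mathscr M$ there are the cotensor product $\{G,F\}^{\mathscr D}=\operatorname{eq}\big(\prod_d\{Gd,Fd\}\rightrightarrows\prod_{d,d'}\{\mathscr D(d,d')\otimes Gd,Fd'\}\big)$, the cobar construction $C(G,\mathscr D,F)$, which is the totalization $\int_n\{\Delta^n,C^n(G,\mathscr D,F)\}$ of the cosimplicial object $$C^n(G,\mathscr D,F)=\prod_{\alpha_0,\dots,\alpha_n}\big\{\mathscr D(\alpha_{n-1},\alpha_n)\otimes\cdots\otimes\mathscr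 D(\alpha_0,\alpha_1)\otimes G\alpha_0,\;F\alpha_n\big\},$$ the natural map $\{G,F\}^{\mathscr D}\to C(G,\mathscr D,F)$, and the diagram $C(\mathscr D,\mathscr D,F)\in\mathscr M^{\mathscr D}$, $e\mapsto C(\mathscr D(e,-),\mathscr D,F)$. For covariant $G\colon\mathscr D\to\mathscr V$ write $B(G,\mathscr D,\mathscr D)\in\mathscr V^{\mathscr D}$ for the diagram $e\mapsto B(\mathscr D(-,e),\mathscr D,G)$. A *homotopical category* is a category with a class of weak equivalences that contains the identities and satisfies 2-out-of-6. A *left deformation* of it is an endofunctor $Q$ with a natural weak equivalence $q\colon Q\to\mathrm{Id}$; a *left deformation retract* is a full subcategory containing the image of some left deformation; it is a *left deformation retract for a functor $T$* if moreover $T$ preserves weak equivalences between its objects. A *(point-set) left derived functor* of $T\colon\mathscr A\to\mathscr B$ is a functor $T'\colon \mathscr A\to\mathscr B$ with a map $T'\to T$ such that, for the localization $\delta\colon\mathscr B\to\operatorname{Ho}\mathscr B$, the functor $\delta T'$ inverts weak equivalences and is terminal among functors $\mathscr A\to\operatorname{Ho}\mathscr B$ that invert weak equivalences and are equipped with a map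 to $\delta T$. The right-handed notions are dual. Two maps $f,g\colon X\to Y$ of $\mathscr V$ or $\mathscr M$ are *simplicially homotopic* if they are related by the equivalence relation generated by the maps $\Delta^1\to\mathscr M(X,Y)$ with endpoints $f$ and $g$; this gives the notion of *simplicial homotopy equivalence*. Assume that $\mathscr V_0$ and $\mathscr M_0$ are homotopical categories in which all simplicial homotopy equivalences (of $\mathscr V$ and of $\mathscr M$) are weak equivalences; give diagram categories the objectwise weak equivalences. For full subcategories $\mathscr V_Q\subset\mathscr V$ and $\mathscr M_Q\subset\mathscr M$ let $\mathscr V_Q^{\mathscr D}$, $\mathscr M_Q^{\mathscr D}$, etc., be the full subcategories of the diagrams that are objectwise in $\mathscr V_Q$, $\mathscr M_Q$. **Theorem (tensor products).** Suppose that $\mathscr D$ is good for the tensor $\odot$ of $\mathscr M$, by means of $\mathscr V_Q$ and $\mathscr M_Q$; that is, $\mathscr V_Q$ and $\mathscr M_Q$ are left deformation retracts of $\mathscr V_0$ and $\mathscr M_0$, $B(-,\mathscr D,-)$ preserves weak equivalences on $\mathscr V_Q^{\mathscr D^{op}}\times\mathscr M_Q^{\mathscr D}$, and for $F\in\mathscr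 M_Q^{\mathscr D}$ and $G\in\mathscr V_Q^{\mathscr D^{op}}$ one has $B(\mathscr D,\mathscr D,F)\in\mathscr M_Q^{\mathscr D}$ and $B(G,\mathscr D,\mathscr D)\in\mathscr V_Q^{\mathscr D^{op}}$. Suppose that $\mathscr V_Q^{\mathscr D^{op}}$ and $\mathscr M_Q^{\mathscr D}$ are left deformation retracts of $(\mathscr V^{\mathscr D^{op}})_0$ and $(\mathscr M^{\mathscr D})_0$. Let $\mathscr M_{BQ}^{\mathscr D}\subset\mathscr M^{\mathscr D}$ be the full subcategory of the diagrams isomorphic to some $B(\mathscr D,\mathscr D,F)$ with $F\in\mathscr M_Q^{\mathscr D}$. Then $(\mathscr V_Q^{\mathscr D^{op}})_0\times(\mathscr M_{BQ}^{\mathscr D})_0$ is a left deformation retract for $$\odot_{\mathscr D}\colon(\mathscr V^{\mathscr D^{op}})_0\times(\mathscr M^{\mathscr D})_0\to\mathscr M_0 .$$ Moreover, for all left deformations $Q_{\mathscr V}$ of $(\mathscr V^{\mathscr D^{op}})_0$ into $\mathscr V_Q^{\mathscr D^{op}}$ and $Q_{\mathscr M}$ of $(\mathscr M^{\mathscr D})_0$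 into $\mathscr M_Q^{\mathscr D}$, the corrected homotopy tensor product $(G,F)\mapsto B(Q_{\mathscr V}G,\mathscr D,Q_{\mathscr M}F)$, with the map $B(Q_{\mathscr V}G,\mathscr D,Q_{\mathscr M}F)\to Q_{\mathscr V}G\odot_{\mathscr D}Q_{\mathscr M}F\to G\odot_{\mathscr D}F$, is a left derived functor of $\odot_{\mathscr D}$. **Theorem (cotensor products).** Suppose that $\mathscr D$ is good for the cotensor of $\mathscr M$, by means of $\mathscr V_Q$ and $\mathscr M_R$; that is, $\mathscr V_Q$ is a left deformation retract of $\mathscr V_0$ and $\mathscr M_R$ is a right deformation retract of $\mathscr M_0$, $C(-,\mathscr D,-)$ preserves weak equivalences on $(\mathscr V_Q^{\mathscr D})^{op}\times\mathscr M_R^{\mathscr D}$, and for $F\in\mathscr M_R^{\mathscr D}$ and $G\in\mathscr V_Q^{\mathscr D}$ one has $C(\mathscr D,\mathscr D,F)\in\mathscr M_R^{\mathscr D}$ and $B(G,\mathscr D,\mathscr D)\in\mathscr V_Q^{\mathscr D}$. Suppose that $\mathscr V_Q^{\mathscr D}$ is a left deformation retract of $(\mathscr V^{\mathscr D})_0$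 and $\mathscr M_R^{\mathscr D}$ is a right deformation retract of $(\mathscr M^{\mathscr D})_0$. Let $\mathscr M_{CR}^{\mathscr D}\subset\mathscr M^{\mathscr D}$ be the full subcategory of the diagrams isomorphic to some $C(\mathscr D,\mathscr D,F)$ with $F\in\mathscr M_R^{\mathscr D}$. Then $(\mathscr V_Q^{\mathscr D})_0^{op}\times(\mathscr M_{CR}^{\mathscr D})_0$ is a right deformation retract for $$\{-,-\}^{\mathscr D}\colon(\mathscr V^{\mathscr D})_0^{op}\times(\mathscr M^{\mathscr D})_0\to\mathscr M_0 .$$ Moreover, for every left deformation $Q$ of $(\mathscr V^{\mathscr D})_0$ into $\mathscr V_Q^{\mathscr D}$ and every right deformation $R$ of $(\mathscr M^{\mathscr D})_0$ into $\mathscr M_R^{\mathscr D}$, the corrected homotopy cotensor product $(G,F)\mapsto C(QG,\mathscr D,RF)$, with the map $\{G,F\}^{\mathscr D}\to\{QG,RF\}^{\mathscr D}\to C(QG,\mathscr D,RF)$, is a right derived functor of $\{-,-\}^{\mathscr D}$. -/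

import Mathlib

open CategoryTheory MonoidalCategory Limits Opposite
open scoped MonoidalClosed

universe v u₁ u₂

set_option linter.unusedSectionVars false

noncomputable section

namespace EnrichedBar

/-! ### Tensors, cotensors, and bicomplete enriched categories -/

section Tensors

variable (V : Type u₁) [Category.{v} V] [MonoidalCategory V] [SymmetricCategory V]
  [MonoidalClosed V] {N : Type u₂} [Category.{v} N] [EnrichedOrdinaryCategory V N]

/-- The composite of two generalized elements of hom-objects. -/
def gcomp {X Y Z : N} {K L : V} (u : K ⟶ (X ⟶[V] Y)) (w : L ⟶ (Y ⟶[V] Z)) :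
    K ⊗ L ⟶ (X ⟶[V] Z) :=
  (u ⊗ₘ w) ≫ eComp V X Y Z

/-- A tensor of `X : N` by `K : V`: an object `obj` with `K ⟶ N(X, obj)` inducing isomorphisms
`N(obj, Y) ≅ [K, N(X, Y)]` in `V`. -/
structure TensorObj (K : V) (X : N) where
  /-- the tensor -/
  obj : N
  /-- the universal generalized element -/
  unit : K ⟶ (X ⟶[V] obj)
  isIso : ∀ Y : N, IsIso (MonoidalClosed.curry (unit ▷ (obj ⟶[V] Y) ≫ eComp V X obj Y) :
    (obj ⟶[V] Y) ⟶ (ihom K).obj (X ⟶[V] Y))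

/-- A cotensor of `Y : N` by `K : V`: an object `obj` with `K ⟶ N(obj, Y)` inducing isomorphisms
`N(X, obj) ≅ [K, N(X, Y)]` in `V`. -/
structure CotensorObj (K : V) (Y : N) where
  /-- the cotensor -/
  obj : N
  /-- the universal generalized element -/
  counit : K ⟶ (obj ⟶[V] Y)
  isIso : ∀ X : N, IsIso (MonoidalClosed.curry
    (counit ▷ (X ⟶[V] obj) ≫ (β_ _ _).hom ≫ eComp V X obj Y) :
    (X ⟶[V] obj) ⟶ (ihom K).obj (X ⟶[V] Y))

variable (N) in
/-- A `V`-category with all tensors and cotensors, whose underlying ordinary category is complete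
and cocomplete; that is, a complete and cocomplete `V`-category. (In the presence of tensors and
cotensors, ordinary limits and colimits are automatically `V`-limits and `V`-colimits.) -/
class EnrichedBicomplete where
  /-- the tensors -/
  tensor : ∀ (K : V) (X : N), TensorObj V K X
  /-- the cotensors -/
  cotensor : ∀ (K : V) (X : N), CotensorObj V K X
  hasLimits : HasLimits N
  hasColimits : HasColimits N

attribute [instance] EnrichedBicomplete.hasLimits EnrichedBicomplete.hasColimits

/-- A tensor is a cotensor in the opposite. -/
def TensorObj.toOp {K : V} {X : N} (T : TensorObj V K X) : CotensorObj V K (op X) where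
  obj := op T.obj
  counit := T.unit
  isIso Y := by
    have h : T.unit ▷ (T.obj ⟶[V] Y.unop) ≫ (β_ _ _).hom ≫ (β_ _ _).hom ≫ eComp V X T.obj Y.unop =
        T.unit ▷ (T.obj ⟶[V] Y.unop) ≫ eComp V X T.obj Y.unop := by simp
    have := T.isIso Y.unop
    rw [← h] at this
    exact this

/-- A cotensor is a tensor in the opposite. -/
def CotensorObj.toOp {K : V} {X : N} (T : CotensorObj V K X) : TensorObj V K (op X) where
  obj := op T.obj
  unit := T.counit
  isIso Y := T.isIso Y.unop

variable (N) in
instance EnrichedBicomplete.opposite [EnrichedBicomplete V N] : EnrichedBicomplete V Nᵒᵖ where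
  tensor K X := (EnrichedBicomplete.cotensor K X.unop).toOp
  cotensor K X := (EnrichedBicomplete.tensor K X.unop).toOp
  hasLimits := inferInstance
  hasColimits := inferInstance

variable [EnrichedBicomplete V N]
variable {V}

/-- The tensor `K ⊙ X`. -/
def ten (K : V) (X : N) : N := (EnrichedBicomplete.tensor K X).obj

/-- The universal `K ⟶ N(X, K ⊙ X)`. -/
def tenUnit (K : V) (X : N) : K ⟶ (X ⟶[V] ten K X) := (EnrichedBicomplete.tensor K X).unit

lemma tenHom_bijective (A K : V) (X Y : N) :
    Function.Bijective (fun f : A ⟶ (ten K X ⟶[V] Y) => gcomp V (tenUnit K X) f) := by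
  have := (EnrichedBicomplete.tensor K X).isIso Y
  have h : (fun f : A ⟶ (ten K X ⟶[V] Y) => gcomp V (tenUnit K X) f) = fun f =>
    MonoidalClosed.uncurry (f ≫ (MonoidalClosed.curry
      (tenUnit K X ▷ (ten K X ⟶[V] Y) ≫ eComp V X (ten K X) Y))) := by
    funext f
    rw [MonoidalClosed.uncurry_natural_left, MonoidalClosed.uncurry_curry]
    exact (by simp [gcomp, MonoidalCategory.tensorHom_def'] : gcomp V (tenUnit K X) f = K ◁ f ≫
      (tenUnit K X ▷ (ten K X ⟶[V] Y)) ≫ eComp V X (ten K X) Y)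
  rw [h]
  change IsIso (MonoidalClosed.curry
      (tenUnit K X ▷ (ten K X ⟶[V] Y) ≫ eComp V X (ten K X) Y)) at this
  constructor
  · intro f g hfg
    have := MonoidalClosed.uncurry_injective hfg
    simpa [cancel_mono] using this
  · intro g
    refine ⟨MonoidalClosed.curry g ≫ inv (MonoidalClosed.curry
      (tenUnit K X ▷ (ten K X ⟶[V] Y) ≫ eComp V X (ten K X) Y)), ?_⟩
    simp

/-- Maps `A ⟶ N(K ⊙ X, Y)` are maps `K ⊗ A ⟶ N(X, Y)`. -/
def tenHom {A K : V} {X Y : N} : (A ⟶ (ten K X ⟶[V] Y)) ≃ (K ⊗ A ⟶ (X ⟶[V] Y)) :=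
  Equiv.ofBijective _ (tenHom_bijective A K X Y)


variable {W X Y Z X' Y' : N} {J K L P K' L' : V}

lemma gcomp_assoc (u : J ⟶ (W ⟶[V] X)) (w : K ⟶ (X ⟶[V] Y)) (x : L ⟶ (Y ⟶[V] Z)) :
    gcomp V (gcomp V u w) x = (α_ _ _ _).hom ≫ gcomp V u (gcomp V w x) := by
  simp only [gcomp]
  have h := e_assoc V W X Y Z
  rw [← cancel_epi (α_ J K L).inv, Iso.inv_hom_id_assoc]
  have h' : ((u ⊗ₘ w) ≫ eComp V W X Y) ⊗ₘ x = ((u ⊗ₘ w) ⊗ₘ x) ≫ eComp V W X Y ▷ _ := by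
    rw [← tensorHom_id, tensorHom_comp_tensorHom, Category.comp_id]
  calc _ = (α_ J K L).inv ≫ ((u ⊗ₘ w) ⊗ₘ x) ≫ eComp V W X Y ▷ _ ≫ eComp V W Y Z := by
        rw [h', Category.assoc]
    _ = (u ⊗ₘ (w ⊗ₘ x)) ≫ _ ◁ eComp V X Y Z ≫ eComp V W X Z := by
        rw [← associator_inv_naturality_assoc, h]
    _ = _ := by simp [MonoidalCategory.tensorHom_def]

lemma comp_gcomp (s : K' ⟶ K) (t : L' ⟶ L) (u : K ⟶ (X ⟶[V] Y)) (w : L ⟶ (Y ⟶[V] Z)) :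
    gcomp V (s ≫ u) (t ≫ w) = (s ⊗ₘ t) ≫ gcomp V u w := by
  simp [gcomp]

lemma comp_gcomp_left (s : K' ⟶ K) (u : K ⟶ (X ⟶[V] Y)) (w : L ⟶ (Y ⟶[V] Z)) :
    gcomp V (s ≫ u) w = s ▷ L ≫ gcomp V u w := by
  simp [gcomp, MonoidalCategory.tensorHom_def]

lemma comp_gcomp_right (t : L' ⟶ L) (u : K ⟶ (X ⟶[V] Y)) (w : L ⟶ (Y ⟶[V] Z)) :
    gcomp V u (t ≫ w) = K ◁ t ≫ gcomp V u w := by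
  simp [gcomp, MonoidalCategory.tensorHom_def']

lemma gcomp_whiskerLeft (u : K ⟶ (X ⟶[V] Y)) (w : L ⟶ (Y ⟶[V] Z)) (g : Z ⟶ Y') :
    gcomp V u (w ≫ eHomWhiskerLeft V Y g) = gcomp V u w ≫ eHomWhiskerLeft V X g := by
  simp [gcomp, MonoidalCategory.tensorHom_def, eComp_eHomWhiskerLeft]

lemma gcomp_whiskerRight (f : X' ⟶ X) (u : K ⟶ (X ⟶[V] Y)) (w : L ⟶ (Y ⟶[V] Z)) :
    gcomp V (u ≫ eHomWhiskerRight V f Y) w = gcomp V u w ≫ eHomWhiskerRight V f Z := by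
  simp [gcomp, MonoidalCategory.tensorHom_def', eComp_eHomWhiskerRight]

lemma gcomp_middle (u : K ⟶ (X ⟶[V] Y)) (g : Y ⟶ Y') (w : L ⟶ (Y' ⟶[V] Z)) :
    gcomp V (u ≫ eHomWhiskerLeft V X g) w = gcomp V u (w ≫ eHomWhiskerRight V g Z) := by
  have h : eHomWhiskerLeft V X g ▷ (Y' ⟶[V] Z) ≫ eComp V X Y' Z =
      (X ⟶[V] Y) ◁ eHomWhiskerRight V g Z ≫ eComp V X Y Z := by
    simp only [eHomWhiskerLeft, eHomWhiskerRight, comp_whiskerRight, Category.assoc,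
      MonoidalCategory.whiskerLeft_comp]
    rw [← e_assoc' V X Y Y' Z]
    simp
  simp only [gcomp]
  calc _ = (u ⊗ₘ w) ≫ eHomWhiskerLeft V X g ▷ (Y' ⟶[V] Z) ≫ eComp V X Y' Z := by
        simp [MonoidalCategory.tensorHom_def, whisker_exchange_assoc]
    _ = _ := by rw [h]; simp [MonoidalCategory.tensorHom_def]

lemma eId_gcomp (w : L ⟶ (X ⟶[V] Z)) : gcomp V (eId V X) w = (λ_ L).hom ≫ w := by
  have h : eId V X ▷ (X ⟶[V] Z) ≫ eComp V X X Z = (λ_ _).hom := by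
    rw [← cancel_epi (λ_ _).inv, e_id_comp, Iso.inv_hom_id]
  simp [gcomp, MonoidalCategory.tensorHom_def', h]

lemma gcomp_eId (w : L ⟶ (X ⟶[V] Z)) : gcomp V w (eId V Z) = (ρ_ L).hom ≫ w := by
  have h : (X ⟶[V] Z) ◁ eId V Z ≫ eComp V X Z Z = (ρ_ _).hom := by
    rw [← cancel_epi (ρ_ _).inv, e_comp_id, Iso.inv_hom_id]
  simp [gcomp, MonoidalCategory.tensorHom_def, h]

lemma gcomp_eHomEquiv (w : L ⟶ (X ⟶[V] Y)) (g : Y ⟶ Z) :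
    gcomp V w (eHomEquiv V g) = (ρ_ L).hom ≫ w ≫ eHomWhiskerLeft V X g := by
  simp [gcomp, MonoidalCategory.tensorHom_def, eHomWhiskerLeft]

lemma eHomEquiv_gcomp (f : X ⟶ Y) (w : L ⟶ (Y ⟶[V] Z)) :
    gcomp V (eHomEquiv V f) w = (λ_ L).hom ≫ w ≫ eHomWhiskerRight V f Z := by
  simp [gcomp, MonoidalCategory.tensorHom_def', eHomWhiskerRight]

/-! The tensor as a functor of two variables, and its structure maps. -/

lemma tenHom_apply (f : J ⟶ (ten K X ⟶[V] Y)) : tenHom f = gcomp V (tenUnit K X) f := rfl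

/-- Maps `K ⊙ X ⟶ Y` are maps `K ⟶ N(X, Y)`. -/
def tenEquiv : (ten K X ⟶ Y) ≃ (K ⟶ (X ⟶[V] Y)) :=
  (eHomEquiv V).trans (tenHom.trans ((ρ_ K).homFromEquiv))

/-- The adjunct of a map `K ⊙ X ⟶ Y`. -/
def ad (f : ten K X ⟶ Y) : K ⟶ (X ⟶[V] Y) := tenUnit K X ≫ eHomWhiskerLeft V X f

lemma tenEquiv_apply (f : ten K X ⟶ Y) : tenEquiv f = ad f := by
  simp [tenEquiv, tenHom_apply, gcomp_eHomEquiv, ad]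

/-- The map `K ⊙ X ⟶ Y` with a given adjunct. -/
def tenDesc (u : K ⟶ (X ⟶[V] Y)) : ten K X ⟶ Y := tenEquiv.symm u

@[simp]
lemma ad_tenDesc (u : K ⟶ (X ⟶[V] Y)) : ad (tenDesc u) = u := by
  rw [← tenEquiv_apply, tenDesc, Equiv.apply_symm_apply]

lemma ten_ext {f g : ten K X ⟶ Y} (h : ad f = ad g) : f = g := by
  apply tenEquiv.injective
  simpa [tenEquiv_apply] using h

lemma ten_gext {f g : J ⟶ (ten K X ⟶[V] Y)} (h : gcomp V (tenUnit K X) f =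
    gcomp V (tenUnit K X) g) : f = g := tenHom.injective h

lemma ten_ext₂ {f g : ten K (ten L X) ⟶ Y}
    (h : gcomp V (tenUnit L X) (ad f) = gcomp V (tenUnit L X) (ad g)) : f = g :=
  ten_ext (ten_gext h)

lemma ten_ext₃ {f g : ten K (ten L (ten J X)) ⟶ Y}
    (h : gcomp V (tenUnit J X) (gcomp V (tenUnit L _) (ad f)) =
      gcomp V (tenUnit J X) (gcomp V (tenUnit L _) (ad g))) : f = g :=
  ten_ext₂ (ten_gext h)

/-- The functoriality `K ⊙ X ⟶ K' ⊙ X'` of tensors. -/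
def tenMap (s : K ⟶ K') (f : X ⟶ X') : ten K X ⟶ ten K' X' :=
  tenDesc (s ≫ tenUnit K' X' ≫ eHomWhiskerRight V f _)

/-- The map `K ⊙ (L ⊙ X) ⟶ P ⊙ X` given by `s : L ⊗ K ⟶ P`. -/
def tenComp (s : L ⊗ K ⟶ P) (X : N) : ten K (ten L X) ⟶ ten P X :=
  tenDesc (tenHom.symm (s ≫ tenUnit P X))

/-- The map `X ⟶ P ⊙ X` given by `e : 𝟙 ⟶ P`. -/
def tenPt (e : 𝟙_ V ⟶ P) (X : N) : X ⟶ ten P X :=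
  (eHomEquiv V).symm (e ≫ tenUnit P X)

/-- The map `P ⊙ X ⟶ X` given by `e : P ⟶ 𝟙`. -/
def tenCounit (e : P ⟶ 𝟙_ V) (X : N) : ten P X ⟶ X := tenDesc (e ≫ eId V X)

lemma ad_comp (f : ten K X ⟶ Y) (g : Y ⟶ Z) : ad (f ≫ g) = ad f ≫ eHomWhiskerLeft V X g := by
  simp [ad]

lemma ad_id : ad (𝟙 (ten K X)) = tenUnit K X := by simp [ad]

lemma tenUnit_gcomp (f : ten L X ⟶ Y) (w : K ⟶ (Y ⟶[V] Z)) :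
    gcomp V (tenUnit L X) (w ≫ eHomWhiskerRight V f Z) = gcomp V (ad f) w := by
  rw [← gcomp_middle]; rfl

lemma ad_tenMap (s : K ⟶ K') (f : X ⟶ X') :
    ad (tenMap s f) = s ≫ tenUnit K' X' ≫ eHomWhiskerRight V f _ := by
  simp [tenMap]

lemma ad_tenMap_comp (s : K ⟶ K') (f : X ⟶ X') (g : ten K' X' ⟶ Y) :
    ad (tenMap s f ≫ g) = s ≫ ad g ≫ eHomWhiskerRight V f _ := by
  simp only [ad_comp, ad_tenMap, Category.assoc, ← eHom_whisker_exchange]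
  simp only [ad, Category.assoc]

lemma ad_tenComp (s : L ⊗ K ⟶ P) (X : N) :
    gcomp V (tenUnit L X) (ad (tenComp s X)) = s ≫ tenUnit P X := by
  simp [tenComp, ← tenHom_apply]

lemma ad_tenComp_comp (s : L ⊗ K ⟶ P) (g : ten P X ⟶ Y) :
    gcomp V (tenUnit L X) (ad (tenComp s X ≫ g)) = s ≫ ad g := by
  rw [ad_comp, gcomp_whiskerLeft, ad_tenComp, Category.assoc]; rfl

lemma ad_tenMap_comp₂ (s : K ⟶ K') (f : ten L X ⟶ X') (g : ten K' X' ⟶ Y) :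
    gcomp V (tenUnit L X) (ad (tenMap s f ≫ g)) = gcomp V (ad f) (s ≫ ad g) := by
  rw [ad_tenMap_comp, ← Category.assoc, tenUnit_gcomp]

@[simp]
lemma tenMap_id : tenMap (𝟙 K) (𝟙 X) = 𝟙 (ten K X) := by
  apply ten_ext; simp [ad_tenMap, ad_id]

lemma tenMap_comp {K'' : V} {X'' : N} (s : K ⟶ K') (f : X ⟶ X') (s' : K' ⟶ K'') (f' : X' ⟶ X'') :
    tenMap s f ≫ tenMap s' f' = tenMap (s ≫ s') (f ≫ f') := by
  apply ten_ext
  simp [ad_tenMap_comp, ad_tenMap]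

lemma tenMap_tenDesc (s : K ⟶ K') (f : X ⟶ X') (u : K' ⟶ (X' ⟶[V] Y)) :
    tenMap s f ≫ tenDesc u = tenDesc (s ≫ u ≫ eHomWhiskerRight V f Y) := by
  apply ten_ext
  simp [ad_tenMap_comp]

lemma tenDesc_comp (u : K ⟶ (X ⟶[V] Y)) (g : Y ⟶ Z) :
    tenDesc u ≫ g = tenDesc (u ≫ eHomWhiskerLeft V X g) := by
  apply ten_ext
  simp [ad_comp]

lemma tenMap_tenMap_tenComp (s : K ⟶ K') (t : L ⟶ L') (f : X ⟶ X') (u : L' ⊗ K' ⟶ P) :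
    tenMap s (tenMap t f) ≫ tenComp u X' = tenComp ((t ⊗ₘ s) ≫ u) X ≫ tenMap (𝟙 P) f := by
  apply ten_ext₂
  rw [ad_tenMap_comp₂, ad_tenComp_comp, ad_tenMap, ad_tenMap, comp_gcomp, gcomp_whiskerRight,
    ad_tenComp]
  simp

lemma tenComp_tenMap (u : L ⊗ K ⟶ P) (p : P ⟶ K') (f : X ⟶ X') :
    tenComp u X ≫ tenMap p f = tenMap (𝟙 K) (tenMap (𝟙 L) f) ≫ tenComp (u ≫ p) X' := by
  apply ten_ext₂
  rw [ad_tenMap_comp₂, ad_tenComp_comp, ad_tenMap, ad_tenMap, comp_gcomp, gcomp_whiskerRight,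
    ad_tenComp]
  simp

lemma tenComp_tenComp {Q R : V} (s : J ⊗ L ⟶ P) (t : P ⊗ K ⟶ R) (s' : L ⊗ K ⟶ Q)
    (t' : J ⊗ Q ⟶ R) (h : s ▷ K ≫ t = (α_ J L K).hom ≫ J ◁ s' ≫ t') :
    tenMap (𝟙 K) (tenComp s X) ≫ tenComp t X = tenComp s' (ten J X) ≫ tenComp t' X := by
  apply ten_ext₃
  rw [ad_tenMap_comp₂, ad_tenComp_comp, Category.id_comp, comp_gcomp_right, ad_tenComp]
  rw [← cancel_epi (α_ J L K).hom, ← gcomp_assoc, ad_tenComp, comp_gcomp_left, ad_tenComp,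
    reassoc_of% h]

lemma tenMap_tenPt_tenComp (e : 𝟙_ V ⟶ P) (s : P ⊗ K ⟶ L) :
    tenMap (𝟙 K) (tenPt e X) ≫ tenComp s X = tenMap ((λ_ K).inv ≫ e ▷ K ≫ s) (𝟙 X) := by
  apply ten_ext
  rw [ad_tenMap_comp, ad_tenMap]
  rw [← cancel_epi (λ_ K).hom, Category.id_comp, ← eHomEquiv_gcomp, tenPt, Equiv.apply_symm_apply,
    comp_gcomp_left, ad_tenComp]
  simp

lemma whiskerLeft_tenPt (w : L ⟶ (X ⟶[V] Y)) (e : 𝟙_ V ⟶ P) :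
    w ≫ eHomWhiskerLeft V X (tenPt e Y) = (ρ_ L).inv ≫ gcomp V w (e ≫ tenUnit P Y) := by
  rw [← cancel_epi (ρ_ L).hom, ← gcomp_eHomEquiv, tenPt, Equiv.apply_symm_apply]
  simp

lemma tenPt_tenComp (e : 𝟙_ V ⟶ P) (s : L ⊗ P ⟶ K) :
    tenPt e (ten L X) ≫ tenComp s X = tenMap ((ρ_ L).inv ≫ L ◁ e ≫ s) (𝟙 X) := by
  apply ten_ext
  rw [ad_comp, ad, whiskerLeft_tenPt, Category.assoc, ← gcomp_whiskerLeft, Category.assoc]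
  rw [comp_gcomp_right]
  change _ ≫ _ ≫ gcomp V _ (ad _) = _
  rw [ad_tenComp, ad_tenMap]
  simp

lemma eHomEquiv_tenPt_comp (e : 𝟙_ V ⟶ P) (f : ten P X ⟶ Y) :
    eHomEquiv V (tenPt e X ≫ f) = e ≫ ad f := by
  have h : ∀ {A B C : N} (f : A ⟶ B) (g : B ⟶ C),
      eHomEquiv V (f ≫ g) = eHomEquiv V f ≫ eHomWhiskerLeft V A g := by
    intro A B C f g
    rw [eHomEquiv_comp]
    have := gcomp_eHomEquiv (V := V) (eHomEquiv V f) g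
    rw [← cancel_epi (λ_ (𝟙_ V)).hom, Iso.hom_inv_id_assoc]
    simpa [gcomp, unitors_equal] using this
  rw [h, tenPt, Equiv.apply_symm_apply, Category.assoc]; rfl

lemma eHomEquiv_comp_left (f : X ⟶ Y) (g : Y ⟶ Z) :
    eHomEquiv V (f ≫ g) = eHomEquiv V g ≫ eHomWhiskerRight V f Z := by
  rw [eHomEquiv_comp]
  have := eHomEquiv_gcomp (V := V) f (eHomEquiv V g)
  rw [← cancel_epi (λ_ (𝟙_ V)).hom, Iso.hom_inv_id_assoc]
  simpa [gcomp] using this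

lemma tenPt_tenMap (e : 𝟙_ V ⟶ P) (s : P ⟶ K) (f : X ⟶ Y) :
    tenPt e X ≫ tenMap s f = f ≫ tenPt (e ≫ s) Y := by
  apply (eHomEquiv V).injective
  rw [eHomEquiv_tenPt_comp, eHomEquiv_comp_left, ad_tenMap, tenPt, Equiv.apply_symm_apply]
  simp

lemma eId_whiskerRight (f : X ⟶ Y) :
    eId V Y ≫ eHomWhiskerRight V f Y = eId V X ≫ eHomWhiskerLeft V X f := by
  rw [← eHomEquiv_id, ← eHomEquiv_comp_left, Category.comp_id, ← eHomEquiv_id]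
  have := gcomp_eHomEquiv (V := V) (eHomEquiv V (𝟙 X)) f
  rw [eHomEquiv_gcomp, eHomWhiskerRight_id, Category.comp_id, unitors_equal,
    cancel_epi] at this
  exact this

lemma tenMap_tenCounit (s : K ⟶ P) (e : P ⟶ 𝟙_ V) (f : X ⟶ Y) :
    tenMap s f ≫ tenCounit e Y = tenCounit (s ≫ e) X ≫ f := by
  apply ten_ext
  rw [ad_tenMap_comp, ad_comp, tenCounit, tenCounit, ad_tenDesc, ad_tenDesc]
  simp [eId_whiskerRight]

end Tensors
end EnrichedBar

namespace EnrichedBar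

/-! ### The base as a bicomplete enriched category -/

section Base

variable {V : Type u₁} [Category.{v} V] [MonoidalCategory V] [SymmetricCategory V]
  [MonoidalClosed V]

lemma uncurry_tensorHom_comp {X Y Z K L : V} (u : K ⟶ (ihom X).obj Y) (w : L ⟶ (ihom Y).obj Z) :
    MonoidalClosed.uncurry ((u ⊗ₘ w) ≫ MonoidalClosed.comp X Y Z) =
      (α_ X K L).inv ≫ MonoidalClosed.uncurry u ▷ L ≫ MonoidalClosed.uncurry w := by
  rw [MonoidalClosed.uncurry_natural_left, MonoidalClosed.comp_eq,
    MonoidalClosed.uncurry_curry, MonoidalClosed.compTranspose_eq,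
    MonoidalClosed.uncurry_eq, MonoidalClosed.uncurry_eq]
  rw [← id_tensorHom, associator_inv_naturality_assoc, MonoidalCategory.tensorHom_def]
  simp only [id_tensorHom, Category.assoc, comp_whiskerRight, whisker_exchange_assoc]
  rfl

lemma uncurry_gcomp {X Y Z K L : V} (u : K ⟶ EnrichedCategory.Hom (V := V) X Y)
    (w : L ⟶ EnrichedCategory.Hom (V := V) Y Z) :
    MonoidalClosed.uncurry (A := X) (gcomp V u w) =
      (α_ X K L).inv ≫ MonoidalClosed.uncurry (A := X) u ▷ L ≫
        MonoidalClosed.uncurry (A := Y) w :=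
  uncurry_tensorHom_comp u w

lemma isIso_of_bijective {A B : V} (f : A ⟶ B)
    (h : ∀ T : V, Function.Bijective (fun g : T ⟶ A => g ≫ f)) : IsIso f :=
  isIso_of_yoneda_map_bijective f h

lemma isIso_curry {A B C : V} {X : V} (f : A ⊗ B ⟶ (ihom X).obj C)
    (h : ∀ T : V, ∃ e : (T ⟶ B) ≃ (X ⊗ (A ⊗ T) ⟶ C), ∀ g : T ⟶ B,
      e g = MonoidalClosed.uncurry (A ◁ g ≫ f)) : IsIso (MonoidalClosed.curry f) := by
  apply isIso_of_bijective
  intro T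
  obtain ⟨e, he⟩ := h T
  have : (fun g : T ⟶ B => g ≫ MonoidalClosed.curry f) =
      fun g => MonoidalClosed.curry (MonoidalClosed.curry (e g)) := by
    funext g
    rw [he, MonoidalClosed.curry_uncurry, MonoidalClosed.curry_natural_left]
  rw [this]
  exact ((ihom.adjunction A).homEquiv _ _).bijective.comp
    ((((ihom.adjunction X).homEquiv _ _).bijective).comp e.bijective)

instance baseBicomplete [HasLimits V] [HasColimits V] : EnrichedBicomplete V V where
  tensor K X :=
    { obj := K ⊗ X
      unit := MonoidalClosed.curry (β_ X K).hom
      isIso := fun Y => by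
        apply isIso_curry
        intro T
        refine ⟨((ihom.adjunction (K ⊗ X)).homEquiv T Y).symm.trans
          (((α_ X K T).symm ≪≫ whiskerRightIso (β_ X K) T).symm.homFromEquiv), ?_⟩
        intro g
        have h : K ◁ g ≫ MonoidalClosed.curry (β_ X K).hom ▷ _ ≫ eComp V X (K ⊗ X) Y =
            gcomp V (MonoidalClosed.curry (β_ X K).hom) g := by
          simp [gcomp, MonoidalCategory.tensorHom_def']
        refine Eq.trans ?_ (congrArg (MonoidalClosed.uncurry (A := X)) h.symm)
        rw [uncurry_gcomp, MonoidalClosed.uncurry_curry]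
        change ((α_ X K T).inv ≫ (β_ X K).hom ▷ T) ≫ MonoidalClosed.uncurry g = _
        simp }
  cotensor K Y :=
    { obj := (ihom K).obj Y
      counit := MonoidalClosed.curry ((β_ _ _).hom ≫ (ihom.ev K).app Y)
      isIso := fun X => by
        apply isIso_curry
        intro T
        refine ⟨((ihom.adjunction X).homEquiv T ((ihom K).obj Y)).symm.trans
          (((ihom.adjunction K).homEquiv _ _).symm.trans
          (whiskerLeftIso X (β_ K T) ≪≫ (α_ X T K).symm ≪≫ β_ _ _).symm.homFromEquiv), ?_⟩
        intro g
        let c : K ⟶ EnrichedCategory.Hom (V := V) ((ihom K).obj Y) Y :=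
          MonoidalClosed.curry ((β_ _ _).hom ≫ (ihom.ev K).app Y)
        have h : K ◁ g ≫ c ▷ _ ≫ (β_ _ _).hom ≫ eComp V X ((ihom K).obj Y) Y =
            (β_ K T).hom ≫ gcomp V g c := by
          simp [gcomp, MonoidalCategory.tensorHom_def]
        refine Eq.trans ?_ (congrArg (MonoidalClosed.uncurry (A := X)) h.symm)
        rw [MonoidalClosed.uncurry_natural_left, uncurry_gcomp, MonoidalClosed.uncurry_curry]
        change (X ◁ (β_ K T).hom ≫ (α_ X T K).inv ≫ (β_ (X ⊗ T) K).hom) ≫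
          MonoidalClosed.uncurry (MonoidalClosed.uncurry g) = _
        rw [MonoidalClosed.uncurry_eq (MonoidalClosed.uncurry g)]
        simp }
  hasLimits := inferInstance
  hasColimits := inferInstance

end Base
end EnrichedBar

namespace EnrichedBar

/-! ### Diagrams -/

section Diagrams

variable (V : Type u₁) [Category.{v} V] [MonoidalCategory V]

/-- A `V`-functor `D ⥤ N`, regarded as a diagram. -/
structure VFun (D : Type v) [EnrichedCategory V D] (N : Type u₂) [EnrichedCategory V N]
  extends EnrichedFunctor V D N

variable {V}

/-- A `V`-natural transformation. -/
@[ext]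
structure VNat {D : Type v} [EnrichedCategory V D] {N : Type u₂} [Category.{v} N]
    [EnrichedOrdinaryCategory V N] (F F' : VFun V D N) where
  /-- the components -/
  app : ∀ d : D, F.obj d ⟶ F'.obj d
  naturality : ∀ a b : D, F.map a b ≫ eHomWhiskerLeft V _ (app b) =
    F'.map a b ≫ eHomWhiskerRight V (app a) _

/-- The underlying ordinary category of the category of `V`-functors `D ⥤ N`. -/
instance {D : Type v} [EnrichedCategory V D] {N : Type u₂} [Category.{v} N]
    [EnrichedOrdinaryCategory V N] : Category.{v} (VFun V D N) where
  Hom F F' := VNat F F'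
  id F := { app := fun d => 𝟙 _, naturality := by simp }
  comp f g :=
    { app := fun d => f.app d ≫ g.app d
      naturality := fun a b => by
        rw [eHomWhiskerLeft_comp, eHomWhiskerRight_comp, reassoc_of% (f.naturality a b),
          ← eHom_whisker_exchange, reassoc_of% (g.naturality a b)] }

@[ext]
lemma VFun.hom_ext {D : Type v} [EnrichedCategory V D] {N : Type u₂} [Category.{v} N]
    [EnrichedOrdinaryCategory V N] {F F' : VFun V D N} {f g : F ⟶ F'}
    (h : ∀ d, f.app d = g.app d) : f = g := VNat.ext (funext h)

@[simp]
lemma VFun.id_app {D : Type v} [EnrichedCategory V D] {N : Type u₂} [Category.{v} N]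
    [EnrichedOrdinaryCategory V N] (F : VFun V D N) (d : D) : VNat.app (𝟙 F) d = 𝟙 _ := rfl

@[simp]
lemma VFun.comp_app {D : Type v} [EnrichedCategory V D] {N : Type u₂} [Category.{v} N]
    [EnrichedOrdinaryCategory V N] {F F' F'' : VFun V D N} (f : F ⟶ F') (g : F' ⟶ F'') (d : D) :
    VNat.app (f ≫ g) d = f.app d ≫ g.app d := rfl

variable (V) in
/-- A `V`-valued presheaf on `D`, given by its action maps `D(a, b) ⊗ G b ⟶ G a`. -/
structure RightModule (D : Type v) [EnrichedCategory V D] where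
  /-- the values -/
  obj : D → V
  /-- the action -/
  act : ∀ a b : D, (a ⟶[V] b) ⊗ obj b ⟶ obj a
  one_act : ∀ a, eId V a ▷ obj a ≫ act a a = (λ_ (obj a)).hom
  mul_act : ∀ a b c, eComp V a b c ▷ obj c ≫ act a c =
    (α_ _ _ _).hom ≫ _ ◁ act b c ≫ act a b

/-- A map of presheaves. -/
@[ext]
structure RightModuleHom {D : Type v} [EnrichedCategory V D] (G G' : RightModule V D) where
  /-- the components -/
  app : ∀ d : D, G.obj d ⟶ G'.obj d
  act_app : ∀ a b : D, G.act a b ≫ app a = _ ◁ app b ≫ G'.act a b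

instance {D : Type v} [EnrichedCategory V D] : Category.{v} (RightModule V D) where
  Hom G G' := RightModuleHom G G'
  id G := { app := fun d => 𝟙 _, act_app := by simp }
  comp f g :=
    { app := fun d => f.app d ≫ g.app d
      act_app := fun a b => by
        rw [reassoc_of% (f.act_app a b), g.act_app, MonoidalCategory.whiskerLeft_comp_assoc] }

@[ext]
lemma RightModule.hom_ext {D : Type v} [EnrichedCategory V D] {G G' : RightModule V D}
    {f g : G ⟶ G'} (h : ∀ d, f.app d = g.app d) : f = g := RightModuleHom.ext (funext h)

@[simp]
lemma RightModule.id_app {D : Type v} [EnrichedCategory V D] (G : RightModule V D) (d : D) :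
    RightModuleHom.app (𝟙 G) d = 𝟙 _ := rfl

@[simp]
lemma RightModule.comp_app {D : Type v} [EnrichedCategory V D] {G G' G'' : RightModule V D}
    (f : G ⟶ G') (g : G' ⟶ G'') (d : D) :
    RightModuleHom.app (f ≫ g) d = f.app d ≫ g.app d := rfl

/-- The representable presheaf `D(-, e)`. -/
def reprModule {D : Type v} [EnrichedCategory V D] (e : D) : RightModule V D where
  obj a := a ⟶[V] e
  act a b := eComp V a b e
  one_act a := by
    rw [← cancel_epi (λ_ _).inv, e_id_comp, Iso.inv_hom_id]
  mul_act a b c := (e_assoc' V a b c e).symm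

end Diagrams

section ModuleOfFunctor

variable {V : Type u₁} [Category.{v} V] [MonoidalCategory V] [SymmetricCategory V]
  [MonoidalClosed V] {D : Type v} [EnrichedCategory V D]

/-- A presheaf from maps `D(a, b) ⟶ [G b, G a]`. -/
def RightModule.ofMap (obj : D → V) (m : ∀ a b : D, (a ⟶[V] b) ⟶ (ihom (obj b)).obj (obj a))
    (m_id : ∀ a, eId V a ≫ m a a = MonoidalClosed.id (obj a))
    (m_comp : ∀ a b c, eComp V a b c ≫ m a c =
      (β_ _ _).hom ≫ (m b c ⊗ₘ m a b) ≫ MonoidalClosed.comp (obj c) (obj b) (obj a)) :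
    RightModule V D where
  obj := obj
  act a b := (β_ _ _).hom ≫ MonoidalClosed.uncurry (m a b)
  one_act a := by
    rw [BraidedCategory.braiding_naturality_left_assoc, ← MonoidalClosed.uncurry_natural_left, m_id,
      MonoidalClosed.id_eq, MonoidalClosed.uncurry_curry]
    simp
  mul_act a b c := by
    rw [BraidedCategory.braiding_naturality_left_assoc, ← MonoidalClosed.uncurry_natural_left,
      m_comp, MonoidalClosed.uncurry_natural_left, uncurry_tensorHom_comp]
    simp

lemma RightModule.ofMap_natural {K X Y X' Y' : V} (m : K ⟶ EnrichedCategory.Hom (V := V) X Y)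
    (m' : K ⟶ EnrichedCategory.Hom (V := V) X' Y') (f : X ⟶ X') (g : Y ⟶ Y')
    (h : m ≫ eHomWhiskerLeft V X g = m' ≫ eHomWhiskerRight V f Y') :
    ((β_ K X).hom ≫ MonoidalClosed.uncurry (A := X) m) ≫ g =
      K ◁ f ≫ (β_ K X').hom ≫ MonoidalClosed.uncurry (A := X') m' := by
  rw [MonoidalClosed.enrichedOrdinaryCategorySelf_eHomWhiskerLeft,
    MonoidalClosed.enrichedOrdinaryCategorySelf_eHomWhiskerRight] at h
  have h1 := MonoidalClosed.uncurry_natural_right (A := X) m g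
  have h2 := MonoidalClosed.uncurry_pre_app (f := m') (g := f)
  rw [BraidedCategory.braiding_naturality_right_assoc, ← h2, Category.assoc, ← h1]
  exact congrArg (fun t => (β_ K X).hom ≫ MonoidalClosed.uncurry t) h

/-- The presheaf given by a `V`-functor `Dᵒᵖ ⥤ V`. -/
def presheafModule : VFun V Dᵒᵖ V ⥤ RightModule V D where
  obj G := RightModule.ofMap (fun a => G.obj (op a)) (fun a b => G.map (op b) (op a))
    (fun a => G.map_id (op a))
    (fun a b c => by
      have h := G.map_comp (op c) (op b) (op a)
      rw [eComp_op_eq] at h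
      rw [← cancel_epi (β_ _ _).hom]
      refine ((Category.assoc _ _ _).symm.trans h).trans ?_
      rw [SymmetricCategory.symmetry_assoc]
      rfl)
  map {G G'} f :=
    { app := fun a => f.app (op a)
      act_app := fun a b => by
        exact RightModule.ofMap_natural _ _ _ _ (f.naturality (op b) (op a)) }

/-- The presheaf on `Dᵒᵖ` given by a `V`-functor `D ⥤ V`. -/
def copresheafModule : VFun V D V ⥤ RightModule V Dᵒᵖ where
  obj G := RightModule.ofMap (fun a => G.obj a.unop) (fun a b => G.map b.unop a.unop)
    (fun a => G.map_id a.unop)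
    (fun a b c => by
      rw [eComp_op_eq, Category.assoc]
      exact congrArg (fun t => (β_ _ _).hom ≫ t) (G.map_comp c.unop b.unop a.unop))
  map {G G'} f :=
    { app := fun a => f.app a.unop
      act_app := fun a b => by
        exact RightModule.ofMap_natural _ _ _ _ (f.naturality b.unop a.unop) }

/-- The representable `V`-functor `D(e, -)`. -/
def corepr (e : D) : VFun V D V where
  obj b := e ⟶[V] b
  map a b := MonoidalClosed.curry (eComp V e a b)
  map_id a := by
    have h : MonoidalClosed.uncurry (A := e ⟶[V] a)
        (eId V a ≫ MonoidalClosed.curry (eComp V e a a)) = (ρ_ _).hom := by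
      rw [MonoidalClosed.uncurry_natural_left, MonoidalClosed.uncurry_curry,
        ← cancel_epi (ρ_ _).inv, e_comp_id, Iso.inv_hom_id]
    exact (MonoidalClosed.eq_curry_iff _ _).2 h
  map_comp a b c := by
    apply MonoidalClosed.uncurry_injective
    refine Eq.trans ?_ (uncurry_tensorHom_comp _ _).symm
    rw [MonoidalClosed.uncurry_natural_left, MonoidalClosed.uncurry_curry,
      MonoidalClosed.uncurry_curry, MonoidalClosed.uncurry_curry, e_assoc]

end ModuleOfFunctor
end EnrichedBar

namespace EnrichedBar

/-! ### Coequalizers of maps between coproducts -/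

/-- A pair of maps between two coproducts. -/
structure SigmaPair (N : Type u₂) [Category.{v} N] where
  /-- the indices of the source -/
  src : Type v
  /-- the indices of the target -/
  tgt : Type v
  /-- the summands of the source -/
  A : src → N
  /-- the summands of the target -/
  B : tgt → N
  /-- the index map of the first map -/
  s : src → tgt
  /-- the index map of the second map -/
  t : src → tgt
  /-- the components of the first map -/
  f : ∀ i, A i ⟶ B (s i)
  /-- the components of the second map -/
  g : ∀ i, A i ⟶ B (t i)

namespace SigmaPair

variable {N : Type u₂} [Category.{v} N] [HasColimits N] (P : SigmaPair N)

/-- The coequalizer of `∐ A ⇉ ∐ B`. -/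
abbrev coeq : N :=
  coequalizer (Sigma.desc fun i => P.f i ≫ Sigma.ι P.B (P.s i))
    (Sigma.desc fun i => P.g i ≫ Sigma.ι P.B (P.t i))

/-- The map from a summand of the target. -/
def inj (k : P.tgt) : P.B k ⟶ P.coeq := Sigma.ι P.B k ≫ coequalizer.π _ _

lemma condition (i : P.src) : P.f i ≫ P.inj (P.s i) = P.g i ≫ P.inj (P.t i) := by
  have h := congrArg (fun t => Sigma.ι P.A i ≫ t) (coequalizer.condition
    (Sigma.desc fun i => P.f i ≫ Sigma.ι P.B (P.s i))
    (Sigma.desc fun i => P.g i ≫ Sigma.ι P.B (P.t i)))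
  rw [Sigma.ι_desc_assoc, Sigma.ι_desc_assoc, Category.assoc, Category.assoc] at h
  exact h

variable {P}

/-- The map induced by a compatible family. -/
def desc {Y : N} (u : ∀ k, P.B k ⟶ Y) (h : ∀ i, P.f i ≫ u (P.s i) = P.g i ≫ u (P.t i)) :
    P.coeq ⟶ Y :=
  coequalizer.desc (Sigma.desc u) (Sigma.hom_ext _ _ fun i => by simpa using h i)

@[simp]
lemma inj_desc {Y : N} (u : ∀ k, P.B k ⟶ Y)
    (h : ∀ i, P.f i ≫ u (P.s i) = P.g i ≫ u (P.t i)) (k : P.tgt) :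
    P.inj k ≫ desc u h = u k := by
  rw [inj, desc, Category.assoc, coequalizer.π_desc, Sigma.ι_desc]

lemma hom_ext {Y : N} {x y : P.coeq ⟶ Y} (h : ∀ k, P.inj k ≫ x = P.inj k ≫ y) : x = y := by
  apply coequalizer.hom_ext
  apply Sigma.hom_ext
  intro k
  rw [← Category.assoc, ← Category.assoc]
  exact h k

end SigmaPair

/-! ### The tensor product of functors -/

section TensorProduct

variable {V : Type u₁} [Category.{v} V] [MonoidalCategory V] [SymmetricCategory V]
  [MonoidalClosed V] {D : Type v} [EnrichedCategory V D]
  {N : Type u₂} [Category.{v} N] [EnrichedOrdinaryCategory V N] [EnrichedBicomplete V N]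

/-- The action `D(a, b) ⊙ F a ⟶ F b`. -/
def VFun.act (F : VFun V D N) (a b : D) : ten (a ⟶[V] b) (F.obj a) ⟶ F.obj b :=
  tenDesc (F.map a b)

lemma VFun.ad_act (F : VFun V D N) (a b : D) : ad (F.act a b) = F.map a b := ad_tenDesc _

lemma VFun.one_act (F : VFun V D N) (a : D) :
    tenPt (eId V a) (F.obj a) ≫ F.act a a = 𝟙 _ := by
  apply (eHomEquiv V).injective
  rw [eHomEquiv_tenPt_comp, F.ad_act, F.map_id, eHomEquiv_id]

lemma VFun.mul_act (F : VFun V D N) (a b c : D) :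
    tenMap (𝟙 (b ⟶[V] c)) (F.act a b) ≫ F.act b c =
      tenComp (eComp V a b c) (F.obj a) ≫ F.act a c := by
  apply ten_ext₂
  rw [ad_tenMap_comp₂, ad_tenComp_comp, F.ad_act, F.ad_act, F.ad_act, F.map_comp, Category.id_comp]
  rfl

lemma VFun.act_app {F F' : VFun V D N} (f : F ⟶ F') (a b : D) :
    F.act a b ≫ f.app b = tenMap (𝟙 _) (f.app a) ≫ F'.act a b := by
  apply ten_ext
  rw [ad_comp, ad_tenMap_comp, F.ad_act, F'.ad_act, Category.id_comp]
  exact f.naturality a b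

/-- The pair `∐ (D(a, b) ⊗ G b) ⊙ F a ⇉ ∐ G a ⊙ F a` of action maps. -/
def tensorPair (G : RightModule V D) (F : VFun V D N) : SigmaPair N where
  src := D × D
  tgt := D
  A i := ten ((i.1 ⟶[V] i.2) ⊗ G.obj i.2) (F.obj i.1)
  B d := ten (G.obj d) (F.obj d)
  s i := i.1
  t i := i.2
  f i := tenMap (G.act i.1 i.2) (𝟙 _)
  g i := tenDesc (gcomp V (F.map i.1 i.2) (tenUnit (G.obj i.2) (F.obj i.2)))

/-- The object `G ⊙_D F`. -/
def tensorObj (G : RightModule V D) (F : VFun V D N) : N := (tensorPair G F).coeq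

/-- The map `G d ⊙ F d ⟶ G ⊙_D F`. -/
def tensorInj (G : RightModule V D) (F : VFun V D N) (d : D) :
    ten (G.obj d) (F.obj d) ⟶ tensorObj G F := (tensorPair G F).inj d

lemma tensorPair_rel_iff (G : RightModule V D) (F : VFun V D N) {a b : D} {Y : N}
    (x : ten (G.obj a) (F.obj a) ⟶ Y) (y : ten (G.obj b) (F.obj b) ⟶ Y) :
    tenMap (G.act a b) (𝟙 (F.obj a)) ≫ x =
      tenDesc (gcomp V (F.map a b) (tenUnit (G.obj b) (F.obj b))) ≫ y ↔
    tenComp (G.act a b) (F.obj a) ≫ x = tenMap (𝟙 (G.obj b)) (F.act a b) ≫ y := by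
  have h1 : ad (tenMap (G.act a b) (𝟙 (F.obj a)) ≫ x) =
      gcomp V (tenUnit _ _) (ad (tenComp (G.act a b) (F.obj a) ≫ x)) := by
    rw [ad_tenMap_comp, ad_tenComp_comp]; simp
  have h2 : ad (tenDesc (gcomp V (F.map a b) (tenUnit (G.obj b) (F.obj b))) ≫ y) =
      gcomp V (tenUnit _ _) (ad (tenMap (𝟙 (G.obj b)) (F.act a b) ≫ y)) := by
    rw [ad_tenMap_comp₂, ad_comp, ad_tenDesc, ← gcomp_whiskerLeft, F.ad_act, Category.id_comp]; rfl
  constructor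
  · intro h
    apply ten_ext₂
    rw [← h1, ← h2, h]
  · intro h
    apply ten_ext
    rw [h1, h2, h]

/-- The relation that holds in the tensor product of functors, for iterated tensors. -/
lemma tensorInj_condition (G : RightModule V D) (F : VFun V D N) (a b : D) :
    tenComp (G.act a b) (F.obj a) ≫ tensorInj G F a =
      tenMap (𝟙 (G.obj b)) (F.act a b) ≫ tensorInj G F b :=
  (tensorPair_rel_iff G F _ _).1 ((tensorPair G F).condition (a, b))

/-- Maps out of `G ⊙_D F`. -/
def tensorDesc {G : RightModule V D} {F : VFun V D N} {Y : N}
    (u : ∀ d, ten (G.obj d) (F.obj d) ⟶ Y)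
    (h : ∀ a b, tenComp (G.act a b) (F.obj a) ≫ u a = tenMap (𝟙 (G.obj b)) (F.act a b) ≫ u b) :
    tensorObj G F ⟶ Y :=
  SigmaPair.desc (P := tensorPair G F) u fun i => (tensorPair_rel_iff G F _ _).2 (h i.1 i.2)

lemma tensorInj_desc {G : RightModule V D} {F : VFun V D N} {Y : N}
    (u : ∀ d, ten (G.obj d) (F.obj d) ⟶ Y)
    (h : ∀ a b, tenComp (G.act a b) (F.obj a) ≫ u a = tenMap (𝟙 (G.obj b)) (F.act a b) ≫ u b)
    (d : D) : tensorInj G F d ≫ tensorDesc u h = u d :=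
  SigmaPair.inj_desc (P := tensorPair G F) _ _ d

lemma tensorObj_ext {G : RightModule V D} {F : VFun V D N} {Y : N} {x y : tensorObj G F ⟶ Y}
    (h : ∀ d, tensorInj G F d ≫ x = tensorInj G F d ≫ y) : x = y :=
  SigmaPair.hom_ext (P := tensorPair G F) h

lemma tenComp_act_natural {G G' : RightModule V D} (g : G ⟶ G') (a b : D) {X X' : N}
    (f : X ⟶ X') :
    tenComp (G.act a b) X ≫ tenMap (g.app a) f =
      tenMap (g.app b) (tenMap (𝟙 _) f) ≫ tenComp (G'.act a b) X' := by
  rw [tenComp_tenMap, tenMap_tenMap_tenComp, g.act_app, tenMap_tenMap_tenComp]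
  simp

/-- The functoriality of `G ⊙_D F`. -/
def tensorObjMap {G G' : RightModule V D} {F F' : VFun V D N} (g : G ⟶ G') (f : F ⟶ F') :
    tensorObj G F ⟶ tensorObj G' F' :=
  tensorDesc (fun d => tenMap (g.app d) (f.app d) ≫ tensorInj G' F' d)
    (fun a b => by
      rw [reassoc_of% tenComp_act_natural g a b (f.app a), reassoc_of% tenMap_comp (𝟙 _) _ _ _,
        VFun.act_app]
      have h := tensorInj_condition G' F' a b
      have h' := congrArg (fun t => tenMap (g.app b) (tenMap (𝟙 _) (f.app a)) ≫ t) h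
      rw [h', reassoc_of% tenMap_comp (g.app b) _ _ _]
      simp)

lemma tensorInj_map {G G' : RightModule V D} {F F' : VFun V D N} (g : G ⟶ G') (f : F ⟶ F')
    (d : D) : tensorInj G F d ≫ tensorObjMap g f =
      tenMap (g.app d) (f.app d) ≫ tensorInj G' F' d := tensorInj_desc _ _ d

/-- The tensor product of functors `G ⊙_D F`, as a functor of `G` and `F`. -/
def tensorProduct : RightModule V D × VFun V D N ⥤ N where
  obj p := tensorObj p.1 p.2
  map f := tensorObjMap f.1 f.2
  map_id p := tensorObj_ext fun d => by
    rw [tensorInj_map]; simp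
  map_comp f g := tensorObj_ext fun d => by
    rw [tensorInj_map, reassoc_of% tensorInj_map, tensorInj_map, reassoc_of% tenMap_comp]
    rfl

end TensorProduct
end EnrichedBar

namespace EnrichedBar

/-! ### The simplicial bar construction -/

section SimplicialBar

variable {V : Type u₁} [Category.{v} V] [MonoidalCategory V] [SymmetricCategory V]
  [MonoidalClosed V] {D : Type v} [EnrichedCategory V D]
  {N : Type u₂} [Category.{v} N] [EnrichedOrdinaryCategory V N] [EnrichedBicomplete V N]

section Chain

variable (F : VFun V D N) {n : ℕ} (α : Fin n → D)

/-- The iterated tensor `D(α_{k-1}, α_k) ⊙ (⋯ ⊙ (D(α_0, α_1) ⊙ F α_0))`. -/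
@[reducible]
def chain : ∀ k : ℕ, k < n → N
  | 0, h => F.obj (α ⟨0, h⟩)
  | k + 1, h => ten (α ⟨k, Nat.lt_of_succ_lt h⟩ ⟶[V] α ⟨k + 1, h⟩) (chain k (Nat.lt_of_succ_lt h))

/-- The map composing the last morphisms of a chain, from `α_i` to `α_j`. -/
def chainBack (i : ℕ) (hi : i < n) (j : ℕ) (hij : i ≤ j) : ∀ hj : j < n,
    chain F α j hj ⟶ ten (α ⟨i, hi⟩ ⟶[V] α ⟨j, hj⟩) (chain F α i hi) :=
  Nat.leRec (motive := fun j _ => ∀ hj : j < n,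
    chain F α j hj ⟶ ten (α ⟨i, hi⟩ ⟶[V] α ⟨j, hj⟩) (chain F α i hi))
    (fun _ => tenPt (eId V _) _)
    (fun _ _ ih hj => tenMap (𝟙 _) (ih (Nat.lt_of_succ_lt hj)) ≫ tenComp (eComp V _ _ _) _) hij

lemma chainBack_self (i : ℕ) (hi : i < n) :
    chainBack F α i hi i le_rfl hi = tenPt (eId V _) _ := by
  simp [chainBack]

lemma chainBack_succ (i : ℕ) (hi : i < n) (j : ℕ) (hij : i ≤ j) (hj : j + 1 < n) :
    chainBack F α i hi (j + 1) (Nat.le_succ_of_le hij) hj =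
      tenMap (𝟙 _) (chainBack F α i hi j hij (Nat.lt_of_succ_lt hj)) ≫
        tenComp (eComp V _ _ _) _ := by
  exact congrFun (Nat.leRec_succ (motive := fun j _ => ∀ hj : j < n,
    chain F α j hj ⟶ ten (α ⟨i, hi⟩ ⟶[V] α ⟨j, hj⟩) (chain F α i hi)) _ _ hij) hj

/-- The map composing all the morphisms of a chain and acting on `F α_0`. -/
def chainAct : ∀ (k : ℕ) (hk : k < n), chain F α k hk ⟶ F.obj (α ⟨k, hk⟩)
  | 0, _ => 𝟙 _
  | k + 1, hk => tenMap (𝟙 _) (chainAct k (Nat.lt_of_succ_lt hk)) ≫ F.act _ _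

/-- The map of chains induced by a monotone map of the indices. -/
def chainPull {m : ℕ} (φ : Fin m →o Fin n) : ∀ (k : ℕ) (hk : k < m),
    chain F α (φ ⟨k, hk⟩).1 (φ ⟨k, hk⟩).2 ⟶ chain F (fun i => α (φ i)) k hk
  | 0, _ => chainAct F α _ _
  | k + 1, hk => chainBack F α _ (φ ⟨k, Nat.lt_of_succ_lt hk⟩).2 _
      (φ.monotone (show (⟨k, Nat.lt_of_succ_lt hk⟩ : Fin m) ≤ ⟨k + 1, hk⟩ from Nat.le_succ k)) _ ≫
      tenMap (𝟙 _) (chainPull φ k (Nat.lt_of_succ_lt hk))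

lemma tenMap_one_comp {K : V} {X Y Z : N} (f : X ⟶ Y) (g : Y ⟶ Z) :
    tenMap (𝟙 K) (f ≫ g) = tenMap (𝟙 K) f ≫ tenMap (𝟙 K) g := by
  rw [tenMap_comp, Category.comp_id]

lemma tenComp_eComp (a b c d : D) (X : N) :
    tenMap (𝟙 _) (tenComp (eComp V a b c) X) ≫ tenComp (eComp V a c d) X =
      tenComp (eComp V b c d) _ ≫ tenComp (eComp V a b d) X :=
  tenComp_tenComp _ _ _ _ (e_assoc' V a b c d).symm

lemma tenComp_tenMap_one {J K L : V} (s : J ⊗ K ⟶ L) {X Y : N} (f : X ⟶ Y) :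
    tenComp s X ≫ tenMap (𝟙 L) f = tenMap (𝟙 K) (tenMap (𝟙 J) f) ≫ tenComp s Y := by
  rw [tenComp_tenMap, Category.comp_id]

lemma chainBack_chainBack (i : ℕ) (hi : i < n) (j : ℕ) (hij : i ≤ j) (hj : j < n) (k : ℕ)
    (hjk : j ≤ k) : ∀ hk : k < n,
    chainBack F α j hj k hjk hk ≫ tenMap (𝟙 _) (chainBack F α i hi j hij hj) ≫
      tenComp (eComp V _ _ _) _ = chainBack F α i hi k (hij.trans hjk) hk := by
  induction hjk using Nat.leRec with
  | refl =>
    intro hk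
    rw [chainBack_self, reassoc_of% tenPt_tenMap, tenPt_tenComp]
    simp
  | le_succ_of_le h ih =>
    intro hk
    rw [chainBack_succ F α j hj _ h, chainBack_succ F α i hi _ (hij.trans h), ← ih, Category.assoc,
      reassoc_of% tenComp_tenMap_one, ← tenComp_eComp, tenMap_one_comp, tenMap_one_comp,
      Category.assoc, Category.assoc]

lemma chainBack_chainAct (i : ℕ) (hi : i < n) (j : ℕ) (hij : i ≤ j) : ∀ hj : j < n,
    chainBack F α i hi j hij hj ≫ tenMap (𝟙 _) (chainAct F α i hi) ≫ F.act _ _ =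
      chainAct F α j hj := by
  induction hij using Nat.leRec with
  | refl =>
    intro hj
    rw [chainBack_self, reassoc_of% tenPt_tenMap, Category.comp_id, F.one_act, Category.comp_id]
  | le_succ_of_le h ih =>
    intro hj
    rw [chainBack_succ F α i hi _ h, chainAct, ← ih, Category.assoc,
      reassoc_of% tenComp_tenMap_one, ← F.mul_act, tenMap_one_comp, tenMap_one_comp,
      Category.assoc, Category.assoc]

variable {m : ℕ} (φ : Fin m →o Fin n)

lemma chainPull_chainAct : ∀ (k : ℕ) (hk : k < m),
    chainPull F α φ k hk ≫ chainAct F (fun i => α (φ i)) k hk =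
      chainAct F α (φ ⟨k, hk⟩).1 (φ ⟨k, hk⟩).2
  | 0, hk => by
    rw [chainPull, chainAct]; exact Category.comp_id _
  | k + 1, hk => by
    rw [chainPull, chainAct, Category.assoc, ← Category.assoc (tenMap _ _), ← tenMap_one_comp,
      chainPull_chainAct k]
    exact chainBack_chainAct F α _ _ _ _ _

lemma chainPull_chainBack (i : ℕ) (hi : i < m) (j : ℕ) (hij : i ≤ j) : ∀ hj : j < m,
    chainPull F α φ j hj ≫ chainBack F (fun i => α (φ i)) i hi j hij hj =
      chainBack F α (φ ⟨i, hi⟩).1 (φ ⟨i, hi⟩).2 (φ ⟨j, hj⟩).1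
        (φ.monotone (show (⟨i, hi⟩ : Fin m) ≤ ⟨j, hj⟩ from hij)) (φ ⟨j, hj⟩).2 ≫
        tenMap (𝟙 _) (chainPull F α φ i hi) := by
  induction hij using Nat.leRec with
  | refl =>
    intro hj
    rw [chainBack_self, chainBack_self, tenPt_tenMap, Category.comp_id]
  | le_succ_of_le h ih =>
    intro hj
    rw [chainBack_succ F _ i hi _ h, chainPull, Category.assoc, ← Category.assoc (tenMap _ _),
      ← tenMap_one_comp, ih, tenMap_one_comp, Category.assoc, ← tenComp_tenMap_one]
    rw [← chainBack_chainBack F α (φ ⟨i, hi⟩).1 (φ ⟨i, hi⟩).2 (φ ⟨_, Nat.lt_of_succ_lt hj⟩).1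
      (φ.monotone (show (⟨i, hi⟩ : Fin m) ≤ ⟨_, Nat.lt_of_succ_lt hj⟩ from h))
      (φ ⟨_, Nat.lt_of_succ_lt hj⟩).2 (φ ⟨_, hj⟩).1
      (φ.monotone (show (⟨_, Nat.lt_of_succ_lt hj⟩ : Fin m) ≤ ⟨_, hj⟩ from Nat.le_succ _))]
    simp only [Category.assoc]

lemma chainPull_id : ∀ (k : ℕ) (hk : k < n),
    chainPull F α (OrderHom.id : Fin n →o Fin n) k hk = 𝟙 _
  | 0, hk => rfl
  | k + 1, hk => by
    rw [chainPull, chainPull_id k]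
    refine Eq.trans ?_ ((chainBack_succ F α k (Nat.lt_of_succ_lt hk) k le_rfl hk).trans ?_)
    · exact (congrArg _ tenMap_id).trans (Category.comp_id _)
    · rw [chainBack_self, tenMap_tenPt_tenComp, e_id_comp, tenMap_id]
      rfl

lemma chainPull_comp {l : ℕ} (ψ : Fin l →o Fin m) : ∀ (k : ℕ) (hk : k < l),
    chainPull F α (φ.comp ψ) k hk =
      chainPull F α φ (ψ ⟨k, hk⟩).1 (ψ ⟨k, hk⟩).2 ≫ chainPull F (fun i => α (φ i)) ψ k hk
  | 0, hk => (chainPull_chainAct F α φ _ _).symm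
  | k + 1, hk => by
    rw [chainPull, chainPull, chainPull_comp ψ k]
    refine (congrArg (fun t => _ ≫ t) (tenMap_one_comp _ _)).trans ?_
    refine (Category.assoc _ _ _).symm.trans (Eq.trans ?_ (Category.assoc _ _ _))
    refine congrArg (fun t => t ≫ _) ?_
    exact (chainPull_chainBack F α φ _ _ _ _ _).symm

end Chain

section ChainNat

variable {F F' : VFun V D N} (f : F ⟶ F') {n : ℕ} (α : Fin n → D)

/-- The functoriality of chains in the diagram. -/
def chainMap : ∀ (k : ℕ) (hk : k < n), chain F α k hk ⟶ chain F' α k hk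
  | 0, _ => f.app _
  | k + 1, hk => tenMap (𝟙 _) (chainMap k (Nat.lt_of_succ_lt hk))

lemma chainMap_id : ∀ (k : ℕ) (hk : k < n), chainMap (𝟙 F) α k hk = 𝟙 _
  | 0, _ => rfl
  | k + 1, hk => by rw [chainMap, chainMap_id k]; exact tenMap_id

lemma chainMap_comp {F'' : VFun V D N} (f' : F' ⟶ F'') : ∀ (k : ℕ) (hk : k < n),
    chainMap (f ≫ f') α k hk = chainMap f α k hk ≫ chainMap f' α k hk
  | 0, _ => rfl
  | k + 1, hk => by rw [chainMap, chainMap_comp f' k]; exact tenMap_one_comp _ _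

lemma chainMap_chainBack (i : ℕ) (hi : i < n) (j : ℕ) (hij : i ≤ j) : ∀ hj : j < n,
    chainMap f α j hj ≫ chainBack F' α i hi j hij hj =
      chainBack F α i hi j hij hj ≫ tenMap (𝟙 _) (chainMap f α i hi) := by
  induction hij using Nat.leRec with
  | refl =>
    intro hj
    rw [chainBack_self, chainBack_self, tenPt_tenMap, Category.comp_id]
  | le_succ_of_le h ih =>
    intro hj
    rw [chainBack_succ F _ i hi _ h, chainBack_succ F' _ i hi _ h, chainMap, Category.assoc,
      ← Category.assoc (tenMap _ _), ← tenMap_one_comp, ih, tenMap_one_comp, Category.assoc,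
      tenComp_tenMap_one]

lemma chainMap_chainAct : ∀ (k : ℕ) (hk : k < n),
    chainMap f α k hk ≫ chainAct F' α k hk = chainAct F α k hk ≫ f.app _
  | 0, _ => (Category.comp_id _).trans (Category.id_comp _).symm
  | k + 1, hk => by
    rw [chainMap, chainAct, chainAct, Category.assoc, VFun.act_app, ← Category.assoc (tenMap _ _),
      ← tenMap_one_comp, chainMap_chainAct k, tenMap_one_comp, Category.assoc]

lemma chainMap_chainPull {m : ℕ} (φ : Fin m →o Fin n) : ∀ (k : ℕ) (hk : k < m),
    chainMap f α (φ ⟨k, hk⟩).1 (φ ⟨k, hk⟩).2 ≫ chainPull F' α φ k hk =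
      chainPull F α φ k hk ≫ chainMap f (fun i => α (φ i)) k hk
  | 0, _ => chainMap_chainAct f α _ _
  | k + 1, hk => by
    rw [chainPull, chainPull, ← Category.assoc, chainMap_chainBack, Category.assoc, Category.assoc,
      ← tenMap_one_comp, chainMap_chainPull φ k, chainMap]
    exact congrArg (fun t => _ ≫ t) (tenMap_one_comp _ _)

end ChainNat

section Cells

variable (G : RightModule V D) (F : VFun V D N) {n : ℕ} (α : Fin (n + 1) → D)

/-- The summand `G α_n ⊙ (D(α_{n-1}, α_n) ⊙ (⋯ ⊙ (D(α_0, α_1) ⊙ F α_0)))`. -/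
abbrev barCell : N := ten (G.obj (α ⟨n, Nat.lt_succ_self n⟩)) (chain F α n (Nat.lt_succ_self n))

/-- The simplicial operators on the summands: morphisms of `D` are composed with each other, those
beyond the last vertex act on `G`, those before the first vertex act on `F`, and identities are
inserted at repeated vertices. -/
def barCellMap {m : ℕ} (φ : Fin (m + 1) →o Fin (n + 1)) :
    barCell G F α ⟶ barCell G F (fun i => α (φ i)) :=
  tenMap (𝟙 _) (chainBack F α _ (φ ⟨m, Nat.lt_succ_self m⟩).2 n
    (Nat.le_of_lt_succ (φ ⟨m, Nat.lt_succ_self m⟩).2) (Nat.lt_succ_self n) ≫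
      tenMap (𝟙 _) (chainPull F α φ m (Nat.lt_succ_self m))) ≫
    tenComp (G.act _ _) _

lemma tenComp_act (a b c : D) (X : N) :
    tenMap (𝟙 _) (tenComp (eComp V a b c) X) ≫ tenComp (G.act a c) X =
      tenComp (G.act b c) _ ≫ tenComp (G.act a b) X :=
  tenComp_tenComp _ _ _ _ (G.mul_act a b c)

lemma barCellMap_id : barCellMap G F α OrderHom.id = 𝟙 _ := by
  have h1 : tenMap (𝟙 (α ⟨n, Nat.lt_succ_self n⟩ ⟶[V] α ⟨n, Nat.lt_succ_self n⟩))
      (chainPull F α OrderHom.id n (Nat.lt_succ_self n)) = 𝟙 _ :=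
    (congrArg _ (chainPull_id F α n (Nat.lt_succ_self n))).trans tenMap_id
  have h2 : tenMap (𝟙 (G.obj (α ⟨n, Nat.lt_succ_self n⟩)))
      (tenPt (eId V (α ⟨n, Nat.lt_succ_self n⟩)) (chain F α n (Nat.lt_succ_self n))) ≫
      tenComp (G.act _ _) _ = 𝟙 _ := by
    rw [tenMap_tenPt_tenComp, G.one_act, Iso.inv_hom_id, tenMap_id]
  refine Eq.trans ?_ h2
  refine congrArg (fun t => tenMap (𝟙 _) t ≫ tenComp (G.act _ _) _) ?_
  refine (congrArg (fun t => _ ≫ t) h1).trans ((Category.comp_id _).trans ?_)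
  exact chainBack_self F α n _

lemma tenComp_act_comp (a b c : D) {X Y Z W P U : N} (x : X ⟶ ten (b ⟶[V] c) Y) (y : Y ⟶ Z)
    (w : Z ⟶ ten (a ⟶[V] b) W) (u : W ⟶ U) (x' : Y ⟶ ten (a ⟶[V] b) P) (p : P ⟶ W)
    (h : y ≫ w = x' ≫ tenMap (𝟙 _) p) :
    tenMap (𝟙 _) ((x ≫ tenMap (𝟙 _) x' ≫ tenComp (eComp V a b c) P) ≫ tenMap (𝟙 _) (p ≫ u)) ≫
        tenComp (G.act a c) U =
      (tenMap (𝟙 _) (x ≫ tenMap (𝟙 _) y) ≫ tenComp (G.act b c) Z) ≫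
        tenMap (𝟙 _) (w ≫ tenMap (𝟙 _) u) ≫ tenComp (G.act a b) U := by
  have k1 : (x ≫ tenMap (𝟙 _) x' ≫ tenComp (eComp V a b c) P) ≫ tenMap (𝟙 _) (p ≫ u) =
      (x ≫ tenMap (𝟙 _) (x' ≫ tenMap (𝟙 _) (p ≫ u))) ≫ tenComp (eComp V a b c) U := by
    rw [Category.assoc, Category.assoc, tenComp_tenMap_one, tenMap_one_comp x', Category.assoc,
      Category.assoc]
  have k2 : x' ≫ tenMap (𝟙 _) (p ≫ u) = y ≫ w ≫ tenMap (𝟙 _) u := by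
    rw [tenMap_one_comp, reassoc_of% h]
  rw [k1, k2, tenMap_one_comp, Category.assoc, tenComp_act, Category.assoc,
    reassoc_of% tenComp_tenMap_one]
  simp only [tenMap_one_comp, Category.assoc]

lemma barCellMap_comp {m l : ℕ} (φ : Fin (m + 1) →o Fin (n + 1)) (ψ : Fin (l + 1) →o Fin (m + 1)) :
    barCellMap G F α (φ.comp ψ) = barCellMap G F α φ ≫ barCellMap G F (fun i => α (φ i)) ψ := by
  have hl := Nat.lt_succ_self l
  have hm := Nat.lt_succ_self m
  have hn := Nat.lt_succ_self n
  have e1 := chainPull_chainBack F α φ (ψ ⟨l, hl⟩).1 (ψ ⟨l, hl⟩).2 m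
    (Nat.le_of_lt_succ (ψ ⟨l, hl⟩).2) hm
  have e2 := chainBack_chainBack F α (φ (ψ ⟨l, hl⟩)).1 (φ (ψ ⟨l, hl⟩)).2 (φ ⟨m, hm⟩).1
    (φ.monotone (Nat.le_of_lt_succ (ψ ⟨l, hl⟩).2)) (φ ⟨m, hm⟩).2 n
    (Nat.le_of_lt_succ (φ ⟨m, hm⟩).2) hn
  have e3 := chainPull_comp F α φ ψ l hl
  refine Eq.trans ?_ (tenComp_act_comp G _ _ _ _ _ _ _ _ _ e1)
  refine congrArg (fun t => tenMap (𝟙 _) t ≫ tenComp (G.act _ _) _) ?_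
  refine (congrArg (fun t => _ ≫ tenMap (𝟙 _) t) e3).trans ?_
  exact congrArg (fun t => t ≫ tenMap (𝟙 _) _) e2.symm

variable {G F} {G' : RightModule V D} {F' : VFun V D N} (g : G ⟶ G') (f : F ⟶ F')

/-- The functoriality of the summands. -/
def barCellNat : barCell G F α ⟶ barCell G' F' α := tenMap (g.app _) (chainMap f α n _)

lemma barCellNat_map {m : ℕ} (φ : Fin (m + 1) →o Fin (n + 1)) :
    barCellNat α g f ≫ barCellMap G' F' α φ =
      barCellMap G F α φ ≫ barCellNat (fun i => α (φ i)) g f := by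
  have hm := Nat.lt_succ_self m
  have hn := Nat.lt_succ_self n
  have e1 := chainMap_chainBack f α (φ ⟨m, hm⟩).1 (φ ⟨m, hm⟩).2 n
    (Nat.le_of_lt_succ (φ ⟨m, hm⟩).2) hn
  have e2 := chainMap_chainPull f α φ m hm
  have e2' := congrArg (fun t =>
    tenMap (𝟙 (α ⟨(φ ⟨m, hm⟩).1, (φ ⟨m, hm⟩).2⟩ ⟶[V] α ⟨n, hn⟩)) t) e2
  simp only [tenMap_one_comp] at e2'
  rw [barCellNat, barCellMap, barCellMap, barCellNat, Category.assoc, tenComp_act_natural,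
    ← Category.assoc, ← Category.assoc, tenMap_comp, tenMap_comp, Category.id_comp,
    Category.comp_id]
  refine congrArg (fun t => tenMap _ t ≫ tenComp (G'.act _ _) _) ?_
  rw [← Category.assoc, e1, Category.assoc, Category.assoc]
  exact congrArg (fun t => _ ≫ t) e2'

end Cells

/-- The two-sided simplicial bar construction `B_•(G, D, F)`, with
`B_n(G, D, F) = ∐_{α_0, …, α_n} G α_n ⊙ (D(α_{n-1}, α_n) ⊙ (⋯ ⊙ (D(α_0, α_1) ⊙ F α_0)))`. -/
def simplicialBarObj (G : RightModule V D) (F : VFun V D N) : SimplexCategoryᵒᵖ ⥤ N where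
  obj n := ∐ fun α : Fin (n.unop.len + 1) → D => barCell G F α
  map φ := Limits.Sigma.desc fun α => barCellMap G F α φ.unop.toOrderHom ≫
    Sigma.ι (fun α => barCell G F α) (fun i => α (φ.unop.toOrderHom i))
  map_id n := by
    apply Limits.Sigma.hom_ext
    intro α
    rw [Sigma.ι_desc, Category.comp_id]
    exact (congrArg (fun t => t ≫ _) (barCellMap_id G F α)).trans (Category.id_comp _)
  map_comp φ ψ := by
    apply Limits.Sigma.hom_ext
    intro α
    rw [Sigma.ι_desc, Sigma.ι_desc_assoc, Category.assoc, Sigma.ι_desc]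
    refine (congrArg (fun t => t ≫ _) (barCellMap_comp G F α _ _)).trans ?_
    exact Category.assoc _ _ _

/-- The functoriality of `B_n(G, D, F)`. -/
def barLevelMap (n : ℕ) {G G' : RightModule V D} {F F' : VFun V D N} (g : G ⟶ G') (f : F ⟶ F') :
    (∐ fun α : Fin (n + 1) → D => barCell G F α) ⟶
      ∐ fun α : Fin (n + 1) → D => barCell G' F' α :=
  Limits.Sigma.desc fun α => barCellNat α g f ≫ Sigma.ι (fun α => barCell G' F' α) α

lemma barLevelMap_id (n : ℕ) (G : RightModule V D) (F : VFun V D N) :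
    barLevelMap n (𝟙 G) (𝟙 F) = 𝟙 _ := by
  apply Limits.Sigma.hom_ext
  intro α
  have h : barCellNat α (𝟙 G) (𝟙 F) = 𝟙 (barCell G F α) := by
    rw [barCellNat, chainMap_id]; exact tenMap_id
  rw [barLevelMap, Sigma.ι_desc, h, Category.id_comp, Category.comp_id]

lemma barLevelMap_comp (n : ℕ) {G G' G'' : RightModule V D} {F F' F'' : VFun V D N}
    (g : G ⟶ G') (f : F ⟶ F') (g' : G' ⟶ G'') (f' : F' ⟶ F'') :
    barLevelMap n (g ≫ g') (f ≫ f') = barLevelMap n g f ≫ barLevelMap n g' f' := by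
  apply Limits.Sigma.hom_ext
  intro α
  have h : barCellNat α (g ≫ g') (f ≫ f') = barCellNat α g f ≫ barCellNat α g' f' := by
    rw [barCellNat, chainMap_comp]; exact (tenMap_comp _ _ _ _).symm
  rw [barLevelMap, barLevelMap, barLevelMap, Sigma.ι_desc, Sigma.ι_desc_assoc, Category.assoc,
    Sigma.ι_desc, h, Category.assoc]

/-- The two-sided simplicial bar construction, as a functor of `G` and `F`. -/
def simplicialBar : RightModule V D × VFun V D N ⥤ (SimplexCategoryᵒᵖ ⥤ N) where
  obj p := simplicialBarObj p.1 p.2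
  map {p p'} f :=
    { app := fun n => barLevelMap n.unop.len f.1 f.2
      naturality := fun n m φ => by
        apply Limits.Sigma.hom_ext
        intro α
        dsimp only [simplicialBarObj, barLevelMap]
        rw [Sigma.ι_desc_assoc, Sigma.ι_desc_assoc, Category.assoc, Category.assoc, Sigma.ι_desc,
          Sigma.ι_desc, ← Category.assoc, ← Category.assoc, barCellNat_map] }
  map_id p := by
    ext n : 2
    exact barLevelMap_id n.unop.len p.1 p.2
  map_comp {p p' p''} f g := by
    ext n : 2
    exact barLevelMap_comp n.unop.len f.1 f.2 g.1 g.2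

end SimplicialBar
end EnrichedBar

namespace EnrichedBar

/-! ### Geometric realization and the bar construction -/

section Realization

variable {V : Type u₁} [Category.{v} V] [MonoidalCategory V] [SymmetricCategory V]
  [MonoidalClosed V] {N : Type u₂} [Category.{v} N] [EnrichedOrdinaryCategory V N]
  [EnrichedBicomplete V N] (Δ : SimplexCategory ⥤ V)

/-- The pair `∐_{φ : m ⟶ n} Δ m ⊙ X n ⇉ ∐_n Δ n ⊙ X n`. -/
def realizePair (X : SimplexCategoryᵒᵖ ⥤ N) : SigmaPair N where
  src := ULift.{v} (Σ m n : SimplexCategory, m ⟶ n)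
  tgt := ULift.{v} SimplexCategory
  A i := ten (Δ.obj i.down.1) (X.obj (op i.down.2.1))
  B n := ten (Δ.obj n.down) (X.obj (op n.down))
  s i := ⟨i.down.2.1⟩
  t i := ⟨i.down.1⟩
  f i := tenMap (Δ.map i.down.2.2) (𝟙 _)
  g i := tenMap (𝟙 _) (X.map i.down.2.2.op)

/-- The geometric realization `Δ ⊙_{Δᵒᵖ} X` of a simplicial object `X`. -/
def realizeObj (X : SimplexCategoryᵒᵖ ⥤ N) : N := (realizePair Δ X).coeq

/-- The map `Δ n ⊙ X n ⟶ |X|`. -/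
def realizeInj (X : SimplexCategoryᵒᵖ ⥤ N) (n : SimplexCategory) :
    ten (Δ.obj n) (X.obj (op n)) ⟶ realizeObj Δ X := (realizePair Δ X).inj ⟨n⟩

lemma realizeInj_condition (X : SimplexCategoryᵒᵖ ⥤ N) {m n : SimplexCategory} (φ : m ⟶ n) :
    tenMap (Δ.map φ) (𝟙 _) ≫ realizeInj Δ X n = tenMap (𝟙 _) (X.map φ.op) ≫ realizeInj Δ X m :=
  (realizePair Δ X).condition ⟨⟨m, n, φ⟩⟩

variable {Δ}

/-- Maps out of the realization. -/
def realizeDesc {X : SimplexCategoryᵒᵖ ⥤ N} {Y : N}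
    (u : ∀ n : SimplexCategory, ten (Δ.obj n) (X.obj (op n)) ⟶ Y)
    (h : ∀ (m n : SimplexCategory) (φ : m ⟶ n),
      tenMap (Δ.map φ) (𝟙 _) ≫ u n = tenMap (𝟙 _) (X.map φ.op) ≫ u m) : realizeObj Δ X ⟶ Y :=
  SigmaPair.desc (P := realizePair Δ X) (fun n => u n.down) fun i => h _ _ i.down.2.2

lemma realizeInj_desc {X : SimplexCategoryᵒᵖ ⥤ N} {Y : N}
    (u : ∀ n : SimplexCategory, ten (Δ.obj n) (X.obj (op n)) ⟶ Y)
    (h : ∀ (m n : SimplexCategory) (φ : m ⟶ n),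
      tenMap (Δ.map φ) (𝟙 _) ≫ u n = tenMap (𝟙 _) (X.map φ.op) ≫ u m) (n : SimplexCategory) :
    realizeInj Δ X n ≫ realizeDesc u h = u n :=
  SigmaPair.inj_desc (P := realizePair Δ X) _ _ ⟨n⟩

lemma realizeObj_ext {X : SimplexCategoryᵒᵖ ⥤ N} {Y : N} {x y : realizeObj Δ X ⟶ Y}
    (h : ∀ n, realizeInj Δ X n ≫ x = realizeInj Δ X n ≫ y) : x = y :=
  SigmaPair.hom_ext (P := realizePair Δ X) fun n => h n.down

/-- The functoriality of geometric realization. -/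
def realizeMap {X Y : SimplexCategoryᵒᵖ ⥤ N} (f : X ⟶ Y) : realizeObj Δ X ⟶ realizeObj Δ Y :=
  realizeDesc (fun n => tenMap (𝟙 _) (f.app (op n)) ≫ realizeInj Δ Y n)
    (fun m n φ => by
      rw [reassoc_of% tenMap_comp, reassoc_of% tenMap_comp, f.naturality]
      have h := congrArg (fun t => tenMap (𝟙 _) (f.app (op n)) ≫ t) (realizeInj_condition Δ Y φ)
      rw [reassoc_of% tenMap_comp, reassoc_of% tenMap_comp] at h
      simpa using h)

lemma realizeInj_map {X Y : SimplexCategoryᵒᵖ ⥤ N} (f : X ⟶ Y) (n : SimplexCategory) :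
    realizeInj Δ X n ≫ realizeMap f = tenMap (𝟙 _) (f.app (op n)) ≫ realizeInj Δ Y n := by
  exact realizeInj_desc _ _ n

variable (Δ) in
/-- Geometric realization, as a functor. -/
def realize : (SimplexCategoryᵒᵖ ⥤ N) ⥤ N where
  obj X := realizeObj Δ X
  map f := realizeMap f
  map_id X := realizeObj_ext fun n => by
    rw [realizeInj_map, NatTrans.id_app, tenMap_id, Category.id_comp, Category.comp_id]
  map_comp f g := realizeObj_ext fun n => by
    rw [realizeInj_map, reassoc_of% realizeInj_map, realizeInj_map,
      reassoc_of% tenMap_comp, NatTrans.comp_app, Category.id_comp]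

/-- For an augmented cosimplicial object `Δ`, the map `|X| ⟶ Y` induced by an augmentation of
`X`. -/
def realizeAug (e : Δ ⟶ (Functor.const _).obj (𝟙_ V)) {X : SimplexCategoryᵒᵖ ⥤ N} {Y : N}
    (u : ∀ n : SimplexCategory, X.obj (op n) ⟶ Y)
    (h : ∀ (m n : SimplexCategory) (φ : m ⟶ n), X.map φ.op ≫ u m = u n) : realizeObj Δ X ⟶ Y :=
  realizeDesc (fun n => tenCounit (e.app n) _ ≫ u n)
    (fun m n φ => by
      rw [← Category.assoc, tenMap_tenCounit, ← Category.assoc, tenMap_tenCounit, e.naturality,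
        Category.assoc, Category.assoc, h]
      simp)

lemma realizeInj_aug (e : Δ ⟶ (Functor.const _).obj (𝟙_ V)) {X : SimplexCategoryᵒᵖ ⥤ N} {Y : N}
    (u : ∀ n : SimplexCategory, X.obj (op n) ⟶ Y)
    (h : ∀ (m n : SimplexCategory) (φ : m ⟶ n), X.map φ.op ≫ u m = u n) (n : SimplexCategory) :
    realizeInj Δ X n ≫ realizeAug e u h = tenCounit (e.app n) _ ≫ u n := by
  exact realizeInj_desc _ _ n

lemma realizeMap_aug (e : Δ ⟶ (Functor.const _).obj (𝟙_ V)) {X X' : SimplexCategoryᵒᵖ ⥤ N}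
    {Y Y' : N} (u : ∀ n : SimplexCategory, X.obj (op n) ⟶ Y)
    (h : ∀ (m n : SimplexCategory) (φ : m ⟶ n), X.map φ.op ≫ u m = u n)
    (u' : ∀ n : SimplexCategory, X'.obj (op n) ⟶ Y')
    (h' : ∀ (m n : SimplexCategory) (φ : m ⟶ n), X'.map φ.op ≫ u' m = u' n)
    (f : X ⟶ X') (g : Y ⟶ Y') (hfg : ∀ n, f.app (op n) ≫ u' n = u n ≫ g) :
    realizeMap f ≫ realizeAug e u' h' = realizeAug e u h ≫ g := by
  apply realizeObj_ext
  intro n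
  rw [reassoc_of% realizeInj_map, realizeInj_aug, reassoc_of% realizeInj_aug, ← hfg,
    ← Category.assoc, tenMap_tenCounit, Category.assoc, Category.id_comp]

end Realization

section Bar

variable {V : Type u₁} [Category.{v} V] [MonoidalCategory V] [SymmetricCategory V]
  [MonoidalClosed V] (Δ : SimplexCategory ⥤ V) (D : Type v) [EnrichedCategory V D]
  (N : Type u₂) [Category.{v} N] [EnrichedOrdinaryCategory V N] [EnrichedBicomplete V N]

/-- The two-sided bar construction `B(G, D, F) = |B_•(G, D, F)|`, as a functor of `G` and `F`. -/
def bar : RightModule V D × VFun V D N ⥤ N := simplicialBar ⋙ realize Δ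

variable {D N}

lemma tenComp_act_tensorInj (G : RightModule V D) (F : VFun V D N) (a b : D) {X Y : N}
    (x : X ⟶ ten (a ⟶[V] b) Y) (y : Y ⟶ F.obj a) :
    (tenMap (𝟙 _) x ≫ tenComp (G.act a b) Y) ≫ tenMap (𝟙 _) y ≫ tensorInj G F a =
      tenMap (𝟙 _) (x ≫ tenMap (𝟙 _) y ≫ F.act a b) ≫ tensorInj G F b := by
  rw [Category.assoc, reassoc_of% tenComp_tenMap_one, tensorInj_condition]
  simp only [tenMap_one_comp, Category.assoc]

lemma barCellMap_chainAct (G : RightModule V D) (F : VFun V D N) {n m : ℕ} (α : Fin (n + 1) → D)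
    (φ : Fin (m + 1) →o Fin (n + 1)) :
    barCellMap G F α φ ≫ tenMap (𝟙 _) (chainAct F (fun i => α (φ i)) m (Nat.lt_succ_self m)) ≫
        tensorInj G F (α (φ ⟨m, Nat.lt_succ_self m⟩)) =
      tenMap (𝟙 _) (chainAct F α n (Nat.lt_succ_self n)) ≫
        tensorInj G F (α ⟨n, Nat.lt_succ_self n⟩) := by
  have hm := Nat.lt_succ_self m
  have e1 := chainBack_chainAct F α (φ ⟨m, hm⟩).1 (φ ⟨m, hm⟩).2 n
    (Nat.le_of_lt_succ (φ ⟨m, hm⟩).2) (Nat.lt_succ_self n)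
  have e2 := chainPull_chainAct F α φ m hm
  refine (tenComp_act_tensorInj G F _ _ _ _).trans ?_
  refine congrArg (fun t => tenMap _ t ≫ _) ?_
  refine Eq.trans ?_ e1
  refine (Category.assoc _ _ _).trans (congrArg (fun t => _ ≫ t) ?_)
  refine (Category.assoc _ _ _).symm.trans (congrArg (fun t => t ≫ F.act _ _) ?_)
  exact (tenMap_one_comp _ _).symm.trans (congrArg (fun t => tenMap _ t) e2)

/-- The map `B_n(G, D, F) ⟶ G ⊙_D F` that composes everything and acts on `F`. -/
def barLevelAug (G : RightModule V D) (F : VFun V D N) (n : ℕ) :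
    (∐ fun α : Fin (n + 1) → D => barCell G F α) ⟶ tensorObj G F :=
  Limits.Sigma.desc fun α => tenMap (𝟙 _) (chainAct F α n (Nat.lt_succ_self n)) ≫
    tensorInj G F (α ⟨n, Nat.lt_succ_self n⟩)

lemma barLevelAug_map (G : RightModule V D) (F : VFun V D N) {m n : SimplexCategory} (φ : m ⟶ n) :
    (simplicialBarObj G F).map φ.op ≫ barLevelAug G F m.len = barLevelAug G F n.len := by
  apply Limits.Sigma.hom_ext
  intro α
  dsimp only [simplicialBarObj, barLevelAug]
  rw [Sigma.ι_desc_assoc, Category.assoc, Sigma.ι_desc, Sigma.ι_desc]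
  exact barCellMap_chainAct G F α _

lemma barLevelAug_natural {G G' : RightModule V D} {F F' : VFun V D N} (g : G ⟶ G') (f : F ⟶ F')
    (n : ℕ) : barLevelMap n g f ≫ barLevelAug G' F' n =
      barLevelAug G F n ≫ tensorObjMap g f := by
  apply Limits.Sigma.hom_ext
  intro α
  dsimp only [barLevelMap, barLevelAug]
  rw [Sigma.ι_desc_assoc, Category.assoc, Sigma.ι_desc, Sigma.ι_desc_assoc, Category.assoc,
    tensorInj_map, ← Category.assoc, ← Category.assoc, barCellNat, tenMap_comp, tenMap_comp,
    Category.id_comp, Category.comp_id]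
  exact congrArg (fun t => tenMap _ t ≫ _) (chainMap_chainAct f α n _)

variable {Δ}

/-- The comparison map `B(G, D, F) ⟶ G ⊙_D F`, for an augmented cosimplicial object `Δ`. -/
def barComparison (e : Δ ⟶ (Functor.const _).obj (𝟙_ V)) :
    bar Δ D N ⟶ tensorProduct where
  app p := realizeAug e (X := simplicialBarObj p.1 p.2) (fun n => barLevelAug p.1 p.2 n.len)
    (fun _ _ φ => barLevelAug_map p.1 p.2 φ)
  naturality _ _ f := realizeMap_aug e _ _ _ _ _ _ fun n => barLevelAug_natural f.1 f.2 n.len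

end Bar
end EnrichedBar

namespace EnrichedBar

/-! ### The `V`-functor `B(D, D, F)` -/

section Opposite

variable {V : Type u₁} [Category.{v} V] [MonoidalCategory V] [SymmetricCategory V]
  {N : Type u₂} [Category.{v} N] [EnrichedOrdinaryCategory V N]

lemma eHomWhiskerLeft_op (Y : N) {X X' : N} (f : X' ⟶ X) :
    eHomWhiskerLeft V (op Y) f.op = eHomWhiskerRight V f Y := by
  have h : (ρ_ (X ⟶[V] Y)).inv ≫ (X ⟶[V] Y) ◁ eHomEquiv V f ≫ (β_ _ _).hom ≫ eComp V X' X Y =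
      (λ_ _).inv ≫ eHomEquiv V f ▷ _ ≫ eComp V X' X Y := by
    simp
  exact h

lemma eHomWhiskerRight_op {Y Y' : N} (g : Y ⟶ Y') (X : N) :
    eHomWhiskerRight V g.op (op X) = eHomWhiskerLeft V X g := by
  have h : (λ_ (X ⟶[V] Y)).inv ≫ eHomEquiv V g ▷ (X ⟶[V] Y) ≫ (β_ _ _).hom ≫ eComp V X Y Y' =
      (ρ_ _).inv ≫ _ ◁ eHomEquiv V g ≫ eComp V X Y Y' := by
    simp
  exact h

end Opposite

section Graded

variable {V : Type u₁} [Category.{v} V] [MonoidalCategory V] [SymmetricCategory V]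
  [MonoidalClosed V] {N : Type u₂} [Category.{v} N] [EnrichedOrdinaryCategory V N]
  [EnrichedBicomplete V N] {J J' K L A A' A'' : V} {X Y Z X' Y' : N}

/-- The cotensor `{K, Y}`. -/
def cot (K : V) (Y : N) : N := (EnrichedBicomplete.cotensor K Y).obj

/-- The universal `K ⟶ N({K, Y}, Y)`. -/
def cotUnit (K : V) (Y : N) : K ⟶ (cot K Y ⟶[V] Y) := (EnrichedBicomplete.cotensor K Y).counit

lemma cotHom_bijective (K : V) (X Y : N) :
    Function.Bijective (fun f : X ⟶ cot K Y => cotUnit K Y ≫ eHomWhiskerRight V f Y) := by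
  let E : (X ⟶ cot K Y) ≃ (K ⟶ (X ⟶[V] Y)) := (opEquiv (op (cot K Y)) (op X)).symm.trans
    (tenEquiv (V := V) (N := Nᵒᵖ) (K := K) (X := op Y) (Y := op X))
  have h : (fun f : X ⟶ cot K Y => cotUnit K Y ≫ eHomWhiskerRight V f Y) = E := by
    funext f
    refine Eq.trans ?_
      (tenEquiv_apply (V := V) (N := Nᵒᵖ) (K := K) (X := op Y) (Y := op X) f.op).symm
    exact congrArg (fun t => cotUnit K Y ≫ t) (eHomWhiskerLeft_op Y f).symm
  rw [h]
  exact E.bijective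

/-- Maps `X ⟶ {K, Y}` are maps `K ⟶ N(X, Y)`. -/
def cotEquiv : (X ⟶ cot K Y) ≃ (K ⟶ (X ⟶[V] Y)) := Equiv.ofBijective _ (cotHom_bijective K X Y)

lemma cotEquiv_apply (f : X ⟶ cot K Y) : cotEquiv f = cotUnit K Y ≫ eHomWhiskerRight V f Y := rfl

lemma cotEquiv_comp (g : X' ⟶ X) (f : X ⟶ cot K Y) :
    cotEquiv (g ≫ f) = cotEquiv f ≫ eHomWhiskerRight V g Y := by
  simp [cotEquiv_apply]

lemma comp_cotEquiv_symm (g : X' ⟶ X) (u : K ⟶ (X ⟶[V] Y)) :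
    g ≫ cotEquiv.symm u = cotEquiv.symm (u ≫ eHomWhiskerRight V g Y) := by
  apply cotEquiv.injective
  rw [cotEquiv_comp, Equiv.apply_symm_apply, Equiv.apply_symm_apply]

section

variable {Δ : SimplexCategory ⥤ V} {S S' S'' : SimplexCategoryᵒᵖ ⥤ N}

/-- Maps `K ⟶ N(|S|, Y)`. -/
def gRealizeDesc (u : ∀ n : SimplexCategory, K ⟶ (ten (Δ.obj n) (S.obj (op n)) ⟶[V] Y))
    (h : ∀ (m n : SimplexCategory) (φ : m ⟶ n),
      u n ≫ eHomWhiskerRight V (tenMap (Δ.map φ) (𝟙 _)) Y =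
        u m ≫ eHomWhiskerRight V (tenMap (𝟙 _) (S.map φ.op)) Y) :
    K ⟶ (realizeObj Δ S ⟶[V] Y) :=
  cotEquiv (realizeDesc (fun n => cotEquiv.symm (u n)) (fun m n φ => by
    rw [comp_cotEquiv_symm, comp_cotEquiv_symm, h]))

lemma gRealizeDesc_inj (u : ∀ n : SimplexCategory, K ⟶ (ten (Δ.obj n) (S.obj (op n)) ⟶[V] Y))
    (h : ∀ (m n : SimplexCategory) (φ : m ⟶ n),
      u n ≫ eHomWhiskerRight V (tenMap (Δ.map φ) (𝟙 _)) Y =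
        u m ≫ eHomWhiskerRight V (tenMap (𝟙 _) (S.map φ.op)) Y) (n : SimplexCategory) :
    gRealizeDesc u h ≫ eHomWhiskerRight V (realizeInj Δ S n) Y = u n := by
  rw [gRealizeDesc, ← cotEquiv_comp, realizeInj_desc, Equiv.apply_symm_apply]

lemma gRealize_ext {x y : K ⟶ (realizeObj Δ S ⟶[V] Y)}
    (h : ∀ n, x ≫ eHomWhiskerRight V (realizeInj Δ S n) Y =
      y ≫ eHomWhiskerRight V (realizeInj Δ S n) Y) : x = y := by
  apply cotEquiv.symm.injective
  apply realizeObj_ext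
  intro n
  rw [comp_cotEquiv_symm, comp_cotEquiv_symm, h]

end

section

variable {ι : Type v} {X : ι → N}

/-- Maps `K ⟶ N(∐ X, Y)`. -/
def gSigmaDesc (u : ∀ i, K ⟶ (X i ⟶[V] Y)) : K ⟶ ((∐ X) ⟶[V] Y) :=
  cotEquiv (Limits.Sigma.desc fun i => cotEquiv.symm (u i))

lemma gSigmaDesc_ι (u : ∀ i, K ⟶ (X i ⟶[V] Y)) (i : ι) :
    gSigmaDesc u ≫ eHomWhiskerRight V (Sigma.ι X i) Y = u i := by
  rw [gSigmaDesc, ← cotEquiv_comp, Sigma.ι_desc, Equiv.apply_symm_apply]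

lemma gSigma_ext {x y : K ⟶ ((∐ X) ⟶[V] Y)}
    (h : ∀ i, x ≫ eHomWhiskerRight V (Sigma.ι X i) Y =
      y ≫ eHomWhiskerRight V (Sigma.ι X i) Y) : x = y := by
  apply cotEquiv.symm.injective
  apply Limits.Sigma.hom_ext
  intro n
  rw [comp_cotEquiv_symm, comp_cotEquiv_symm, h]

end

/-! Enriched functoriality of the tensor in each variable. -/

/-- The map `K ⟶ N(J ⊙ X, J ⊙ Y)` induced by `K ⟶ N(X, Y)`. -/
def gTenMap (J : V) (u : K ⟶ (X ⟶[V] Y)) : K ⟶ (ten J X ⟶[V] ten J Y) :=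
  tenHom.symm ((β_ J K).hom ≫ gcomp V u (tenUnit J Y))

/-- The map `K ⟶ N(A ⊙ X, A' ⊙ X)` induced by `A ⊗ K ⟶ A'`. -/
def gTenAct (s : A ⊗ K ⟶ A') (X : N) : K ⟶ (ten A X ⟶[V] ten A' X) :=
  tenHom.symm (s ≫ tenUnit A' X)

lemma tenUnit_gTenMap (u : K ⟶ (X ⟶[V] Y)) :
    gcomp V (tenUnit J X) (gTenMap J u) = (β_ J K).hom ≫ gcomp V u (tenUnit J Y) := by
  rw [← tenHom_apply, gTenMap, Equiv.apply_symm_apply]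

lemma tenUnit_gTenAct (s : A ⊗ K ⟶ A') (X : N) :
    gcomp V (tenUnit A X) (gTenAct s X) = s ≫ tenUnit A' X := by
  rw [← tenHom_apply, gTenAct, Equiv.apply_symm_apply]

lemma gTenMap_eId : gTenMap J (eId V X) = eId V (ten J X) := by
  apply ten_gext
  rw [tenUnit_gTenMap, eId_gcomp, gcomp_eId]
  simp

lemma gTenMap_gcomp (u : K ⟶ (X ⟶[V] Y)) (w : L ⟶ (Y ⟶[V] Z)) :
    gTenMap J (gcomp V u w) = gcomp V (gTenMap J u) (gTenMap J w) := by
  apply ten_gext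
  rw [tenUnit_gTenMap, ← cancel_epi (α_ _ _ _).hom, ← gcomp_assoc, tenUnit_gTenMap,
    comp_gcomp_left, gcomp_assoc, gcomp_assoc, tenUnit_gTenMap, comp_gcomp_right]
  simp

lemma comp_gTenMap (s : L ⟶ K) (u : K ⟶ (X ⟶[V] Y)) :
    gTenMap J (s ≫ u) = s ≫ gTenMap J u := by
  apply ten_gext
  rw [tenUnit_gTenMap, comp_gcomp_left, comp_gcomp_right, tenUnit_gTenMap]
  simp

lemma gTenMap_whiskerLeft (u : K ⟶ (X ⟶[V] Y)) (g : Y ⟶ Z) :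
    gTenMap J (u ≫ eHomWhiskerLeft V X g) = gTenMap J u ≫ eHomWhiskerLeft V _ (tenMap (𝟙 J) g) := by
  apply ten_gext
  rw [tenUnit_gTenMap, gcomp_whiskerLeft, tenUnit_gTenMap, gcomp_middle, Category.assoc,
    ← gcomp_whiskerLeft]
  congr 2
  exact (Category.id_comp _).symm.trans (ad_tenMap (𝟙 J) g).symm

lemma gTenMap_whiskerRight (f : X' ⟶ X) (u : K ⟶ (X ⟶[V] Y)) :
    gTenMap J (u ≫ eHomWhiskerRight V f Y) =
      gTenMap J u ≫ eHomWhiskerRight V (tenMap (𝟙 J) f) _ := by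
  apply ten_gext
  rw [tenUnit_gTenMap, tenUnit_gcomp, ad_tenMap, Category.id_comp, gcomp_whiskerRight,
    gcomp_whiskerRight, tenUnit_gTenMap, Category.assoc]

lemma gTenMap_exchange (s : J ⟶ J') (u : K ⟶ (X ⟶[V] Y)) :
    gTenMap J u ≫ eHomWhiskerLeft V _ (tenMap s (𝟙 Y)) =
      gTenMap J' u ≫ eHomWhiskerRight V (tenMap s (𝟙 X)) _ := by
  apply ten_gext
  rw [gcomp_whiskerLeft, tenUnit_gTenMap, tenUnit_gcomp, Category.assoc, ← gcomp_whiskerLeft]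
  change _ ≫ gcomp V u (ad _) = _
  rw [ad_tenMap, ad_tenMap, eHomWhiskerRight_id, eHomWhiskerRight_id, Category.comp_id,
    Category.comp_id, comp_gcomp_right, comp_gcomp_left, tenUnit_gTenMap]
  simp

lemma gTenAct_id (s : A ⊗ 𝟙_ V ⟶ A) (h : s = (ρ_ A).hom) : gTenAct s X = eId V (ten A X) := by
  apply ten_gext
  rw [tenUnit_gTenAct, gcomp_eId, h]

lemma comp_gTenAct (t : L ⟶ K) (s : A ⊗ K ⟶ A') :
    t ≫ gTenAct s X = gTenAct (A ◁ t ≫ s) X := by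
  apply ten_gext
  rw [tenUnit_gTenAct, comp_gcomp_right, tenUnit_gTenAct, Category.assoc]

lemma gcomp_gTenAct (s : A ⊗ K ⟶ A') (s' : A' ⊗ L ⟶ A'') :
    gcomp V (gTenAct s X) (gTenAct s' X) = gTenAct ((α_ _ _ _).inv ≫ s ▷ L ≫ s') X := by
  apply ten_gext
  rw [tenUnit_gTenAct, ← cancel_epi (α_ _ _ _).hom, ← gcomp_assoc, tenUnit_gTenAct,
    comp_gcomp_left, tenUnit_gTenAct]
  simp

lemma gTenAct_exchange (s : A ⊗ K ⟶ A') (f : X ⟶ Y) :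
    gTenAct s X ≫ eHomWhiskerLeft V _ (tenMap (𝟙 A') f) =
      gTenAct s Y ≫ eHomWhiskerRight V (tenMap (𝟙 A) f) _ := by
  apply ten_gext
  rw [gcomp_whiskerLeft, tenUnit_gTenAct, tenUnit_gcomp, Category.assoc]
  change _ ≫ ad _ = _
  rw [ad_tenMap, ad_tenMap, Category.id_comp, Category.id_comp, gcomp_whiskerRight,
    tenUnit_gTenAct, Category.assoc]

lemma gTenAct_tenComp {P Q : V} (s : A ⊗ K ⟶ A') (p : P ⊗ A ⟶ Q) {Q' : V} (p' : P ⊗ A' ⟶ Q')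
    (t : Q ⊗ K ⟶ Q') (h : p ▷ K ≫ t = (α_ _ _ _).hom ≫ P ◁ s ≫ p') (X : N) :
    gTenAct s (ten P X) ≫ eHomWhiskerLeft V _ (tenComp p' X) =
      gTenAct t X ≫ eHomWhiskerRight V (tenComp p X) _ := by
  apply ten_gext
  rw [gcomp_whiskerLeft, tenUnit_gTenAct, tenUnit_gcomp, Category.assoc]
  change _ ≫ ad _ = _
  apply ten_gext
  rw [comp_gcomp_right, ad_tenComp, ← cancel_epi (α_ _ _ _).hom, ← gcomp_assoc, ad_tenComp,
    comp_gcomp_left, tenUnit_gTenAct, reassoc_of% h]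

end Graded
end EnrichedBar

namespace EnrichedBar

section BarDiagram

variable {V : Type u₁} [Category.{v} V] [MonoidalCategory V] [SymmetricCategory V]
  [MonoidalClosed V] {D : Type v} [EnrichedCategory V D]
  {N : Type u₂} [Category.{v} N] [EnrichedOrdinaryCategory V N] [EnrichedBicomplete V N]
  {K L : V}

/-- The map `B_n`-summand by summand induced by `D(e, e')`, from `D(-, e)` to `D(-, e')`. -/
def gCell (e e' : D) (F : VFun V D N) {n : ℕ} (α : Fin (n + 1) → D) :
    (e ⟶[V] e') ⟶ (barCell (reprModule e) F α ⟶[V] barCell (reprModule e') F α) :=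
  gTenAct (eComp V (α ⟨n, Nat.lt_succ_self n⟩) e e') (chain F α n (Nat.lt_succ_self n))

lemma gTenAct_barCell (a b e e' : D) {X Y : N} (x : X ⟶ ten (a ⟶[V] b) Y) :
    gTenAct (eComp V b e e') X ≫ eHomWhiskerLeft V _
        (tenMap (𝟙 _) x ≫ tenComp (eComp V a b e') Y) =
      gTenAct (eComp V a e e') Y ≫ eHomWhiskerRight V
        (tenMap (𝟙 _) x ≫ tenComp (eComp V a b e) Y) _ := by
  rw [eHomWhiskerLeft_comp, eHomWhiskerRight_comp, ← Category.assoc, gTenAct_exchange,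
    Category.assoc, ← eHom_whisker_exchange, ← Category.assoc,
    gTenAct_tenComp _ (eComp V a b e) _ (eComp V a e e') (e_assoc' V a b e e').symm,
    Category.assoc]

lemma gCell_map (e e' : D) (F : VFun V D N) {n m : ℕ} (α : Fin (n + 1) → D)
    (φ : Fin (m + 1) →o Fin (n + 1)) :
    gCell e e' F α ≫ eHomWhiskerLeft V _ (barCellMap (reprModule e') F α φ) =
      gCell e e' F (fun i => α (φ i)) ≫
        eHomWhiskerRight V (barCellMap (reprModule e) F α φ) _ :=
  gTenAct_barCell _ _ _ _ _

/-- The map `D(e, e') ⟶ N(B_n(D(-, e), D, F), B_n(D(-, e'), D, F))`. -/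
def gLevel (e e' : D) (F : VFun V D N) (n : ℕ) :
    (e ⟶[V] e') ⟶ ((∐ fun α : Fin (n + 1) → D => barCell (reprModule e) F α) ⟶[V]
      (∐ fun α : Fin (n + 1) → D => barCell (reprModule e') F α)) :=
  gSigmaDesc fun α => gCell e e' F α ≫
    eHomWhiskerLeft V _ (Sigma.ι (fun α => barCell (reprModule e') F α) α)

lemma gLevel_map (e e' : D) (F : VFun V D N) {m n : SimplexCategory} (φ : m ⟶ n) :
    gLevel e e' F n.len ≫ eHomWhiskerLeft V _ ((simplicialBarObj (reprModule e') F).map φ.op) =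
      gLevel e e' F m.len ≫
        eHomWhiskerRight V ((simplicialBarObj (reprModule e) F).map φ.op) _ := by
  apply gSigma_ext
  intro α
  dsimp only [simplicialBarObj, gLevel]
  rw [Category.assoc, eHom_whisker_exchange, ← Category.assoc, gSigmaDesc_ι, Category.assoc,
    ← eHomWhiskerLeft_comp, Sigma.ι_desc, Category.assoc, ← eHomWhiskerRight_comp, Sigma.ι_desc,
    eHomWhiskerRight_comp, ← Category.assoc (gSigmaDesc _), gSigmaDesc_ι, Category.assoc,
    eHom_whisker_exchange, eHomWhiskerLeft_comp, ← Category.assoc, ← Category.assoc]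
  exact congrArg (fun t => t ≫ _) (gCell_map e e' F α φ.toOrderHom)

lemma gTenAct_eId (a b : D) (X : N) :
    eId V b ≫ gTenAct (eComp V a b b) X = eId V (ten (a ⟶[V] b) X) := by
  rw [comp_gTenAct]
  apply gTenAct_id
  rw [← cancel_epi (ρ_ _).inv, Iso.inv_hom_id]
  exact e_comp_id V _ _

lemma gTenAct_eComp (a e e' e'' : D) (X : N) :
    eComp V e e' e'' ≫ gTenAct (eComp V a e e'') X =
      gcomp V (gTenAct (eComp V a e e') X) (gTenAct (eComp V a e' e'') X) := by
  rw [comp_gTenAct, gcomp_gTenAct]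
  exact congrArg (fun t => gTenAct t _) (e_assoc V _ e e' e'').symm

lemma gLevel_eId (e : D) (F : VFun V D N) (n : ℕ) :
    eId V e ≫ gLevel e e F n = eId V _ := by
  apply gSigma_ext
  intro α
  have h : eId V e ≫ gCell e e F α = eId V _ := gTenAct_eId _ _ _
  rw [Category.assoc, gLevel, gSigmaDesc_ι, reassoc_of% h, eId_whiskerRight]

lemma gLevel_eComp (e e' e'' : D) (F : VFun V D N) (n : ℕ) :
    eComp V e e' e'' ≫ gLevel e e'' F n = gcomp V (gLevel e e' F n) (gLevel e' e'' F n) := by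
  apply gSigma_ext
  intro α
  rw [← gcomp_whiskerRight, Category.assoc, gLevel, gSigmaDesc_ι, gLevel, gSigmaDesc_ι, gcomp_middle,
    gLevel, gSigmaDesc_ι, gcomp_whiskerLeft]
  have h : eComp V e e' e'' ≫ gCell e e'' F α = gcomp V (gCell e e' F α) (gCell e' e'' F α) :=
    gTenAct_eComp _ _ _ _ _
  rw [reassoc_of% h]

variable (Δ : SimplexCategory ⥤ V)

section

variable {Δ} {S S' S'' : SimplexCategoryᵒᵖ ⥤ N}

/-- The map `K ⟶ N(|S|, |S'|)` induced by compatible maps `K ⟶ N(S n, S' n)`. -/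
def gRealizeMap (w : ∀ n : SimplexCategory, K ⟶ (S.obj (op n) ⟶[V] S'.obj (op n)))
    (hw : ∀ (m n : SimplexCategory) (φ : m ⟶ n), w n ≫ eHomWhiskerLeft V _ (S'.map φ.op) =
      w m ≫ eHomWhiskerRight V (S.map φ.op) _) :
    K ⟶ (realizeObj Δ S ⟶[V] realizeObj Δ S') :=
  gRealizeDesc (fun n => gTenMap (Δ.obj n) (w n) ≫ eHomWhiskerLeft V _ (realizeInj Δ S' n))
    (fun m n φ => by
      rw [Category.assoc, eHom_whisker_exchange, ← Category.assoc, ← gTenMap_exchange,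
        Category.assoc, ← eHomWhiskerLeft_comp, realizeInj_condition, eHomWhiskerLeft_comp,
        ← Category.assoc, ← gTenMap_whiskerLeft, hw, gTenMap_whiskerRight,
        Category.assoc, Category.assoc, eHom_whisker_exchange])

lemma gRealizeMap_inj (w : ∀ n : SimplexCategory, K ⟶ (S.obj (op n) ⟶[V] S'.obj (op n)))
    (hw : ∀ (m n : SimplexCategory) (φ : m ⟶ n), w n ≫ eHomWhiskerLeft V _ (S'.map φ.op) =
      w m ≫ eHomWhiskerRight V (S.map φ.op) _) (n : SimplexCategory) :
    gRealizeMap w hw ≫ eHomWhiskerRight V (realizeInj Δ S n) _ =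
      gTenMap (Δ.obj n) (w n) ≫ eHomWhiskerLeft V _ (realizeInj Δ S' n) :=
  gRealizeDesc_inj _ _ n

lemma gRealizeMap_eId (w : ∀ n : SimplexCategory, K ⟶ (S.obj (op n) ⟶[V] S.obj (op n)))
    (hw : ∀ (m n : SimplexCategory) (φ : m ⟶ n), w n ≫ eHomWhiskerLeft V _ (S.map φ.op) =
      w m ≫ eHomWhiskerRight V (S.map φ.op) _) (s : 𝟙_ V ⟶ K) (h : ∀ n, s ≫ w n = eId V _) :
    s ≫ gRealizeMap (Δ := Δ) w hw = eId V _ := by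
  apply gRealize_ext
  intro n
  rw [Category.assoc, gRealizeMap_inj, eId_whiskerRight, ← Category.assoc, ← comp_gTenMap, h,
    gTenMap_eId]

lemma gRealizeMap_gcomp {K₁ K₂ : V}
    (w : ∀ n : SimplexCategory, K ⟶ (S.obj (op n) ⟶[V] S''.obj (op n)))
    (hw : ∀ (m n : SimplexCategory) (φ : m ⟶ n), w n ≫ eHomWhiskerLeft V _ (S''.map φ.op) =
      w m ≫ eHomWhiskerRight V (S.map φ.op) _)
    (w₁ : ∀ n : SimplexCategory, K₁ ⟶ (S.obj (op n) ⟶[V] S'.obj (op n)))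
    (hw₁ : ∀ (m n : SimplexCategory) (φ : m ⟶ n), w₁ n ≫ eHomWhiskerLeft V _ (S'.map φ.op) =
      w₁ m ≫ eHomWhiskerRight V (S.map φ.op) _)
    (w₂ : ∀ n : SimplexCategory, K₂ ⟶ (S'.obj (op n) ⟶[V] S''.obj (op n)))
    (hw₂ : ∀ (m n : SimplexCategory) (φ : m ⟶ n), w₂ n ≫ eHomWhiskerLeft V _ (S''.map φ.op) =
      w₂ m ≫ eHomWhiskerRight V (S'.map φ.op) _) (s : K₁ ⊗ K₂ ⟶ K)
    (h : ∀ n, s ≫ w n = gcomp V (w₁ n) (w₂ n)) :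
    s ≫ gRealizeMap (Δ := Δ) w hw = gcomp V (gRealizeMap w₁ hw₁) (gRealizeMap w₂ hw₂) := by
  apply gRealize_ext
  intro n
  rw [Category.assoc, gRealizeMap_inj, ← Category.assoc, ← comp_gTenMap, h,
    ← gcomp_whiskerRight, gRealizeMap_inj, gcomp_middle, gRealizeMap_inj, gcomp_whiskerLeft,
    gTenMap_gcomp]

end

/-- The map `D(e, e') ⟶ N(B(D(-, e), D, F), B(D(-, e'), D, F))`. -/
def gBar (e e' : D) (F : VFun V D N) :
    (e ⟶[V] e') ⟶ (realizeObj Δ (simplicialBarObj (reprModule e) F) ⟶[V]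
      realizeObj Δ (simplicialBarObj (reprModule e') F)) :=
  gRealizeMap (S := simplicialBarObj (reprModule e) F) (S' := simplicialBarObj (reprModule e') F)
    (fun n => gLevel e e' F n.len) fun _ _ φ => gLevel_map e e' F φ

lemma gBar_eId (e : D) (F : VFun V D N) : eId V e ≫ gBar Δ e e F = eId V _ :=
  gRealizeMap_eId _ _ _ fun n => gLevel_eId e F n.len

lemma gBar_eComp (e e' e'' : D) (F : VFun V D N) :
    eComp V e e' e'' ≫ gBar Δ e e'' F = gcomp V (gBar Δ e e' F) (gBar Δ e' e'' F) :=
  gRealizeMap_gcomp _ _ _ _ _ _ _ fun n => gLevel_eComp e e' e'' F n.len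

/-- The `V`-functor `B(D, D, F) : D ⥤ N`, `e ↦ B(D(-, e), D, F)`. -/
def barDiagram (F : VFun V D N) : VFun V D N where
  obj e := (bar Δ D N).obj (reprModule e, F)
  map e e' := gBar Δ e e' F
  map_id e := gBar_eId Δ e F
  map_comp e e' e'' := gBar_eComp Δ e e' e'' F

end BarDiagram
end EnrichedBar

namespace EnrichedBar

/-! ### Opposite diagrams and the cotensor product of functors -/

section OppositeDiagrams

variable {V : Type u₁} [Category.{v} V] [MonoidalCategory V] [SymmetricCategory V]
  {D : Type v} [EnrichedCategory V D]
  {M : Type u₂} [Category.{v} M] [EnrichedOrdinaryCategory V M]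

/-- The opposite `V`-functor `Dᵒᵖ ⥤ Mᵒᵖ` of a `V`-functor `D ⥤ M`. -/
def VFun.op (F : VFun V D M) : VFun V Dᵒᵖ Mᵒᵖ where
  obj d := Opposite.op (F.obj d.unop)
  map a b := F.map b.unop a.unop
  map_id a := F.map_id a.unop
  map_comp a b c := by
    have h := F.map_comp c.unop b.unop a.unop
    rw [eComp_op_eq, eComp_op_eq, Category.assoc, h,
      ← BraidedCategory.braiding_naturality_assoc]

/-- The `V`-functor `D ⥤ M` with a given opposite `Dᵒᵖ ⥤ Mᵒᵖ`. -/
def VFun.unop (F : VFun V Dᵒᵖ Mᵒᵖ) : VFun V D M where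
  obj d := (F.obj (Opposite.op d)).unop
  map a b := F.map (Opposite.op b) (Opposite.op a)
  map_id a := F.map_id (Opposite.op a)
  map_comp a b c := by
    have h := F.map_comp (Opposite.op c) (Opposite.op b) (Opposite.op a)
    rw [eComp_op_eq, eComp_op_eq] at h
    rw [← cancel_epi (β_ (b ⟶[V] c) (a ⟶[V] b)).hom]
    refine ((Category.assoc _ _ _).symm.trans h).trans ?_
    exact BraidedCategory.braiding_naturality_assoc _ _ _

/-- Passage to the opposite diagram. -/
def opDiagram : (VFun V D M)ᵒᵖ ⥤ VFun V Dᵒᵖ Mᵒᵖ where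
  obj F := F.unop.op
  map f :=
    { app := fun d => (f.unop.app d.unop).op
      naturality := fun a b => by
        have h := f.unop.naturality b.unop a.unop
        refine Eq.trans (congrArg (fun t => _ ≫ t) (eHomWhiskerLeft_op _ _)) ?_
        refine Eq.trans ?_ (congrArg (fun t => _ ≫ t) (eHomWhiskerRight_op _ _)).symm
        exact h.symm }

end OppositeDiagrams

section OpProd

variable {C : Type*} [Category* C] {E : Type*} [Category* E] {M : Type*} [Category* M]

/-- The functor `Cᵒᵖ × E ⥤ M` opposite to a functor `C × Eᵒᵖ ⥤ Mᵒᵖ`. -/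
def opProd (A : C × Eᵒᵖ ⥤ Mᵒᵖ) : Cᵒᵖ × E ⥤ M where
  obj p := (A.obj (p.1.unop, op p.2)).unop
  map {p p'} f := (A.map (X := (p'.1.unop, op p'.2)) (Y := (p.1.unop, op p.2))
    (Prod.mkHom f.1.unop f.2.op)).unop
  map_id p := congrArg Quiver.Hom.unop (A.map_id (p.1.unop, op p.2))
  map_comp {p p' p''} f g := congrArg Quiver.Hom.unop
    (A.map_comp (X := (p''.1.unop, op p''.2)) (Y := (p'.1.unop, op p'.2))
      (Z := (p.1.unop, op p.2)) (Prod.mkHom g.1.unop g.2.op) (Prod.mkHom f.1.unop f.2.op))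

/-- The natural transformation opposite to a natural transformation. -/
def opProdMap {A A' : C × Eᵒᵖ ⥤ Mᵒᵖ} (c : A ⟶ A') : opProd A' ⟶ opProd A where
  app p := (c.app (p.1.unop, op p.2)).unop
  naturality p p' f := congrArg Quiver.Hom.unop
    (c.naturality (X := (p'.1.unop, op p'.2)) (Y := (p.1.unop, op p.2))
      (Prod.mkHom f.1.unop f.2.op)).symm

end OpProd

/-! ### The tensor product, the cotensor product, the bar and the cobar construction -/

section Functors

variable {V : Type u₁} [Category.{v} V] [MonoidalCategory V] [SymmetricCategory V]
  [MonoidalClosed V]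

section

variable (L : SSet.{v} ⥤ V)

/-- The canonical cosimplicial object `n ↦ L Δ[n]`. -/
def cosimplicial : SimplexCategory ⥤ V := SSet.stdSimplex ⋙ L

/-- The map `L K ⟶ E` to the unit object induced by `K ⟶ *`. -/
def toUnitObj [L.Monoidal] (K : SSet.{v}) : L.obj K ⟶ 𝟙_ V :=
  L.map (CartesianMonoidalCategory.toUnit K) ≫ Functor.OplaxMonoidal.η L

lemma map_toUnitObj [L.Monoidal] {K K' : SSet.{v}} (f : K ⟶ K') :
    L.map f ≫ toUnitObj L K' = toUnitObj L K := by
  rw [toUnitObj, toUnitObj, ← Category.assoc, ← L.map_comp]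
  congr 2

/-- The augmentation of the canonical cosimplicial object. -/
def augmentation [L.Monoidal] : cosimplicial L ⟶ (Functor.const _).obj (𝟙_ V) where
  app n := toUnitObj L (SSet.stdSimplex.obj n)
  naturality _ _ φ := (map_toUnitObj L (SSet.stdSimplex.map φ)).trans (Category.comp_id _).symm

/-- The canonical cosimplicial object with the order of the vertices reversed. -/
def cosimplicialRev : SimplexCategory ⥤ V := SimplexCategory.rev ⋙ cosimplicial L

/-- The augmentation of the reversed cosimplicial object. -/
def augmentationRev [L.Monoidal] : cosimplicialRev L ⟶ (Functor.const _).obj (𝟙_ V) where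
  app n := (augmentation L).app (SimplexCategory.rev.obj n)
  naturality _ _ φ := (augmentation L).naturality (SimplexCategory.rev.map φ)

end

variable (L : SSet.{v} ⥤ V) (D : Type v) [EnrichedCategory V D]
  (M : Type u₂) [Category.{v} M] [EnrichedOrdinaryCategory V M] [EnrichedBicomplete V M]

variable (V) in
/-- The tensor product of functors `(G, F) ↦ G ⊙_D F`. -/
def tensorFunctor : VFun V Dᵒᵖ V × VFun V D M ⥤ M :=
  presheafModule.prod (𝟭 _) ⋙ tensorProduct

/-- The two-sided bar construction `(G, F) ↦ B(G, D, F)`. -/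
def barFunctor : VFun V Dᵒᵖ V × VFun V D M ⥤ M :=
  presheafModule.prod (𝟭 _) ⋙ bar (cosimplicial L) D M

/-- The natural map `B(G, D, F) ⟶ G ⊙_D F`. -/
def barToTensor [L.Monoidal] : barFunctor L D M ⟶ tensorFunctor V D M :=
  Functor.whiskerLeft _ (barComparison (augmentation L))

variable (V) in
/-- The cotensor product of functors `(G, F) ↦ {G, F}^D`: the tensor product, in `Mᵒᵖ` and over
`Dᵒᵖ`, of `G` and the opposite of `F`; that is, the equalizer of
`∏_d {G d, F d} ⇉ ∏_{d, d'} {D(d, d') ⊗ G d, F d'}`. -/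
def cotensorFunctor : (VFun V D V)ᵒᵖ × VFun V D M ⥤ M :=
  opProd (copresheafModule.prod opDiagram ⋙ tensorProduct)

/-- The two-sided cobar construction `(G, F) ↦ C(G, D, F)`: the totalization of the cosimplicial
object `C^n(G, D, F) = ∏_{α_0, …, α_n} {D(α_{n-1}, α_n) ⊗ ⋯ ⊗ D(α_0, α_1) ⊗ G α_0, F α_n}`.
It is computed as a bar construction in `Mᵒᵖ` over `Dᵒᵖ`. This reverses the order of the vertices,
whence the reversal of the cosimplicial object. -/
def cobarFunctor : (VFun V D V)ᵒᵖ × VFun V D M ⥤ M :=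
  opProd (copresheafModule.prod opDiagram ⋙ bar (cosimplicialRev L) Dᵒᵖ Mᵒᵖ)

/-- The natural map `{G, F}^D ⟶ C(G, D, F)`. -/
def cotensorToCobar [L.Monoidal] : cotensorFunctor V D M ⟶ cobarFunctor L D M :=
  opProdMap (Functor.whiskerLeft _ (barComparison (augmentationRev L)))

variable {D M}

/-- The `V`-functor `B(D, D, F) : D ⥤ M`, `e ↦ B(D(-, e), D, F)`. -/
def barResolution (F : VFun V D M) : VFun V D M := barDiagram (cosimplicial L) F

/-- The `V`-functor `C(D, D, F) : D ⥤ M`, `e ↦ C(D(e, -), D, F)`. -/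
def cobarResolution (F : VFun V D M) : VFun V D M :=
  (barDiagram (cosimplicialRev L) F.op).unop

end Functors

/-! ### Homotopical categories, deformations, derived functors -/

section Homotopical

variable {C : Type*} [Category* C] {E : Type*} [Category* E]

/-- The weak equivalences of a homotopical category: a class of morphisms that contains the
identities and satisfies the 2-out-of-6 property. -/
structure IsHomotopical (W : MorphismProperty C) : Prop where
  id_mem : ∀ X : C, W (𝟙 X)
  two_out_of_six : ∀ {X Y Z T : C} (f : X ⟶ Y) (g : Y ⟶ Z) (h : Z ⟶ T),
    W (f ≫ g) → W (g ≫ h) → W f ∧ W g ∧ W h ∧ W (f ≫ g ≫ h)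

/-- A left deformation of `C` into a full subcategory `P`. -/
structure LeftDeformation (W : MorphismProperty C) (P : ObjectProperty C) where
  /-- the replacement functor -/
  Q : C ⥤ C
  /-- the natural weak equivalence -/
  q : Q ⟶ 𝟭 C
  weq : ∀ X, W (q.app X)
  mem : ∀ X, P (Q.obj X)

/-- A right deformation of `C` into a full subcategory `P`. -/
structure RightDeformation (W : MorphismProperty C) (P : ObjectProperty C) where
  /-- the replacement functor -/
  R : C ⥤ C
  /-- the natural weak equivalence -/
  r : 𝟭 C ⟶ R
  weq : ∀ X, W (r.app X)
  mem : ∀ X, P (R.obj X)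

/-- A left deformation retract: a full subcategory that contains the image of some left
deformation. -/
def IsLeftDeformationRetract (W : MorphismProperty C) (P : ObjectProperty C) : Prop :=
  Nonempty (LeftDeformation W P)

/-- A right deformation retract. -/
def IsRightDeformationRetract (W : MorphismProperty C) (P : ObjectProperty C) : Prop :=
  Nonempty (RightDeformation W P)

/-- The functor `T` preserves weak equivalences between objects of the full subcategory `P`. -/
def IsHomotopicalOn (W : MorphismProperty C) (W' : MorphismProperty E) (T : C ⥤ E)
    (P : ObjectProperty C) : Prop :=
  ∀ ⦃X Y : C⦄ (f : X ⟶ Y), P X → P Y → W f → W' (T.map f)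

/-- A left `T`-deformation retract: a left deformation retract on which `T` is homotopical. -/
def IsLeftDeformationRetractFor (W : MorphismProperty C) (W' : MorphismProperty E) (T : C ⥤ E)
    (P : ObjectProperty C) : Prop :=
  IsLeftDeformationRetract W P ∧ IsHomotopicalOn W W' T P

/-- A right `T`-deformation retract: a right deformation retract on which `T` is homotopical. -/
def IsRightDeformationRetractFor (W : MorphismProperty C) (W' : MorphismProperty E) (T : C ⥤ E)
    (P : ObjectProperty C) : Prop :=
  IsRightDeformationRetract W P ∧ IsHomotopicalOn W W' T P

/-- `T'` with the comparison map `c : T' ⟶ T` is a (point-set) left derived functor of `T`: its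
composite with the localization functor `W'.Q : E ⥤ Ho E` inverts weak equivalences, and is terminal
among such functors over `T ⋙ W'.Q`. -/
structure IsLeftDerived (W : MorphismProperty C) (W' : MorphismProperty E) (T T' : C ⥤ E)
    (c : T' ⟶ T) : Prop where
  inverts : W.IsInvertedBy (T' ⋙ W'.Q)
  terminal : ∀ H : C ⥤ W'.Localization, W.IsInvertedBy H → ∀ b : H ⟶ T ⋙ W'.Q,
    ∃! a : H ⟶ T' ⋙ W'.Q, a ≫ Functor.whiskerRight c W'.Q = b

/-- `T'` with the comparison map `c : T ⟶ T'` is a (point-set) right derived functor of `T`. -/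
structure IsRightDerived (W : MorphismProperty C) (W' : MorphismProperty E) (T T' : C ⥤ E)
    (c : T ⟶ T') : Prop where
  inverts : W.IsInvertedBy (T' ⋙ W'.Q)
  initial : ∀ H : C ⥤ W'.Localization, W.IsInvertedBy H → ∀ b : T ⋙ W'.Q ⟶ H,
    ∃! a : T' ⋙ W'.Q ⟶ H, Functor.whiskerRight c W'.Q ≫ a = b

/-- The replacement of both variables of a functor `T' : C × E ⥤ M` by deformed ones, with the map
induced by `T' ⟶ T` and the two deformations. -/
def correctedLeft {M : Type*} [Category* M] {W : MorphismProperty C} {P : ObjectProperty C}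
    {W' : MorphismProperty E} {P' : ObjectProperty E} {T T' : C × E ⥤ M} (c : T' ⟶ T)
    (q : LeftDeformation W P) (q' : LeftDeformation W' P') : q.Q.prod q'.Q ⋙ T' ⟶ T where
  app p := c.app (q.Q.obj p.1, q'.Q.obj p.2) ≫ T.map (Prod.mkHom (q.q.app p.1) (q'.q.app p.2))
  naturality p p' f := by
    refine (c.naturality_assoc (Prod.mkHom (q.Q.map f.1) (q'.Q.map f.2)) _).trans ?_
    rw [Category.assoc, ← T.map_comp, ← T.map_comp]
    congr 2
    exact Prod.ext (q.q.naturality f.1) (q'.q.naturality f.2)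

/-- The replacement of both variables of a functor `T' : Cᵒᵖ × E ⥤ M`, by a left deformation of `C`
and a right deformation of `E`, with the induced map. -/
def correctedRight {M : Type*} [Category* M] {W : MorphismProperty C} {P : ObjectProperty C}
    {W' : MorphismProperty E} {P' : ObjectProperty E} {T T' : Cᵒᵖ × E ⥤ M} (c : T ⟶ T')
    (q : LeftDeformation W P) (r : RightDeformation W' P') : T ⟶ q.Q.op.prod r.R ⋙ T' where
  app p := T.map (X := p) (Y := (op (q.Q.obj p.1.unop), r.R.obj p.2))
    (Prod.mkHom ((q.q.app p.1.unop).op) (r.r.app p.2)) ≫ c.app (op (q.Q.obj p.1.unop), r.R.obj p.2)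
  naturality p p' f := by
    have h := c.naturality (X := (op (q.Q.obj p.1.unop), r.R.obj p.2))
      (Y := (op (q.Q.obj p'.1.unop), r.R.obj p'.2))
      (Prod.mkHom (q.Q.op.map f.1) (r.R.map f.2))
    refine Eq.trans ?_ ((congrArg (fun t => _ ≫ t) h).trans (Category.assoc _ _ _).symm)
    refine (Category.assoc _ _ _).symm.trans (Eq.trans ?_ (Category.assoc _ _ _))
    refine congrArg (fun t => t ≫ _) ?_
    refine (T.map_comp _ _).symm.trans (Eq.trans ?_ (T.map_comp _ _))
    refine congrArg (fun t => T.map t) ?_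
    exact Prod.ext (congrArg Quiver.Hom.op (q.q.naturality f.1.unop)).symm (r.r.naturality f.2)

end Homotopical

end EnrichedBar

namespace EnrichedBar

/-! ### Simplicial homotopy, diagrams with good values, and goodness -/

section SimplicialHomotopy

variable {V : Type u₁} [Category.{v} V] [MonoidalCategory V] (L : SSet.{v} ⥤ V) [L.Monoidal]
  {M : Type u₂} [Category.{v} M] [EnrichedOrdinaryCategory V M]

/-- There is a 1-simplex `L Δ[1] ⟶ M(X, Y)` of the simplicial mapping space from `f` to `g`. -/
def IsElementarilyHomotopic {X Y : M} (f g : X ⟶ Y) : Prop :=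
  ∃ h : L.obj (SSet.stdSimplex.obj (SimplexCategory.mk 1)) ⟶ (X ⟶[V] Y),
    L.map (SSet.stdSimplex.map (SimplexCategory.δ 1)) ≫ h = toUnitObj L _ ≫ eHomEquiv V f ∧
    L.map (SSet.stdSimplex.map (SimplexCategory.δ 0)) ≫ h = toUnitObj L _ ≫ eHomEquiv V g

/-- Simplicial homotopy: the equivalence relation generated by the 1-simplices of the simplicial
mapping spaces. -/
def IsSimpliciallyHomotopic {X Y : M} (f g : X ⟶ Y) : Prop :=
  Relation.EqvGen (IsElementarilyHomotopic L) f g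

variable (M) in
/-- The simplicial homotopy equivalences of `M`. -/
def simplicialHomotopyEquivalences : MorphismProperty M := fun X Y f =>
  ∃ g : Y ⟶ X, IsSimpliciallyHomotopic L (f ≫ g) (𝟙 X) ∧ IsSimpliciallyHomotopic L (g ≫ f) (𝟙 Y)

end SimplicialHomotopy

section Goodness

variable {V : Type u₁} [Category.{v} V] [MonoidalCategory V] [SymmetricCategory V]
  [MonoidalClosed V]

section

variable (V) (D : Type v) [EnrichedCategory V D]
  {M : Type u₂} [Category.{v} M] [EnrichedOrdinaryCategory V M]

/-- The objectwise weak equivalences of diagrams. -/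
def objectwise (W : MorphismProperty M) : MorphismProperty (VFun V D M) :=
  fun _ _ f => ∀ d : D, W (f.app d)

/-- The full subcategory of the diagrams that are objectwise in `P`. -/
def diagramsIn (P : ObjectProperty M) : ObjectProperty (VFun V D M) :=
  fun F => ∀ d : D, P (F.obj d)

end

/-- The full subcategory of a product category whose objects are the pairs with components in `P`
and `P'`. -/
def prodProperty {C : Type*} [Category* C] {E : Type*} [Category* E] (P : ObjectProperty C)
    (P' : ObjectProperty E) : ObjectProperty (C × E) := fun p => P p.1 ∧ P' p.2

/-- Transport of a full subcategory to the opposite. -/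
def opProperty {C : Type*} [Category* C] (P : ObjectProperty C) : ObjectProperty Cᵒᵖ :=
  fun X => P X.unop

variable [HasLimits V] [HasColimits V] (L : SSet.{v} ⥤ V) (D : Type v) [EnrichedCategory V D]
  {M : Type u₂} [Category.{v} M] [EnrichedOrdinaryCategory V M] [EnrichedBicomplete V M]
  (WV : MorphismProperty V) (WM : MorphismProperty M)

/-- `D` is good for the tensor of `M`, as witnessed by the left deformation retracts `VQ` and `MQ`
of `V` and `M`. -/
structure GoodForTensor (VQ : ObjectProperty V) (MQ : ObjectProperty M) : Prop where
  retract_V : IsLeftDeformationRetract WV VQ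
  retract_M : IsLeftDeformationRetract WM MQ
  /-- `B(-, D, -)` is homotopical on objectwise good diagrams. -/
  homotopical : IsHomotopicalOn ((objectwise V Dᵒᵖ WV).prod (objectwise V D WM)) WM (barFunctor L D M)
    (prodProperty (diagramsIn V Dᵒᵖ VQ) (diagramsIn V D MQ))
  /-- `B(D, D, F)` is objectwise in `MQ`. -/
  bar_right : ∀ F : VFun V D M, diagramsIn V D MQ F → diagramsIn V D MQ (barResolution L F)
  /-- `B(G, D, D)` is objectwise in `VQ`; its value at `e` is `B(G, D, D(e, -))`. -/
  bar_left : ∀ G : VFun V Dᵒᵖ V, diagramsIn V Dᵒᵖ VQ G →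
    ∀ e : D, VQ ((barFunctor L D V).obj (G, corepr e))

/-- `D` is good for the cotensor of `M`, as witnessed by the left deformation retract `VQ` of `V`
and the right deformation retract `MR` of `M`. -/
structure GoodForCotensor (VQ : ObjectProperty V) (MR : ObjectProperty M) : Prop where
  retract_V : IsLeftDeformationRetract WV VQ
  retract_M : IsRightDeformationRetract WM MR
  /-- `C(-, D, -)` is homotopical on objectwise good diagrams. -/
  homotopical : IsHomotopicalOn ((objectwise V D WV).op.prod (objectwise V D WM)) WM
    (cobarFunctor L D M) (prodProperty (opProperty (diagramsIn V D VQ)) (diagramsIn V D MR))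
  /-- `C(D, D, F)` is objectwise in `MR`. -/
  cobar_right : ∀ F : VFun V D M, diagramsIn V D MR F → diagramsIn V D MR (cobarResolution L F)
  /-- For a covariant `G`, the bar construction of `G` with `D`, with values
  `B(D(-, e), D, G)`, is objectwise in `VQ`. -/
  bar_left : ∀ G : VFun V D V, diagramsIn V D VQ G → diagramsIn V D VQ (barResolution L G)

variable {D}

/-- The full image of `B(D, D, -)` on the diagrams objectwise in `MQ`. -/
def barImage (MQ : ObjectProperty M) : ObjectProperty (VFun V D M) :=
  fun X => ∃ F : VFun V D M, diagramsIn V D MQ F ∧ Nonempty (X ≅ barResolution L F)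

/-- The full image of `C(D, D, -)` on the diagrams objectwise in `MR`. -/
def cobarImage (MR : ObjectProperty M) : ObjectProperty (VFun V D M) :=
  fun X => ∃ F : VFun V D M, diagramsIn V D MR F ∧ Nonempty (X ≅ cobarResolution L F)

end Goodness

end EnrichedBar

end

/-! Write `T` for the tensor product of functors, `T'` for the bar construction, `c : T' ⟶ T` for
the comparison, and `P` for the pairs of objectwise good diagrams. Let `K` send `(G, F)` to `(G,
B(D, D, F))`, with the augmentation `k : K ⟶ 𝟭`. The theorem is a formal consequence of four facts:
`T'` is homotopical on `P`; `K` preserves `P`; `k` is a weak equivalence; and `c` is a weak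
equivalence at `K X` for `X` in `P`. The first two are part of goodness. The formal consequence is
`isHomotopicalOn_of_leftResolution` and `isLeftDerived_of_leftResolution`: on resolutions `T` agrees
with `T'` up to weak equivalence, and a transformation out of a functor that inverts weak
equivalences is determined by its components at resolutions, where `c` is invertible in the homotopy
category.

The augmentation `B(D(-, e), D, F) ⟶ F e` is a simplicial homotopy equivalence by an extra
degeneracy: vertices at the end of a chain are pushed to `e` along the morphism that `D(-, e)`
provides (`barCounit_mem_simplicialHomotopyEquivalences`).

For the fourth fact, `G ⊙_D B(D, D, F)` is isomorphic to `B(G, D, F)` by the map `core`: the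
resolution is a colimit of cells `D(γ_n, -) ⊙ X`, and `G ⊙_D (D(γ_n, -) ⊙ X)` is `G γ_n ⊙ X`. It
remains to compare two maps `B(G, D, B(D, D, F)) ⟶ B(G, D, F)`. One is the comparison map followed
by `core`; the other is `B(G, D, k)`, which is a weak equivalence since `B` is homotopical on good
diagrams. A cell of the source consists of an inner sequence `γ_0, …, γ_q` and an outer sequence
`β_0, …, β_p` joined by a morphism `γ_q ⟶ β_0`, that is, of a sequence indexed by the join of `[q]`
and `[p]`. The first map keeps the inner sequence and lets the outer morphisms act on `G`; the
second keeps the outer sequence and lets the inner morphisms act on `F`. The canonical map from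
`Δ[q] × Δ[p] × Δ[1]` to the join is a homotopy between them
(`isSimpliciallyHomotopic_comparison_core`). The enriched colimit property of the bar construction,
`isColimit_barCocone`, is what allows this homotopy to be defined cell by cell.

Finally, weak equivalences are invariant under simplicial homotopy, because the cylinder `Δ[1] ⊙ X`
contracts onto `X` (`IsSimpliciallyHomotopic.mem_iff`). So the comparison map followed by an
isomorphism is a weak equivalence, and so is the comparison map.

The cotensor statement is the same argument in `Mᵒᵖ` over `Dᵒᵖ`. Passing to opposites reverses the
order of the vertices, so all homotopies are built for a cosimplicial object twisted by an
automorphism of the simplex category (`SimplexTwist`), either trivial or the reversal. -/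

noncomputable section

namespace EnrichedBar

/-! ### Homotopical categories and derived functors -/

section Derived

variable {C : Type*} [Category* C] {E : Type*} [Category* E]

namespace IsHomotopical

variable {W : MorphismProperty C} (hW : IsHomotopical W)
include hW

/-- In the string `f`, `f⁻¹`, `f` both consecutive composites are identities, so 2-out-of-6 applies.
-/
lemma of_isIso {X Y : C} (f : X ⟶ Y) [IsIso f] : W f :=
  (hW.two_out_of_six f (inv f) f (by simpa using hW.id_mem X) (by simpa using hW.id_mem Y)).1

/-- This and the next two lemmas are 2-out-of-3, obtained from 2-out-of-6 by inserting an identity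
in the string. -/
lemma comp {X Y Z : C} {f : X ⟶ Y} {g : Y ⟶ Z} (hf : W f) (hg : W g) : W (f ≫ g) := by
  simpa using (hW.two_out_of_six f (𝟙 Y) g (by simpa using hf) (by simpa using hg)).2.2.2

lemma of_precomp {X Y Z : C} {f : X ⟶ Y} {g : Y ⟶ Z} (hf : W f) (hfg : W (f ≫ g)) : W g :=
  (hW.two_out_of_six (𝟙 X) f g (by simpa using hf) hfg).2.2.1

lemma of_postcomp {X Y Z : C} {f : X ⟶ Y} {g : Y ⟶ Z} (hg : W g) (hfg : W (f ≫ g)) : W f :=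
  (hW.two_out_of_six f g (𝟙 Z) hfg (by simpa using hg)).1

lemma op : IsHomotopical W.op where
  id_mem X := hW.id_mem X.unop
  two_out_of_six f g h h₁ h₂ := by
    obtain ⟨a, b, c, d⟩ := hW.two_out_of_six h.unop g.unop f.unop h₂ h₁
    refine ⟨c, b, a, ?_⟩
    change W (f ≫ g ≫ h).unop
    simpa using d

lemma prod {W' : MorphismProperty E} (hW' : IsHomotopical W') : IsHomotopical (W.prod W') where
  id_mem X := ⟨hW.id_mem X.1, hW'.id_mem X.2⟩
  two_out_of_six f g h h₁ h₂ := by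
    obtain ⟨a, b, c, d⟩ := hW.two_out_of_six f.1 g.1 h.1 h₁.1 h₂.1
    obtain ⟨a', b', c', d'⟩ := hW'.two_out_of_six f.2 g.2 h.2 h₁.2 h₂.2
    exact ⟨⟨a, a'⟩, ⟨b, b'⟩, ⟨c, c'⟩, ⟨d, d'⟩⟩

end IsHomotopical

/-! ### Left derived functors from a resolution on which the comparison map is a weak equivalence -/

section Left

variable {W : MorphismProperty C} {W' : MorphismProperty E} {P : ObjectProperty C}
  {T T' : C ⥤ E} (c : T' ⟶ T) {K : C ⥤ C} (k : K ⟶ 𝟭 C)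

/-- The naturality square of `c` compares `T.map` with `T'.map` between objects `K.obj Y`, and both
of its vertical maps are weak equivalences. The map in question need not come from a map `Y ⟶ Y'`:
only the naturality of `c` is used, after conjugation with the isomorphisms to `K.obj Y` and `K.obj
Y'`. -/
lemma isHomotopicalOn_of_leftResolution (hW : IsHomotopical W) (hW' : IsHomotopical W')
    (hT' : IsHomotopicalOn W W' T' P) (hK : ∀ X, P X → P (K.obj X))
    (hc : ∀ X, P X → W' (c.app (K.obj X))) :
    IsHomotopicalOn W W' T fun X => ∃ Y, P Y ∧ Nonempty (X ≅ K.obj Y) := by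
  rintro X X' f ⟨Y, hY, ⟨i⟩⟩ ⟨Y', hY', ⟨i'⟩⟩ hf
  have h₁ : W (i.inv ≫ f ≫ i'.hom) :=
    hW.comp (hW.of_isIso _) (hW.comp hf (hW.of_isIso _))
  have h₂ := hT' _ (hK _ hY) (hK _ hY') h₁
  have h₃ : W' (T.map (i.inv ≫ f ≫ i'.hom)) := by
    refine hW'.of_precomp (hc _ hY) ?_
    rw [← c.naturality]
    exact hW'.comp h₂ (hc _ hY')
  have h₄ : T.map f = T.map i.hom ≫ T.map (i.inv ≫ f ≫ i'.hom) ≫ T.map i'.inv := by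
    rw [← T.map_comp, ← T.map_comp]
    congr 1
    simp
  rw [h₄]
  exact hW'.comp (hW'.of_isIso _) (hW'.comp h₃ (hW'.of_isIso _))

lemma isInvertedBy_of_homotopicalOn (hW : IsHomotopical W) (hT' : IsHomotopicalOn W W' T' P)
    (q : LeftDeformation W P) : W.IsInvertedBy ((q.Q ⋙ T') ⋙ W'.Q) := by
  intro X Y f hf
  have h : W (q.Q.map f) := by
    refine hW.of_postcomp (q.weq Y) ?_
    rw [q.q.naturality]
    exact hW.comp (q.weq X) hf
  exact Localization.inverts W'.Q W' _ (hT' _ (q.mem X) (q.mem Y) h)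

/-- `T` is not assumed homotopical on `P`, so the deformation `Q` alone does not suffice; the
resolution `K` is applied after it. Every component of a transformation out of `H` is determined by
the one at `K Q X`, since `H` inverts the weak equivalence `p : K Q X ⟶ X`, and at `K Q X` the map
`c'` is invertible in the homotopy category. -/
theorem isLeftDerived_of_leftResolution (hW : IsHomotopical W)
    (hT' : IsHomotopicalOn W W' T' P) (hK : ∀ X, P X → P (K.obj X))
    (hk : ∀ X, P X → W (k.app X)) (hc : ∀ X, P X → W' (c.app (K.obj X)))
    (q : LeftDeformation W P) (c' : q.Q ⋙ T' ⟶ T)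
    (hc' : ∀ X, c'.app X = c.app (q.Q.obj X) ≫ T.map (q.q.app X)) :
    IsLeftDerived W W' T (q.Q ⋙ T') c' where
  inverts := isInvertedBy_of_homotopicalOn hW hT' q
  terminal H hH b := by
    let p : ∀ X, K.obj (q.Q.obj X) ⟶ X := fun X => k.app (q.Q.obj X) ≫ q.q.app X
    have p_nat : ∀ {X Y : C} (f : X ⟶ Y), K.map (q.Q.map f) ≫ p Y = p X ≫ f := fun f => by
      simp [p]
    have hp : ∀ X, W (p X) := fun X => hW.comp (hk _ (q.mem X)) (q.weq X)
    have hHp : ∀ X, IsIso (H.map (p X)) := fun X => hH _ (hp X)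
    have hic : ∀ X, IsIso (W'.Q.map (c.app (K.obj (q.Q.obj X)))) := fun X =>
      Localization.inverts W'.Q W' _ (hc _ (q.mem X))
    -- By naturality of `c`, this component of `c'` is `T'.map q` followed by `c` at a resolution.
    -- The first is inverted because `Q K Q X` and `K Q X` both lie in `P`.
    have hc'K : ∀ X, IsIso (W'.Q.map (c'.app (K.obj (q.Q.obj X)))) := fun X => by
      have h₁ := Localization.inverts W'.Q W' _
        (hT' _ (q.mem _) (hK _ (q.mem X)) (q.weq (K.obj (q.Q.obj X))))
      have h₂ := hic X
      have h₃ : c'.app (K.obj (q.Q.obj X)) =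
          T'.map (q.q.app (K.obj (q.Q.obj X))) ≫ c.app (K.obj (q.Q.obj X)) := by
        rw [hc', ← c.naturality]; rfl
      rw [h₃, Functor.map_comp]
      exact IsIso.comp_isIso' h₁ h₂
    have uniq : ∀ a a' : H ⟶ (q.Q ⋙ T') ⋙ W'.Q, a ≫ Functor.whiskerRight c' W'.Q = b →
        a' ≫ Functor.whiskerRight c' W'.Q = b → a = a' := by
      intro a a' ha ha'
      ext X
      have h := hc'K X
      have h₁ : a.app (K.obj (q.Q.obj X)) = a'.app (K.obj (q.Q.obj X)) := by
        rw [← cancel_mono (W'.Q.map (c'.app (K.obj (q.Q.obj X))))]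
        exact congrArg (fun t => t.app (K.obj (q.Q.obj X))) (ha.trans ha'.symm)
      rw [← cancel_epi (H.map (p X)), a.naturality, a'.naturality, h₁]
    refine existsUnique_of_exists_of_unique ?_ uniq
    -- The only possible formula: go back from `X` to `K Q X` inside `H`, apply `b` there, lift
    -- along the invertible `c`, and return to `Q X` along `k`.
    refine ⟨{ app := fun X => inv (H.map (p X)) ≫ b.app (K.obj (q.Q.obj X)) ≫
                inv (W'.Q.map (c.app (K.obj (q.Q.obj X)))) ≫ W'.Q.map (T'.map (k.app (q.Q.obj X)))
              naturality := fun X Y f => ?_ }, ?_⟩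
    · have h₁ := b.naturality (K.map (q.Q.map f))
      have h₂ := c.naturality (K.map (q.Q.map f))
      have h₃ : T'.map (K.map (q.Q.map f)) ≫ T'.map (k.app (q.Q.obj Y)) =
          T'.map (k.app (q.Q.obj X)) ≫ T'.map (q.Q.map f) := by
        rw [← T'.map_comp, k.naturality, T'.map_comp]; rfl
      have h₄ := congrArg (fun t => H.map t) (p_nat f)
      simp only [Functor.map_comp] at h₄
      rw [← cancel_epi (H.map (p X)), ← reassoc_of% h₄]
      simp only [Category.assoc, IsIso.hom_inv_id_assoc]
      rw [reassoc_of% h₁]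
      congr 1
      have h₅ := congrArg (fun t => W'.Q.map t) h₂
      have h₆ := congrArg (fun t => W'.Q.map t) h₃
      simp only [Functor.map_comp] at h₅ h₆
      rw [← cancel_epi (W'.Q.map (c.app (K.obj (q.Q.obj X))))]
      simp only [Functor.comp_map, Functor.comp_obj, IsIso.hom_inv_id_assoc]
      rw [← reassoc_of% h₅, IsIso.hom_inv_id_assoc, h₆]
    -- Naturality of `c` at `k` turns the lift followed by `T'.map k` into `T.map k`; what remains
    -- is naturality of `b` at `p`.
    · ext X
      have h₁ := congrArg (fun t => W'.Q.map t) (c.naturality (k.app (q.Q.obj X)))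
      have h₂ := b.naturality (p X)
      simp only [Functor.map_comp] at h₁
      simp only [NatTrans.comp_app, Functor.whiskerRight_app, Category.assoc, hc', Functor.map_comp]
      rw [reassoc_of% h₁, IsIso.inv_hom_id_assoc, IsIso.inv_comp_eq, h₂]
      simp [p]

end Left

/-! ### The dual criterion, for right deformations and right derived functors -/

section Right

variable {W : MorphismProperty C} {W' : MorphismProperty E} {P : ObjectProperty C}
  {T T' : C ⥤ E} (c : T ⟶ T') {K : C ⥤ C} (k : 𝟭 C ⟶ K)

lemma isHomotopicalOn_of_rightResolution (hW : IsHomotopical W) (hW' : IsHomotopical W')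
    (hT' : IsHomotopicalOn W W' T' P) (hK : ∀ X, P X → P (K.obj X))
    (hc : ∀ X, P X → W' (c.app (K.obj X))) :
    IsHomotopicalOn W W' T fun X => ∃ Y, P Y ∧ Nonempty (X ≅ K.obj Y) := by
  rintro X X' f ⟨Y, hY, ⟨i⟩⟩ ⟨Y', hY', ⟨i'⟩⟩ hf
  have h₁ : W (i.inv ≫ f ≫ i'.hom) :=
    hW.comp (hW.of_isIso _) (hW.comp hf (hW.of_isIso _))
  have h₂ := hT' _ (hK _ hY) (hK _ hY') h₁
  have h₃ : W' (T.map (i.inv ≫ f ≫ i'.hom)) := by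
    refine hW'.of_postcomp (hc _ hY') ?_
    rw [c.naturality]
    exact hW'.comp (hc _ hY) h₂
  have h₄ : T.map f = T.map i.hom ≫ T.map (i.inv ≫ f ≫ i'.hom) ≫ T.map i'.inv := by
    rw [← T.map_comp, ← T.map_comp]
    congr 1
    simp
  rw [h₄]
  exact hW'.comp (hW'.of_isIso _) (hW'.comp h₃ (hW'.of_isIso _))

/-- Dual to `isLeftDerived_of_leftResolution`. At `K R X` the map `c'` is `c` followed by `T'.map
r`, and `r` is there a map between objects of `P`. A transformation into `H` is determined by these
components because `H` inverts `p : X ⟶ K R X`. -/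
theorem isRightDerived_of_rightResolution (hW : IsHomotopical W)
    (hT' : IsHomotopicalOn W W' T' P) (hK : ∀ X, P X → P (K.obj X))
    (hk : ∀ X, P X → W (k.app X)) (hc : ∀ X, P X → W' (c.app (K.obj X)))
    (r : RightDeformation W P) (c' : T ⟶ r.R ⋙ T')
    (hc' : ∀ X, c'.app X = T.map (r.r.app X) ≫ c.app (r.R.obj X)) :
    IsRightDerived W W' T (r.R ⋙ T') c' where
  inverts := by
    intro X Y f hf
    have h : W (r.R.map f) := by
      refine hW.of_precomp (r.weq X) ?_
      rw [← r.r.naturality]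
      exact hW.comp hf (r.weq Y)
    exact Localization.inverts W'.Q W' _ (hT' _ (r.mem X) (r.mem Y) h)
  initial H hH b := by
    let p : ∀ X, X ⟶ K.obj (r.R.obj X) := fun X => r.r.app X ≫ k.app (r.R.obj X)
    have p_nat : ∀ {X Y : C} (f : X ⟶ Y), p X ≫ K.map (r.R.map f) = f ≫ p Y := fun {X Y} f => by
      have h₁ := k.naturality (r.R.map f)
      have h₂ := r.r.naturality f
      simp only [Functor.id_map] at h₁ h₂
      simp only [p, Category.assoc]
      rw [reassoc_of% h₂]
      exact congrArg (fun t => r.r.app X ≫ t) h₁.symm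
    have hp : ∀ X, W (p X) := fun X => hW.comp (r.weq X) (hk _ (r.mem X))
    have hHp : ∀ X, IsIso (H.map (p X)) := fun X => hH _ (hp X)
    have hic : ∀ X, IsIso (W'.Q.map (c.app (K.obj (r.R.obj X)))) := fun X =>
      Localization.inverts W'.Q W' _ (hc _ (r.mem X))
    have hc'K : ∀ X, IsIso (W'.Q.map (c'.app (K.obj (r.R.obj X)))) := fun X => by
      have h₁ := Localization.inverts W'.Q W' _
        (hT' _ (hK _ (r.mem X)) (r.mem _) (r.weq (K.obj (r.R.obj X))))
      have h₂ := hic X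
      have h₃ : c'.app (K.obj (r.R.obj X)) =
          c.app (K.obj (r.R.obj X)) ≫ T'.map (r.r.app (K.obj (r.R.obj X))) := by
        rw [hc', c.naturality]; rfl
      rw [h₃, Functor.map_comp]
      exact IsIso.comp_isIso' h₂ h₁
    have uniq : ∀ a a' : (r.R ⋙ T') ⋙ W'.Q ⟶ H, Functor.whiskerRight c' W'.Q ≫ a = b →
        Functor.whiskerRight c' W'.Q ≫ a' = b → a = a' := by
      intro a a' ha ha'
      ext X
      have h := hc'K X
      have h₁ : a.app (K.obj (r.R.obj X)) = a'.app (K.obj (r.R.obj X)) := by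
        rw [← cancel_epi (W'.Q.map (c'.app (K.obj (r.R.obj X))))]
        exact congrArg (fun t => t.app (K.obj (r.R.obj X))) (ha.trans ha'.symm)
      rw [← cancel_mono (H.map (p X)), ← a.naturality, ← a'.naturality, h₁]
    refine existsUnique_of_exists_of_unique ?_ uniq
    -- The only possible formula: move to `K R X` along `k`, undo the invertible `c`, apply `b`, and
    -- return to `X` by the inverse of `H.map p`.
    refine ⟨{ app := fun X => W'.Q.map (T'.map (k.app (r.R.obj X))) ≫
                inv (W'.Q.map (c.app (K.obj (r.R.obj X)))) ≫ b.app (K.obj (r.R.obj X)) ≫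
                  inv (H.map (p X))
              naturality := fun X Y f => ?_ }, ?_⟩
    · have h₁ := b.naturality (K.map (r.R.map f))
      have h₂ := c.naturality (K.map (r.R.map f))
      have h₃ : T'.map (r.R.map f) ≫ T'.map (k.app (r.R.obj Y)) =
          T'.map (k.app (r.R.obj X)) ≫ T'.map (K.map (r.R.map f)) := by
        rw [← T'.map_comp, ← T'.map_comp, ← k.naturality]; rfl
      have h₄ := congrArg (fun t => H.map t) (p_nat f)
      have h₅ := congrArg (fun t => W'.Q.map t) h₂
      have h₆ := congrArg (fun t => W'.Q.map t) h₃
      simp only [Functor.map_comp] at h₄ h₅ h₆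
      rw [← cancel_mono (H.map (p Y))]
      simp only [Category.assoc, IsIso.inv_hom_id, Category.comp_id]
      rw [← h₄, IsIso.inv_hom_id_assoc, ← h₁]
      simp only [Functor.comp_map]
      rw [reassoc_of% h₆]
      congr 1
      rw [IsIso.eq_inv_comp, ← reassoc_of% h₅, IsIso.hom_inv_id_assoc]
    · ext X
      have h₁ := congrArg (fun t => W'.Q.map t) (c.naturality (k.app (r.R.obj X)))
      have h₂ := b.naturality (p X)
      simp only [Functor.map_comp] at h₁
      simp only [NatTrans.comp_app, Functor.whiskerRight_app, Category.assoc, hc', Functor.map_comp]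
      rw [← cancel_mono (H.map (p X)), ← h₂]
      simp only [Category.assoc, IsIso.inv_hom_id, Category.comp_id]
      have h₃ : W'.Q.map (c.app (r.R.obj X)) ≫ W'.Q.map (T'.map (k.app (r.R.obj X))) ≫
          inv (W'.Q.map (c.app (K.obj (r.R.obj X)))) = W'.Q.map (T.map (k.app (r.R.obj X))) := by
        rw [← Category.assoc, IsIso.comp_inv_eq]
        exact h₁.symm
      rw [reassoc_of% h₃]
      simp [p]

end Right

end Derived

/-! ### Simplicial homotopies from combinatorial homotopies -/

/-- The cosimplicial simplicial set `n ↦ Δ[n]`, as a functor. -/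
def simplexFunctor : SimplexCategory ⥤ SSet.{v} := SSet.stdSimplex

instance : simplexFunctor.{v}.Full := inferInstanceAs SSet.stdSimplex.Full

instance : simplexFunctor.{v}.Faithful := inferInstanceAs SSet.stdSimplex.Faithful

/-- The Yoneda lemma for `Δ[n]`. -/
def simplexEquiv {n : SimplexCategory} {X : SSet.{v}} :
    (simplexFunctor.obj n ⟶ X) ≃ X.obj (op n) := SSet.yonedaEquiv

lemma simplexEquiv_comp {n : SimplexCategory} {X Y : SSet.{v}} (x : simplexFunctor.obj n ⟶ X)
    (f : X ⟶ Y) : simplexEquiv (x ≫ f) = f.app _ (simplexEquiv x) :=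
  SSet.yonedaEquiv_comp x f

lemma simplexEquiv_map {m n : SimplexCategory} (φ : m ⟶ n) {X : SSet.{v}}
    (x : simplexFunctor.obj n ⟶ X) :
    simplexEquiv (simplexFunctor.map φ ≫ x) = X.map φ.op (simplexEquiv x) :=
  (SSet.yonedaEquiv_naturality φ x).symm

/-! ### Maps out of `L K` as compatible families on the simplices of `K` -/

section LeftAdjoint

variable {V : Type u₁} [Category.{v} V] (L : SSet.{v} ⥤ V) [L.IsLeftAdjoint] {K : SSet.{v}} {Z : V}

variable {L} in
-- A simplicial set is the colimit of its simplices and `L` preserves colimits. Transposed along the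
-- adjunction, this says that a simplicial map is determined by its values on simplices.
lemma map_simplex_ext {f g : L.obj K ⟶ Z}
    (h : ∀ (m : SimplexCategory) (x : simplexFunctor.obj m ⟶ K), L.map x ≫ f = L.map x ≫ g) :
    f = g := by
  apply ((Adjunction.ofIsLeftAdjoint L).homEquiv _ _).injective
  ext m k
  obtain ⟨x, rfl⟩ := simplexEquiv.surjective k
  have h₁ := congrArg (fun t => (Adjunction.ofIsLeftAdjoint L).homEquiv _ _ t) (h m.unop x)
  simp only [Adjunction.homEquiv_naturality_left] at h₁
  have h₂ := congrArg simplexEquiv h₁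
  rwa [simplexEquiv_comp, simplexEquiv_comp] at h₂

/-- A map out of `L K` given by a compatible family of maps out of `L Δ[m]`, for the simplices of
`K`. -/
def simplexDesc (z : ∀ m : SimplexCategory, (simplexFunctor.obj m ⟶ K) →
      (L.obj (simplexFunctor.obj m) ⟶ Z))
    (hz : ∀ (m n : SimplexCategory) (φ : m ⟶ n) (x : simplexFunctor.obj n ⟶ K),
      z m (simplexFunctor.map φ ≫ x) = L.map (simplexFunctor.map φ) ≫ z n x) : L.obj K ⟶ Z :=
  ((Adjunction.ofIsLeftAdjoint L).homEquiv _ _).symm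
    { app := fun m => ↾fun k => simplexEquiv
        ((Adjunction.ofIsLeftAdjoint L).homEquiv _ _ (z m.unop (simplexEquiv.symm k)))
      naturality := fun n m φ => by
        ext k
        obtain ⟨x, rfl⟩ := simplexEquiv.surjective k
        have h := hz _ _ φ.unop x
        have h₁ : simplexEquiv.symm (K.map φ (simplexEquiv x)) = simplexFunctor.map φ.unop ≫ x := by
          rw [Equiv.symm_apply_eq, simplexEquiv_map]; rfl
        change simplexEquiv ((Adjunction.ofIsLeftAdjoint L).homEquiv _ _
            (z m.unop (simplexEquiv.symm (K.map φ (simplexEquiv x))))) =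
          _root_.id (((_ : SSet.{v}).map φ) (simplexEquiv
            ((Adjunction.ofIsLeftAdjoint L).homEquiv _ _
              (z n.unop (simplexEquiv.symm (simplexEquiv x))))))
        rw [h₁, h, Adjunction.homEquiv_naturality_left, simplexEquiv_map, Equiv.symm_apply_apply]
        rfl }

lemma map_simplexDesc (z : ∀ m : SimplexCategory, (simplexFunctor.obj m ⟶ K) →
      (L.obj (simplexFunctor.obj m) ⟶ Z))
    (hz : ∀ (m n : SimplexCategory) (φ : m ⟶ n) (x : simplexFunctor.obj n ⟶ K),
      z m (simplexFunctor.map φ ≫ x) = L.map (simplexFunctor.map φ) ≫ z n x)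
    (m : SimplexCategory) (x : simplexFunctor.obj m ⟶ K) :
    L.map x ≫ simplexDesc L z hz = z m x := by
  rw [simplexDesc, ← Adjunction.homEquiv_naturality_left_symm, Equiv.symm_apply_eq]
  apply simplexEquiv.injective
  rw [simplexEquiv_comp]
  change simplexEquiv ((Adjunction.ofIsLeftAdjoint L).homEquiv _ _
    (z m (simplexEquiv.symm (simplexEquiv x)))) = _
  rw [Equiv.symm_apply_apply]

end LeftAdjoint

/-! ### Automorphisms of the simplex category, treating the bar and cobar constructions together -/

section Twist

/-- An automorphism of the simplex category that is the identity on objects. -/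
structure SimplexTwist where
  /-- the action on morphisms -/
  map : ∀ {m n : SimplexCategory}, (m ⟶ n) ≃ (m ⟶ n)
  map_comp : ∀ {l m n : SimplexCategory} (f : l ⟶ m) (g : m ⟶ n), map (f ≫ g) = map f ≫ map g

namespace SimplexTwist

variable (t : SimplexTwist)

/-- Preservation of identities is automatic for bijections compatible with composition: writing `𝟙
n` as `t.map (t.map.symm (𝟙 n))`, composition with it on the right must both keep and erase `t.map
(𝟙 n)`. -/
lemma map_id (n : SimplexCategory) : t.map (𝟙 n) = 𝟙 n := by
  have h := t.map_comp (𝟙 n) (t.map.symm (𝟙 n))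
  rw [Category.id_comp, Equiv.apply_symm_apply, Category.comp_id] at h
  exact h.symm

lemma symm_comp {l m n : SimplexCategory} (f : l ⟶ m) (g : m ⟶ n) :
    t.map.symm (f ≫ g) = t.map.symm f ≫ t.map.symm g := by
  rw [Equiv.symm_apply_eq, t.map_comp, Equiv.apply_symm_apply, Equiv.apply_symm_apply]

/-- The trivial automorphism. -/
def refl : SimplexTwist where
  map := Equiv.refl _
  map_comp _ _ := rfl

/-- The reversal of the order of the vertices. -/
def rev : SimplexTwist where
  map :=
    { toFun := fun f => SimplexCategory.rev.map f
      invFun := fun f => SimplexCategory.rev.map f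
      left_inv := fun f => SimplexCategory.rev_map_rev_map f
      right_inv := fun f => SimplexCategory.rev_map_rev_map f }
  map_comp f g := SimplexCategory.rev.map_comp f g

/-- The cosimplicial object `n ↦ L Δ[n]`, twisted by an automorphism of the simplex category. -/
def cosimplicial {V : Type u₁} [Category.{v} V] (L : SSet.{v} ⥤ V) : SimplexCategory ⥤ V where
  obj n := L.obj (simplexFunctor.obj n)
  map φ := L.map (simplexFunctor.map (t.map φ))
  map_id n := by rw [t.map_id, CategoryTheory.Functor.map_id, CategoryTheory.Functor.map_id]
  map_comp f g := by rw [t.map_comp, Functor.map_comp, Functor.map_comp]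

end SimplexTwist

end Twist

/-! ### Realizing a simplicial homotopy through prisms -/

section Homotopy

variable {N : Type u₂} [Category.{v} N]

/-- A simplicial homotopy, given by maps `S n ⟶ S' n` for all `n ⟶ [1]`. -/
structure CombinatorialHomotopy (S S' : SimplexCategoryᵒᵖ ⥤ N) where
  /-- the components -/
  app : ∀ n : SimplexCategory, (n ⟶ SimplexCategory.mk 1) → (S.obj (op n) ⟶ S'.obj (op n))
  naturality : ∀ {m n : SimplexCategory} (φ : m ⟶ n) (τ : n ⟶ SimplexCategory.mk 1),
    S.map φ.op ≫ app m (φ ≫ τ) = app n τ ≫ S'.map φ.op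

/-- The end of a homotopy at a vertex of `Δ[1]`. -/
def CombinatorialHomotopy.endpoint {S S' : SimplexCategoryᵒᵖ ⥤ N} (h : CombinatorialHomotopy S S')
    (k : SimplexCategory.mk 0 ⟶ SimplexCategory.mk 1) : S ⟶ S' where
  app n := h.app n.unop (SimplexCategory.const _ _ 0 ≫ k)
  naturality m n φ := by
    have := h.naturality φ.unop (SimplexCategory.const _ _ 0 ≫ k)
    rw [← Category.assoc] at this
    exact this

variable {V : Type u₁} [Category.{v} V] [MonoidalCategory V] [SymmetricCategory V]
  [MonoidalClosed V] [EnrichedOrdinaryCategory V N] [EnrichedBicomplete V N]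

/-- The adjunct form of the defining relation of the realization. It makes the cells of `|S|` a
compatible family of maps out of the simplices, as `simplexDesc` requires. -/
lemma ad_realizeInj (Δ : SimplexCategory ⥤ V) (S : SimplexCategoryᵒᵖ ⥤ N) {m n : SimplexCategory}
    (φ : m ⟶ n) : Δ.map φ ≫ ad (realizeInj Δ S n) =
      ad (realizeInj Δ S m) ≫ eHomWhiskerRight V (S.map φ.op) _ := by
  have h := congrArg ad (realizeInj_condition Δ S φ)
  simpa [ad_tenMap_comp] using h

variable (t : SimplexTwist) (L : SSet.{v} ⥤ V) [L.Monoidal] [L.IsLeftAdjoint]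
  {S S' : SimplexCategoryᵒᵖ ⥤ N} (h : CombinatorialHomotopy S S') {Y : N}

/-- The map `L (Δ[n] × Δ[1]) ⟶ N(S n, Y)` given by a homotopy from `S` to `S'` and a compatible
family of maps `L Δ[m] ⟶ N(S' m, Y)`. -/
def prismMap (i : ∀ m : SimplexCategory, L.obj (simplexFunctor.obj m) ⟶ (S'.obj (op m) ⟶[V] Y))
    (hi : ∀ {m n : SimplexCategory} (φ : m ⟶ n), L.map (simplexFunctor.map (t.map φ)) ≫ i n =
      i m ≫ eHomWhiskerRight V (S'.map φ.op) Y) (n : SimplexCategory) :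
    L.obj (simplexFunctor.obj n ⊗ simplexFunctor.obj (SimplexCategory.mk 1)) ⟶
      (S.obj (op n) ⟶[V] Y) :=
  -- An `m`-simplex of the prism is a pair of maps `σ : m ⟶ n` and `τ : m ⟶ [1]`, recovered by the
  -- Yoneda lemma and untwisted. It goes to the `m`-cell `i m`, restricted along `S σ` followed by
  -- the homotopy at `τ`.
  simplexDesc L (fun m x => i m ≫ eHomWhiskerRight V (S.map (t.map.symm
        (simplexFunctor.preimage (x ≫ SemiCartesianMonoidalCategory.fst _ _))).op ≫
          h.app m (t.map.symm
        (simplexFunctor.preimage (x ≫ SemiCartesianMonoidalCategory.snd _ _)))) _) (by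
    intro m k φ x
    have h₁ := hi (t.map.symm φ)
    rw [Equiv.apply_symm_apply] at h₁
    have h₂ : t.map.symm (simplexFunctor.preimage ((simplexFunctor.map φ ≫ x) ≫
          SemiCartesianMonoidalCategory.fst _ _)) = t.map.symm φ ≫ t.map.symm
        (simplexFunctor.preimage (x ≫ SemiCartesianMonoidalCategory.fst _ _)) := by
      rw [← t.symm_comp, Category.assoc, Functor.preimage_comp, Functor.preimage_map]
    have h₃ : t.map.symm (simplexFunctor.preimage ((simplexFunctor.map φ ≫ x) ≫
          SemiCartesianMonoidalCategory.snd _ _)) = t.map.symm φ ≫ t.map.symm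
        (simplexFunctor.preimage (x ≫ SemiCartesianMonoidalCategory.snd _ _)) := by
      rw [← t.symm_comp, Category.assoc, Functor.preimage_comp, Functor.preimage_map]
    rw [reassoc_of% h₁, ← eHomWhiskerRight_comp, h₂, h₃, op_comp, Functor.map_comp,
      Category.assoc, h.naturality, Category.assoc])

variable {t L} in
lemma prismMap_simplex
    (i : ∀ m : SimplexCategory, L.obj (simplexFunctor.obj m) ⟶ (S'.obj (op m) ⟶[V] Y))
    (hi : ∀ {m n : SimplexCategory} (φ : m ⟶ n), L.map (simplexFunctor.map (t.map φ)) ≫ i n =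
      i m ≫ eHomWhiskerRight V (S'.map φ.op) Y) {m n : SimplexCategory}
    (x : simplexFunctor.obj m ⟶
      simplexFunctor.obj n ⊗ simplexFunctor.obj (SimplexCategory.mk 1))
    (σ : m ⟶ n) (τ : m ⟶ SimplexCategory.mk 1)
    (hσ : x ≫ SemiCartesianMonoidalCategory.fst _ _ = simplexFunctor.map (t.map σ))
    (hτ : x ≫ SemiCartesianMonoidalCategory.snd _ _ = simplexFunctor.map (t.map τ)) :
    L.map x ≫ prismMap t L h i hi n = i m ≫ eHomWhiskerRight V (S.map σ.op ≫ h.app m τ) _ := by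
  rw [prismMap, map_simplexDesc, hσ, hτ]
  simp only [Functor.preimage_map, Equiv.symm_apply_apply]

variable {t L} in
-- The compatibility in `n` under which the prisms glue to a map out of the realization of `S`.
lemma map_prismMap
    (i : ∀ m : SimplexCategory, L.obj (simplexFunctor.obj m) ⟶ (S'.obj (op m) ⟶[V] Y))
    (hi : ∀ {m n : SimplexCategory} (φ : m ⟶ n), L.map (simplexFunctor.map (t.map φ)) ≫ i n =
      i m ≫ eHomWhiskerRight V (S'.map φ.op) Y) {m n : SimplexCategory} (φ : m ⟶ n) :
    L.map (simplexFunctor.map (t.map φ) ▷ simplexFunctor.obj (SimplexCategory.mk 1)) ≫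
        prismMap t L h i hi n =
      prismMap t L h i hi m ≫ eHomWhiskerRight V (S.map φ.op) _ := by
  apply map_simplex_ext
  intro k x
  obtain ⟨σ, hσ⟩ := simplexFunctor.map_surjective (x ≫ SemiCartesianMonoidalCategory.fst _ _)
  obtain ⟨τ, hτ⟩ := simplexFunctor.map_surjective (x ≫ SemiCartesianMonoidalCategory.snd _ _)
  obtain ⟨σ, rfl⟩ := t.map.surjective σ
  obtain ⟨τ, rfl⟩ := t.map.surjective τ
  rw [← Category.assoc, ← L.map_comp, prismMap_simplex h i hi _ (σ ≫ φ) τ _ _,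
    ← Category.assoc, prismMap_simplex h i hi _ σ τ hσ.symm hτ.symm, Category.assoc,
    ← eHomWhiskerRight_comp, op_comp, Functor.map_comp, Category.assoc]
  · rw [Category.assoc, CartesianMonoidalCategory.whiskerRight_fst, ← Category.assoc, ← hσ,
      t.map_comp, Functor.map_comp]
  · rw [Category.assoc, CartesianMonoidalCategory.whiskerRight_snd, hτ]

variable {t L} in
-- Over an end of the prism the second coordinate of every simplex is constant, so the homotopy
-- contributes only its endpoint; naturality of the endpoint then collects all simplices into the
-- projection to `Δ[n]`.
lemma map_prismMap_endpoint
    (i : ∀ m : SimplexCategory, L.obj (simplexFunctor.obj m) ⟶ (S'.obj (op m) ⟶[V] Y))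
    (hi : ∀ {m n : SimplexCategory} (φ : m ⟶ n), L.map (simplexFunctor.map (t.map φ)) ≫ i n =
      i m ≫ eHomWhiskerRight V (S'.map φ.op) Y) (n : SimplexCategory)
    (k : SimplexCategory.mk 0 ⟶ SimplexCategory.mk 1) :
    L.map (simplexFunctor.obj n ◁ simplexFunctor.map (t.map k)) ≫ prismMap t L h i hi n =
      L.map (SemiCartesianMonoidalCategory.fst _ _) ≫ i n ≫
        eHomWhiskerRight V ((h.endpoint k).app (op n)) _ := by
  apply map_simplex_ext
  intro m x
  obtain ⟨σ, hσ⟩ := simplexFunctor.map_surjective (x ≫ SemiCartesianMonoidalCategory.fst _ _)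
  obtain ⟨τ, hτ⟩ := simplexFunctor.map_surjective (x ≫ SemiCartesianMonoidalCategory.snd _ _)
  obtain ⟨σ, rfl⟩ := t.map.surjective σ
  obtain ⟨τ, rfl⟩ := t.map.surjective τ
  -- `[0]` is terminal in the simplex category.
  obtain rfl : τ = SimplexCategory.const m (SimplexCategory.mk 0) 0 := by
    ext j
    exact congrArg Fin.val (Subsingleton.elim (α := Fin 1) _ _)
  have h₁ := (h.endpoint k).naturality σ.op
  rw [← Category.assoc, ← L.map_comp, prismMap_simplex h i hi _ σ
    (SimplexCategory.const m (SimplexCategory.mk 0) 0 ≫ k) _ _,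
    ← Category.assoc, ← L.map_comp, ← hσ, reassoc_of% hi σ, ← eHomWhiskerRight_comp]
  · exact congrArg (fun f => i m ≫ eHomWhiskerRight V f Y) h₁
  · rw [Category.assoc, CartesianMonoidalCategory.whiskerLeft_fst, ← hσ]
  · rw [Category.assoc, CartesianMonoidalCategory.whiskerLeft_snd, ← Category.assoc, ← hτ,
      t.map_comp, Functor.map_comp]

/-- The family of maps from the simplices to a realization. -/
def realizeCell (m : SimplexCategory) : L.obj (simplexFunctor.obj m) ⟶
    (S'.obj (op m) ⟶[V] realizeObj (t.cosimplicial L) S') :=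
  ad (realizeInj (t.cosimplicial L) S' m)

lemma realizeCell_map {m n : SimplexCategory} (φ : m ⟶ n) :
    L.map (simplexFunctor.map (t.map φ)) ≫ realizeCell t L (S' := S') n =
      realizeCell t L m ≫ eHomWhiskerRight V (S'.map φ.op) _ :=
  ad_realizeInj (t.cosimplicial L) S' φ

/-- The homotopy of realizations given by a combinatorial homotopy. -/
def realizeHomotopy : L.obj (simplexFunctor.obj (SimplexCategory.mk 1)) ⟶
    (realizeObj (t.cosimplicial L) S ⟶[V] realizeObj (t.cosimplicial L) S') :=
  -- The monoidal structure of `L` identifies `L Δ[n] ⊗ L Δ[1]` with `L (Δ[n] × Δ[1])`, the source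
  -- of the prism map.
  gRealizeDesc (fun n => tenHom.symm (Functor.LaxMonoidal.μ L _ _ ≫
      prismMap t L h (realizeCell t L) (realizeCell_map t L) n)) (fun m n φ => by
    apply ten_gext
    have h₁ := map_prismMap (t := t) (L := L) h _ (realizeCell_map t L (S' := S')) φ
    have h₂ := Functor.LaxMonoidal.μ_natural_left (F := L) (simplexFunctor.map (t.map φ))
      (simplexFunctor.obj (SimplexCategory.mk 1))
    rw [tenUnit_gcomp, tenUnit_gcomp, ad_tenMap, ad_tenMap, eHomWhiskerRight_id, Category.comp_id,
      Category.id_comp, comp_gcomp_left, gcomp_whiskerRight, ← tenHom_apply, ← tenHom_apply,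
      Equiv.apply_symm_apply, Equiv.apply_symm_apply]
    have h₃ := (reassoc_of% h₂) (prismMap t L h _ (realizeCell_map t L (S' := S')) n)
    rw [h₁, ← Category.assoc (Functor.LaxMonoidal.μ L _ _)] at h₃
    exact h₃)

/-- A projection from a product of simplicial sets is the collapse of one factor followed by a
unitor, and a strong monoidal functor carries this description over to tensor products. -/
lemma whiskerLeft_toUnitObj (K K' : SSet.{v}) :
    L.obj K ◁ toUnitObj L K' ≫ (ρ_ _).hom =
      Functor.LaxMonoidal.μ L _ _ ≫ L.map (SemiCartesianMonoidalCategory.fst _ _) := by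
  have h₁ := Functor.OplaxMonoidal.right_unitality_hom L K
  have h₂ := Functor.OplaxMonoidal.δ_natural_right (F := L) K (CartesianMonoidalCategory.toUnit K')
  have h₃ : (SemiCartesianMonoidalCategory.fst K K') =
    K ◁ CartesianMonoidalCategory.toUnit _ ≫ (ρ_ K).hom := by
    rw [CartesianMonoidalCategory.rightUnitor_hom, CartesianMonoidalCategory.whiskerLeft_fst]
  rw [h₃, L.map_comp, ← h₁, ← Category.assoc (L.map _), ← h₂, toUnitObj,
    MonoidalCategory.whiskerLeft_comp]
  simp

lemma whiskerRight_toUnitObj (K K' : SSet.{v}) :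
    toUnitObj L K ▷ L.obj K' ≫ (λ_ _).hom =
      Functor.LaxMonoidal.μ L _ _ ≫ L.map (SemiCartesianMonoidalCategory.snd _ _) := by
  have h₁ := Functor.OplaxMonoidal.left_unitality_hom L K'
  have h₂ := Functor.OplaxMonoidal.δ_natural_left (F := L) (CartesianMonoidalCategory.toUnit K) K'
  have h₃ : (SemiCartesianMonoidalCategory.snd K K') =
    CartesianMonoidalCategory.toUnit _ ▷ K' ≫ (λ_ K').hom := by
    rw [CartesianMonoidalCategory.leftUnitor_hom, CartesianMonoidalCategory.whiskerRight_snd]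
  rw [h₃, L.map_comp, ← h₁, ← Category.assoc (L.map _), ← h₂, toUnitObj, comp_whiskerRight]
  simp

lemma realizeHomotopy_endpoint (k : SimplexCategory.mk 0 ⟶ SimplexCategory.mk 1) :
    L.map (simplexFunctor.map (t.map k)) ≫ realizeHomotopy t L h =
      toUnitObj L _ ≫ eHomEquiv V (realizeMap (h.endpoint k)) := by
  apply gRealize_ext
  intro n
  apply ten_gext
  have h₁ := map_prismMap_endpoint h _ (realizeCell_map t L (S' := S')) n k
  have h₂ := Functor.LaxMonoidal.μ_natural_right (F := L) (simplexFunctor.obj n)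
    (simplexFunctor.map (t.map k))
  rw [Category.assoc, realizeHomotopy, gRealizeDesc_inj, Category.assoc, ← eHomEquiv_comp_left,
    realizeInj_map, comp_gcomp_right, ← tenHom_apply, Equiv.apply_symm_apply, comp_gcomp_right,
    gcomp_eHomEquiv]
  change _ = _ ≫ _ ≫ ad _
  rw [ad_tenMap_comp, Category.id_comp]
  have h₃ := (reassoc_of% h₂) (prismMap t L h _ (realizeCell_map t L (S' := S')) n)
  rw [h₁, ← Category.assoc (Functor.LaxMonoidal.μ L _ _),
    ← whiskerLeft_toUnitObj L (simplexFunctor.obj n) (simplexFunctor.obj (SimplexCategory.mk 0)), Category.assoc] at h₃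
  exact h₃

/-- The twist may exchange the two vertices of `Δ[1]`, so the ends are read through `t.map.symm`. -/
lemma isSimpliciallyHomotopic_endpoints :
    IsSimpliciallyHomotopic L (realizeMap (Δ := t.cosimplicial L)
        (h.endpoint (t.map.symm (SimplexCategory.δ 1))))
      (realizeMap (Δ := t.cosimplicial L) (h.endpoint (t.map.symm (SimplexCategory.δ 0)))) := by
  apply Relation.EqvGen.rel
  refine ⟨realizeHomotopy t L h, ?_, ?_⟩
  · have := realizeHomotopy_endpoint t L h (t.map.symm (SimplexCategory.δ 1))
    rw [Equiv.apply_symm_apply] at this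
    exact this
  · have := realizeHomotopy_endpoint t L h (t.map.symm (SimplexCategory.δ 0))
    rw [Equiv.apply_symm_apply] at this
    exact this

lemma eq_δ_zero_or_one (k : SimplexCategory.mk 0 ⟶ SimplexCategory.mk 1) :
    k = SimplexCategory.δ 0 ∨ k = SimplexCategory.δ 1 := by
  have key : ∀ a b : SimplexCategory.mk 0 ⟶ SimplexCategory.mk 1,
      a.toOrderHom 0 = b.toOrderHom 0 → a = b := by
    intro a b hab
    ext j
    obtain rfl : j = 0 := Subsingleton.elim (α := Fin 1) _ _
    exact congrArg Fin.val hab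
  have : k.toOrderHom 0 = 0 ∨ k.toOrderHom 0 = 1 := by
    generalize k.toOrderHom 0 = j
    change Fin 2 at j
    fin_cases j <;> simp
  rcases this with h | h
  · exact Or.inr (key _ _ h)
  · exact Or.inl (key _ _ h)

/-- The realizations of the two ends of a combinatorial homotopy are homotopic. -/
lemma isSimpliciallyHomotopic_realizeMap :
    IsSimpliciallyHomotopic L (realizeMap (Δ := t.cosimplicial L) (h.endpoint (SimplexCategory.δ 1)))
      (realizeMap (Δ := t.cosimplicial L) (h.endpoint (SimplexCategory.δ 0))) := by
  have H := isSimpliciallyHomotopic_endpoints t L h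
  have h₁ : t.map.symm (SimplexCategory.δ (0 : Fin 2)) ≠ t.map.symm (SimplexCategory.δ 1) := by
    rw [Ne, EmbeddingLike.apply_eq_iff_eq]
    intro h
    have := congrArg (fun f => f.toOrderHom 0) h
    exact absurd this (by decide)
  -- The twist permutes the two vertices of `Δ[1]`. If it exchanges them, the homotopy runs
  -- backwards, which the symmetry of the relation absorbs.
  rcases eq_δ_zero_or_one (t.map.symm (SimplexCategory.δ 0)) with h0 | h0 <;>
  rcases eq_δ_zero_or_one (t.map.symm (SimplexCategory.δ 1)) with h1 | h1
  · exact absurd (h0.trans h1.symm) h₁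
  · rwa [h0, h1] at H
  · rw [h0, h1] at H
    exact H.symm
  · exact absurd (h0.trans h1.symm) h₁

end Homotopy

/-! ### The extra degeneracy -/

section ChainSystem

variable {V : Type u₁} [Category.{v} V] [MonoidalCategory V] [SymmetricCategory V]
  [MonoidalClosed V] {D : Type v} [EnrichedCategory V D]
  {N : Type u₂} [Category.{v} N] [EnrichedOrdinaryCategory V N] [EnrichedBicomplete V N]

/-- This lemma and the next three are unit and associativity laws for maps `X ⟶ D(a, b) ⊙ Y`. They
are the axioms of a `ChainSystem` in the cases that involve a new top vertex. -/
lemma tenPt_coact {a b : D} {X Y : N} (x : X ⟶ ten (a ⟶[V] b) Y) :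
    tenPt (eId V b) X ≫ tenMap (𝟙 _) x ≫ tenComp (eComp V a b b) Y = x := by
  rw [← Category.assoc, tenPt_tenMap, Category.assoc, Category.comp_id, tenPt_tenComp, e_comp_id,
    tenMap_id, Category.comp_id]

lemma tenPt_act (F : VFun V D N) {b : D} {X : N} (x : X ⟶ F.obj b) :
    tenPt (eId V b) X ≫ tenMap (𝟙 _) x ≫ F.act b b = x := by
  rw [← Category.assoc, tenPt_tenMap, Category.assoc, Category.comp_id, F.one_act, Category.comp_id]

lemma tenComp_coact {a b c e : D} {X Y Z : N} (x : X ⟶ ten (b ⟶[V] c) Y)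
    (y : Y ⟶ ten (a ⟶[V] b) Z) :
    (tenMap (𝟙 _) x ≫ tenComp (eComp V b c e) Y) ≫ tenMap (𝟙 _) y ≫ tenComp (eComp V a b e) Z =
      tenMap (𝟙 _) (x ≫ tenMap (𝟙 _) y ≫ tenComp (eComp V a b c) Z) ≫
        tenComp (eComp V a c e) Z := by
  rw [Category.assoc, reassoc_of% tenComp_tenMap_one]
  simp only [tenMap_one_comp, Category.assoc]
  rw [tenComp_eComp]

lemma tenComp_coact_act (F : VFun V D N) {b c e : D} {X Y : N} (x : X ⟶ ten (b ⟶[V] c) Y)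
    (y : Y ⟶ F.obj b) :
    (tenMap (𝟙 _) x ≫ tenComp (eComp V b c e) Y) ≫ tenMap (𝟙 _) y ≫ F.act b e =
      tenMap (𝟙 _) (x ≫ tenMap (𝟙 _) y ≫ F.act b c) ≫ F.act c e := by
  rw [Category.assoc, reassoc_of% tenComp_tenMap_one]
  simp only [tenMap_one_comp, Category.assoc]
  rw [F.mul_act]

lemma comp_tenPt {P : V} (e : 𝟙_ V ⟶ P) {X Y : N} (f : X ⟶ Y) :
    f ≫ tenPt e Y = tenPt e X ≫ tenMap (𝟙 P) f := by
  rw [tenPt_tenMap, Category.comp_id]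

/-- Two consecutive coactions separated by a map `y` can be merged once `y` intertwines the second
with some `x'`. This is the mechanism by which operators on cells compose. -/
lemma coact_map_coact {a b c : D} {X Y Z W P U : N} (x : X ⟶ ten (b ⟶[V] c) Y) (y : Y ⟶ Z)
    (w : Z ⟶ ten (a ⟶[V] b) W) (u : W ⟶ U) {x' : Y ⟶ ten (a ⟶[V] b) P} (p : P ⟶ W)
    (z : X ⟶ ten (a ⟶[V] c) P) (h : y ≫ w = x' ≫ tenMap (𝟙 _) p)
    (h' : x ≫ tenMap (𝟙 _) x' ≫ tenComp (eComp V a b c) P = z) :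
    (x ≫ tenMap (𝟙 _) y) ≫ tenMap (𝟙 _) (w ≫ tenMap (𝟙 _) u) ≫ tenComp (eComp V a b c) U =
      z ≫ tenMap (𝟙 _) (p ≫ u) := by
  calc _ = x ≫ tenMap (𝟙 _) (y ≫ w) ≫ tenMap (𝟙 _) (tenMap (𝟙 _) u) ≫
        tenComp (eComp V a b c) U := by simp only [tenMap_one_comp, Category.assoc]
    _ = x ≫ tenMap (𝟙 _) x' ≫ tenMap (𝟙 _) (tenMap (𝟙 _) (p ≫ u)) ≫
        tenComp (eComp V a b c) U := by rw [h]; simp only [tenMap_one_comp, Category.assoc]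
    _ = _ := by rw [← tenComp_tenMap_one, ← h']; simp only [Category.assoc]

lemma coact_map_coact' {a b c : D} {X Y Z W P : N} (x : X ⟶ ten (b ⟶[V] c) Y) (y : Y ⟶ Z)
    (w : Z ⟶ ten (a ⟶[V] b) W) {x' : Y ⟶ ten (a ⟶[V] b) P} (p : P ⟶ W)
    {z : X ⟶ ten (a ⟶[V] c) P} (h : y ≫ w = x' ≫ tenMap (𝟙 _) p)
    (h' : x ≫ tenMap (𝟙 _) x' ≫ tenComp (eComp V a b c) P = z) :
    (x ≫ tenMap (𝟙 _) y) ≫ tenMap (𝟙 _) w ≫ tenComp (eComp V a b c) W = z ≫ tenMap (𝟙 _) p := by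
  have := coact_map_coact x y w (𝟙 W) p z h h'
  rwa [tenMap_id, Category.comp_id, Category.comp_id] at this

/-- A family of objects of `N` that can be pulled back to the chains of `F`. -/
structure ChainSystem (F : VFun V D N) {P : Type} (le : P → P → Prop) (o : P → D) where
  /-- the objects -/
  C : P → N
  /-- the coaction -/
  back : ∀ p q : P, le p q → (C q ⟶ ten (o p ⟶[V] o q) (C p))
  /-- the augmentation -/
  act : ∀ p : P, C p ⟶ F.obj (o p)
  back_self : ∀ (p : P) (h : le p p), back p p h = tenPt (eId V (o p)) (C p)
  back_back : ∀ (p q r : P) (h : le p q) (h' : le q r) (h'' : le p r),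
    back q r h' ≫ tenMap (𝟙 _) (back p q h) ≫ tenComp (eComp V _ _ _) _ = back p r h''
  back_act : ∀ (p q : P) (h : le p q), back p q h ≫ tenMap (𝟙 _) (act p) ≫ F.act _ _ = act q

namespace ChainSystem

variable {F : VFun V D N} {P P' : Type} {le : P → P → Prop} {le' : P' → P' → Prop} {o : P → D}

/-- The restriction of a system along a map of the indices. -/
def comap (S : ChainSystem F le o) (f : P' → P) (hf : ∀ p q, le' p q → le (f p) (f q)) :
    ChainSystem F le' (fun p => o (f p)) where
  C p := S.C (f p)
  back p q h := S.back (f p) (f q) (hf p q h)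
  act p := S.act (f p)
  back_self p h := S.back_self (f p) _
  back_back p q r h h' h'' := S.back_back _ _ _ _ _ _
  back_act p q h := S.back_act _ _ _

/-- The map to the chains of `F`. -/
def pull (S : ChainSystem F le o) {m : ℕ} (φ : Fin m → P)
    (hφ : ∀ i j, i ≤ j → le (φ i) (φ j)) : ∀ (k : ℕ) (hk : k < m),
    S.C (φ ⟨k, hk⟩) ⟶ chain F (fun i => o (φ i)) k hk
  | 0, hk => S.act (φ ⟨0, hk⟩)
  | k + 1, hk => S.back (φ ⟨k, Nat.lt_of_succ_lt hk⟩) (φ ⟨k + 1, hk⟩)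
      (hφ ⟨k, Nat.lt_of_succ_lt hk⟩ ⟨k + 1, hk⟩ (Nat.le_succ k)) ≫
        tenMap (𝟙 _) (pull S φ hφ k (Nat.lt_of_succ_lt hk))

variable (S S' : ChainSystem F le o) {m : ℕ} (φ : Fin m → P) (hφ : ∀ i j, i ≤ j → le (φ i) (φ j))

lemma pull_chainAct : ∀ (k : ℕ) (hk : k < m),
    S.pull φ hφ k hk ≫ chainAct F (fun i => o (φ i)) k hk = S.act (φ ⟨k, hk⟩)
  | 0, hk => by rw [pull, chainAct]; exact Category.comp_id _
  | k + 1, hk => by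
    rw [pull, chainAct, Category.assoc, ← Category.assoc (tenMap _ _), ← tenMap_one_comp,
      pull_chainAct k]
    exact S.back_act _ _ _

/-- With `pull_chainAct`, this says that pulling back respects the coaction and the augmentation. A
chain is built by iterating exactly these two structures, so the induction is the one used for
`chainPull`. -/
lemma pull_chainBack (i : ℕ) (hi : i < m) (j : ℕ) (hij : i ≤ j) : ∀ hj : j < m,
    S.pull φ hφ j hj ≫ chainBack F (fun i => o (φ i)) i hi j hij hj =
      S.back (φ ⟨i, hi⟩) (φ ⟨j, hj⟩) (hφ ⟨i, hi⟩ ⟨j, hj⟩ hij) ≫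
        tenMap (𝟙 _) (S.pull φ hφ i hi) := by
  induction hij using Nat.leRec with
  | refl =>
    intro hj
    rw [chainBack_self, S.back_self, tenPt_tenMap, Category.comp_id]
  | le_succ_of_le h ih =>
    intro hj
    rw [chainBack_succ F _ i hi _ h, pull, Category.assoc, ← Category.assoc (tenMap _ _),
      ← tenMap_one_comp, ih, tenMap_one_comp, Category.assoc, ← tenComp_tenMap_one]
    rw [← S.back_back (φ ⟨i, hi⟩) (φ ⟨_, Nat.lt_of_succ_lt hj⟩) (φ ⟨_, hj⟩)
      (hφ ⟨i, hi⟩ ⟨_, Nat.lt_of_succ_lt hj⟩ h)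
      (hφ ⟨_, Nat.lt_of_succ_lt hj⟩ ⟨_, hj⟩ (Nat.le_succ _))]
    simp only [Category.assoc]

/-- The initial vertex is governed by `pull_chainAct`, since everything before it acts on `F`, and
each further vertex by `pull_chainBack`. -/
lemma pull_comp {l : ℕ} (ψ : Fin l →o Fin m) : ∀ (k : ℕ) (hk : k < l),
    S.pull (fun i => φ (ψ i)) (fun i j h => hφ _ _ (ψ.monotone h)) k hk =
      S.pull φ hφ (ψ ⟨k, hk⟩).1 (ψ ⟨k, hk⟩).2 ≫ chainPull F (fun i => o (φ i)) ψ k hk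
  | 0, hk => (S.pull_chainAct φ hφ _ _).symm
  | k + 1, hk => by
    rw [pull, chainPull, pull_comp ψ k]
    refine (congrArg (fun t => _ ≫ t) (tenMap_one_comp _ _)).trans ?_
    refine (Category.assoc _ _ _).symm.trans (Eq.trans ?_ (Category.assoc _ _ _))
    refine congrArg (fun t => t ≫ _) ?_
    exact (S.pull_chainBack φ hφ _ _ _ _ _).symm

variable {S S'} in
-- A map of systems that respects coactions and augmentations becomes invisible after pulling back
-- to chains. Naturality of operators in the sequence of vertices is deduced from this.
lemma map_pull (c : ∀ p, S.C p ⟶ S'.C p) (hact : ∀ p, c p ≫ S'.act p = S.act p)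
    (hback : ∀ p q h, c q ≫ S'.back p q h = S.back p q h ≫ tenMap (𝟙 _) (c p)) :
    ∀ (k : ℕ) (hk : k < m), c (φ ⟨k, hk⟩) ≫ S'.pull φ hφ k hk = S.pull φ hφ k hk
  | 0, hk => hact _
  | k + 1, hk => by
    rw [pull, pull, ← map_pull c hact hback k, ← Category.assoc, hback, Category.assoc,
      tenMap_one_comp]

lemma comap_pull (f : P' → P) (hf : ∀ p q, le' p q → le (f p) (f q)) (φ : Fin m → P')
    (hφ : ∀ i j, i ≤ j → le' (φ i) (φ j)) : ∀ (k : ℕ) (hk : k < m),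
    (S.comap f hf).pull φ hφ k hk =
      S.pull (fun i => f (φ i)) (fun i j h => hf _ _ (hφ i j h)) k hk
  | 0, hk => rfl
  | k + 1, hk => by rw [pull, pull, comap_pull f hf φ hφ k]; rfl

end ChainSystem

/-- The preorder of the vertices of a cone. -/
def coneLE {n : ℕ} : Bool × Fin n → Bool × Fin n → Prop
  | (false, i), (false, j) => i.1 ≤ j.1
  | (true, _), (false, _) => False
  | (_, _), (true, _) => True

/-- The vertices of a cone. -/
abbrev coneVertex (e : D) {n : ℕ} (α : Fin n → D) (p : Bool × Fin n) : D := cond p.1 e (α p.2)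

/-- The system of the chains and of a cell of `B(D(-, e), D, F)`. -/
def coneSystem (F : VFun V D N) (e : D) {n : ℕ} (α : Fin (n + 1) → D) :
    ChainSystem F coneLE (coneVertex e α) where
  C := fun
    | (false, i) => chain F α i.1 i.2
    | (true, _) => barCell (reprModule e) F α
  back := fun
    | (false, i), (false, j), h => chainBack F α i.1 i.2 j.1 h j.2
    | (false, i), (true, _), _ => tenMap (𝟙 _) (chainBack F α i.1 i.2 n (Nat.le_of_lt_succ i.2)
        (Nat.lt_succ_self n)) ≫ tenComp (eComp V _ _ _) _
    | (true, _), (true, _), _ => tenPt (eId V e) _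
  act := fun
    | (false, i) => chainAct F α i.1 i.2
    | (true, _) => tenMap (𝟙 _) (chainAct F α n (Nat.lt_succ_self n)) ≫ F.act _ _
  back_self := fun
    | (false, i), h => chainBack_self F α _ _
    | (true, i), h => rfl
  back_back := fun
    | (false, i), (false, j), (false, k), h, h', _ =>
      chainBack_chainBack F α i.1 i.2 j.1 h j.2 k.1 h' k.2
    | (false, i), (false, j), (true, _), h, _, _ =>
      (tenComp_coact _ _).trans (congrArg (fun t => tenMap (𝟙 _) t ≫ tenComp (eComp V _ _ _) _)
        (chainBack_chainBack F α i.1 i.2 j.1 h j.2 n (Nat.le_of_lt_succ j.2) (Nat.lt_succ_self n)))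
    | (false, _), (true, _), (true, _), _, _, _ => tenPt_coact _
    | (true, _), (true, _), (true, _), _, _, _ => tenPt_coact _
  back_act := fun
    | (false, i), (false, j), h => chainBack_chainAct F α i.1 i.2 j.1 h j.2
    | (false, i), (true, _), _ =>
      (tenComp_coact_act F _ _).trans (congrArg (fun t => tenMap (𝟙 _) t ≫ F.act _ _)
        (chainBack_chainAct F α i.1 i.2 n (Nat.le_of_lt_succ i.2) (Nat.lt_succ_self n)))
    | (true, _), (true, _), _ => tenPt_act F _

/-! ### Operators on the cells of `B(D(-, e), D, F)` indexed by the simplices of a cone -/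

section Cone

variable (F : VFun V D N) (e : D) {n : ℕ} (α : Fin (n + 1) → D)

lemma coneSystem_pull_false {m : ℕ} (φ : Fin m →o Fin (n + 1)) : ∀ (k : ℕ) (hk : k < m),
    (coneSystem F e α).pull (fun i => (false, φ i)) (fun _ _ h => φ.monotone h) k hk =
      chainPull F α φ k hk
  | 0, hk => rfl
  | k + 1, hk => by
    exact congrArg (fun t => chainBack F α _ _ _ _ _ ≫ tenMap (𝟙 _) t)
      (coneSystem_pull_false φ k (Nat.lt_of_succ_lt hk))

/-- The operator on the cells of `B(D(-, e), D, F)` given by a simplex of a cone. -/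
def coneCell {m : ℕ} (ψ : Fin (m + 1) → Bool × Fin (n + 1))
    (hψ : ∀ i j, i ≤ j → coneLE (ψ i) (ψ j)) : barCell (reprModule e) F α ⟶
      barCell (reprModule e) F (fun i => coneVertex e α (ψ i)) :=
  (coneSystem F e α).back (ψ ⟨m, Nat.lt_succ_self m⟩) (true, 0)
      (by obtain ⟨b, i⟩ := ψ ⟨m, Nat.lt_succ_self m⟩; cases b <;> trivial) ≫
    tenMap (𝟙 _) ((coneSystem F e α).pull ψ hψ m (Nat.lt_succ_self m))

lemma coneCell_false {m : ℕ} (φ : Fin (m + 1) →o Fin (n + 1)) :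
    coneCell F e α (fun i => (false, φ i)) (fun _ _ h => φ.monotone h) =
      barCellMap (reprModule e) F α φ := by
  refine (congrArg (fun t => (tenMap (𝟙 _) (chainBack F α _ _ n _ _) ≫
    tenComp (eComp V _ _ _) _) ≫ tenMap (𝟙 _) t) (coneSystem_pull_false F e α φ m _)).trans ?_
  rw [Category.assoc, tenComp_tenMap_one, barCellMap, tenMap_one_comp, Category.assoc]
  rfl

lemma coneLE_top {p : Bool × Fin (n + 1)} : coneLE p (true, 0) := by
  obtain ⟨_ | _, i⟩ := p <;> trivial

/-- The last vertex of the smaller simplex lies below that of the larger one, which lies below the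
cone point; so the coactions compose by `back_back` and the remaining chains by `pull_comp`. -/
lemma coneCell_barCellMap {m l : ℕ} (ψ : Fin (m + 1) → Bool × Fin (n + 1))
    (hψ : ∀ i j, i ≤ j → coneLE (ψ i) (ψ j)) (φ : Fin (l + 1) →o Fin (m + 1)) :
    coneCell F e α ψ hψ ≫ barCellMap (reprModule e) F _ φ =
      coneCell F e α (fun i => ψ (φ i)) (fun i j h => hψ _ _ (φ.monotone h)) := by
  have hm := Nat.lt_succ_self m
  have hl := Nat.lt_succ_self l
  have e1 := (coneSystem F e α).pull_chainBack ψ hψ (φ ⟨l, hl⟩).1 (φ ⟨l, hl⟩).2 m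
    (Nat.le_of_lt_succ (φ ⟨l, hl⟩).2) hm
  have e2 := (coneSystem F e α).back_back (ψ (φ ⟨l, hl⟩)) (ψ ⟨m, hm⟩) (true, 0)
    (hψ _ _ (Nat.le_of_lt_succ (φ ⟨l, hl⟩).2)) coneLE_top coneLE_top
  have e3 := (coneSystem F e α).pull_comp ψ hψ φ l hl
  refine (coact_map_coact _ _ _ _ _ _ e1 e2).trans ?_
  exact congrArg (fun t => (coneSystem F e α).back _ _ _ ≫ tenMap (𝟙 _) t) e3.symm

variable {m : ℕ} (φ : Fin (m + 1) →o Fin (n + 1))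

/-- An ordinary operator is thereby the coaction from the cone point followed by a pullback of
chains, so the laws of the system `coneSystem` apply to it. -/
lemma barCellMap_repr : barCellMap (reprModule e) F α φ =
    (coneSystem F e α).back (false, φ ⟨m, Nat.lt_succ_self m⟩) (true, 0) trivial ≫
      tenMap (𝟙 _) (chainPull F α φ m (Nat.lt_succ_self m)) := by
  refine (coneCell_false F e α φ).symm.trans ?_
  exact congrArg (fun t => (tenMap (𝟙 _) (chainBack F α _ _ n _ _) ≫
    tenComp (eComp V _ _ _) _) ≫ tenMap (𝟙 _) t) (coneSystem_pull_false F e α φ m _)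

/-- The map of systems given by a map of the indices. -/
def coneSystemMap : ∀ p : Bool × Fin (m + 1), (coneSystem F e α).C (p.1, φ p.2) ⟶
    (coneSystem F e (fun i => α (φ i))).C p
  | (false, i) => chainPull F α φ i.1 i.2
  | (true, _) => barCellMap (reprModule e) F α φ

lemma coneSystemMap_act : ∀ p : Bool × Fin (m + 1),
    coneSystemMap F e α φ p ≫ (coneSystem F e (fun i => α (φ i))).act p =
      (coneSystem F e α).act (p.1, φ p.2)
  | (false, i) => chainPull_chainAct F α φ i.1 i.2
  | (true, _) => by
    have hm := Nat.lt_succ_self m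
    refine Eq.trans ?_ ((coneSystem F e α).back_act (false, φ ⟨m, hm⟩) (true, 0) trivial)
    refine Eq.trans ?_ (congrArg (fun t =>
      (coneSystem F e α).back (false, φ ⟨m, hm⟩) (true, 0) trivial ≫
      tenMap (𝟙 _) t ≫ F.act _ _) (chainPull_chainAct F α φ m hm))
    refine (congrArg (fun t => t ≫ _) (barCellMap_repr F e α φ)).trans ?_
    refine (Category.assoc _ _ _).trans (congrArg (fun t => _ ≫ t) ?_)
    refine (Category.assoc _ _ _).symm.trans (congrArg (fun t => t ≫ F.act _ _) ?_)
    exact (tenMap_one_comp _ _).symm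

lemma coneSystemMap_back : ∀ (p q : Bool × Fin (m + 1)) (h : coneLE p q)
    (h' : coneLE (p.1, φ p.2) (q.1, φ q.2)),
    coneSystemMap F e α φ q ≫ (coneSystem F e (fun i => α (φ i))).back p q h =
      (coneSystem F e α).back (p.1, φ p.2) (q.1, φ q.2) h' ≫
        tenMap (𝟙 _) (coneSystemMap F e α φ p)
  | (false, i), (false, j), h, _ => chainPull_chainBack F α φ i.1 i.2 j.1 h j.2
  | (true, _), (true, _), _, _ => comp_tenPt _ _
  | (false, i), (true, _), _, _ => by
    have hm := Nat.lt_succ_self m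
    have hi : i.1 ≤ m := Nat.le_of_lt_succ i.2
    refine (congrArg (fun t => t ≫ _) (barCellMap_repr F e α φ)).trans ?_
    exact coact_map_coact' _ _ _ _ (chainPull_chainBack F α φ i.1 i.2 m hi hm)
      ((coneSystem F e α).back_back (false, φ i) (false, φ ⟨m, hm⟩) (true, 0)
        (φ.monotone hi) trivial trivial)

/-- The pairs `(true, i)` all stand for the one cone point and `i` is a dummy. A map of the indices
moves the dummy, so the two labels have to be compared. -/
lemma coneSystem_back_true : ∀ (p : Bool × Fin (n + 1)) (i j : Fin (n + 1))
    (h : coneLE p (true, i)) (h' : coneLE p (true, j)),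
    (coneSystem F e α).back p (true, i) h = (coneSystem F e α).back p (true, j) h'
  | (false, _), _, _, _, _ => rfl
  | (true, _), _, _, _, _ => rfl

/-- The operator on the cells for the pullback of a map of the indices. -/
lemma barCellMap_coneCell {l : ℕ} (ψ : Fin (l + 1) → Bool × Fin (m + 1))
    (hψ : ∀ i j, i ≤ j → coneLE (ψ i) (ψ j))
    (hφ : ∀ p q : Bool × Fin (m + 1), coneLE p q → coneLE (p.1, φ p.2) (q.1, φ q.2)) :
    barCellMap (reprModule e) F α φ ≫ coneCell F e (fun i => α (φ i)) ψ hψ =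
      coneCell F e α (fun i => ((ψ i).1, φ (ψ i).2)) (fun i j h => hφ _ _ (hψ i j h)) := by
  have hl := Nat.lt_succ_self l
  have h₁ := coneSystemMap_back F e α φ (ψ ⟨l, hl⟩) (true, 0) coneLE_top
    (hφ _ (true, 0) coneLE_top)
  have h₂ := ChainSystem.map_pull
    (S := (coneSystem F e α).comap (le' := coneLE)
      (fun p : Bool × Fin (m + 1) => ((p.1, φ p.2) : Bool × Fin (n + 1))) hφ)
    (S' := coneSystem F e (fun i => α (φ i))) ψ hψ (coneSystemMap F e α φ)
    (coneSystemMap_act F e α φ) (fun p q h => coneSystemMap_back F e α φ p q h (hφ p q h)) l hl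
  refine (Category.assoc _ _ _).symm.trans ((congrArg (fun t => t ≫ _) h₁).trans ?_)
  refine (Category.assoc _ _ _).trans ?_
  rw [coneCell]
  refine (congrArg (fun t => t ≫ _)
    (coneSystem_back_true F e α _ (φ 0) 0 (hφ _ (true, 0) coneLE_top) coneLE_top)).trans ?_
  refine congrArg (fun t => (coneSystem F e α).back ((ψ ⟨l, hl⟩).1, φ (ψ ⟨l, hl⟩).2) (true, 0)
    coneLE_top ≫ t) ?_
  refine (tenMap_one_comp _ _).symm.trans (congrArg (fun t => tenMap _ t) ?_)
  exact h₂.trans (ChainSystem.comap_pull _ _ _ _ _ _ _)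

lemma coneSystem_pull_true {m : ℕ} (ψ ψ' : Fin m → Fin (n + 1)) : ∀ (k : ℕ) (hk : k < m),
    (coneSystem F e α).pull (fun i => (true, ψ i)) (fun _ _ _ => trivial) k hk =
      (coneSystem F e α).pull (fun i => (true, ψ' i)) (fun _ _ _ => trivial) k hk
  | 0, _ => rfl
  | k + 1, hk => congrArg (fun t => tenPt (eId V e) _ ≫ tenMap (𝟙 _) t)
      (coneSystem_pull_true ψ ψ' k (Nat.lt_of_succ_lt hk))

lemma coneCell_true (ψ ψ' : Fin (m + 1) → Fin (n + 1)) :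
    coneCell F e α (fun i => (true, ψ i)) (fun _ _ _ => trivial) =
      coneCell F e α (fun i => (true, ψ' i)) (fun _ _ _ => trivial) :=
  congrArg (fun t => tenPt (eId V e) _ ≫ tenMap (𝟙 _) t)
    (coneSystem_pull_true F e α ψ ψ' m _)

/-- A simplex concentrated at the cone point is degenerate: the whole chain is composed and acts on
`F`, giving an element of `F e`, after which only identities of `e` are inserted. -/
lemma coneCell_true_eq (ψ : Fin (m + 1) → Fin (n + 1)) (ψ' : Fin (m + 1) →o Fin (0 + 1)) :
    coneCell F e α (fun i => (true, ψ i)) (fun _ _ _ => trivial) =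
      ((tenMap (𝟙 _) (chainAct F α n (Nat.lt_succ_self n)) ≫ F.act _ _) ≫
        tenPt (eId V e) (F.obj e)) ≫ barCellMap (reprModule e) F (fun _ => e) ψ' := by
  refine (coneCell_true F e α ψ (fun _ => 0)).trans ?_
  refine (coneCell_barCellMap F e α (fun _ : Fin (0 + 1) => (true, 0)) (fun _ _ _ => trivial)
    ψ').symm.trans (congrArg (fun t => t ≫ _) ?_)
  exact (comp_tenPt _ _).symm

/-- The component of the homotopy. -/
def coneInj (b : Fin (n + 1) → Bool)
    (hb : ∀ i j, i ≤ j → coneLE ((b i, i) : Bool × Fin (n + 1)) (b j, j)) :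
    barCell (reprModule e) F α ⟶ ∐ fun α : Fin (n + 1) → D => barCell (reprModule e) F α :=
  coneCell F e α (fun i => (b i, i)) hb ≫
    Sigma.ι (fun α => barCell (reprModule e) F α) (fun i => coneVertex e α (b i, i))

lemma coneInj_false (b : Fin (n + 1) → Bool)
    (hb : ∀ i j, i ≤ j → coneLE ((b i, i) : Bool × Fin (n + 1)) (b j, j))
    (h : ∀ i, b i = false) :
    coneInj F e α b hb = Sigma.ι (fun α => barCell (reprModule e) F α) α := by
  obtain rfl : b = fun _ => false := funext h
  have := (coneCell_false F e α OrderHom.id).trans (barCellMap_id (reprModule e) F α)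
  exact (congrArg (fun t => t ≫ Sigma.ι (fun α => barCell (reprModule e) F α) α) this).trans
    (Category.id_comp _)

lemma coneInj_true (b : Fin (n + 1) → Bool)
    (hb : ∀ i j, i ≤ j → coneLE ((b i, i) : Bool × Fin (n + 1)) (b j, j))
    (h : ∀ i, b i = true) (ψ : Fin (n + 1) →o Fin (0 + 1)) :
    coneInj F e α b hb = (tenMap (𝟙 _) (chainAct F α n (Nat.lt_succ_self n)) ≫ F.act _ _) ≫
        tenPt (eId V e) (F.obj e) ≫ barCellMap (reprModule e) F (fun _ => e) ψ ≫
          Sigma.ι (fun α => barCell (reprModule e) F α) fun _ => e := by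
  obtain rfl : b = fun _ => true := funext h
  refine (congrArg (fun t => t ≫ Sigma.ι (fun α => barCell (reprModule e) F α) fun _ => e)
    (coneCell_true_eq F e α _ ψ)).trans ?_
  exact (Category.assoc _ _ _).trans (Category.assoc _ _ _)

/-- The vertices of a simplex of `Δ[1]`. -/
def intervalVertex {n : SimplexCategory} (τ : n ⟶ SimplexCategory.mk 1) (i : Fin (n.len + 1)) :
    Bool := decide (τ.toOrderHom i = (1 : Fin 2))

lemma coneLE_intervalVertex {n : SimplexCategory} (τ : n ⟶ SimplexCategory.mk 1)
    (i j : Fin (n.len + 1)) (hij : i ≤ j) :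
    coneLE (intervalVertex τ i, i) (intervalVertex τ j, j) := by
  have h : τ.toOrderHom i ≤ τ.toOrderHom j := τ.toOrderHom.monotone hij
  unfold intervalVertex
  generalize τ.toOrderHom i = x at h
  generalize τ.toOrderHom j = y at h
  change Fin 2 at x y
  fin_cases x <;> fin_cases y <;> first | exact hij | trivial

lemma coneLE_map {l : ℕ} (φ : Fin l →o Fin n) (p q : Bool × Fin l) (h : coneLE p q) :
    coneLE (p.1, φ p.2) (q.1, φ q.2) := by
  obtain ⟨_ | _, i⟩ := p <;> obtain ⟨_ | _, j⟩ := q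
  · exact φ.monotone h
  · trivial
  · exact h
  · trivial

/-- The extra degeneracy, as a homotopy. -/
def coneHomotopy : CombinatorialHomotopy (simplicialBarObj (reprModule e) F)
    (simplicialBarObj (reprModule e) F) where
  -- The vertices lying over `1` are moved to `e`. As `τ` is monotone these come last, and `D(-, e)`
  -- supplies the morphism from the last remaining vertex to `e`.
  app n τ := Limits.Sigma.desc fun α => coneInj F e α (intervalVertex τ) (coneLE_intervalVertex τ)
  naturality {m n} φ τ := by
    apply Limits.Sigma.hom_ext
    intro α
    dsimp only [simplicialBarObj]
    rw [Sigma.ι_desc_assoc, Sigma.ι_desc_assoc, Category.assoc, Sigma.ι_desc]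
    have h₁ := barCellMap_coneCell F e α φ.toOrderHom (fun i => (intervalVertex (φ ≫ τ) i, i))
      (coneLE_intervalVertex (φ ≫ τ)) (coneLE_map _)
    have h₂ := coneCell_barCellMap F e α (fun i => (intervalVertex τ i, i))
      (coneLE_intervalVertex τ) φ.toOrderHom
    rw [coneInj, coneInj, Category.assoc, Sigma.ι_desc, ← Category.assoc, ← Category.assoc]
    exact congrArg (fun t => t ≫ Sigma.ι (fun α => barCell (reprModule e) F α)
      (fun i => coneVertex e α (intervalVertex τ (φ.toOrderHom i), φ.toOrderHom i)))
      (h₁.trans h₂.symm)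

end Cone

end ChainSystem

/-! ### The resolution of a diagram by its bar construction -/

section BarResolution

variable {V : Type u₁} [Category.{v} V] [MonoidalCategory V] [SymmetricCategory V]
  [MonoidalClosed V] {D : Type v} [EnrichedCategory V D]
  {N : Type u₂} [Category.{v} N] [EnrichedOrdinaryCategory V N] [EnrichedBicomplete V N]

lemma gTenMap_tenCounit {J K : V} {X Y : N} (u : K ⟶ (X ⟶[V] Y)) (e : J ⟶ 𝟙_ V) :
    gTenMap J u ≫ eHomWhiskerLeft V _ (tenCounit e Y) =
      u ≫ eHomWhiskerRight V (tenCounit e X) Y := by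
  apply ten_gext
  rw [gcomp_whiskerLeft, tenUnit_gTenMap, tenUnit_gcomp, Category.assoc, ← gcomp_whiskerLeft]
  change _ ≫ gcomp V u (ad _) = _
  rw [tenCounit, ad_tenDesc, tenCounit, ad_tenDesc, comp_gcomp_left, comp_gcomp_right, gcomp_eId,
    eId_gcomp, ← BraidedCategory.braiding_naturality_left_assoc, braiding_rightUnitor_assoc]

lemma tenPt_tenCounit {P : V} (p : 𝟙_ V ⟶ P) (e : P ⟶ 𝟙_ V) (h : p ≫ e = 𝟙 _) (X : N) :
    tenPt p X ≫ tenCounit e X = 𝟙 X := by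
  apply (eHomEquiv V).injective
  rw [eHomEquiv_tenPt_comp, tenCounit, ad_tenDesc, reassoc_of% h, eHomEquiv_id]

lemma tenCounit_tenPt {P Q : V} (p : 𝟙_ V ⟶ P) (e : Q ⟶ 𝟙_ V) (X : N) :
    tenCounit e X ≫ tenPt p X = tenMap (e ≫ p) (𝟙 X) := by
  apply ten_ext
  rw [ad_comp, tenCounit, ad_tenDesc, whiskerLeft_tenPt, comp_gcomp_left, eId_gcomp, ad_tenMap,
    eHomWhiskerRight_id]
  simp [← unitors_inv_equal]

/-- Associativity of the action of `D` on `F`, with the outer morphism kept as a parameter. It makes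
the augmentations of the cells `V`-natural in `e`. -/
lemma gTenAct_act (F : VFun V D N) (a b c : D) :
    gTenAct (eComp V a b c) (F.obj a) ≫ eHomWhiskerLeft V _ (F.act a c) =
      F.map b c ≫ eHomWhiskerRight V (F.act a b) _ := by
  apply ten_gext
  rw [gcomp_whiskerLeft, tenUnit_gTenAct, tenUnit_gcomp, Category.assoc]
  change _ ≫ ad _ = _
  rw [F.ad_act, F.ad_act, F.map_comp]
  rfl

lemma gTenAct_map_act (F : VFun V D N) (a b c : D) {X : N} (x : X ⟶ F.obj a) :
    gTenAct (eComp V a b c) X ≫ eHomWhiskerLeft V _ (tenMap (𝟙 _) x ≫ F.act a c) =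
      F.map b c ≫ eHomWhiskerRight V (tenMap (𝟙 _) x ≫ F.act a b) _ := by
  rw [eHomWhiskerLeft_comp, ← Category.assoc, gTenAct_exchange, Category.assoc,
    ← eHom_whisker_exchange, reassoc_of% gTenAct_act, eHomWhiskerRight_comp]

section Graded

variable {Δ : SimplexCategory ⥤ V} {K : V} {S S' T T' : SimplexCategoryᵒᵖ ⥤ N} {Y Y' : N}

/-- A commuting square of enriched and ordinary maps may be checked level by level before realizing.
Applied to a map of diagrams, it makes `B(D, D, -)` a functor. -/
lemma gRealizeMap_natural (w : ∀ n : SimplexCategory, K ⟶ (S.obj (op n) ⟶[V] S'.obj (op n)))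
    (hw : ∀ (m n : SimplexCategory) (φ : m ⟶ n), w n ≫ eHomWhiskerLeft V _ (S'.map φ.op) =
      w m ≫ eHomWhiskerRight V (S.map φ.op) _)
    (w' : ∀ n : SimplexCategory, K ⟶ (T.obj (op n) ⟶[V] T'.obj (op n)))
    (hw' : ∀ (m n : SimplexCategory) (φ : m ⟶ n), w' n ≫ eHomWhiskerLeft V _ (T'.map φ.op) =
      w' m ≫ eHomWhiskerRight V (T.map φ.op) _) (f : S ⟶ T) (g : S' ⟶ T')
    (h : ∀ n, w n ≫ eHomWhiskerLeft V _ (g.app (op n)) =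
      w' n ≫ eHomWhiskerRight V (f.app (op n)) _) :
    gRealizeMap (Δ := Δ) w hw ≫ eHomWhiskerLeft V _ (realizeMap g) =
      gRealizeMap (Δ := Δ) w' hw' ≫ eHomWhiskerRight V (realizeMap f) _ := by
  apply gRealize_ext
  intro n
  rw [Category.assoc, eHom_whisker_exchange, ← Category.assoc, gRealizeMap_inj, Category.assoc,
    ← eHomWhiskerLeft_comp, realizeInj_map, Category.assoc, ← eHomWhiskerRight_comp,
    realizeInj_map, eHomWhiskerLeft_comp, ← Category.assoc, ← gTenMap_whiskerLeft, h,
    gTenMap_whiskerRight, eHomWhiskerRight_comp, ← Category.assoc (gRealizeMap _ _),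
    gRealizeMap_inj, Category.assoc, Category.assoc, eHom_whisker_exchange]

lemma gRealizeMap_aug (e : Δ ⟶ (Functor.const _).obj (𝟙_ V))
    (w : ∀ n : SimplexCategory, K ⟶ (S.obj (op n) ⟶[V] S'.obj (op n)))
    (hw : ∀ (m n : SimplexCategory) (φ : m ⟶ n), w n ≫ eHomWhiskerLeft V _ (S'.map φ.op) =
      w m ≫ eHomWhiskerRight V (S.map φ.op) _) (x : K ⟶ (Y ⟶[V] Y'))
    (u : ∀ n : SimplexCategory, S.obj (op n) ⟶ Y)
    (hu : ∀ (m n : SimplexCategory) (φ : m ⟶ n), S.map φ.op ≫ u m = u n)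
    (u' : ∀ n : SimplexCategory, S'.obj (op n) ⟶ Y')
    (hu' : ∀ (m n : SimplexCategory) (φ : m ⟶ n), S'.map φ.op ≫ u' m = u' n)
    (h : ∀ n, w n ≫ eHomWhiskerLeft V _ (u' n) = x ≫ eHomWhiskerRight V (u n) _) :
    gRealizeMap (Δ := Δ) w hw ≫ eHomWhiskerLeft V _ (realizeAug e u' hu') =
      x ≫ eHomWhiskerRight V (realizeAug e u hu) _ := by
  apply gRealize_ext
  intro n
  rw [Category.assoc, eHom_whisker_exchange, ← Category.assoc, gRealizeMap_inj, Category.assoc,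
    ← eHomWhiskerLeft_comp, realizeInj_aug, Category.assoc, ← eHomWhiskerRight_comp,
    realizeInj_aug, eHomWhiskerLeft_comp, ← Category.assoc, gTenMap_tenCounit, Category.assoc,
    ← eHom_whisker_exchange, reassoc_of% h, eHomWhiskerRight_comp]

end Graded

/-- The action of `F` on `D(-, e) ⊙_D F`. -/
def actDesc (F : VFun V D N) (e : D) : tensorObj (reprModule e) F ⟶ F.obj e :=
  tensorDesc (fun d => F.act d e) fun a b => (F.mul_act a b e).symm

lemma tensorInj_actDesc (F : VFun V D N) (e d : D) :
    tensorInj (reprModule e) F d ≫ actDesc F e = F.act d e := tensorInj_desc _ _ d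

lemma actDesc_natural {F F' : VFun V D N} (f : F ⟶ F') (e : D) :
    tensorObjMap (𝟙 (reprModule e)) f ≫ actDesc F' e = actDesc F e ≫ f.app e := by
  apply tensorObj_ext
  intro d
  rw [reassoc_of% tensorInj_map, tensorInj_actDesc, reassoc_of% tensorInj_actDesc]
  exact (VFun.act_app f d e).symm

lemma tenMap_chainAct_actDesc (F : VFun V D N) (e : D) {n : ℕ} (α : Fin (n + 1) → D) :
    (tenMap (𝟙 ((reprModule e).obj (α ⟨n, Nat.lt_succ_self n⟩)))
        (chainAct F α n (Nat.lt_succ_self n)) ≫ tensorInj (reprModule e) F _) ≫ actDesc F e =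
      tenMap (𝟙 _) (chainAct F α n (Nat.lt_succ_self n)) ≫ F.act _ _ := by
  rw [Category.assoc, tensorInj_actDesc]
  rfl

lemma ι_barLevelAug (G : RightModule V D) (F : VFun V D N) {n : ℕ} (α : Fin (n + 1) → D) :
    Sigma.ι (fun α : Fin (n + 1) → D => barCell G F α) α ≫ barLevelAug G F n =
      tenMap (𝟙 _) (chainAct F α n (Nat.lt_succ_self n)) ≫ tensorInj G F _ := by
  rw [barLevelAug, Sigma.ι_desc]

lemma gLevel_actDesc (F : VFun V D N) (a b : D) (n : ℕ) :
    gLevel a b F n ≫ eHomWhiskerLeft V _ (barLevelAug (reprModule b) F n ≫ actDesc F b) =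
      F.map a b ≫ eHomWhiskerRight V (barLevelAug (reprModule a) F n ≫ actDesc F a) _ := by
  apply gSigma_ext
  intro α
  rw [Category.assoc, eHom_whisker_exchange, ← Category.assoc, gLevel, gSigmaDesc_ι, Category.assoc,
    ← eHomWhiskerLeft_comp, Category.assoc, ← eHomWhiskerRight_comp, ← Category.assoc (Sigma.ι _ _),
    ← Category.assoc (Sigma.ι _ _), ι_barLevelAug, ι_barLevelAug, tenMap_chainAct_actDesc,
    tenMap_chainAct_actDesc, gCell]
  exact gTenAct_map_act F _ a b _

variable {Δ : SimplexCategory ⥤ V}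

/-- The augmentation of `B_•(D(-, e), D, F)`. -/
def levelCounit (F : VFun V D N) (e : D) (n : ℕ) :
    (∐ fun α : Fin (n + 1) → D => barCell (reprModule e) F α) ⟶ F.obj e :=
  barLevelAug (reprModule e) F n ≫ actDesc F e

lemma ι_levelCounit (F : VFun V D N) (e : D) {n : ℕ} (α : Fin (n + 1) → D) :
    Sigma.ι (fun α : Fin (n + 1) → D => barCell (reprModule e) F α) α ≫ levelCounit F e n =
      tenMap (𝟙 _) (chainAct F α n (Nat.lt_succ_self n)) ≫ F.act _ _ := by
  rw [levelCounit, ← Category.assoc, ι_barLevelAug, tenMap_chainAct_actDesc]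

lemma levelCounit_map (F : VFun V D N) (e : D) {m n : SimplexCategory} (φ : m ⟶ n) :
    (simplicialBarObj (reprModule e) F).map φ.op ≫ levelCounit F e m.len =
      levelCounit F e n.len := by
  have h := congrArg (fun t => t ≫ actDesc F e) (barLevelAug_map (reprModule e) F φ)
  exact (Category.assoc _ _ _).symm.trans h

/-- The augmentation of the resolution factors through `D(-, e) ⊙_D F`. Its naturality in `F` is
thus inherited from that of `barComparison` and `actDesc`. -/
lemma barComparison_actDesc (aug : Δ ⟶ (Functor.const _).obj (𝟙_ V)) (F : VFun V D N) (e : D) :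
    (barComparison aug).app (reprModule e, F) ≫ actDesc F e =
      realizeAug aug (X := simplicialBarObj (reprModule e) F) (fun n => levelCounit F e n.len)
        (fun _ _ φ => levelCounit_map F e φ) := by
  apply realizeObj_ext
  intro n
  refine Eq.trans ?_ (realizeInj_aug aug _ _ n).symm
  refine (Category.assoc _ _ _).symm.trans ?_
  refine (congrArg (fun t => t ≫ actDesc F e) (realizeInj_aug aug (X := simplicialBarObj (reprModule e) F)
    _ (fun _ _ φ => barLevelAug_map (reprModule e) F φ) n)).trans ?_
  exact Category.assoc _ _ _

/-- The map `B(D, D, F) ⟶ F`. -/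
def barCounit (aug : Δ ⟶ (Functor.const _).obj (𝟙_ V)) (F : VFun V D N) :
    barDiagram Δ F ⟶ F where
  app e := realizeAug aug (X := simplicialBarObj (reprModule e) F)
    (fun n => levelCounit F e n.len) (fun _ _ φ => levelCounit_map F e φ)
  naturality a b := gRealizeMap_aug aug _ (fun _ _ φ => gLevel_map a b F φ) _ _ _ _ _
    fun n => gLevel_actDesc F a b n.len

lemma gLevel_barLevelMap {F F' : VFun V D N} (f : F ⟶ F') (a b : D) (n : ℕ) :
    gLevel a b F n ≫ eHomWhiskerLeft V _ (barLevelMap n (𝟙 (reprModule b)) f) =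
      gLevel a b F' n ≫ eHomWhiskerRight V (barLevelMap n (𝟙 (reprModule a)) f) _ := by
  apply gSigma_ext
  intro α
  rw [Category.assoc, eHom_whisker_exchange, ← Category.assoc, gLevel, gSigmaDesc_ι, Category.assoc,
    ← eHomWhiskerLeft_comp, Category.assoc, ← eHomWhiskerRight_comp, barLevelMap, Sigma.ι_desc,
    barLevelMap, Sigma.ι_desc, eHomWhiskerLeft_comp, eHomWhiskerRight_comp, gLevel,
    ← Category.assoc (gSigmaDesc _), gSigmaDesc_ι, Category.assoc, eHom_whisker_exchange,
    ← Category.assoc, ← Category.assoc]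
  exact congrArg (fun t => t ≫ _) (gTenAct_exchange _ _)

variable (Δ) in
/-- The functor `F ↦ B(D, D, F)`. -/
def barDiagramFunctor : VFun V D N ⥤ VFun V D N where
  obj F := barDiagram Δ F
  map {F F'} f :=
    { app := fun e => (bar Δ D N).map (Y := (reprModule e, F')) (Prod.mkHom (𝟙 (reprModule e)) f)
      naturality := fun a b => gRealizeMap_natural _ (fun _ _ φ => gLevel_map a b F φ) _
        (fun _ _ φ => gLevel_map a b F' φ) _ _ fun n => gLevel_barLevelMap f a b n.len }
  map_id F := by
    ext e
    exact (bar Δ D N).map_id (reprModule e, F)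
  map_comp {F F' F''} f g := by
    ext e
    let f' : ((reprModule e, F) : RightModule V D × VFun V D N) ⟶ (reprModule e, F') :=
      Prod.mkHom (𝟙 _) f
    let g' : ((reprModule e, F') : RightModule V D × VFun V D N) ⟶ (reprModule e, F'') :=
      Prod.mkHom (𝟙 _) g
    have h : Prod.mkHom (𝟙 (reprModule e)) (f ≫ g) = f' ≫ g' :=
      Prod.ext (Category.comp_id _).symm rfl
    exact (congrArg (bar Δ D N).map h).trans ((bar Δ D N).map_comp f' g')

/-- The natural map `B(D, D, F) ⟶ F`. -/
def barCounitNat (aug : Δ ⟶ (Functor.const _).obj (𝟙_ V)) :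
    barDiagramFunctor (D := D) (N := N) Δ ⟶ 𝟭 _ where
  app F := barCounit aug F
  naturality F F' f := by
    ext e
    have h := (barComparison aug).naturality (X := (reprModule e, F)) (Y := (reprModule e, F'))
      (Prod.mkHom (𝟙 (reprModule e)) f)
    refine (congrArg (fun t => _ ≫ t) (barComparison_actDesc aug F' e).symm).trans ?_
    refine Eq.trans ?_ (congrArg (fun t => t ≫ f.app e) (barComparison_actDesc aug F e))
    refine ((reassoc_of% h) (actDesc F' e)).trans ?_
    exact (congrArg (fun t => _ ≫ t) (actDesc_natural f e)).trans (Category.assoc _ _ _).symm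

/-! ### The augmentation of the resolution is objectwise a simplicial homotopy equivalence -/

section HomotopyEquivalence

variable (t : SimplexTwist) (L : SSet.{v} ⥤ V) [L.Monoidal]

/-- The augmentation of a twist of the canonical cosimplicial object. -/
def SimplexTwist.augmentation : t.cosimplicial L ⟶ (Functor.const _).obj (𝟙_ V) where
  app n := toUnitObj L (simplexFunctor.obj n)
  naturality _ _ φ := (map_toUnitObj L (simplexFunctor.map (t.map φ))).trans
    (Category.comp_id _).symm

/-- The vertex of `Δ[0]`. -/
def zeroVertex : 𝟙_ V ⟶ (t.cosimplicial L).obj (SimplexCategory.mk 0) :=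
  Functor.LaxMonoidal.ε L ≫
    L.map (SSet.stdSimplex.isTerminalObj₀.from (𝟙_ SSet.{v}))

/-- `Δ[0]` is terminal, hence isomorphic to the unit of simplicial sets, and `L` preserves the unit.
-/
lemma zeroVertex_augmentation :
    zeroVertex t L ≫ (t.augmentation L).app (SimplexCategory.mk 0) = 𝟙 _ := by
  have h : SSet.stdSimplex.isTerminalObj₀.from (𝟙_ SSet.{v}) ≫
    CartesianMonoidalCategory.toUnit _ = 𝟙 _ := CartesianMonoidalCategory.toUnit_unique _ _
  have h₁ := congrArg (fun f => Functor.LaxMonoidal.ε L ≫ L.map f ≫ Functor.OplaxMonoidal.η L) h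
  simp only [L.map_comp, Category.assoc] at h₁
  refine (Category.assoc _ _ _).trans (h₁.trans ?_)
  refine (congrArg (fun f => _ ≫ f ≫ _) (L.map_id (𝟙_ SSet.{v}))).trans ?_
  exact (congrArg (fun f => _ ≫ f) (Category.id_comp _)).trans (Functor.Monoidal.ε_η L)

lemma augmentation_zeroVertex (n : SimplexCategory) :
    (t.augmentation L).app n ≫ zeroVertex t L =
      (t.cosimplicial L).map (SimplexCategory.const n (SimplexCategory.mk 0) 0) := by
  have h : CartesianMonoidalCategory.toUnit (simplexFunctor.obj n) ≫
      SSet.stdSimplex.isTerminalObj₀.from (𝟙_ SSet.{v}) =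
      simplexFunctor.map (t.map (SimplexCategory.const n (SimplexCategory.mk 0) 0)) :=
    SSet.stdSimplex.isTerminalObj₀.hom_ext _ _
  refine Eq.trans ?_ (congrArg (fun f => L.map f) h)
  refine Eq.trans ?_ (L.map_comp _ _).symm
  refine (Category.assoc _ _ _).trans (congrArg (fun f => L.map _ ≫ f) ?_)
  exact Functor.Monoidal.η_ε_assoc _ _

section Section

variable {S : SimplexCategoryᵒᵖ ⥤ N} {Y : N} (l : Y ⟶ S.obj (op (SimplexCategory.mk 0)))
  (u : ∀ n : SimplexCategory, S.obj (op n) ⟶ Y)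
  (hu : ∀ (m n : SimplexCategory) (φ : m ⟶ n), S.map φ.op ≫ u m = u n)

/-- The inclusion of a vertex in a realization. -/
def vertexInj : Y ⟶ realizeObj (t.cosimplicial L) S :=
  tenPt (zeroVertex t L) Y ≫ tenMap (𝟙 _) l ≫
    realizeInj (t.cosimplicial L) S (SimplexCategory.mk 0)

lemma vertexInj_realizeAug : vertexInj t L l ≫ realizeAug (t.augmentation L) u hu =
    l ≫ u (SimplexCategory.mk 0) := by
  rw [vertexInj, Category.assoc, Category.assoc, realizeInj_aug, ← Category.assoc (tenMap _ _),
    tenMap_tenCounit, Category.id_comp, ← Category.assoc,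
    ← Category.assoc, tenPt_tenCounit _ _ (zeroVertex_augmentation t L), Category.id_comp]

/-- In the realization, a cell with values in degeneracies of a vertex is identified with that
vertex by the relation for `n ⟶ [0]`. So augmenting and then including `Y` as a vertex is the
realization of the simplicial map that augments, applies `l` and degenerates. -/
lemma realizeAug_vertexInj (g : S ⟶ S) (hg : ∀ n : SimplexCategory, g.app (op n) =
      u n ≫ l ≫ S.map (SimplexCategory.const n (SimplexCategory.mk 0) 0).op) :
    realizeAug (t.augmentation L) u hu ≫ vertexInj t L l = realizeMap g := by
  apply realizeObj_ext
  intro n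
  have h' := realizeInj_condition (t.cosimplicial L) S
    (SimplexCategory.const n (SimplexCategory.mk 0) 0)
  rw [realizeInj_map, hg, ← Category.assoc, realizeInj_aug, tenMap_one_comp, tenMap_one_comp,
    Category.assoc, Category.assoc, Category.assoc, ← h', vertexInj, ← Category.assoc (u n),
    comp_tenPt, Category.assoc, ← Category.assoc (tenCounit _ _), tenCounit_tenPt,
    augmentation_zeroVertex]
  simp only [← Category.assoc, tenMap_comp, Category.id_comp, Category.comp_id]

end Section

/-- The inclusion of a cell in the simplicial object `B_•(G, D, F)`. -/
def barInj (G : RightModule V D) (F : VFun V D N) {n : ℕ} (α : Fin (n + 1) → D) :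
    barCell G F α ⟶ (simplicialBarObj G F).obj (op (SimplexCategory.mk n)) :=
  Sigma.ι (fun α : Fin (n + 1) → D => barCell G F α) α

lemma barInj_levelCounit (F : VFun V D N) (e : D) {n : ℕ} (α : Fin (n + 1) → D) :
    barInj (reprModule e) F α ≫ levelCounit F e n =
      tenMap (𝟙 _) (chainAct F α n (Nat.lt_succ_self n)) ≫ F.act _ _ := ι_levelCounit F e α

lemma barInj_map (G : RightModule V D) (F : VFun V D N) {m n : ℕ} (α : Fin (n + 1) → D)
    (φ : SimplexCategory.mk m ⟶ SimplexCategory.mk n) :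
    barInj G F α ≫ (simplicialBarObj G F).map φ.op =
      barCellMap G F α φ.toOrderHom ≫ barInj G F (fun i => α (φ.toOrderHom i)) :=
  Sigma.ι_desc _ _

/-- The inclusion of the vertex `e` in the simplicial object `B_•(D(-, e), D, F)`. -/
def levelUnit (F : VFun V D N) (e : D) :
    F.obj e ⟶ (simplicialBarObj (reprModule e) F).obj (op (SimplexCategory.mk 0)) :=
  tenPt (eId V e) (F.obj e) ≫ barInj (reprModule e) F (n := 0) fun _ => e

lemma levelUnit_levelCounit (F : VFun V D N) (e : D) :
    levelUnit F e ≫ levelCounit F e 0 = 𝟙 _ := by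
  refine (Category.assoc _ _ _).trans ?_
  refine (congrArg (fun t => _ ≫ t) (barInj_levelCounit F e (n := 0) fun _ => e)).trans ?_
  exact tenPt_act F (𝟙 _)

/-- `δ 1` omits `1` and so is the vertex `0` of `[1]`, over which no vertex is moved to `e`. -/
lemma endpoint_coneHomotopy_zero (F : VFun V D N) (e : D) :
    (coneHomotopy F e).endpoint (SimplexCategory.δ 1) = 𝟙 _ := by
  ext n : 2
  apply Limits.Sigma.hom_ext
  intro α
  refine (Sigma.ι_desc _ _).trans ((coneInj_false F e α _ _ ?_).trans (Category.comp_id _).symm)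
  intro i
  rfl

/-- `δ 0` is the vertex `1` of `[1]`, over which all vertices are moved to `e`. -/
lemma endpoint_coneHomotopy_one (F : VFun V D N) (e : D) (n : SimplexCategory) :
    ((coneHomotopy F e).endpoint (SimplexCategory.δ 0)).app (op n) =
      levelCounit F e n.len ≫ levelUnit F e ≫ (simplicialBarObj (reprModule e) F).map
        (SimplexCategory.const n (SimplexCategory.mk 0) 0).op := by
  apply Limits.Sigma.hom_ext
  intro α
  refine (Sigma.ι_desc _ _).trans ((coneInj_true F e α _ _ ?_
    (SimplexCategory.const n (SimplexCategory.mk 0) 0).toOrderHom).trans ?_)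
  · intro i
    rfl
  · refine Eq.trans ?_ (Category.assoc _ _ _)
    refine Eq.trans ?_ (congrArg (fun t => t ≫ _) (ι_levelCounit F e α)).symm
    refine congrArg (fun t => (tenMap (𝟙 _) (chainAct F α n.len _) ≫ F.act _ _) ≫ t) ?_
    refine Eq.trans ?_ (Category.assoc _ _ _).symm
    refine congrArg (fun t => tenPt (eId V e) (F.obj e) ≫ t) ?_
    exact (barInj_map (reprModule e) F (n := 0) (fun _ => e)
      (SimplexCategory.const n (SimplexCategory.mk 0) 0)).symm

/-- The map `B(D, D, F) ⟶ F` is objectwise a simplicial homotopy equivalence. -/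
lemma barCounit_mem_simplicialHomotopyEquivalences [L.IsLeftAdjoint] (F : VFun V D N) (e : D) :
    simplicialHomotopyEquivalences L N ((barCounit (t.augmentation L) F).app e) := by
  -- The homotopy inverse includes `F e` at the vertex given by the identity of `e`. On `F e` the
  -- composite is the identity exactly; on the resolution it is one end of `coneHomotopy`, whose
  -- other end is the identity.
  refine ⟨vertexInj t L (levelUnit F e), ?_, ?_⟩
  · have h := isSimpliciallyHomotopic_realizeMap t L (coneHomotopy F e)
    rw [endpoint_coneHomotopy_zero] at h
    refine (congrArg (fun f => IsSimpliciallyHomotopic L f (𝟙 _)) (realizeAug_vertexInj t L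
      (levelUnit F e) _ (fun _ _ φ => levelCounit_map F e φ) _
      (endpoint_coneHomotopy_one F e))).mpr ?_
    exact ((congrArg (fun f => IsSimpliciallyHomotopic L f _)
      ((realize (t.cosimplicial L)).map_id _)).mp h).symm
  · refine (congrArg (fun f => IsSimpliciallyHomotopic L f (𝟙 _))
      ((vertexInj_realizeAug t L (levelUnit F e) _ (fun _ _ φ => levelCounit_map F e φ)).trans
        (levelUnit_levelCounit F e))).mpr ?_
    exact Relation.EqvGen.refl _

section Opposite

variable {X Y : N}

/-- The mapping objects of `Nᵒᵖ` are those of `N` with the two variables exchanged, so the same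
1-simplex witnesses the homotopy. -/
lemma isSimpliciallyHomotopic_unop {X Y : Nᵒᵖ} {f g : X ⟶ Y} (h : IsSimpliciallyHomotopic L f g) :
    IsSimpliciallyHomotopic L f.unop g.unop := by
  induction h with
  | rel f g h =>
    obtain ⟨u, h₁, h₂⟩ := h
    exact Relation.EqvGen.rel _ _ ⟨u, h₁, h₂⟩
  | refl f => exact Relation.EqvGen.refl _
  | symm _ _ _ h => exact h.symm
  | trans _ _ _ _ _ h h' => exact h.trans _ _ _ h'

lemma simplicialHomotopyEquivalences_unop {X Y : Nᵒᵖ} {f : X ⟶ Y}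
    (h : simplicialHomotopyEquivalences L Nᵒᵖ f) : simplicialHomotopyEquivalences L N f.unop := by
  obtain ⟨g, h₁, h₂⟩ := h
  exact ⟨g.unop, isSimpliciallyHomotopic_unop L h₂, isSimpliciallyHomotopic_unop L h₁⟩

end Opposite

end HomotopyEquivalence

end BarResolution

/-! ### Graded natural transformations -/

section Graded

variable {V : Type u₁} [Category.{v} V] [MonoidalCategory V] [SymmetricCategory V]
  [MonoidalClosed V] {D : Type v} [EnrichedCategory V D]
  {N : Type u₂} [Category.{v} N] [EnrichedOrdinaryCategory V N] [EnrichedBicomplete V N]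

section Square

variable {J K L P : V} {X X' X'' Y Y' Y'' : N}

/-- The generalized elements `u` and `u'` of hom-objects are intertwined by `x` and `y`. -/
def GSquare (u : K ⟶ (X ⟶[V] Y)) (u' : K ⟶ (X' ⟶[V] Y')) (x : X ⟶ X') (y : Y ⟶ Y') : Prop :=
  u ≫ eHomWhiskerLeft V X y = u' ≫ eHomWhiskerRight V x Y'

lemma GSquare.refl (u : K ⟶ (X ⟶[V] Y)) : GSquare u u (𝟙 X) (𝟙 Y) := by simp [GSquare]

lemma GSquare.comp {u : K ⟶ (X ⟶[V] Y)} {u' : K ⟶ (X' ⟶[V] Y')} {u'' : K ⟶ (X'' ⟶[V] Y'')}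
    {x : X ⟶ X'} {y : Y ⟶ Y'} {x' : X' ⟶ X''} {y' : Y' ⟶ Y''} (h : GSquare u u' x y)
    (h' : GSquare u' u'' x' y') : GSquare u u'' (x ≫ x') (y ≫ y') := by
  unfold GSquare at *
  rw [eHomWhiskerLeft_comp, reassoc_of% h, ← eHom_whisker_exchange, reassoc_of% h',
    eHomWhiskerRight_comp]

lemma GSquare.ten {u : K ⟶ (X ⟶[V] Y)} {u' : K ⟶ (X' ⟶[V] Y')} {x : X ⟶ X'} {y : Y ⟶ Y'}
    (h : GSquare u u' x y) :
    GSquare (gTenMap J u) (gTenMap J u') (tenMap (𝟙 J) x) (tenMap (𝟙 J) y) := by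
  unfold GSquare at *
  rw [← gTenMap_whiskerLeft, h, gTenMap_whiskerRight]

/-- Sliding the parameter of `u` past `J` and then past `L` is sliding it past `J ⊗ L`, by the
hexagon identity; naturality of the braiding then carries it across `s`. -/
lemma gSquare_tenComp (u : K ⟶ (X ⟶[V] Y)) (s : J ⊗ L ⟶ P) :
    GSquare (gTenMap L (gTenMap J u)) (gTenMap P u) (tenComp s X) (tenComp s Y) := by
  unfold GSquare
  apply ten_gext
  apply ten_gext
  rw [gcomp_whiskerLeft, tenUnit_gTenMap, Category.assoc, ← gcomp_whiskerLeft, tenUnit_gcomp]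
  change gcomp V _ (_ ≫ gcomp V _ (ad _)) = _
  have h : gcomp V (tenUnit J X) (gcomp V (gTenMap J u) (ad (tenComp s Y))) =
      (α_ _ _ _).inv ≫ (β_ J K).hom ▷ L ≫ (α_ _ _ _).hom ≫ K ◁ s ≫ gcomp V u (tenUnit P Y) := by
    rw [← cancel_epi (α_ _ _ _).hom, ← gcomp_assoc, tenUnit_gTenMap, comp_gcomp_left, gcomp_assoc,
      ad_tenComp, comp_gcomp_right, Iso.hom_inv_id_assoc]
  rw [comp_gcomp_right, h, ← cancel_epi (α_ _ _ _).hom, ← gcomp_assoc, ad_tenComp, comp_gcomp_left,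
    tenUnit_gTenMap]
  simp

lemma gSquare_tenPt (u : K ⟶ (X ⟶[V] Y)) (e : 𝟙_ V ⟶ P) :
    GSquare u (gTenMap P u) (tenPt e X) (tenPt e Y) := by
  unfold GSquare
  rw [whiskerLeft_tenPt, ← cancel_epi (λ_ K).hom]
  have := eHomEquiv_gcomp (V := V) (tenPt e X) (gTenMap P u)
  rw [← this, tenPt, Equiv.apply_symm_apply, comp_gcomp_left, tenUnit_gTenMap, comp_gcomp_right]
  rw [BraidedCategory.braiding_naturality_left_assoc]
  simp

end Square

/-- A `V`-natural family of maps `K ⟶ N(F d, F' d)`. -/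
structure GNat (K : V) (F F' : VFun V D N) where
  /-- the components -/
  app : ∀ d : D, K ⟶ (F.obj d ⟶[V] F'.obj d)
  naturality : ∀ a b : D, GSquare (gTenMap (a ⟶[V] b) (app a)) (app b) (F.act a b) (F'.act a b)

variable {K : V} {F F' : VFun V D N} (ω : GNat K F F') {n : ℕ} (α : Fin n → D)

/-- The action of graded natural transformations on chains. -/
def gChainMap : ∀ (k : ℕ) (hk : k < n), K ⟶ (chain F α k hk ⟶[V] chain F' α k hk)
  | 0, _ => ω.app _
  | k + 1, hk => gTenMap _ (gChainMap k (Nat.lt_of_succ_lt hk))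

lemma gChainMap_chainBack (i : ℕ) (hi : i < n) (j : ℕ) (hij : i ≤ j) : ∀ hj : j < n,
    GSquare (gChainMap ω α j hj) (gTenMap _ (gChainMap ω α i hi))
      (chainBack F α i hi j hij hj) (chainBack F' α i hi j hij hj) := by
  induction hij using Nat.leRec with
  | refl =>
    intro hj
    rw [chainBack_self, chainBack_self]
    exact gSquare_tenPt _ _
  | le_succ_of_le h ih =>
    intro hj
    rw [chainBack_succ F _ i hi _ h, chainBack_succ F' _ i hi _ h]
    exact (ih _).ten.comp (gSquare_tenComp _ _)

lemma gChainMap_chainAct : ∀ (k : ℕ) (hk : k < n),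
    GSquare (gChainMap ω α k hk) (ω.app _) (chainAct F α k hk) (chainAct F' α k hk)
  | 0, _ => GSquare.refl _
  | k + 1, _ => (gChainMap_chainAct k _).ten.comp (ω.naturality _ _)

lemma gChainMap_chainPull {m : ℕ} (φ : Fin m →o Fin n) : ∀ (k : ℕ) (hk : k < m),
    GSquare (gChainMap ω α (φ ⟨k, hk⟩).1 (φ ⟨k, hk⟩).2) (gChainMap ω (fun i => α (φ i)) k hk)
      (chainPull F α φ k hk) (chainPull F' α φ k hk)
  | 0, _ => gChainMap_chainAct ω α _ _
  | k + 1, _ => (gChainMap_chainBack ω α _ _ _ _ _).comp (gChainMap_chainPull φ k _).ten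

/-- The action of graded natural transformations on the cells of the bar construction. -/
def gBarCellMap (G : RightModule V D) {n : ℕ} (α : Fin (n + 1) → D) :
    K ⟶ (barCell G F α ⟶[V] barCell G F' α) :=
  gTenMap _ (gChainMap ω α n (Nat.lt_succ_self n))

/-- The operators on cells are assembled from `chainBack`, `chainPull` and `tenComp`, so the squares
for these can be pasted. -/
lemma gBarCellMap_barCellMap (G : RightModule V D) {n m : ℕ} (α : Fin (n + 1) → D)
    (φ : Fin (m + 1) →o Fin (n + 1)) :
    GSquare (gBarCellMap ω G α) (gBarCellMap ω G (fun i => α (φ i)))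
      (barCellMap G F α φ) (barCellMap G F' α φ) :=
  ((gChainMap_chainBack ω α _ _ _ _ _).comp (gChainMap_chainPull ω α φ m _).ten).ten.comp
    (gSquare_tenComp _ _)

end Graded

/-! ### Enriched colimits over the cells of a bar construction -/

section Cells

variable {V : Type u₁} [Category.{v} V] [MonoidalCategory V] [SymmetricCategory V]
  [MonoidalClosed V] {D : Type v} [EnrichedCategory V D]
  {N : Type u₂} [Category.{v} N] [EnrichedOrdinaryCategory V N] [EnrichedBicomplete V N]

variable (D N) in
/-- Objects indexed by the sequences of objects of `D`, with simplicial operators. -/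
structure CellDiagram where
  /-- the objects -/
  obj : ∀ q : SimplexCategory, (Fin (q.len + 1) → D) → N
  /-- the operators -/
  map : ∀ {p q : SimplexCategory} (φ : p ⟶ q) (γ : Fin (q.len + 1) → D),
    obj q γ ⟶ obj p (fun i => γ (φ.toOrderHom i))

/-- A cocone under a diagram of cells, weighted by a cosimplicial object. -/
structure CellCocone (Δ : SimplexCategory ⥤ V) (X : CellDiagram D N) (B : N) where
  /-- the injections -/
  inj : ∀ (q : SimplexCategory) (γ : Fin (q.len + 1) → D), Δ.obj q ⟶ (X.obj q γ ⟶[V] B)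
  condition : ∀ {p q : SimplexCategory} (φ : p ⟶ q) (γ : Fin (q.len + 1) → D),
    Δ.map φ ≫ inj q γ = inj p _ ≫ eHomWhiskerRight V (X.map φ γ) B

/-- The universal property of an enriched weighted colimit. -/
structure CellCocone.IsColimit {Δ : SimplexCategory ⥤ V} {X : CellDiagram D N} {B : N}
    (c : CellCocone Δ X B) : Prop where
  hom_ext : ∀ {A : V} {Y : N} {u v : A ⟶ (B ⟶[V] Y)},
    (∀ q γ, gcomp V (c.inj q γ) u = gcomp V (c.inj q γ) v) → u = v
  exists_desc : ∀ {A : V} {Y : N} (w : ∀ (q : SimplexCategory) (γ : Fin (q.len + 1) → D),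
      Δ.obj q ⊗ A ⟶ (X.obj q γ ⟶[V] Y)),
    (∀ {p q : SimplexCategory} (φ : p ⟶ q) (γ : Fin (q.len + 1) → D),
      Δ.map φ ▷ A ≫ w q γ = w p _ ≫ eHomWhiskerRight V (X.map φ γ) Y) →
    ∃ u : A ⟶ (B ⟶[V] Y), ∀ q γ, gcomp V (c.inj q γ) u = w q γ

section

variable {Δ : SimplexCategory ⥤ V} {X : CellDiagram D N} {B : N} (J : V)

/-- The tensor of a diagram of cells. -/
@[reducible]
def CellDiagram.ten (X : CellDiagram D N) : CellDiagram D N where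
  obj q γ := EnrichedBar.ten J (X.obj q γ)
  map φ γ := tenMap (𝟙 J) (X.map φ γ)

/-- The tensor of a cocone. -/
def CellCocone.ten (c : CellCocone Δ X B) : CellCocone Δ (X.ten J) (EnrichedBar.ten J B) where
  inj q γ := gTenMap J (c.inj q γ)
  condition φ γ := by
    rw [← comp_gTenMap, c.condition, gTenMap_whiskerRight]

lemma tenUnit_gcomp_gTenMap {J K A : V} {X Y Z : N} (u : K ⟶ (X ⟶[V] Y))
    (w : A ⟶ (ten J Y ⟶[V] Z)) :
    gcomp V (tenUnit J X) (gcomp V (gTenMap J u) w) =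
      (α_ _ _ _).inv ≫ (β_ J K).hom ▷ A ≫ (α_ _ _ _).hom ≫ gcomp V u (gcomp V (tenUnit J Y) w) := by
  rw [← cancel_epi (α_ _ _ _).hom, ← gcomp_assoc, tenUnit_gTenMap, comp_gcomp_left, gcomp_assoc,
    Iso.hom_inv_id_assoc]

/-- Maps out of `J ⊙ B` with parameter `A` are maps out of `B` with parameter `J ⊗ A`, so the
universal property of `B` is used at `J ⊗ A`. The braidings only move `J` past the weight. -/
lemma CellCocone.IsColimit.ten {c : CellCocone Δ X B} (hc : c.IsColimit) :
    (c.ten J).IsColimit where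
  hom_ext {A Y u v} h := by
    apply ten_gext
    apply hc.hom_ext
    intro q γ
    have h' := congrArg (fun t => gcomp V (tenUnit J _) t) (h q γ)
    have h₁ := tenUnit_gcomp_gTenMap (J := J) (c.inj q γ) u
    have h₂ := tenUnit_gcomp_gTenMap (J := J) (c.inj q γ) v
    have := h₁.symm.trans (h'.trans h₂)
    simpa [cancel_epi] using this
  exists_desc {A Y} w hw := by
    obtain ⟨u, hu⟩ := hc.exists_desc (A := J ⊗ A) (Y := Y)
      (fun q γ => (α_ _ _ _).inv ≫ (β_ (Δ.obj q) J).hom ▷ A ≫ (α_ _ _ _).hom ≫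
        gcomp V (tenUnit J (X.obj q γ)) (w q γ)) (by
      intro p q φ γ
      have h := congrArg (fun t => gcomp V (tenUnit J (X.obj q γ)) t) (hw φ γ)
      have h₁ : gcomp V (tenUnit J (X.obj q γ)) (w p (fun i => γ (φ.toOrderHom i)) ≫
          eHomWhiskerRight V (tenMap (𝟙 J) (X.map φ γ)) Y) =
          gcomp V (tenUnit J _) (w p (fun i => γ (φ.toOrderHom i))) ≫
            eHomWhiskerRight V (X.map φ γ) Y := by
        rw [tenUnit_gcomp, ad_tenMap, Category.id_comp, gcomp_whiskerRight]
      have h₂ := h.trans h₁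
      rw [comp_gcomp_right] at h₂
      simp only [Category.assoc, ← h₂]
      rw [associator_inv_naturality_left_assoc, ← comp_whiskerRight_assoc,
        BraidedCategory.braiding_naturality_left, comp_whiskerRight_assoc,
        associator_naturality_middle_assoc])
    refine ⟨tenHom.symm u, fun q γ => ?_⟩
    apply ten_gext
    refine (tenUnit_gcomp_gTenMap (J := J) (c.inj q γ) _).trans ?_
    rw [← tenHom_apply (tenHom.symm u), Equiv.apply_symm_apply, hu, Iso.hom_inv_id_assoc,
      ← comp_whiskerRight_assoc, SymmetricCategory.symmetry]
    simp

end

section Bar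

variable (Δ : SimplexCategory ⥤ V) (G : RightModule V D) (F : VFun V D N)

/-- The cells of a bar construction. -/
@[reducible]
def barCells : CellDiagram D N where
  obj _ γ := barCell G F γ
  map φ γ := barCellMap G F γ φ.toOrderHom

/-- The inclusion of a cell. -/
def cellInj (q : SimplexCategory) (γ : Fin (q.len + 1) → D) :
    barCell G F γ ⟶ (simplicialBarObj G F).obj (op q) :=
  Sigma.ι (fun γ : Fin (q.len + 1) → D => barCell G F γ) γ

lemma cellInj_map {p q : SimplexCategory} (φ : p ⟶ q) (γ : Fin (q.len + 1) → D) :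
    cellInj G F q γ ≫ (simplicialBarObj G F).map φ.op =
      barCellMap G F γ φ.toOrderHom ≫ cellInj G F p _ :=
  Sigma.ι_desc _ _

variable {G F} in
lemma cell_gext {q : SimplexCategory} {K : V} {Y : N}
    {x y : K ⟶ ((simplicialBarObj G F).obj (op q) ⟶[V] Y)}
    (h : ∀ γ, x ≫ eHomWhiskerRight V (cellInj G F q γ) Y =
      y ≫ eHomWhiskerRight V (cellInj G F q γ) Y) : x = y := gSigma_ext h

variable {G F} in
/-- Maps from the levels of a bar construction. -/
def cellDesc {q : SimplexCategory} {K : V} {Y : N}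
    (u : ∀ γ : Fin (q.len + 1) → D, K ⟶ (barCell G F γ ⟶[V] Y)) :
    K ⟶ ((simplicialBarObj G F).obj (op q) ⟶[V] Y) := gSigmaDesc u

variable {G F} in
lemma cellDesc_inj {q : SimplexCategory} {K : V} {Y : N}
    (u : ∀ γ : Fin (q.len + 1) → D, K ⟶ (barCell G F γ ⟶[V] Y)) (γ : Fin (q.len + 1) → D) :
    cellDesc u ≫ eHomWhiskerRight V (cellInj G F q γ) Y = u γ := gSigmaDesc_ι u γ

/-- The bar construction as a cocone. -/
def barCocone : CellCocone Δ (barCells G F) (realizeObj Δ (simplicialBarObj G F)) where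
  inj q γ := ad (realizeInj Δ (simplicialBarObj G F) q) ≫ eHomWhiskerRight V (cellInj G F q γ) _
  condition φ γ := by
    rw [reassoc_of% ad_realizeInj, Category.assoc, ← eHomWhiskerRight_comp,
      ← eHomWhiskerRight_comp, cellInj_map]

variable {Δ G F} in
lemma barCocone_gcomp {A : V} {Y : N} (u : A ⟶ (realizeObj Δ (simplicialBarObj G F) ⟶[V] Y))
    (q : SimplexCategory) (γ : Fin (q.len + 1) → D) :
    gcomp V ((barCocone Δ G F).inj q γ) u =
      gcomp V (tenUnit (Δ.obj q) ((simplicialBarObj G F).obj (op q)))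
        (u ≫ eHomWhiskerRight V (realizeInj Δ (simplicialBarObj G F) q) _) ≫ eHomWhiskerRight V
          (cellInj G F q γ) _ := by
  rw [tenUnit_gcomp, ← gcomp_whiskerRight]
  rfl

/-- Realizations, coproducts and tensors each have a universal property for maps carrying a
parameter in `V`; applied in this order, the three reduce a map out of the bar construction to its
cells. -/
lemma isColimit_barCocone : (barCocone Δ G F).IsColimit where
  hom_ext {A Y u v} h := by
    apply gRealize_ext
    intro q
    apply ten_gext
    apply cell_gext
    intro γ
    exact (barCocone_gcomp u q γ).symm.trans ((h q γ).trans (barCocone_gcomp v q γ))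
  exists_desc {A Y} w hw := by
    refine ⟨gRealizeDesc (S := simplicialBarObj G F)
      (fun q => tenHom.symm (cellDesc (w q))) ?_, fun q γ => ?_⟩
    · intro p q φ
      apply ten_gext
      rw [tenUnit_gcomp, tenUnit_gcomp, ad_tenMap, ad_tenMap, eHomWhiskerRight_id, Category.comp_id,
        Category.id_comp, comp_gcomp_left, gcomp_whiskerRight, ← tenHom_apply, ← tenHom_apply,
        Equiv.apply_symm_apply, Equiv.apply_symm_apply]
      apply cell_gext
      intro γ
      rw [Category.assoc, Category.assoc, ← eHomWhiskerRight_comp, cellInj_map,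
        eHomWhiskerRight_comp, cellDesc_inj, reassoc_of% cellDesc_inj, hw]
    · rw [barCocone_gcomp, gRealizeDesc_inj, ← tenHom_apply, Equiv.apply_symm_apply, cellDesc_inj]

end Bar

/-- Passes between squares of tensors and equations between composites of generalized elements. It
yields the `V`-naturality of the cell inclusions `cellNat`. -/
lemma gSquare_tenDesc_iff {J K : V} {X Y X' Y' : N} (u : K ⟶ (X ⟶[V] Y)) (u' : K ⟶ (X' ⟶[V] Y'))
    (x : J ⟶ (X ⟶[V] X')) (y : J ⟶ (Y ⟶[V] Y')) :
    GSquare (gTenMap J u) u' (tenDesc x) (tenDesc y) ↔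
      (β_ J K).hom ≫ gcomp V u y = gcomp V x u' := by
  have h₁ : gcomp V (tenUnit J X) (gTenMap J u ≫ eHomWhiskerLeft V _ (tenDesc y)) =
      (β_ J K).hom ≫ gcomp V u y := by
    rw [gcomp_whiskerLeft, tenUnit_gTenMap, Category.assoc, ← gcomp_whiskerLeft]
    exact congrArg (fun t => _ ≫ gcomp V u t) (ad_tenDesc y)
  have h₂ : gcomp V (tenUnit J X) (u' ≫ eHomWhiskerRight V (tenDesc x) _) = gcomp V x u' := by
    rw [tenUnit_gcomp, ad_tenDesc]
  constructor
  · intro h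
    rw [← h₁, ← h₂, h]
  · intro h
    apply ten_gext
    rw [h₁, h₂, h]

section CellFun

variable (Δ : SimplexCategory ⥤ V) (F : VFun V D N)

/-- The `V`-functor `e ↦ D(γ_n, e) ⊙ (D(γ_{n-1}, γ_n) ⊙ (⋯ ⊙ F γ_0))`. -/
def cellFun {n : ℕ} (γ : Fin (n + 1) → D) : VFun V D N where
  obj e := barCell (reprModule e) F γ
  map e e' := gCell e e' F γ
  map_id _ := gTenAct_eId _ _ _
  map_comp _ _ _ := gTenAct_eComp _ _ _ _ _

/-- The simplicial operators on the `V`-functors `cellFun F γ`. -/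
def cellFunMap {n m : ℕ} (γ : Fin (n + 1) → D) (φ : Fin (m + 1) →o Fin (n + 1)) :
    cellFun F γ ⟶ cellFun F (fun i => γ (φ i)) where
  app e := barCellMap (reprModule e) F γ φ
  naturality a b := gCell_map a b F γ φ

lemma barCocone_gRealizeMap {G G' : RightModule V D} {F F' : VFun V D N} {K : V}
    (w : ∀ n : SimplexCategory, K ⟶
      ((simplicialBarObj G F).obj (op n) ⟶[V] (simplicialBarObj G' F').obj (op n)))
    (hw : ∀ (m n : SimplexCategory) (φ : m ⟶ n),
      w n ≫ eHomWhiskerLeft V _ ((simplicialBarObj G' F').map φ.op) =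
        w m ≫ eHomWhiskerRight V ((simplicialBarObj G F).map φ.op) _) {q : SimplexCategory}
    {γ : Fin (q.len + 1) → D} (c : K ⟶ (barCell G F γ ⟶[V] barCell G' F' γ))
    (hc : w q ≫ eHomWhiskerRight V (cellInj G F q γ) _ =
      c ≫ eHomWhiskerLeft V _ (cellInj G' F' q γ)) :
    gcomp V ((barCocone Δ G F).inj q γ) (gRealizeMap w hw) =
      (β_ _ _).hom ≫ gcomp V c ((barCocone Δ G' F').inj q γ) := by
  have h : gcomp V (w q) (tenUnit (Δ.obj q) _) ≫
      eHomWhiskerLeft V _ (realizeInj Δ (simplicialBarObj G' F') q) =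
      gcomp V (w q) (ad (realizeInj Δ (simplicialBarObj G' F') q)) :=
    (gcomp_whiskerLeft _ _ _).symm
  rw [barCocone_gcomp, gRealizeMap_inj, gcomp_whiskerLeft, tenUnit_gTenMap, Category.assoc,
    Category.assoc, reassoc_of% h, ← gcomp_whiskerRight, hc]
  exact congrArg (fun t => (β_ _ _).hom ≫ t) (gcomp_middle _ _ _)

/-- A morphism of `D` acts on the resolution through its action on each cell; equivalently, the
inclusions of the cells are `V`-natural in `e`. -/
lemma gcomp_gBar (e e' : D) (q : SimplexCategory) (γ : Fin (q.len + 1) → D) :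
    gcomp V ((barCocone Δ (reprModule e) F).inj q γ) (gBar Δ e e' F) =
      (β_ _ _).hom ≫ gcomp V (gCell e e' F γ) ((barCocone Δ (reprModule e') F).inj q γ) :=
  barCocone_gRealizeMap Δ _ (fun _ _ φ => gLevel_map e e' F φ) _ (gSigmaDesc_ι _ γ)

/-- The injections of the cells of `B(D, D, F)`, as graded natural transformations. -/
def cellNat (q : SimplexCategory) (γ : Fin (q.len + 1) → D) :
    GNat (Δ.obj q) (cellFun F γ) (barDiagram Δ F) where
  app e := (barCocone Δ (reprModule e) F).inj q γ
  naturality a b := (gSquare_tenDesc_iff _ _ _ _).2 (by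
    rw [← cancel_epi (β_ _ _).hom, SymmetricCategory.symmetry_assoc]
    exact gcomp_gBar Δ F a b q γ)

end CellFun

end Cells

/-! ### The bar construction as a tensor product with the resolution -/

section TensorResolution

variable {V : Type u₁} [Category.{v} V] [MonoidalCategory V] [SymmetricCategory V]
  [MonoidalClosed V] {D : Type v} [EnrichedCategory V D]
  {N : Type u₂} [Category.{v} N] [EnrichedOrdinaryCategory V N] [EnrichedBicomplete V N]

section

variable {Δ : SimplexCategory ⥤ V} {X : CellDiagram D N} {B : N} {c : CellCocone Δ X B}

/-- This lemma and the next are the universal property for ordinary maps, the case where the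
parameter is the unit object. -/
lemma CellCocone.IsColimit.map_ext (hc : c.IsColimit) {Y : N} {f g : B ⟶ Y}
    (h : ∀ q γ, c.inj q γ ≫ eHomWhiskerLeft V _ f = c.inj q γ ≫ eHomWhiskerLeft V _ g) : f = g := by
  apply (eHomEquiv V).injective
  apply hc.hom_ext
  intro q γ
  rw [gcomp_eHomEquiv, gcomp_eHomEquiv, h]

lemma CellCocone.IsColimit.exists_map (hc : c.IsColimit) {Y : N}
    (w : ∀ (q : SimplexCategory) (γ : Fin (q.len + 1) → D), Δ.obj q ⟶ (X.obj q γ ⟶[V] Y))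
    (hw : ∀ {p q : SimplexCategory} (φ : p ⟶ q) (γ : Fin (q.len + 1) → D),
      Δ.map φ ≫ w q γ = w p _ ≫ eHomWhiskerRight V (X.map φ γ) Y) :
    ∃ f : B ⟶ Y, ∀ q γ, c.inj q γ ≫ eHomWhiskerLeft V _ f = w q γ := by
  obtain ⟨u, hu⟩ := hc.exists_desc (A := 𝟙_ V) (fun q γ => (ρ_ _).hom ≫ w q γ) (by
    intro p q φ γ
    rw [rightUnitor_naturality_assoc, hw, Category.assoc])
  refine ⟨(eHomEquiv V).symm u, fun q γ => ?_⟩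
  rw [← cancel_epi (ρ_ _).hom, ← gcomp_eHomEquiv, Equiv.apply_symm_apply, hu]

end

lemma gTenAct_tenPt {A K : V} {P : V} (e : 𝟙_ V ⟶ A) (s : A ⊗ K ⟶ P) (X : N) :
    gTenAct s X ≫ eHomWhiskerRight V (tenPt e X) _ = (λ_ K).inv ≫ e ▷ K ≫ s ≫ tenUnit P X := by
  rw [← cancel_epi (λ_ K).hom, ← eHomEquiv_gcomp, tenPt, Equiv.apply_symm_apply, comp_gcomp_left,
    tenUnit_gTenAct, Iso.hom_inv_id_assoc]

lemma gTenAct_act_tenPt (G : RightModule V D) (a : D) (X : N) :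
    gTenAct (G.act a a) X ≫ eHomWhiskerRight V (tenPt (eId V a) X) _ = tenUnit (G.obj a) X := by
  rw [gTenAct_tenPt, reassoc_of% (G.one_act a), Iso.inv_hom_id_assoc]

/-- Associativity of the action of `G`: letting `G` absorb a morphism and then a further one from
the chain is absorbing their composite. -/
lemma gTenAct_act_cell (G : RightModule V D) (a b e : D) {X Y : N} (x : X ⟶ ten (a ⟶[V] b) Y) :
    gTenAct (G.act b e) X ≫ eHomWhiskerLeft V _ (tenMap (𝟙 _) x ≫ tenComp (G.act a b) Y) =
      gTenAct (G.act a e) Y ≫ eHomWhiskerRight V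
        (tenMap (𝟙 _) x ≫ tenComp (eComp V a b e) Y) _ := by
  rw [eHomWhiskerLeft_comp, eHomWhiskerRight_comp, ← Category.assoc, gTenAct_exchange,
    Category.assoc, ← eHom_whisker_exchange, ← Category.assoc,
    gTenAct_tenComp _ (eComp V a b e) _ (G.act a e) (G.mul_act a b e), Category.assoc]

lemma gcomp_gTenAct_act (G : RightModule V D) (a b c : D) (X : N) :
    gcomp V (gTenAct (eComp V a b c) X) (gTenAct (G.act a c) X) =
      G.act b c ≫ gTenAct (G.act a b) X := by
  rw [gcomp_gTenAct, comp_gTenAct, G.mul_act, Iso.inv_hom_id_assoc]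

lemma gcomp_tenDesc {J K : V} {X Y Z : N} (u : K ⟶ (X ⟶[V] Y)) (y : J ⟶ (Y ⟶[V] Z)) :
    gcomp V (tenUnit J X) (gTenMap J u ≫ eHomWhiskerLeft V _ (tenDesc y)) =
      (β_ J K).hom ≫ gcomp V u y := by
  rw [gcomp_whiskerLeft, tenUnit_gTenMap, Category.assoc, ← gcomp_whiskerLeft]
  exact congrArg (fun t => _ ≫ gcomp V u t) (ad_tenDesc y)

lemma gcomp_gTenMap_ad {J K : V} {X Y Z : N} (u : K ⟶ (X ⟶[V] Y)) (y : ten J Y ⟶ Z) :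
    gcomp V (tenUnit J X) (gTenMap J u ≫ eHomWhiskerLeft V _ y) =
      (β_ J K).hom ≫ gcomp V u (ad y) := by
  rw [gcomp_whiskerLeft, tenUnit_gTenMap, Category.assoc, ← gcomp_whiskerLeft]
  rfl

variable (Δ : SimplexCategory ⥤ V) (G : RightModule V D) (F : VFun V D N)

section Resolution

/-- The cells of `B(D(-, d), D, F)`. -/
@[reducible]
def cellsAt (d : D) : CellDiagram D N where
  obj _ γ := (cellFun F γ).obj d
  map φ γ := (cellFunMap F γ φ.toOrderHom).app d

/-- The cocone given by `B(D(-, d), D, F)`. -/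
def cellNatCocone (d : D) : CellCocone Δ (cellsAt F d) ((barDiagram Δ F).obj d) where
  inj q γ := (cellNat Δ F q γ).app d
  condition φ γ := (barCocone Δ (reprModule d) F).condition φ γ

lemma isColimit_cellNatCocone (d : D) : (cellNatCocone Δ F d).IsColimit where
  hom_ext h := (isColimit_barCocone Δ (reprModule d) F).hom_ext h
  exists_desc w hw := (isColimit_barCocone Δ (reprModule d) F).exists_desc w hw

lemma GNat.gcomp_map {K : V} {F F' : VFun V D N} (ω : GNat K F F') (a b : D) :
    gcomp V (ω.app a) (F'.map a b) = (β_ _ _).hom ≫ gcomp V (F.map a b) (ω.app b) := by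
  have h := (gSquare_tenDesc_iff (ω.app a) (ω.app b) (F.map a b) (F'.map a b)).1 (ω.naturality a b)
  rw [← h, SymmetricCategory.symmetry_assoc]

/-- The action of `G d` on the cells of `B(D(-, d), D, F)`. -/
def gActCell {n : ℕ} (γ : Fin (n + 1) → D) (d : D) :
    G.obj d ⟶ ((cellFun F γ).obj d ⟶[V] barCell G F γ) :=
  gTenAct (G.act (γ ⟨n, Nat.lt_succ_self _⟩) d) (chain F γ n (Nat.lt_succ_self _))

/-- A morphism `a ⟶ b` of `D` may act on the cell or on `G` with the same result. This balancing
makes the action descend to the tensor product over `D`. -/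
lemma map_gActCell {n : ℕ} (γ : Fin (n + 1) → D) (a b : D) :
    gcomp V ((cellFun F γ).map a b) (gActCell G F γ b) = G.act a b ≫ gActCell G F γ a :=
  gcomp_gTenAct_act G _ a b _

lemma gActCell_barCellMap {n m : ℕ} (γ : Fin (n + 1) → D) (φ : Fin (m + 1) →o Fin (n + 1)) (d : D) :
    gActCell G F γ d ≫ eHomWhiskerLeft V _ (barCellMap G F γ φ) =
      gActCell G F (fun i => γ (φ i)) d ≫ eHomWhiskerRight V ((cellFunMap F γ φ).app d) _ :=
  gTenAct_act_cell G _ _ d _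

/-- The inclusion of a chain in a cell, by an identity. -/
def unitCell {n : ℕ} (γ : Fin (n + 1) → D) : chain F γ n (Nat.lt_succ_self n) ⟶
    (cellFun F γ).obj (γ ⟨n, Nat.lt_succ_self n⟩) :=
  tenPt (eId V _) _

/-- With `map_unitCell`, this is the Yoneda argument on a cell: `cellFun F γ` is `D(γ_n, -)`
tensored with a chain, and acting on its identity element gives back the universal element of the
tensor. -/
lemma gActCell_unitCell {n : ℕ} (γ : Fin (n + 1) → D) :
    gActCell G F γ (γ ⟨n, Nat.lt_succ_self n⟩) ≫ eHomWhiskerRight V (unitCell F γ) _ =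
      tenUnit _ _ := gTenAct_act_tenPt G _ _

lemma map_unitCell {n : ℕ} (γ : Fin (n + 1) → D) (d : D) :
    (cellFun F γ).map (γ ⟨n, Nat.lt_succ_self n⟩) d ≫ eHomWhiskerRight V (unitCell F γ) _ =
      tenUnit (γ ⟨n, Nat.lt_succ_self n⟩ ⟶[V] d) (chain F γ n (Nat.lt_succ_self n)) :=
  gTenAct_act_tenPt (reprModule d) _ _

/-- An operator does not preserve the inclusion of the identity. If it drops the last vertices, the
identity becomes the composite morphism from the new last vertex to the old one, acting on the new
cell. -/
lemma unitCell_map {n m : ℕ} (γ : Fin (n + 1) → D) (φ : Fin (m + 1) →o Fin (n + 1)) :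
    unitCell F γ ≫ (cellFunMap F γ φ).app (γ ⟨n, Nat.lt_succ_self n⟩) =
      (chainBack F γ _ (φ ⟨m, Nat.lt_succ_self m⟩).2 n
        (Nat.le_of_lt_succ (φ ⟨m, Nat.lt_succ_self m⟩).2) (Nat.lt_succ_self n) ≫
      tenMap (𝟙 _) (chainPull F γ φ m (Nat.lt_succ_self m))) ≫
        tenMap (𝟙 _) (unitCell F (fun i => γ (φ i))) ≫ (cellFun F (fun i => γ (φ i))).act _ _ := by
  refine (tenPt_coact _).trans ?_
  have h : tenMap (𝟙 _) (unitCell F (fun i => γ (φ i))) ≫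
      (cellFun F (fun i => γ (φ i))).act (γ (φ ⟨m, Nat.lt_succ_self m⟩))
        (γ ⟨n, Nat.lt_succ_self n⟩) = 𝟙 _ := by
    refine (tenMap_tenPt_tenComp _ _).trans ?_
    rw [e_id_comp, tenMap_id]
  exact ((congrArg (fun t => _ ≫ t) h).trans (Category.comp_id _)).symm

/-- The cells of the map `G ⊙_D B(D, D, F) ⟶ B(G, D, F)`. -/
def coreCell (d : D) (q : SimplexCategory) (γ : Fin (q.len + 1) → D) :
    Δ.obj q ⊗ G.obj d ⟶ ((cellFun F γ).obj d ⟶[V] realizeObj Δ (simplicialBarObj G F)) :=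
  (β_ _ _).hom ≫ gcomp V (gActCell G F γ d) ((barCocone Δ G F).inj q γ)

lemma coreCell_condition (d : D) {p q : SimplexCategory} (φ : p ⟶ q) (γ : Fin (q.len + 1) → D) :
    Δ.map φ ▷ G.obj d ≫ coreCell Δ G F d q γ = coreCell Δ G F d p _ ≫
      eHomWhiskerRight V ((cellFunMap F γ φ.toOrderHom).app d) _ := by
  unfold coreCell
  rw [BraidedCategory.braiding_naturality_left_assoc, ← comp_gcomp_right, (barCocone Δ G F).condition,
    Category.assoc, ← gcomp_whiskerRight, ← gcomp_middle, gActCell_barCellMap]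

/-- The components of the map `G ⊙_D B(D, D, F) ⟶ B(G, D, F)`. -/
def gCore (d : D) : G.obj d ⟶ ((barDiagram Δ F).obj d ⟶[V] realizeObj Δ (simplicialBarObj G F)) :=
  ((isColimit_cellNatCocone Δ F d).exists_desc (coreCell Δ G F d)
    (fun φ γ => coreCell_condition Δ G F d φ γ)).choose

lemma gcomp_gCore (d : D) (q : SimplexCategory) (γ : Fin (q.len + 1) → D) :
    gcomp V ((cellNat Δ F q γ).app d) (gCore Δ G F d) =
      (β_ _ _).hom ≫ gcomp V (gActCell G F γ d) ((barCocone Δ G F).inj q γ) :=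
  ((isColimit_cellNatCocone Δ F d).exists_desc (coreCell Δ G F d)
    (fun φ γ => coreCell_condition Δ G F d φ γ)).choose_spec q γ

lemma braiding_coherence {A B C : V} : (α_ A B C).inv ≫ (β_ A B).hom ▷ C ≫ (α_ B A C).hom ≫
    B ◁ (β_ A C).hom ≫ (α_ B C A).inv = (β_ A (B ⊗ C)).hom := by
  simp

/-- By the colimit property it suffices to look at a cell, where this is `map_gActCell`; the
remaining braidings agree by the hexagon identity. -/
lemma act_gCore (a b : D) :
    G.act a b ≫ gCore Δ G F a = gcomp V ((barDiagram Δ F).map a b) (gCore Δ G F b) := by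
  apply (isColimit_cellNatCocone Δ F a).hom_ext
  intro q γ
  change gcomp V ((cellNat Δ F q γ).app a) _ = gcomp V ((cellNat Δ F q γ).app a) _
  have h₁ : gcomp V ((cellNat Δ F q γ).app a)
      (gcomp V ((barDiagram Δ F).map a b) (gCore Δ G F b)) =
      (α_ _ _ _).inv ≫ (β_ _ _).hom ▷ _ ≫ (α_ _ _ _).hom ≫ _ ◁ (β_ _ _).hom ≫ (α_ _ _ _).inv ≫
        gcomp V (gcomp V ((cellFun F γ).map a b) (gActCell G F γ b))
          ((barCocone Δ G F).inj q γ) := by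
    rw [← cancel_epi (α_ _ _ _).hom, ← gcomp_assoc, GNat.gcomp_map, comp_gcomp_left, gcomp_assoc,
      gcomp_gCore, comp_gcomp_right, Iso.hom_inv_id_assoc, gcomp_assoc, Iso.inv_hom_id_assoc]
  rw [h₁, map_gActCell, comp_gcomp_right, gcomp_gCore, comp_gcomp_left,
    BraidedCategory.braiding_naturality_right_assoc, ← braiding_coherence]
  simp only [Category.assoc]

/-- The map `G ⊙_D B(D, D, F) ⟶ B(G, D, F)`. -/
def core : tensorObj G (barDiagram Δ F) ⟶ realizeObj Δ (simplicialBarObj G F) :=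
  tensorDesc (fun d => tenDesc (gCore Δ G F d)) (fun a b => by
    apply ten_ext₂
    rw [ad_tenComp_comp, ad_tenMap_comp₂, ad_tenDesc, ad_tenDesc, Category.id_comp, VFun.ad_act]
    exact act_gCore Δ G F a b)

lemma tensorInj_core (d : D) :
    tensorInj G (barDiagram Δ F) d ≫ core Δ G F = tenDesc (gCore Δ G F d) := tensorInj_desc _ _ d

lemma ad_tensorInj (F' : VFun V D N) (a b : D) :
    gcomp V (F'.map a b) (ad (tensorInj G F' b)) = G.act a b ≫ ad (tensorInj G F' a) := by
  rw [← ad_tenComp_comp, tensorInj_condition, ad_tenMap_comp₂, VFun.ad_act, Category.id_comp]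

/-- The cells of the inverse map. -/
def coreInvCell (q : SimplexCategory) (γ : Fin (q.len + 1) → D) :
    Δ.obj q ⟶ (barCell G F γ ⟶[V] tensorObj G (barDiagram Δ F)) :=
  gTenMap _ ((cellNat Δ F q γ).app (γ ⟨q.len, Nat.lt_succ_self _⟩) ≫
    eHomWhiskerRight V (unitCell F γ) _) ≫
      eHomWhiskerLeft V _ (tensorInj G (barDiagram Δ F) _)

lemma gTenMap_tensorInj (F' : VFun V D N) {K : V} {X : N} (a b : D) (u : K ⟶ (X ⟶[V] F'.obj a)) :
    gTenMap (G.obj a) u ≫ eHomWhiskerLeft V _ (tensorInj G F' a) ≫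
        eHomWhiskerRight V (tenComp (G.act a b) X) _ =
      gTenMap (G.obj b) (gTenMap (a ⟶[V] b) u ≫ eHomWhiskerLeft V _ (F'.act a b)) ≫
        eHomWhiskerLeft V _ (tensorInj G F' b) := by
  have h : GSquare (gTenMap (G.obj b) (gTenMap (a ⟶[V] b) u)) (gTenMap (G.obj a) u)
    (tenComp (G.act a b) X) (tenComp (G.act a b) (F'.obj a)) := gSquare_tenComp _ _
  unfold GSquare at h
  rw [eHom_whisker_exchange, ← reassoc_of% h, ← eHomWhiskerLeft_comp, tensorInj_condition,
    gTenMap_whiskerLeft, eHomWhiskerLeft_comp, Category.assoc]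

/-- The composite morphism produced by `unitCell_map` sits on the side of the diagram `F'`.
`V`-naturality of `ω` and the defining relation of the tensor product carry it over to `G`, where
the operators on cells expect it. -/
lemma coreInv_aux {F' F₁ : VFun V D N} {K : V} (ω : GNat K F₁ F') {a b : D} {X Y : N}
    (y : Y ⟶ F₁.obj a) (x : X ⟶ ten (a ⟶[V] b) Y) :
    gTenMap (G.obj b) (ω.app b ≫ eHomWhiskerRight V (x ≫ tenMap (𝟙 _) y ≫ F₁.act a b) _) ≫
        eHomWhiskerLeft V _ (tensorInj G F' b) =
      (gTenMap (G.obj a) (ω.app a ≫ eHomWhiskerRight V y _) ≫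
        eHomWhiskerLeft V _ (tensorInj G F' a)) ≫
        eHomWhiskerRight V (tenMap (𝟙 _) x ≫ tenComp (G.act a b) Y) _ := by
  have h := ω.naturality a b
  unfold GSquare at h
  have h₂ : ω.app b ≫ eHomWhiskerRight V (x ≫ tenMap (𝟙 _) y ≫ F₁.act a b) _ =
      (gTenMap (a ⟶[V] b) (ω.app a ≫ eHomWhiskerRight V y _) ≫
        eHomWhiskerLeft V _ (F'.act a b)) ≫ eHomWhiskerRight V x _ := by
    rw [eHomWhiskerRight_comp, eHomWhiskerRight_comp, Category.assoc, ← reassoc_of% h, gTenMap_whiskerRight,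
      Category.assoc, Category.assoc, eHom_whisker_exchange_assoc]
  rw [h₂, gTenMap_whiskerRight, Category.assoc, ← eHom_whisker_exchange, ← Category.assoc,
    ← gTenMap_tensorInj, eHomWhiskerRight_comp, Category.assoc, Category.assoc, Category.assoc]

lemma coreInvCell_condition {p q : SimplexCategory} (φ : p ⟶ q) (γ : Fin (q.len + 1) → D) :
    Δ.map φ ≫ coreInvCell Δ G F q γ = coreInvCell Δ G F p _ ≫
      eHomWhiskerRight V (barCellMap G F γ φ.toOrderHom) _ := by
  refine Eq.trans ?_ (coreInv_aux G (cellNat Δ F p (fun i => γ (φ.toOrderHom i)))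
    (unitCell F fun i => γ (φ.toOrderHom i)) _)
  have h := (cellNatCocone Δ F (γ ⟨q.len, Nat.lt_succ_self _⟩)).condition φ γ
  unfold coreInvCell
  rw [← Category.assoc, ← comp_gTenMap]
  refine congrArg (fun t => gTenMap _ t ≫ _) ?_
  refine ((Category.assoc _ _ _).symm.trans (congrArg (fun t => t ≫ _) h)).trans ?_
  rw [Category.assoc, ← eHomWhiskerRight_comp, unitCell_map]
  rfl

/-- The Yoneda principle for a cell: the universal element of the tensor is the identity `unitCell`
transported along `D(γ_n, d)`, and maps out of the tensor are tested on it. -/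
lemma cellFun_gext {n : ℕ} {γ : Fin (n + 1) → D} {d : D} {K : V} {Y : N}
    {x y : K ⟶ ((cellFun F γ).obj d ⟶[V] Y)}
    (h : gcomp V ((cellFun F γ).map (γ ⟨n, Nat.lt_succ_self n⟩) d) x ≫
        eHomWhiskerRight V (unitCell F γ) _ =
      gcomp V ((cellFun F γ).map (γ ⟨n, Nat.lt_succ_self n⟩) d) y ≫
        eHomWhiskerRight V (unitCell F γ) _) : x = y := by
  rw [← gcomp_whiskerRight, ← gcomp_whiskerRight, map_unitCell] at h
  exact ten_gext h

/-- One composite of `core` with its inverse, restricted to a cell. By `cellFun_gext` it is tested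
on an identity, where the morphism `γ_n ⟶ d` is moved across the tensor product by `ad_tensorInj`.
-/
lemma gActCell_tensorInj (F' : VFun V D N) {n : ℕ} (γ : Fin (n + 1) → D) {K : V}
    (ω : GNat K (cellFun F γ) F') (d : D) :
    (β_ _ _).hom ≫ gcomp V (gActCell G F γ d) (gTenMap _ (ω.app (γ ⟨n, Nat.lt_succ_self n⟩) ≫
        eHomWhiskerRight V (unitCell F γ) _) ≫ eHomWhiskerLeft V _ (tensorInj G F' _)) =
      gcomp V (ω.app d) (ad (tensorInj G F' d)) := by
  apply cellFun_gext
  have h₁ : gcomp V ((cellFun F γ).map (γ ⟨n, Nat.lt_succ_self n⟩) d)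
      (gcomp V (ω.app d) (ad (tensorInj G F' d))) = (α_ _ _ _).inv ≫ (β_ _ _).hom ▷ _ ≫
        (α_ _ _ _).hom ≫ _ ◁ G.act _ d ≫ gcomp V (ω.app _) (ad (tensorInj G F' _)) := by
    have h := ω.gcomp_map (γ ⟨n, Nat.lt_succ_self n⟩) d
    rw [← cancel_epi (β_ _ _).hom, SymmetricCategory.symmetry_assoc] at h
    rw [← cancel_epi (α_ _ _ _).hom, ← gcomp_assoc, ← h, comp_gcomp_left, gcomp_assoc,
      ad_tensorInj, comp_gcomp_right, Iso.hom_inv_id_assoc]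
  have h₂ : ∀ {L : V} {Z : N} (z : L ⟶ (barCell G F γ ⟶[V] Z)),
      gcomp V ((cellFun F γ).map (γ ⟨n, Nat.lt_succ_self n⟩) d) (gcomp V (gActCell G F γ d) z) ≫
        eHomWhiskerRight V (unitCell F γ) _ =
      (α_ _ _ _).inv ≫ G.act _ d ▷ _ ≫ gcomp V (tenUnit _ _) z := by
    intro L Z z
    rw [← cancel_epi (α_ _ _ _).hom, ← Category.assoc, ← gcomp_assoc, map_gActCell,
      ← gcomp_whiskerRight, Category.assoc, gActCell_unitCell, comp_gcomp_left,
      Iso.hom_inv_id_assoc]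
  rw [comp_gcomp_right, Category.assoc, h₂, gcomp_gTenMap_ad, h₁,
    BraidedCategory.braiding_naturality_left_assoc, gcomp_whiskerRight]
  simp [← MonoidalCategory.whiskerLeft_comp_assoc]

/-- On a cell this is the isomorphism of `G ⊙_D (D(γ_n, -) ⊙ X)` with `G γ_n ⊙ X`, and both sides
are colimits of their cells. The inverse inserts an identity of `γ_n`; one composite is
`gActCell_tensorInj`, the other is the unit law `gActCell_unitCell`. -/
instance : IsIso (core Δ G F) := by
  obtain ⟨κ, hκ⟩ := (isColimit_barCocone Δ G F).exists_map (coreInvCell Δ G F)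
    (fun φ γ => coreInvCell_condition Δ G F φ γ)
  refine ⟨κ, ?_, ?_⟩
  · apply tensorObj_ext
    intro d
    apply ten_ext
    rw [reassoc_of% tensorInj_core, ad_comp, ad_tenDesc, Category.comp_id]
    apply (isColimit_cellNatCocone Δ F d).hom_ext
    intro q γ
    change gcomp V ((cellNat Δ F q γ).app d) _ = gcomp V ((cellNat Δ F q γ).app d) _
    have h : (barCocone Δ G F).inj q γ ≫ eHomWhiskerLeft V (barCell G F γ) κ =
      coreInvCell Δ G F q γ := hκ q γ
    rw [gcomp_whiskerLeft, gcomp_gCore, Category.assoc, ← gcomp_whiskerLeft, h]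
    exact gActCell_tensorInj G F (barDiagram Δ F) γ (cellNat Δ F q γ) d
  · apply (isColimit_barCocone Δ G F).map_ext
    intro q γ
    rw [eHomWhiskerLeft_comp, reassoc_of% hκ, coreInvCell, Category.assoc, ← eHomWhiskerLeft_comp,
      tensorInj_core]
    apply ten_gext
    rw [gcomp_tenDesc, gcomp_whiskerRight, gcomp_gCore, Category.assoc,
      SymmetricCategory.symmetry_assoc, ← gcomp_whiskerRight, gActCell_unitCell,
      eHomWhiskerLeft_id, Category.comp_id]

end Resolution

end TensorResolution

/-! ### Joins of cells -/

section Join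

variable {V : Type u₁} [Category.{v} V] [MonoidalCategory V] [SymmetricCategory V]
  [MonoidalClosed V] {D : Type v} [EnrichedCategory V D]
  {N : Type u₂} [Category.{v} N] [EnrichedOrdinaryCategory V N] [EnrichedBicomplete V N]

/-- The preorder of the vertices of a join. -/
def joinLE {m n : ℕ} : Bool × Fin m × Fin n → Bool × Fin m × Fin n → Prop
  | (false, j, _), (false, j', _) => j.1 ≤ j'.1
  | (true, _, _), (false, _, _) => False
  | (false, _, _), (true, _, _) => True
  | (true, _, i), (true, _, i') => i.1 ≤ i'.1

/-- The vertices of a join. -/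
abbrev joinVertex {m n : ℕ} (γ : Fin m → D) (β : Fin n → D) (x : Bool × Fin m × Fin n) : D :=
  cond x.1 (β x.2.2) (γ x.2.1)

variable (F : VFun V D N) {q p : ℕ} (γ : Fin (q + 1) → D) (β : Fin (p + 1) → D)

/-- The action on `F` of all the morphisms of a cell of `B(D, D, F)`. -/
def cellFunAct : cellFun F γ ⟶ F where
  app e := tenMap (𝟙 _) (chainAct F γ q (Nat.lt_succ_self q)) ≫ F.act _ e
  naturality a b := gTenAct_map_act F _ a b _

/-- The map composing the last morphisms of a cell of `B(D, D, F)`. -/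
def cellFunBack (j : Fin (q + 1)) (e : D) :
    (cellFun F γ).obj e ⟶ ten (γ j ⟶[V] e) (chain F γ j.1 j.2) :=
  tenMap (𝟙 _) (chainBack F γ j.1 j.2 q (Nat.le_of_lt_succ j.2) (Nat.lt_succ_self q)) ≫
    tenComp (eComp V _ _ e) _

lemma cellFun_act_back (j : Fin (q + 1)) (a b : D) :
    (cellFun F γ).act a b ≫ cellFunBack F γ j b =
      tenMap (𝟙 _) (cellFunBack F γ j a) ≫ tenComp (eComp V (γ j) a b) _ := by
  refine (Category.assoc _ _ _).symm.trans ?_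
  refine (congrArg (fun t => t ≫ _) (tenComp_tenMap_one _ _)).trans ?_
  refine (Category.assoc _ _ _).trans ((congrArg (fun t => _ ≫ t) (tenComp_eComp _ _ _ _ _).symm).trans ?_)
  exact (Category.assoc _ _ _).symm.trans
    (congrArg (fun t => t ≫ tenComp _ _) (tenMap_one_comp _ _).symm)

/-- The system of the chains of a cell and of the chains of a cell of cells. -/
def joinSystem : ChainSystem F joinLE (joinVertex γ β) where
  C := fun
    | (false, j, _) => chain F γ j.1 j.2
    | (true, _, i) => chain (cellFun F γ) β i.1 i.2
  back := fun
    | (false, j, _), (false, j', _), h => chainBack F γ j.1 j.2 j'.1 h j'.2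
    -- From an outer vertex back to an inner one: the outer chain is composed onto the cell `D(γ_q,
    -- β_i) ⊙ ⋯`, whose last morphisms are then composed down to `γ_j`.
    | (false, j, _), (true, _, i), _ => chainAct (cellFun F γ) β i.1 i.2 ≫ cellFunBack F γ j (β i)
    | (true, _, i), (true, _, i'), h => chainBack (cellFun F γ) β i.1 i.2 i'.1 h i'.2
  act := fun
    | (false, j, _) => chainAct F γ j.1 j.2
    | (true, _, i) => chainAct (cellFun F γ) β i.1 i.2 ≫ (cellFunAct F γ).app (β i)
  back_self := fun
    | (false, j, _), h => chainBack_self F γ _ _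
    | (true, _, i), h => chainBack_self (cellFun F γ) β _ _
  back_back := fun
    | (false, i, _), (false, j, _), (false, k, _), h, h', _ =>
      chainBack_chainBack F γ i.1 i.2 j.1 h j.2 k.1 h' k.2
    | (false, i, _), (false, j, _), (true, _, _), h, _, _ =>
      (Category.assoc _ _ _).trans (congrArg (fun t => _ ≫ t) ((tenComp_coact _ _).trans
        (congrArg (fun t => tenMap (𝟙 _) t ≫ tenComp (eComp V _ _ _) _)
          (chainBack_chainBack F γ i.1 i.2 j.1 h j.2 q (Nat.le_of_lt_succ j.2)
            (Nat.lt_succ_self q)))))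
    | (false, j, _), (true, _, i), (true, _, i'), _, h, _ => by
      have h₁ := chainBack_chainAct (cellFun F γ) β i.1 i.2 i'.1 h i'.2
      refine Eq.trans ?_ (congrArg (fun t => t ≫ cellFunBack F γ j (β i')) h₁)
      simp only [Category.assoc]
      rw [cellFun_act_back, tenMap_one_comp, Category.assoc]
      rfl
    | (true, _, i), (true, _, j), (true, _, k), h, h', _ =>
      chainBack_chainBack (cellFun F γ) β i.1 i.2 j.1 h j.2 k.1 h' k.2
  back_act := fun
    | (false, i, _), (false, j, _), h => chainBack_chainAct F γ i.1 i.2 j.1 h j.2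
    | (false, i, _), (true, _, _), _ =>
      (Category.assoc _ _ _).trans (congrArg (fun t => _ ≫ t)
        ((tenComp_coact_act F _ _).trans (congrArg (fun t => tenMap (𝟙 _) t ≫ F.act _ _)
          (chainBack_chainAct F γ i.1 i.2 q (Nat.le_of_lt_succ i.2) (Nat.lt_succ_self q)))))
    | (true, _, i), (true, _, i'), h => by
      have h₁ := chainBack_chainAct (cellFun F γ) β i.1 i.2 i'.1 h i'.2
      refine Eq.trans ?_ (congrArg (fun t => t ≫ (cellFunAct F γ).app (β i')) h₁)
      simp only [Category.assoc]
      rw [VFun.act_app, tenMap_one_comp, Category.assoc]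
      rfl

/-- The last vertex of a join. -/
abbrev joinTop : Bool × Fin (q + 1) × Fin (p + 1) :=
  (true, ⟨q, Nat.lt_succ_self q⟩, ⟨p, Nat.lt_succ_self p⟩)

lemma joinLE_top (x : Bool × Fin (q + 1) × Fin (p + 1)) : joinLE x joinTop := by
  obtain ⟨_ | _, j, i⟩ := x
  · trivial
  · exact Nat.le_of_lt_succ i.2

variable (G : RightModule V D) {m l : ℕ}

/-- The cell of `B(G, D, F)` given by a simplex of a join. -/
def joinCell (ω : Fin (m + 1) → Bool × Fin (q + 1) × Fin (p + 1))
    (hω : ∀ i j, i ≤ j → joinLE (ω i) (ω j)) :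
    barCell G (cellFun F γ) β ⟶ barCell G F (fun i => joinVertex γ β (ω i)) :=
  tenMap (𝟙 _) ((joinSystem F γ β).back (ω ⟨m, Nat.lt_succ_self m⟩) joinTop (joinLE_top _) ≫
    tenMap (𝟙 _) ((joinSystem F γ β).pull ω hω m (Nat.lt_succ_self m))) ≫ tenComp (G.act _ _) _

/-- As for `coneCell_barCellMap`, with the action on `G` of what lies beyond the last vertex:
coactions compose by `back_back` and chains by `pull_comp`. -/
lemma joinCell_barCellMap (ω : Fin (m + 1) → Bool × Fin (q + 1) × Fin (p + 1))
    (hω : ∀ i j, i ≤ j → joinLE (ω i) (ω j)) (φ : Fin (l + 1) →o Fin (m + 1)) :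
    joinCell F γ β G ω hω ≫ barCellMap G F _ φ =
      joinCell F γ β G (fun i => ω (φ i)) (fun i j h => hω _ _ (φ.monotone h)) := by
  have hm := Nat.lt_succ_self m
  have hl := Nat.lt_succ_self l
  have e1 := (joinSystem F γ β).pull_chainBack ω hω (φ ⟨l, hl⟩).1 (φ ⟨l, hl⟩).2 m
    (Nat.le_of_lt_succ (φ ⟨l, hl⟩).2) hm
  have e2 := (joinSystem F γ β).back_back (ω (φ ⟨l, hl⟩)) (ω ⟨m, hm⟩) joinTop
    (hω _ _ (Nat.le_of_lt_succ (φ ⟨l, hl⟩).2)) (joinLE_top _) (joinLE_top _)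
  have e3 := (joinSystem F γ β).pull_comp ω hω φ l hl
  refine ((tenComp_act_comp G _ _ _ _ _ _ _ _ _ e1).symm.trans ?_)
  refine congrArg (fun t => tenMap (𝟙 _) t ≫ tenComp (G.act _ _) _) ?_
  refine (congrArg (fun t => t ≫ tenMap (𝟙 _) _) e2).trans ?_
  exact congrArg (fun t => (joinSystem F γ β).back _ _ (joinLE_top _) ≫ tenMap (𝟙 _) t) e3.symm

section Right

variable {p' : ℕ} (φ : Fin (p' + 1) →o Fin (p + 1))

lemma joinLE_mapRight (x y : Bool × Fin (q + 1) × Fin (p' + 1)) (h : joinLE x y) :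
    joinLE (x.1, x.2.1, φ x.2.2) (y.1, y.2.1, φ y.2.2) := by
  obtain ⟨_ | _, j, i⟩ := x <;> obtain ⟨_ | _, j', i'⟩ := y
  · exact h
  · trivial
  · exact h
  · exact φ.monotone h

/-- The map of join systems given by a map of the indices of the outer cell. -/
def joinSystemRight : ∀ x : Bool × Fin (q + 1) × Fin (p' + 1),
    (joinSystem F γ β).C (x.1, x.2.1, φ x.2.2) ⟶ (joinSystem F γ (fun i => β (φ i))).C x
  | (false, _, _) => 𝟙 _
  | (true, _, i) => chainPull (cellFun F γ) β φ i.1 i.2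

lemma joinSystemRight_act : ∀ x : Bool × Fin (q + 1) × Fin (p' + 1),
    joinSystemRight F γ β φ x ≫ (joinSystem F γ (fun i => β (φ i))).act x =
      (joinSystem F γ β).act (x.1, x.2.1, φ x.2.2)
  | (false, _, _) => Category.id_comp _
  | (true, _, i) => (Category.assoc _ _ _).symm.trans
    (congrArg (fun t => t ≫ _) (chainPull_chainAct (cellFun F γ) β φ i.1 i.2))

lemma joinSystemRight_back : ∀ (x y : Bool × Fin (q + 1) × Fin (p' + 1)) (h : joinLE x y)
    (h' : joinLE (x.1, x.2.1, φ x.2.2) (y.1, y.2.1, φ y.2.2)),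
    joinSystemRight F γ β φ y ≫ (joinSystem F γ (fun i => β (φ i))).back x y h =
      (joinSystem F γ β).back (x.1, x.2.1, φ x.2.2) (y.1, y.2.1, φ y.2.2) h' ≫
        tenMap (𝟙 _) (joinSystemRight F γ β φ x)
  | (false, _, _), (false, _, _), _, _ => (Category.id_comp _).trans
      ((congrArg (fun t => _ ≫ t) tenMap_id).trans (Category.comp_id _)).symm
  | (false, _, _), (true, _, i), _, _ => (Category.assoc _ _ _).symm.trans
      ((congrArg (fun t => t ≫ _) (chainPull_chainAct (cellFun F γ) β φ i.1 i.2)).trans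
        ((congrArg (fun t => _ ≫ t) tenMap_id).trans (Category.comp_id _)).symm)
  | (true, _, i), (true, _, i'), h, _ =>
    chainPull_chainBack (cellFun F γ) β φ i.1 i.2 i'.1 h i'.2

/-- Naturality in the outer sequence. `joinSystemRight` is a map of systems, hence invisible after
pulling back to chains; what is left is the composition of coactions through the vertex `φ p'` below
the top. -/
lemma barCellMap_joinCell (ω : Fin (m + 1) → Bool × Fin (q + 1) × Fin (p' + 1))
    (hω : ∀ i j, i ≤ j → joinLE (ω i) (ω j)) :
    barCellMap G (cellFun F γ) β φ ≫ joinCell F γ (fun i => β (φ i)) G ω hω =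
      joinCell F γ β G (fun k => ((ω k).1, (ω k).2.1, φ (ω k).2.2))
        (fun i j h => joinLE_mapRight φ _ _ (hω i j h)) := by
  have hm := Nat.lt_succ_self m
  have hp := Nat.lt_succ_self p'
  have e1 := joinSystemRight_back F γ β φ (ω ⟨m, hm⟩) joinTop (joinLE_top _)
    (joinLE_mapRight φ _ _ (joinLE_top _))
  have e2 := (joinSystem F γ β).back_back ((ω ⟨m, hm⟩).1, (ω ⟨m, hm⟩).2.1, φ (ω ⟨m, hm⟩).2.2)
    (true, ⟨q, Nat.lt_succ_self q⟩, φ ⟨p', hp⟩) joinTop (joinLE_mapRight φ _ _ (joinLE_top _))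
    (joinLE_top _) (joinLE_top _)
  have e3 := ChainSystem.map_pull
    (S := (joinSystem F γ β).comap (le' := joinLE)
      (fun x : Bool × Fin (q + 1) × Fin (p' + 1) =>
        ((x.1, x.2.1, φ x.2.2) : Bool × Fin (q + 1) × Fin (p + 1))) (joinLE_mapRight φ))
    (S' := joinSystem F γ (fun i => β (φ i))) ω hω (joinSystemRight F γ β φ)
    (joinSystemRight_act F γ β φ)
    (fun x y h => joinSystemRight_back F γ β φ x y h (joinLE_mapRight φ x y h)) m hm
  refine ((tenComp_act_comp G _ _ _ _ _ _ _ _ _ e1).symm.trans ?_)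
  refine congrArg (fun t => tenMap (𝟙 _) t ≫ tenComp (G.act _ _) _) ?_
  refine (congrArg (fun t => t ≫ tenMap (𝟙 _) _) e2).trans ?_
  refine congrArg (fun t => (joinSystem F γ β).back _ _ (joinLE_top _) ≫ tenMap (𝟙 _) t) ?_
  exact e3.trans (ChainSystem.comap_pull _ _ _ _ _ _ _)

end Right

section Left

variable {q' : ℕ} (φ : Fin (q' + 1) →o Fin (q + 1))

lemma joinLE_mapLeft (x y : Bool × Fin (q' + 1) × Fin (p + 1)) (h : joinLE x y) :
    joinLE (x.1, φ x.2.1, x.2.2) (y.1, φ y.2.1, y.2.2) := by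
  obtain ⟨_ | _, j, i⟩ := x <;> obtain ⟨_ | _, j', i'⟩ := y
  · exact φ.monotone h
  · trivial
  · exact h
  · exact h

/-- The map of join systems given by a map of the indices of the inner cell. -/
def joinSystemLeft : ∀ x : Bool × Fin (q' + 1) × Fin (p + 1),
    (joinSystem F γ β).C (x.1, φ x.2.1, x.2.2) ⟶ (joinSystem F (fun j => γ (φ j)) β).C x
  | (false, j, _) => chainPull F γ φ j.1 j.2
  | (true, _, i) => chainMap (cellFunMap F γ φ) β i.1 i.2

lemma cellFunMap_act (e : D) : (cellFunMap F γ φ).app e ≫ (cellFunAct F (fun j => γ (φ j))).app e =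
    (cellFunAct F γ).app e :=
  coneSystemMap_act F e γ φ (true, 0)

lemma cellFunMap_back (j : Fin (q' + 1)) (e : D) :
    (cellFunMap F γ φ).app e ≫ cellFunBack F (fun j => γ (φ j)) j e =
      cellFunBack F γ (φ j) e ≫ tenMap (𝟙 _) (chainPull F γ φ j.1 j.2) :=
  coneSystemMap_back F e γ φ (false, j) (true, 0) trivial trivial

lemma joinSystemLeft_act : ∀ x : Bool × Fin (q' + 1) × Fin (p + 1),
    joinSystemLeft F γ β φ x ≫ (joinSystem F (fun j => γ (φ j)) β).act x =
      (joinSystem F γ β).act (x.1, φ x.2.1, x.2.2)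
  | (false, j, _) => chainPull_chainAct F γ φ j.1 j.2
  | (true, _, i) => by
    refine (Category.assoc _ _ _).symm.trans
      ((congrArg (fun t => t ≫ _) (chainMap_chainAct (cellFunMap F γ φ) β i.1 i.2)).trans ?_)
    exact (Category.assoc _ _ _).trans (congrArg (fun t => _ ≫ t) (cellFunMap_act F γ φ _))

lemma joinSystemLeft_back : ∀ (x y : Bool × Fin (q' + 1) × Fin (p + 1)) (h : joinLE x y)
    (h' : joinLE (x.1, φ x.2.1, x.2.2) (y.1, φ y.2.1, y.2.2)),
    joinSystemLeft F γ β φ y ≫ (joinSystem F (fun j => γ (φ j)) β).back x y h =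
      (joinSystem F γ β).back (x.1, φ x.2.1, x.2.2) (y.1, φ y.2.1, y.2.2) h' ≫
        tenMap (𝟙 _) (joinSystemLeft F γ β φ x)
  | (false, j, _), (false, j', _), h, _ => chainPull_chainBack F γ φ j.1 j.2 j'.1 h j'.2
  | (false, j, _), (true, _, i), _, _ => by
    refine (Category.assoc _ _ _).symm.trans
      ((congrArg (fun t => t ≫ _) (chainMap_chainAct (cellFunMap F γ φ) β i.1 i.2)).trans ?_)
    refine (Category.assoc _ _ _).trans
      ((congrArg (fun t => _ ≫ t) (cellFunMap_back F γ φ j _)).trans ?_)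
    exact (Category.assoc _ _ _).symm
  | (true, _, i), (true, _, i'), h, _ =>
    chainMap_chainBack (cellFunMap F γ φ) β i.1 i.2 i'.1 h i'.2

/-- The inner index of an outer vertex is a dummy, and a map of the inner indices moves it. -/
lemma joinSystem_back_top : ∀ (x : Bool × Fin (q + 1) × Fin (p + 1)) (j j' : Fin (q + 1))
    (i : Fin (p + 1)) (h : joinLE x (true, j, i)) (h' : joinLE x (true, j', i)),
    (joinSystem F γ β).back x (true, j, i) h = (joinSystem F γ β).back x (true, j', i) h'
  | (false, _, _), _, _, _, _, _ => rfl
  | (true, _, _), _, _, _, _, _ => rfl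

/-- Naturality in the inner sequence. Here the last outer vertex is unchanged, so only the dummy
label of the top has to be adjusted before `map_pull` applies. -/
lemma barCellNat_joinCell (ω : Fin (m + 1) → Bool × Fin (q' + 1) × Fin (p + 1))
    (hω : ∀ i j, i ≤ j → joinLE (ω i) (ω j)) :
    barCellNat β (𝟙 G) (cellFunMap F γ φ) ≫ joinCell F (fun j => γ (φ j)) β G ω hω =
      joinCell F γ β G (fun k => ((ω k).1, φ (ω k).2.1, (ω k).2.2))
        (fun i j h => joinLE_mapLeft φ _ _ (hω i j h)) := by
  have hm := Nat.lt_succ_self m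
  have hp := Nat.lt_succ_self p
  have e1 := joinSystemLeft_back F γ β φ (ω ⟨m, hm⟩) joinTop (joinLE_top _)
    (joinLE_mapLeft φ _ _ (joinLE_top _))
  have e2 := joinSystem_back_top F γ β ((ω ⟨m, hm⟩).1, φ (ω ⟨m, hm⟩).2.1, (ω ⟨m, hm⟩).2.2)
    (φ ⟨q', Nat.lt_succ_self q'⟩) ⟨q, Nat.lt_succ_self q⟩ ⟨p, hp⟩
    (joinLE_mapLeft φ _ _ (joinLE_top _)) (joinLE_top _)
  have e3 := ChainSystem.map_pull
    (S := (joinSystem F γ β).comap (le' := joinLE)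
      (fun x : Bool × Fin (q' + 1) × Fin (p + 1) =>
        ((x.1, φ x.2.1, x.2.2) : Bool × Fin (q + 1) × Fin (p + 1))) (joinLE_mapLeft φ))
    (S' := joinSystem F (fun j => γ (φ j)) β) ω hω (joinSystemLeft F γ β φ)
    (joinSystemLeft_act F γ β φ)
    (fun x y h => joinSystemLeft_back F γ β φ x y h (joinLE_mapLeft φ x y h)) m hm
  refine (Category.assoc _ _ _).symm.trans (congrArg (fun t => t ≫ tenComp (G.act _ _) _) ?_)
  refine (tenMap_one_comp _ _).symm.trans (congrArg (fun t => tenMap (𝟙 _) t) ?_)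
  refine (Category.assoc _ _ _).symm.trans ((congrArg (fun t => t ≫ _) e1).trans ?_)
  refine (Category.assoc _ _ _).trans ?_
  refine (congrArg (fun t => t ≫ _) e2).trans ?_
  refine congrArg (fun t => (joinSystem F γ β).back _ _ (joinLE_top _) ≫ t) ?_
  refine (tenMap_one_comp _ _).symm.trans (congrArg (fun t => tenMap _ t) ?_)
  exact e3.trans (ChainSystem.comap_pull _ _ _ _ _ _ _)

end Left

lemma joinSystem_pull_false (ψ : Fin m →o Fin (q + 1)) (φ : Fin m → Fin (p + 1)) :
    ∀ (k : ℕ) (hk : k < m), (joinSystem F γ β).pull (fun i => (false, ψ i, φ i))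
      (fun _ _ h => ψ.monotone h) k hk = chainPull F γ ψ k hk
  | 0, hk => rfl
  | k + 1, hk => congrArg (fun t => chainBack F γ _ _ _ _ _ ≫ tenMap (𝟙 _) t)
      (joinSystem_pull_false ψ φ k (Nat.lt_of_succ_lt hk))

lemma joinSystem_pull_true (ψ : Fin m → Fin (q + 1)) (φ : Fin m →o Fin (p + 1)) :
    ∀ (k : ℕ) (hk : k < m), (joinSystem F γ β).pull (fun i => (true, ψ i, φ i))
      (fun _ _ h => φ.monotone h) k hk = chainPull (cellFun F γ) β φ k hk ≫
        chainMap (cellFunAct F γ) (fun i => β (φ i)) k hk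
  | 0, hk => rfl
  | k + 1, hk => by
    refine (congrArg (fun t => chainBack (cellFun F γ) β _ _ _ _ _ ≫ tenMap (𝟙 _) t)
      (joinSystem_pull_true ψ φ k (Nat.lt_of_succ_lt hk))).trans ?_
    exact (congrArg (fun t => _ ≫ t) (tenMap_one_comp _ _)).trans (Category.assoc _ _ _).symm

lemma tenComp_act_map {a b c : D} {X Y W U : N} (x : X ⟶ ten (b ⟶[V] c) Y)
    (w : Y ⟶ ten (a ⟶[V] b) W) (u : W ⟶ U) :
    tenMap (𝟙 _) ((x ≫ tenMap (𝟙 _) w ≫ tenComp (eComp V a b c) W) ≫ tenMap (𝟙 _) u) ≫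
        tenComp (G.act a c) U =
      (tenMap (𝟙 _) x ≫ tenComp (G.act b c) Y) ≫
        tenMap (𝟙 _) (w ≫ tenMap (𝟙 _) u) ≫ tenComp (G.act a b) U := by
  have h := tenComp_act_comp G a b c x (𝟙 Y) w u w (𝟙 W) (by simp)
  simpa using h

/-- The map that composes the morphisms of the outer cell. -/
def dropCell : barCell G (cellFun F γ) β ⟶ barCell G F γ :=
  tenMap (𝟙 _) (chainAct (cellFun F γ) β p (Nat.lt_succ_self p)) ≫ tenComp (G.act _ _) _

/-- When all vertices are inner, the outer chain is composed and acts on `G`, and an operator on the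
inner cell remains. -/
lemma joinCell_false (ψ : Fin (m + 1) →o Fin (q + 1)) (φ : Fin (m + 1) → Fin (p + 1)) :
    joinCell F γ β G (fun i => (false, ψ i, φ i)) (fun _ _ h => ψ.monotone h) =
      dropCell F γ β G ≫ barCellMap G F γ ψ := by
  have h := joinSystem_pull_false F γ β ψ φ m (Nat.lt_succ_self m)
  refine (congrArg (fun t => tenMap (𝟙 _) ((chainAct (cellFun F γ) β p _ ≫
    cellFunBack F γ _ _) ≫ tenMap (𝟙 _) t) ≫ tenComp (G.act _ _) _) h).trans ?_
  exact tenComp_act_map G _ _ _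

/-- When all vertices are outer, the inner chain is composed and acts on `F`, and an operator on the
outer cell remains. -/
lemma joinCell_true (ψ : Fin (m + 1) → Fin (q + 1)) (φ : Fin (m + 1) →o Fin (p + 1)) :
    joinCell F γ β G (fun i => (true, ψ i, φ i)) (fun _ _ h => φ.monotone h) =
      barCellMap G (cellFun F γ) β φ ≫ barCellNat (fun i => β (φ i)) (𝟙 G) (cellFunAct F γ) := by
  have h := joinSystem_pull_true F γ β ψ φ m (Nat.lt_succ_self m)
  refine (congrArg (fun t => tenMap (𝟙 _) (chainBack (cellFun F γ) β _ _ p _ _ ≫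
    tenMap (𝟙 _) t) ≫ tenComp (G.act _ _) _) h).trans ?_
  refine Eq.trans ?_ (Category.assoc _ _ _).symm
  refine Eq.trans ?_ (congrArg (fun t => _ ≫ t) (tenComp_tenMap_one _ _).symm)
  refine Eq.trans ?_ (Category.assoc _ _ _)
  refine congrArg (fun t => t ≫ tenComp (G.act _ _) _) ?_
  refine Eq.trans ?_ (tenMap_one_comp _ _)
  refine congrArg (fun t => tenMap _ t) ?_
  exact (congrArg (fun t => _ ≫ t) (tenMap_one_comp _ _)).trans (Category.assoc _ _ _).symm

end Join

/-! ### Families of simplices indexed by products of simplices -/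

section PrismFamily

variable {N : Type u₂} [Category.{v} N]

/-- A simplicial family of maps `X ⟶ S m` indexed by the simplices of `Δ[q] × Δ[p] × Δ[r]`. -/
structure PrismFamily (S : SimplexCategoryᵒᵖ ⥤ N) (X : N) (q p r : SimplexCategory) where
  /-- the maps -/
  app : ∀ m : SimplexCategory, (m ⟶ q) → (m ⟶ p) → (m ⟶ r) → (X ⟶ S.obj (op m))
  app_map : ∀ {l m : SimplexCategory} (σ : l ⟶ m) (ψ : m ⟶ q) (φ : m ⟶ p) (τ : m ⟶ r),
    app m ψ φ τ ≫ S.map σ.op = app l (σ ≫ ψ) (σ ≫ φ) (σ ≫ τ)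

variable {V : Type u₁} [Category.{v} V] [MonoidalCategory V] [SymmetricCategory V]
  [MonoidalClosed V] [EnrichedOrdinaryCategory V N] [EnrichedBicomplete V N]
  (t : SimplexTwist) (L : SSet.{v} ⥤ V) [L.Monoidal] [L.IsLeftAdjoint]
  {S : SimplexCategoryᵒᵖ ⥤ N} {X X' : N} {q p r q' p' r' : SimplexCategory}

/-- The operator underlying a simplex of `Δ[n]`. -/
def twistPreimage {m n : SimplexCategory} (x : simplexFunctor.{v}.obj m ⟶ simplexFunctor.obj n) :
    m ⟶ n := t.map.symm (simplexFunctor.preimage x)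

lemma twistPreimage_comp {l m n : SimplexCategory} (φ : l ⟶ m)
    (x : simplexFunctor.{v}.obj m ⟶ simplexFunctor.obj n) :
    twistPreimage t (simplexFunctor.map φ ≫ x) = t.map.symm φ ≫ twistPreimage t x := by
  rw [twistPreimage, twistPreimage, ← t.symm_comp, Functor.preimage_comp, Functor.preimage_map]

lemma comp_twistPreimage {l m n : SimplexCategory} (x : simplexFunctor.{v}.obj l ⟶ simplexFunctor.obj m)
    (φ : m ⟶ n) : twistPreimage t (x ≫ simplexFunctor.map (t.map φ)) = twistPreimage t x ≫ φ := by
  rw [twistPreimage, twistPreimage, Functor.preimage_comp, Functor.preimage_map, t.symm_comp,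
    Equiv.symm_apply_apply]

lemma map_twistPreimage {m n : SimplexCategory}
    (x : simplexFunctor.{v}.obj m ⟶ simplexFunctor.obj n) :
    simplexFunctor.map (t.map (twistPreimage t x)) = x := by
  rw [twistPreimage, Equiv.apply_symm_apply, Functor.map_preimage]

open SemiCartesianMonoidalCategory (fst snd)

variable {L} in
-- The version for three factors of `whiskerLeft_toUnitObj`: projecting to the first factor is
-- collapsing the other two by their augmentations.
lemma whiskerLeft_μ_fst {K K' K'' : SSet.{v}} {Z : V} (z : L.obj K ⟶ Z) :
    L.obj K ◁ Functor.LaxMonoidal.μ L K' K'' ≫ Functor.LaxMonoidal.μ L _ _ ≫ L.map (fst _ _) ≫ z =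
      L.obj K ◁ (L.obj K' ◁ toUnitObj L K'' ≫ (ρ_ _).hom ≫ toUnitObj L K') ≫ (ρ_ _).hom ≫ z := by
  have h₂ := whiskerLeft_toUnitObj L K (K' ⊗ K'')
  have h₃ := whiskerLeft_toUnitObj L K' K''
  rw [reassoc_of% h₃, map_toUnitObj, MonoidalCategory.whiskerLeft_comp, Category.assoc,
    reassoc_of% h₂]

variable {L} in
lemma whiskerLeft_μ_snd {K K' K'' : SSet.{v}} {Z : V} (z : L.obj K' ⟶ Z) :
    L.obj K ◁ Functor.LaxMonoidal.μ L K' K'' ≫ Functor.LaxMonoidal.μ L _ _ ≫ L.map (snd _ _) ≫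
        L.map (fst _ _) ≫ z =
      toUnitObj L K ▷ _ ≫ (λ_ _).hom ≫ L.obj K' ◁ toUnitObj L K'' ≫ (ρ_ _).hom ≫ z := by
  have h₂ := whiskerRight_toUnitObj L K (K' ⊗ K'')
  have h₃ := whiskerLeft_toUnitObj L K' K''
  rw [reassoc_of% h₃, ← leftUnitor_naturality_assoc, ← whisker_exchange_assoc, reassoc_of% h₂]

namespace PrismFamily

variable (J : PrismFamily S X q p r) (J' : PrismFamily S X' q' p' r')

/-- The map `L (Δ[q] × Δ[p] × Δ[r]) ⟶ N(X, |S|)` given by a family. -/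
def desc : L.obj (simplexFunctor.obj q ⊗ (simplexFunctor.obj p ⊗ simplexFunctor.obj r)) ⟶
    (X ⟶[V] realizeObj (t.cosimplicial L) S) :=
  simplexDesc L (fun m x => realizeCell t L m ≫ eHomWhiskerRight V
    (J.app m (twistPreimage t (x ≫ fst _ _)) (twistPreimage t ((x ≫ snd _ _) ≫ fst _ _))
      (twistPreimage t ((x ≫ snd _ _) ≫ snd _ _))) _) (by
    intro m n φ x
    have h := realizeCell_map t L (S' := S) (t.map.symm φ)
    rw [Equiv.apply_symm_apply] at h
    simp only [Category.assoc, twistPreimage_comp]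
    rw [reassoc_of% h, ← eHomWhiskerRight_comp, J.app_map])

lemma map_desc {m : SimplexCategory} (x : simplexFunctor.obj m ⟶
      simplexFunctor.obj q ⊗ (simplexFunctor.obj p ⊗ simplexFunctor.obj r)) :
    L.map x ≫ J.desc t L = realizeCell t L m ≫ eHomWhiskerRight V
      (J.app m (twistPreimage t (x ≫ fst _ _)) (twistPreimage t ((x ≫ snd _ _) ≫ fst _ _))
        (twistPreimage t ((x ≫ snd _ _) ≫ snd _ _))) _ := map_simplexDesc L _ _ m x

/-- Naturality of the assembled map in all three simplices and in the source at once. It is used to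
change the inner sequence, to change the outer sequence, and to restrict to an end of the interval.
-/
lemma map_tensor_desc (a : q' ⟶ q) (b : p' ⟶ p) (c : r' ⟶ r) (f : X ⟶ X')
    (h : ∀ m ψ φ τ, J.app m (ψ ≫ a) (φ ≫ b) (τ ≫ c) = f ≫ J'.app m ψ φ τ) :
    L.map (simplexFunctor.map (t.map a) ⊗ₘ
        (simplexFunctor.map (t.map b) ⊗ₘ simplexFunctor.map (t.map c))) ≫ J.desc t L =
      J'.desc t L ≫ eHomWhiskerRight V f _ := by
  apply map_simplex_ext
  intro m x
  rw [← Category.assoc, ← L.map_comp, map_desc, ← Category.assoc, map_desc]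
  simp only [Category.assoc, ← eHomWhiskerRight_comp, ← h, ← comp_twistPreimage,
    CartesianMonoidalCategory.tensorHom_fst, CartesianMonoidalCategory.tensorHom_snd]

/-- The map `L Δ[q] ⊗ (L Δ[p] ⊗ L Δ[r]) ⟶ N(X, |S|)` given by a family. -/
def elt : (t.cosimplicial L).obj q ⊗ ((t.cosimplicial L).obj p ⊗ (t.cosimplicial L).obj r) ⟶
    (X ⟶[V] realizeObj (t.cosimplicial L) S) :=
  L.obj (simplexFunctor.obj q) ◁ Functor.LaxMonoidal.μ L _ _ ≫ Functor.LaxMonoidal.μ L _ _ ≫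
    J.desc t L

lemma map_elt (a : q' ⟶ q) (b : p' ⟶ p) (c : r' ⟶ r) (f : X ⟶ X')
    (h : ∀ m ψ φ τ, J.app m (ψ ≫ a) (φ ≫ b) (τ ≫ c) = f ≫ J'.app m ψ φ τ) :
    ((t.cosimplicial L).map a ⊗ₘ ((t.cosimplicial L).map b ⊗ₘ (t.cosimplicial L).map c)) ≫
        J.elt t L = J'.elt t L ≫ eHomWhiskerRight V f _ := by
  have h₁ := map_tensor_desc t L J J' a b c f h
  have h₂ := Functor.LaxMonoidal.μ_natural (F := L) (simplexFunctor.map (t.map b))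
    (simplexFunctor.map (t.map c))
  have h₃ := Functor.LaxMonoidal.μ_natural (F := L) (simplexFunctor.map (t.map a))
    (simplexFunctor.map (t.map b) ⊗ₘ simplexFunctor.map (t.map c))
  have h₄ : (L.map (simplexFunctor.map (t.map a)) ⊗ₘ (L.map (simplexFunctor.map (t.map b)) ⊗ₘ
      L.map (simplexFunctor.map (t.map c)))) ≫
      L.obj (simplexFunctor.obj q) ◁ Functor.LaxMonoidal.μ L _ _ =
      L.obj (simplexFunctor.obj q') ◁ Functor.LaxMonoidal.μ L _ _ ≫
        (L.map (simplexFunctor.map (t.map a)) ⊗ₘ L.map (simplexFunctor.map (t.map b) ⊗ₘ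
          simplexFunctor.map (t.map c))) := by
    rw [← id_tensorHom, ← id_tensorHom, tensorHom_comp_tensorHom, tensorHom_comp_tensorHom, h₂,
      Category.id_comp, Category.comp_id]
  change (L.map (simplexFunctor.map (t.map a)) ⊗ₘ (L.map (simplexFunctor.map (t.map b)) ⊗ₘ
      L.map (simplexFunctor.map (t.map c)))) ≫ L.obj (simplexFunctor.obj q) ◁ _ ≫ _ ≫ _ = _
  rw [reassoc_of% h₄, reassoc_of% h₃, h₁]
  exact (congrArg (fun t => _ ≫ t) (Category.assoc _ _ _).symm).trans (Category.assoc _ _ _).symm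

/-- A family generated by a single `q`-simplex factors through the projection to `Δ[q]`, so the
other two factors are collapsed by their augmentations. -/
lemma elt_fst (f : X ⟶ S.obj (op q)) (h : ∀ m ψ φ τ, J.app m ψ φ τ = f ≫ S.map ψ.op) :
    J.elt t L = (t.cosimplicial L).obj q ◁ ((t.cosimplicial L).obj p ◁
        (t.augmentation L).app r ≫ (ρ_ _).hom ≫ (t.augmentation L).app p) ≫
      (ρ_ _).hom ≫ realizeCell t L q ≫ eHomWhiskerRight V f _ := by
  have h₁ : J.desc t L = L.map (fst _ _) ≫ realizeCell t L q ≫ eHomWhiskerRight V f _ := by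
    apply map_simplex_ext
    intro m x
    have h₂ := realizeCell_map t L (S' := S) (twistPreimage t (x ≫ fst _ _))
    rw [map_twistPreimage] at h₂
    rw [map_desc, h, ← Category.assoc (L.map x), ← L.map_comp, reassoc_of% h₂,
      eHomWhiskerRight_comp]
  exact (congrArg (fun u => _ ≫ _ ≫ u) h₁).trans (whiskerLeft_μ_fst _)

lemma elt_snd (f : X ⟶ S.obj (op p)) (h : ∀ m ψ φ τ, J.app m ψ φ τ = f ≫ S.map φ.op) :
    J.elt t L = (t.augmentation L).app q ▷ _ ≫ (λ_ _).hom ≫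
      (t.cosimplicial L).obj p ◁ (t.augmentation L).app r ≫ (ρ_ _).hom ≫
        realizeCell t L p ≫ eHomWhiskerRight V f _ := by
  have h₁ : J.desc t L = L.map (snd _ _) ≫ L.map (fst _ _) ≫ realizeCell t L p ≫
      eHomWhiskerRight V f _ := by
    apply map_simplex_ext
    intro m x
    have h₂ := realizeCell_map t L (S' := S) (twistPreimage t ((x ≫ snd _ _) ≫ fst _ _))
    rw [map_twistPreimage] at h₂
    rw [map_desc, h, ← Category.assoc (L.map x), ← L.map_comp, ← Category.assoc (L.map (x ≫ _)),
      ← L.map_comp]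
    generalize (x ≫ snd _ _) ≫ fst _ _ = y at h₂ ⊢
    rw [reassoc_of% h₂, eHomWhiskerRight_comp]
  exact (congrArg (fun u => _ ≫ _ ≫ u) h₁).trans (whiskerLeft_μ_snd _)

end PrismFamily

end PrismFamily

/-! ### The homotopy between the two maps `B(G, D, B(D, D, F)) ⟶ B(G, D, F)` -/

section JoinHomotopy

variable {V : Type u₁} [Category.{v} V] [MonoidalCategory V] [SymmetricCategory V]
  [MonoidalClosed V] {D : Type v} [EnrichedCategory V D]
  {N : Type u₂} [Category.{v} N] [EnrichedOrdinaryCategory V N] [EnrichedBicomplete V N]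
  (G : RightModule V D) (F : VFun V D N)

/-- The vertices of a simplex of a join. -/
def joinSimplex {m q p r : SimplexCategory} (ψ : m ⟶ q) (φ : m ⟶ p) (τ : m ⟶ r)
    (k : r ⟶ SimplexCategory.mk 1) (i : Fin (m.len + 1)) :
    Bool × Fin (q.len + 1) × Fin (p.len + 1) :=
  -- The canonical map from the product to the join: the third coordinate selects the inner sequence
  -- over `0` and the outer one over `1`. The parameter `k` is `𝟙` for the homotopy itself and a
  -- vertex of `[1]` for its ends.
  (intervalVertex (τ ≫ k) i, ψ.toOrderHom i, φ.toOrderHom i)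

lemma joinLE_joinSimplex {m q p r : SimplexCategory} (ψ : m ⟶ q) (φ : m ⟶ p) (τ : m ⟶ r)
    (k : r ⟶ SimplexCategory.mk 1) (i j : Fin (m.len + 1)) (hij : i ≤ j) :
    joinLE (joinSimplex ψ φ τ k i) (joinSimplex ψ φ τ k j) := by
  have h : (τ ≫ k).toOrderHom i ≤ (τ ≫ k).toOrderHom j := (τ ≫ k).toOrderHom.monotone hij
  have hψ : ψ.toOrderHom i ≤ ψ.toOrderHom j := ψ.toOrderHom.monotone hij
  have hφ : φ.toOrderHom i ≤ φ.toOrderHom j := φ.toOrderHom.monotone hij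
  unfold joinSimplex intervalVertex
  generalize (τ ≫ k).toOrderHom i = x at h
  generalize (τ ≫ k).toOrderHom j = y at h
  change Fin 2 at x y
  fin_cases x <;> fin_cases y
  · exact hψ
  · trivial
  -- Monotonicity of `τ ≫ k` excludes a return from the outer sequence to the inner one.
  · exact absurd h (by decide)
  · exact hφ

variable {q p : SimplexCategory} (γ : Fin (q.len + 1) → D) (β : Fin (p.len + 1) → D)

/-- The simplices of `B(G, D, F)` given by the simplices of a join. -/
def joinFamily {r : SimplexCategory} (k : r ⟶ SimplexCategory.mk 1) :
    PrismFamily (simplicialBarObj G F) (barCell G (cellFun F γ) β) q p r where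
  app m ψ φ τ := joinCell F γ β G (joinSimplex ψ φ τ k) (joinLE_joinSimplex ψ φ τ k) ≫
    cellInj G F m _
  app_map {l m} σ ψ φ τ := by
    refine (Category.assoc _ _ _).trans ((congrArg (fun t => _ ≫ t) (cellInj_map G F σ _)).trans ?_)
    refine (Category.assoc _ _ _).symm.trans ?_
    exact congrArg (fun t => t ≫ cellInj G F l _)
      (joinCell_barCellMap F γ β G (joinSimplex ψ φ τ k) (joinLE_joinSimplex ψ φ τ k) σ.toOrderHom)

lemma joinFamily_right {p' : SimplexCategory} (b : p' ⟶ p) (m : SimplexCategory) (ψ : m ⟶ q)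
    (φ : m ⟶ p') (τ : m ⟶ SimplexCategory.mk 1) :
    (joinFamily G F γ β (𝟙 _)).app m ψ (φ ≫ b) τ = barCellMap G (cellFun F γ) β b.toOrderHom ≫
      (joinFamily G F γ (fun i => β (b.toOrderHom i)) (𝟙 _)).app m ψ φ τ :=
  ((Category.assoc _ _ _).symm.trans (congrArg (fun t => t ≫ cellInj G F m _)
    (barCellMap_joinCell F γ β G b.toOrderHom (joinSimplex ψ φ τ (𝟙 _))
      (joinLE_joinSimplex ψ φ τ (𝟙 _))))).symm

lemma joinFamily_left {q' : SimplexCategory} (a : q' ⟶ q) (m : SimplexCategory) (ψ : m ⟶ q')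
    (φ : m ⟶ p) (τ : m ⟶ SimplexCategory.mk 1) :
    (joinFamily G F γ β (𝟙 _)).app m (ψ ≫ a) φ τ =
      barCellNat β (𝟙 G) (cellFunMap F γ a.toOrderHom) ≫
        (joinFamily G F (fun i => γ (a.toOrderHom i)) β (𝟙 _)).app m ψ φ τ :=
  ((Category.assoc _ _ _).symm.trans (congrArg (fun t => t ≫ cellInj G F m _)
    (barCellNat_joinCell F γ β G a.toOrderHom (joinSimplex ψ φ τ (𝟙 _))
      (joinLE_joinSimplex ψ φ τ (𝟙 _))))).symm

lemma joinFamily_const {r : SimplexCategory} (k : r ⟶ SimplexCategory.mk 1) (m : SimplexCategory)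
    (ψ : m ⟶ q) (φ : m ⟶ p) (τ : m ⟶ r) :
    (joinFamily G F γ β (𝟙 _)).app m ψ φ (τ ≫ k) = (joinFamily G F γ β k).app m ψ φ τ := rfl

lemma intervalVertex_comp_δ_one {m : SimplexCategory} (τ : m ⟶ SimplexCategory.mk 0)
    (i : Fin (m.len + 1)) : intervalVertex (τ ≫ SimplexCategory.δ 1) i = false := by
  have h : τ.toOrderHom i = (0 : Fin 1) := Subsingleton.elim (α := Fin 1) _ _
  change decide ((SimplexCategory.δ (1 : Fin 2)).toOrderHom (τ.toOrderHom i) = (1 : Fin 2)) = false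
  rw [h]
  decide

lemma intervalVertex_comp_δ_zero {m : SimplexCategory} (τ : m ⟶ SimplexCategory.mk 0)
    (i : Fin (m.len + 1)) : intervalVertex (τ ≫ SimplexCategory.δ 0) i = true := by
  have h : τ.toOrderHom i = (0 : Fin 1) := Subsingleton.elim (α := Fin 1) _ _
  change decide ((SimplexCategory.δ (0 : Fin 2)).toOrderHom (τ.toOrderHom i) = (1 : Fin 2)) = true
  rw [h]
  decide

/-- The target cell depends on the labels of the vertices, so equality of labels is used only after
inclusion in the whole level. -/
lemma joinCell_cellInj {m : SimplexCategory}
    {ω ω' : Fin (m.len + 1) → Bool × Fin (q.len + 1) × Fin (p.len + 1)} (h : ω = ω')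
    (hω : ∀ i j, i ≤ j → joinLE (ω i) (ω j)) (hω' : ∀ i j, i ≤ j → joinLE (ω' i) (ω' j)) :
    joinCell F γ β G ω hω ≫ cellInj G F m _ = joinCell F γ β G ω' hω' ≫ cellInj G F m _ := by
  subst h
  rfl

/-- Over the vertex `0` the family is generated by one `q`-simplex, as `elt_fst` requires; over the
vertex `1`, in `joinFamily_one`, by one `p`-simplex, as `elt_snd` requires. -/
lemma joinFamily_zero (m : SimplexCategory) (ψ : m ⟶ q) (φ : m ⟶ p)
    (τ : m ⟶ SimplexCategory.mk 0) :
    (joinFamily G F γ β (SimplexCategory.δ 1)).app m ψ φ τ =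
      (dropCell F γ β G ≫ cellInj G F q γ) ≫ (simplicialBarObj G F).map ψ.op := by
  refine Eq.trans ?_ (Category.assoc _ _ _).symm
  refine Eq.trans ?_ (congrArg (fun t => _ ≫ t) (cellInj_map G F ψ _)).symm
  refine Eq.trans ?_ (Category.assoc _ _ _)
  refine (joinCell_cellInj G F γ β (funext fun i =>
    congrArg (fun b => (b, ψ.toOrderHom i, φ.toOrderHom i)) (intervalVertex_comp_δ_one τ i)) _
      (fun _ _ h => ψ.toOrderHom.monotone h)).trans ?_
  exact congrArg (fun t => t ≫ cellInj G F m _) (joinCell_false F γ β G ψ.toOrderHom φ.toOrderHom)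

lemma joinFamily_one (m : SimplexCategory) (ψ : m ⟶ q) (φ : m ⟶ p)
    (τ : m ⟶ SimplexCategory.mk 0) :
    (joinFamily G F γ β (SimplexCategory.δ 0)).app m ψ φ τ =
      (barCellNat β (𝟙 G) (cellFunAct F γ) ≫ cellInj G F p β) ≫
        (simplicialBarObj G F).map φ.op := by
  refine Eq.trans ?_ (Category.assoc _ _ _).symm
  refine Eq.trans ?_ (congrArg (fun t => _ ≫ t) (cellInj_map G F φ _)).symm
  refine Eq.trans ?_ (Category.assoc _ _ _)
  refine (joinCell_cellInj G F γ β (funext fun i =>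
    congrArg (fun b => (b, ψ.toOrderHom i, φ.toOrderHom i)) (intervalVertex_comp_δ_zero τ i)) _
      (fun _ _ h => φ.toOrderHom.monotone h)).trans ?_
  refine congrArg (fun t => t ≫ cellInj G F m (fun i => β (φ.toOrderHom i))) ?_
  exact (joinCell_true F γ β G ψ.toOrderHom φ.toOrderHom).trans
    (barCellNat_map β (𝟙 G) (cellFunAct F γ) φ.toOrderHom).symm

end JoinHomotopy

/-! ### The cells of `B(G, D, B(D, D, F))` as colimits of cells of cells -/

section CellsOver

variable {V : Type u₁} [Category.{v} V] [MonoidalCategory V] [SymmetricCategory V]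
  [MonoidalClosed V] {D : Type v} [EnrichedCategory V D]
  {N : Type u₂} [Category.{v} N] [EnrichedOrdinaryCategory V N] [EnrichedBicomplete V N]
  (Δ : SimplexCategory ⥤ V) (G : RightModule V D) (F : VFun V D N)

/-- The chains with values in the cells of `B(D, D, F)`. -/
@[reducible]
def chainCells {n : ℕ} (β : Fin n → D) (k : ℕ) (hk : k < n) : CellDiagram D N where
  obj _ γ := chain (cellFun F γ) β k hk
  map φ γ := chainMap (cellFunMap F γ φ.toOrderHom) β k hk

lemma map_gChainMap_cellNat {n : ℕ} (β : Fin n → D) {p q : SimplexCategory} (φ : p ⟶ q)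
    (γ : Fin (q.len + 1) → D) : ∀ (k : ℕ) (hk : k < n),
    Δ.map φ ≫ gChainMap (cellNat Δ F q γ) β k hk =
      gChainMap (cellNat Δ F p (fun i => γ (φ.toOrderHom i))) β k hk ≫
        eHomWhiskerRight V (chainMap (cellFunMap F γ φ.toOrderHom) β k hk) _
  | 0, hk => (cellNatCocone Δ F (β ⟨0, hk⟩)).condition φ γ
  | k + 1, hk => (comp_gTenMap _ _).symm.trans ((congrArg (fun t => gTenMap _ t)
      (map_gChainMap_cellNat β φ γ k (Nat.lt_of_succ_lt hk))).trans (gTenMap_whiskerRight _ _))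

/-- The chains with values in `B(D, D, F)`, as a cocone. -/
def chainCocone {n : ℕ} (β : Fin n → D) (k : ℕ) (hk : k < n) :
    CellCocone Δ (chainCells F β k hk) (chain (barDiagram Δ F) β k hk) where
  inj q γ := gChainMap (cellNat Δ F q γ) β k hk
  condition φ γ := map_gChainMap_cellNat Δ F β φ γ k hk

/-- A chain is an iterated tensor of a value of the resolution, and tensors preserve enriched
colimits of cells. -/
lemma isColimit_chainCocone {n : ℕ} (β : Fin n → D) : ∀ (k : ℕ) (hk : k < n),
    (chainCocone Δ F β k hk).IsColimit
  | 0, hk => isColimit_cellNatCocone Δ F (β ⟨0, hk⟩)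
  | k + 1, hk => (isColimit_chainCocone β k (Nat.lt_of_succ_lt hk)).ten _

/-- The cells with values in the cells of `B(D, D, F)`. -/
@[reducible]
def cellsOver {p : ℕ} (β : Fin (p + 1) → D) : CellDiagram D N where
  obj _ γ := barCell G (cellFun F γ) β
  map φ γ := barCellNat β (𝟙 G) (cellFunMap F γ φ.toOrderHom)

/-- The cells with values in `B(D, D, F)`, as a cocone. -/
def cellsOverCocone {p : ℕ} (β : Fin (p + 1) → D) :
    CellCocone Δ (cellsOver G F β) (barCell G (barDiagram Δ F) β) where
  inj q γ := gBarCellMap (cellNat Δ F q γ) G β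
  condition φ γ := ((chainCocone Δ F β p (Nat.lt_succ_self p)).ten _).condition φ γ

lemma isColimit_cellsOverCocone {p : ℕ} (β : Fin (p + 1) → D) :
    (cellsOverCocone Δ G F β).IsColimit :=
  (isColimit_chainCocone Δ F β p (Nat.lt_succ_self p)).ten _

end CellsOver

/-! ### Gluing the join homotopy over the inner and the outer cells -/

section JoinHomotopy

variable {V : Type u₁} [Category.{v} V] [MonoidalCategory V] [SymmetricCategory V]
  [MonoidalClosed V] {D : Type v} [EnrichedCategory V D]
  {N : Type u₂} [Category.{v} N] [EnrichedOrdinaryCategory V N] [EnrichedBicomplete V N]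
  (t : SimplexTwist) (L : SSet.{v} ⥤ V) [L.Monoidal] [L.IsLeftAdjoint]
  (G : RightModule V D) (F : VFun V D N)

/-- The inner sequences are glued first, for a fixed outer sequence. The outer weight and the
interval travel along as the parameter of the enriched colimit, which is why its universal property
is needed with parameters. -/
lemma exists_joinCellHomotopy (p : SimplexCategory) (β : Fin (p.len + 1) → D) :
    ∃ u : (t.cosimplicial L).obj p ⊗ (t.cosimplicial L).obj (SimplexCategory.mk 1) ⟶
        (barCell G (barDiagram (t.cosimplicial L) F) β ⟶[V]
          realizeObj (t.cosimplicial L) (simplicialBarObj G F)),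
      ∀ (q : SimplexCategory) (γ : Fin (q.len + 1) → D),
        gcomp V (gBarCellMap (cellNat (t.cosimplicial L) F q γ) G β) u =
          (joinFamily G F γ β (𝟙 _)).elt t L := by
  refine (isColimit_cellsOverCocone (t.cosimplicial L) G F β).exists_desc
    (fun q γ => (joinFamily G F γ β (𝟙 _)).elt t L) ?_
  intro q' q a γ
  have h := PrismFamily.map_elt t L (joinFamily G F γ β (𝟙 _))
    (joinFamily G F (fun i => γ (a.toOrderHom i)) β (𝟙 _)) a (𝟙 p) (𝟙 _)
    (barCellNat β (𝟙 G) (cellFunMap F γ a.toOrderHom)) (fun m ψ φ τ => by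
      rw [Category.comp_id, Category.comp_id]
      exact joinFamily_left G F γ β a m ψ φ τ)
  rw [CategoryTheory.Functor.map_id, CategoryTheory.Functor.map_id, id_tensorHom_id,
    tensorHom_id] at h
  exact h

/-- The second gluing, over the outer sequences, with only the interval as parameter. Its
compatibility condition is an equation of maps out of an outer cell, which is itself a colimit over
inner sequences, so it is tested there. -/
lemma exists_joinHomotopy :
    ∃ h : (t.cosimplicial L).obj (SimplexCategory.mk 1) ⟶
        (realizeObj (t.cosimplicial L) (simplicialBarObj G (barDiagram (t.cosimplicial L) F)) ⟶[V]
          realizeObj (t.cosimplicial L) (simplicialBarObj G F)),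
      ∀ (p : SimplexCategory) (β : Fin (p.len + 1) → D) (q : SimplexCategory)
        (γ : Fin (q.len + 1) → D),
        gcomp V (gBarCellMap (cellNat (t.cosimplicial L) F q γ) G β)
            (gcomp V ((barCocone (t.cosimplicial L) G (barDiagram (t.cosimplicial L) F)).inj p β)
              h) = (joinFamily G F γ β (𝟙 _)).elt t L := by
  choose u hu using exists_joinCellHomotopy t L G F
  obtain ⟨h, hh⟩ := (isColimit_barCocone (t.cosimplicial L) G
    (barDiagram (t.cosimplicial L) F)).exists_desc u (by
      intro p' p b β
      apply (isColimit_cellsOverCocone (t.cosimplicial L) G F β).hom_ext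
      intro q γ
      change gcomp V (gBarCellMap (cellNat (t.cosimplicial L) F q γ) G β) _ =
        gcomp V (gBarCellMap (cellNat (t.cosimplicial L) F q γ) G β) _
      have h₁ := PrismFamily.map_elt t L (joinFamily G F γ β (𝟙 _))
        (joinFamily G F γ (fun i => β (b.toOrderHom i)) (𝟙 _)) (𝟙 q) b (𝟙 _)
        (barCellMap G (cellFun F γ) β b.toOrderHom) (fun m ψ φ τ => by
          rw [Category.comp_id, Category.comp_id]
          exact joinFamily_right G F γ β b m ψ φ τ)
      rw [CategoryTheory.Functor.map_id, CategoryTheory.Functor.map_id, tensorHom_id,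
        id_tensorHom] at h₁
      have h₂ : GSquare _ _ _ _ :=
        gBarCellMap_barCellMap (cellNat (t.cosimplicial L) F q γ) G β b.toOrderHom
      unfold GSquare at h₂
      rw [comp_gcomp_right, hu, h₁, ← gcomp_middle, h₂, gcomp_whiskerRight, hu])
  exact ⟨h, fun p β q γ => (congrArg (fun x => gcomp V _ x) (hh p β)).trans (hu p β q γ)⟩

/-- An end of the homotopy is identified by testing on cells of cells; this reduces each end to the
equation `hf` about the family restricted to a vertex of the interval. -/
lemma joinHomotopy_endpoint
    {h : (t.cosimplicial L).obj (SimplexCategory.mk 1) ⟶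
        (realizeObj (t.cosimplicial L) (simplicialBarObj G (barDiagram (t.cosimplicial L) F)) ⟶[V]
          realizeObj (t.cosimplicial L) (simplicialBarObj G F))}
    (hh : ∀ (p : SimplexCategory) (β : Fin (p.len + 1) → D) (q : SimplexCategory)
        (γ : Fin (q.len + 1) → D),
        gcomp V (gBarCellMap (cellNat (t.cosimplicial L) F q γ) G β)
            (gcomp V ((barCocone (t.cosimplicial L) G (barDiagram (t.cosimplicial L) F)).inj p β)
              h) = (joinFamily G F γ β (𝟙 _)).elt t L)
    (k : SimplexCategory.mk 0 ⟶ SimplexCategory.mk 1)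
    (f : realizeObj (t.cosimplicial L) (simplicialBarObj G (barDiagram (t.cosimplicial L) F)) ⟶
      realizeObj (t.cosimplicial L) (simplicialBarObj G F))
    (hf : ∀ (p : SimplexCategory) (β : Fin (p.len + 1) → D) (q : SimplexCategory)
        (γ : Fin (q.len + 1) → D), (joinFamily G F γ β k).elt t L =
      (t.cosimplicial L).obj q ◁ ((t.cosimplicial L).obj p ◁ (t.augmentation L).app _ ≫
        (ρ_ _).hom) ≫ gcomp V (gBarCellMap (cellNat (t.cosimplicial L) F q γ) G β)
          ((barCocone (t.cosimplicial L) G (barDiagram (t.cosimplicial L) F)).inj p β ≫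
            eHomWhiskerLeft V _ f)) :
    (t.cosimplicial L).map k ≫ h = (t.augmentation L).app _ ≫ eHomEquiv V f := by
  apply (isColimit_barCocone (t.cosimplicial L) G (barDiagram (t.cosimplicial L) F)).hom_ext
  intro p β
  apply (isColimit_cellsOverCocone (t.cosimplicial L) G F β).hom_ext
  intro q γ
  change gcomp V (gBarCellMap (cellNat (t.cosimplicial L) F q γ) G β) _ =
    gcomp V (gBarCellMap (cellNat (t.cosimplicial L) F q γ) G β) _
  have h₁ := PrismFamily.map_elt t L (joinFamily G F γ β (𝟙 _)) (joinFamily G F γ β k)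
    (𝟙 q) (𝟙 p) k (𝟙 _) (fun m ψ φ τ => by
      rw [Category.comp_id, Category.comp_id, Category.id_comp]
      exact joinFamily_const G F γ β k m ψ φ τ)
  rw [CategoryTheory.Functor.map_id, CategoryTheory.Functor.map_id, id_tensorHom, id_tensorHom,
    eHomWhiskerRight_id, Category.comp_id] at h₁
  have h₂ := gcomp_eHomEquiv ((barCocone (t.cosimplicial L) G
    (barDiagram (t.cosimplicial L) F)).inj p β) f
  rw [comp_gcomp_right, comp_gcomp_right, hh, h₁, comp_gcomp_right]
  refine Eq.trans ?_ (congrArg (fun x => gcomp V _ (_ ≫ x)) h₂).symm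
  rw [hf p β q γ, ← comp_gcomp_right, Category.assoc]

end JoinHomotopy

/-! ### The ends of the homotopy -/

section JoinEndpoints

variable {V : Type u₁} [Category.{v} V] [MonoidalCategory V] [SymmetricCategory V]
  [MonoidalClosed V] {D : Type v} [EnrichedCategory V D]
  {N : Type u₂} [Category.{v} N] [EnrichedOrdinaryCategory V N] [EnrichedBicomplete V N]

section

variable {Δ : SimplexCategory ⥤ V} {G G' : RightModule V D} {F F' F'' : VFun V D N}

lemma barCocone_comp {Y : N} (f : realizeObj Δ (simplicialBarObj G F) ⟶ Y) (p : SimplexCategory)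
    (β : Fin (p.len + 1) → D) :
    (barCocone Δ G F).inj p β ≫ eHomWhiskerLeft V _ f =
      ad (realizeInj Δ (simplicialBarObj G F) p ≫ f) ≫ eHomWhiskerRight V (cellInj G F p β) _ := by
  rw [ad_comp, Category.assoc, eHom_whisker_exchange]
  exact Category.assoc _ _ _

lemma barCocone_level {p : SimplexCategory} {β : Fin (p.len + 1) → D}
    {b : (simplicialBarObj G F).obj (op p) ⟶ (simplicialBarObj G' F').obj (op p)}
    {f : realizeObj Δ (simplicialBarObj G F) ⟶ realizeObj Δ (simplicialBarObj G' F')}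
    (h₁ : realizeInj Δ (simplicialBarObj G F) p ≫ f =
      tenMap (𝟙 _) b ≫ realizeInj Δ (simplicialBarObj G' F') p)
    {c : barCell G F β ⟶ barCell G' F' β}
    (h₂ : cellInj G F p β ≫ b = c ≫ cellInj G' F' p β) :
    (barCocone Δ G F).inj p β ≫ eHomWhiskerLeft V _ f =
      (barCocone Δ G' F').inj p β ≫ eHomWhiskerRight V c _ := by
  refine (barCocone_comp _ p β).trans ((congrArg (fun x => ad x ≫ _) h₁).trans ?_)
  rw [ad_tenMap_comp, Category.id_comp, Category.assoc, ← eHomWhiskerRight_comp, h₂,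
    eHomWhiskerRight_comp]
  exact (Category.assoc _ _ _).symm

lemma barCocone_bar_map (g : G ⟶ G') (f : F ⟶ F') (p : SimplexCategory)
    (β : Fin (p.len + 1) → D) :
    (barCocone Δ G F).inj p β ≫ eHomWhiskerLeft V _
        ((bar Δ D N).map (X := (G, F)) (Y := (G', F')) (Prod.mkHom g f)) =
      (barCocone Δ G' F').inj p β ≫ eHomWhiskerRight V (barCellNat β g f) _ := by
  have h₁ : realizeInj Δ (simplicialBarObj G F) p ≫
      (bar Δ D N).map (X := (G, F)) (Y := (G', F')) (Prod.mkHom g f) =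
      tenMap (𝟙 _) (barLevelMap p.len g f) ≫ realizeInj Δ (simplicialBarObj G' F') p :=
    realizeInj_map (X := simplicialBarObj G F) (Y := simplicialBarObj G' F') _ _
  have h₂ : cellInj G F p β ≫ barLevelMap p.len g f = barCellNat β g f ≫ cellInj G' F' p β :=
    Sigma.ι_desc _ _
  exact barCocone_level h₁ h₂

lemma ad_tenCounit_comp {P : V} (e : P ⟶ 𝟙_ V) {X Y : N} (u : X ⟶ Y) :
    ad (tenCounit e X ≫ u) = e ≫ eHomEquiv V u := by
  rw [tenCounit, ad_comp, ad_tenDesc, Category.assoc, ← eId_whiskerRight, ← eHomEquiv_id,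
    ← eHomEquiv_comp_left, Category.comp_id]

lemma barCocone_realizeAug (aug : Δ ⟶ (Functor.const _).obj (𝟙_ V)) {Y : N}
    (u : ∀ n : SimplexCategory, (simplicialBarObj G F).obj (op n) ⟶ Y)
    (h : ∀ (m n : SimplexCategory) (φ : m ⟶ n), (simplicialBarObj G F).map φ.op ≫ u m = u n)
    (q : SimplexCategory) (γ : Fin (q.len + 1) → D) :
    (barCocone Δ G F).inj q γ ≫ eHomWhiskerLeft V _ (realizeAug aug u h) =
      aug.app q ≫ eHomEquiv V (cellInj G F q γ ≫ u q) := by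
  refine (barCocone_comp _ q γ).trans
    ((congrArg (fun x => ad x ≫ _) (realizeInj_aug aug u h q)).trans ?_)
  rw [eHomEquiv_comp_left]
  exact (congrArg (fun x => x ≫ _) (ad_tenCounit_comp _ _)).trans (Category.assoc _ _ _)

lemma eHomEquiv_comp_right {X Y Z : N} (f : X ⟶ Y) (g : Y ⟶ Z) :
    eHomEquiv V (f ≫ g) = eHomEquiv V f ≫ eHomWhiskerLeft V X g := by
  have h := gcomp_eHomEquiv (V := V) (eHomEquiv V f) g
  rw [eHomEquiv_comp, ← cancel_epi (λ_ (𝟙_ V)).hom, Iso.hom_inv_id_assoc]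
  simpa [gcomp, unitors_equal] using h

/-- On an honest map, the enriched functoriality of the tensor reduces to the ordinary one. -/
lemma gTenMap_eHomEquiv {J : V} {X Y : N} (f : X ⟶ Y) :
    gTenMap J (eHomEquiv V f) = eHomEquiv V (tenMap (𝟙 J) f) := by
  have h : ∀ {X Y : N} (f : X ⟶ Y), eHomEquiv V f = eId V X ≫ eHomWhiskerLeft V X f := by
    intro X Y f
    rw [← eId_whiskerRight, ← eHomEquiv_id, ← eHomEquiv_comp_left, Category.comp_id]
  rw [h, gTenMap_whiskerLeft, gTenMap_eId, ← h]

variable {K : V} (ω : GNat K F F') (f : F' ⟶ F'') (g : F ⟶ F'') (e : K ⟶ 𝟙_ V)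

lemma gChainMap_chainMap
    (h : ∀ d, ω.app d ≫ eHomWhiskerLeft V _ (f.app d) = e ≫ eHomEquiv V (g.app d))
    {n : ℕ} (β : Fin n → D) : ∀ (k : ℕ) (hk : k < n),
    gChainMap ω β k hk ≫ eHomWhiskerLeft V _ (chainMap f β k hk) =
      e ≫ eHomEquiv V (chainMap g β k hk)
  | 0, _ => h _
  | k + 1, hk => by
    refine (gTenMap_whiskerLeft _ _).symm.trans ((congrArg (fun t => gTenMap _ t)
      (gChainMap_chainMap h β k (Nat.lt_of_succ_lt hk))).trans ?_)
    rw [comp_gTenMap, gTenMap_eHomEquiv]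
    rfl

lemma gBarCellMap_barCellNat
    (h : ∀ d, ω.app d ≫ eHomWhiskerLeft V _ (f.app d) = e ≫ eHomEquiv V (g.app d))
    {n : ℕ} (β : Fin (n + 1) → D) :
    gBarCellMap ω G β ≫ eHomWhiskerLeft V _ (barCellNat β (𝟙 G) f) =
      e ≫ eHomEquiv V (barCellNat β (𝟙 G) g) := by
  refine (gTenMap_whiskerLeft _ _).symm.trans ((congrArg (fun t => gTenMap _ t)
    (gChainMap_chainMap ω f g e h β n (Nat.lt_succ_self n))).trans ?_)
  rw [comp_gTenMap, gTenMap_eHomEquiv]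
  rfl

/-- On a cell of the resolution the augmentation forgets the weight and lets all morphisms act on
`F`. -/
lemma cellNat_barCounit (aug : Δ ⟶ (Functor.const _).obj (𝟙_ V)) (q : SimplexCategory)
    (γ : Fin (q.len + 1) → D) (d : D) :
    (cellNat Δ F q γ).app d ≫ eHomWhiskerLeft V _ ((barCounit aug F).app d) =
      aug.app q ≫ eHomEquiv V ((cellFunAct F γ).app d) :=
  (barCocone_realizeAug aug _ (fun _ _ φ => levelCounit_map F d φ) q γ).trans
    (congrArg (fun x => aug.app q ≫ eHomEquiv V x) (ι_levelCounit F d γ))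

lemma gTenMap_gCore (q : SimplexCategory) (γ : Fin (q.len + 1) → D) (d : D) :
    gTenMap (G.obj d) ((cellNat Δ F q γ).app d) ≫ eHomWhiskerLeft V _ (tenDesc (gCore Δ G F d)) =
      (barCocone Δ G F).inj q γ ≫ eHomWhiskerRight V
        (tenComp (G.act (γ ⟨q.len, Nat.lt_succ_self _⟩) d) _) _ := by
  apply ten_gext
  rw [gcomp_tenDesc]
  refine (congrArg (fun x => _ ≫ x) (gcomp_gCore Δ G F d q γ)).trans ?_
  rw [SymmetricCategory.symmetry_assoc]
  refine Eq.trans ?_ (tenUnit_gcomp _ _).symm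
  exact congrArg (fun x => gcomp V x _) (ad_tenDesc _).symm

/-- The comparison map composes the outer chain down to its last vertex, and `core` then lets the
resulting morphism act on `G`; on an inner cell the two steps together are `dropCell`. -/
lemma gBarCellMap_core (q : SimplexCategory) (γ : Fin (q.len + 1) → D) {p : ℕ}
    (β : Fin (p + 1) → D) :
    gBarCellMap (cellNat Δ F q γ) G β ≫ eHomWhiskerLeft V _
        ((tenMap (𝟙 _) (chainAct (barDiagram Δ F) β p (Nat.lt_succ_self p)) ≫
          tensorInj G (barDiagram Δ F) (β ⟨p, Nat.lt_succ_self p⟩)) ≫ core Δ G F) =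
      (barCocone Δ G F).inj q γ ≫ eHomWhiskerRight V (dropCell F γ β G) _ := by
  have h := (gChainMap_chainAct (cellNat Δ F q γ) β p (Nat.lt_succ_self p)).ten
    (J := G.obj (β ⟨p, Nat.lt_succ_self p⟩))
  unfold GSquare at h
  have h₂ := gTenMap_gCore (Δ := Δ) (G := G) (F := F) q γ (β ⟨p, Nat.lt_succ_self p⟩)
  rw [Category.assoc, tensorInj_core, eHomWhiskerLeft_comp]
  refine (Category.assoc _ _ _).symm.trans ((congrArg (fun x => x ≫ _) h).trans ?_)
  rw [Category.assoc, ← eHom_whisker_exchange]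
  refine (Category.assoc _ _ _).symm.trans ((congrArg (fun x => x ≫ _) h₂).trans ?_)
  refine (Category.assoc _ _ _).trans (congrArg (fun x => _ ≫ x) ?_)
  exact (eHomWhiskerRight_comp V _ _ _).symm

section

variable {J K P : V} {X Y Z W : N}

lemma whiskerRight_gcomp {u : J ⟶ (X ⟶[V] Y)} {y : Y ⟶ Z} {z : X ⟶ Z} {e : J ⟶ 𝟙_ V}
    (h : u ≫ eHomWhiskerLeft V X y = e ≫ eHomEquiv V z) (a : P ⟶ 𝟙_ V) (x : K ⟶ (Z ⟶[V] W)) :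
    e ▷ (K ⊗ P) ≫ (λ_ _).hom ≫ K ◁ a ≫ (ρ_ _).hom ≫ x ≫ eHomWhiskerRight V z W =
      J ◁ (K ◁ a ≫ (ρ_ _).hom) ≫ gcomp V u (x ≫ eHomWhiskerRight V y W) := by
  rw [← gcomp_middle, h, comp_gcomp_left, eHomEquiv_gcomp, whisker_exchange_assoc,
    leftUnitor_naturality_assoc, Category.assoc]

lemma whiskerLeft_gcomp {u : J ⟶ (X ⟶[V] Y)} (y : Y ⟶ Z) (a : P ⟶ 𝟙_ V) (e : K ⟶ 𝟙_ V) :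
    J ◁ (K ◁ a ≫ (ρ_ _).hom ≫ e) ≫ (ρ_ _).hom ≫ u ≫ eHomWhiskerLeft V X y =
      J ◁ (K ◁ a ≫ (ρ_ _).hom) ≫ gcomp V u (e ≫ eHomEquiv V y) := by
  rw [comp_gcomp_right, gcomp_eHomEquiv]
  simp only [MonoidalCategory.whiskerLeft_comp, Category.assoc]

end

end

variable (t : SimplexTwist) (L : SSet.{v} ⥤ V) [L.Monoidal] [L.IsLeftAdjoint]
  (G : RightModule V D) (F : VFun V D N)

/-- At the outer end only the outer simplex survives, and the inner chain acts on `F` as it does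
under the augmentation of the resolution. -/
lemma joinFamily_one_elt (p : SimplexCategory) (β : Fin (p.len + 1) → D) (q : SimplexCategory)
    (γ : Fin (q.len + 1) → D) : (joinFamily G F γ β (SimplexCategory.δ 0)).elt t L =
      (t.cosimplicial L).obj q ◁ ((t.cosimplicial L).obj p ◁
          (t.augmentation L).app (SimplexCategory.mk 0) ≫ (ρ_ _).hom) ≫
        gcomp V (gBarCellMap (cellNat (t.cosimplicial L) F q γ) G β)
          ((barCocone (t.cosimplicial L) G (barDiagram (t.cosimplicial L) F)).inj p β ≫
            eHomWhiskerLeft V _ ((bar (t.cosimplicial L) D N).map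
              (X := (G, barDiagram (t.cosimplicial L) F)) (Y := (G, F))
                (Prod.mkHom (𝟙 G) (barCounit (t.augmentation L) F)))) := by
  rw [PrismFamily.elt_snd t L _ _ (joinFamily_one G F γ β)]
  have h₁ := barCocone_bar_map (Δ := t.cosimplicial L) (𝟙 G) (barCounit (t.augmentation L) F) p β
  have h₂ := gBarCellMap_barCellNat (G := G) (cellNat (t.cosimplicial L) F q γ)
    (barCounit (t.augmentation L) F) (cellFunAct F γ) _ (cellNat_barCounit (t.augmentation L) q γ) β
  refine Eq.trans ?_ (congrArg (fun x => _ ≫ gcomp V _ x) h₁).symm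
  refine Eq.trans ?_ (whiskerRight_gcomp h₂ _ _)
  refine congrArg (fun x => _ ≫ _ ≫ _ ≫ _ ≫ x) ?_
  refine Eq.trans ?_ (Category.assoc _ _ _).symm
  exact congrArg (fun x => _ ≫ x) (eHomWhiskerRight_comp V _ _ _)

/-- At the inner end only the inner simplex survives, and the outer chain acts on `G` as it does
under the comparison map followed by `core`. -/
lemma joinFamily_zero_elt (p : SimplexCategory) (β : Fin (p.len + 1) → D) (q : SimplexCategory)
    (γ : Fin (q.len + 1) → D) : (joinFamily G F γ β (SimplexCategory.δ 1)).elt t L =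
      (t.cosimplicial L).obj q ◁ ((t.cosimplicial L).obj p ◁
          (t.augmentation L).app (SimplexCategory.mk 0) ≫ (ρ_ _).hom) ≫
        gcomp V (gBarCellMap (cellNat (t.cosimplicial L) F q γ) G β)
          ((barCocone (t.cosimplicial L) G (barDiagram (t.cosimplicial L) F)).inj p β ≫
            eHomWhiskerLeft V _ ((barComparison (t.augmentation L)).app
              (G, barDiagram (t.cosimplicial L) F) ≫ core (t.cosimplicial L) G F)) := by
  rw [PrismFamily.elt_fst t L _ _ (joinFamily_zero G F γ β)]
  have h₁ := barCocone_realizeAug (t.augmentation L)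
    (fun n => barLevelAug G (barDiagram (t.cosimplicial L) F) n.len)
    (fun _ _ φ => barLevelAug_map G (barDiagram (t.cosimplicial L) F) φ) p β
  have h₂ : cellInj G (barDiagram (t.cosimplicial L) F) p β ≫
      barLevelAug G (barDiagram (t.cosimplicial L) F) p.len = _ := ι_barLevelAug _ _ _
  have h₃ := gBarCellMap_core (Δ := t.cosimplicial L) (G := G) (F := F) q γ β
  have h₄ := h₁.trans (congrArg (fun x => _ ≫ eHomEquiv V x) h₂)
  have h₅ : (barCocone (t.cosimplicial L) G (barDiagram (t.cosimplicial L) F)).inj p β ≫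
      eHomWhiskerLeft V _ ((barComparison (t.augmentation L)).app
        (G, barDiagram (t.cosimplicial L) F) ≫ core (t.cosimplicial L) G F) = _ :=
    (congrArg (fun x => _ ≫ x) (eHomWhiskerLeft_comp V _ _ _)).trans
      ((Category.assoc _ _ _).symm.trans ((congrArg (fun x => x ≫ _) h₄).trans
        ((Category.assoc _ _ _).trans (congrArg (fun x => _ ≫ x)
          (eHomEquiv_comp_right _ _).symm))))
  refine Eq.trans ?_ (congrArg (fun x => _ ≫ gcomp V _ x) h₅).symm
  refine Eq.trans ?_ (whiskerLeft_gcomp _ _ _)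
  refine congrArg (fun x => _ ≫ _ ≫ x) ?_
  refine Eq.trans ?_ h₃.symm
  refine Eq.trans ?_ (Category.assoc _ _ _).symm
  exact congrArg (fun x => _ ≫ x) (eHomWhiskerRight_comp V _ _ _)

lemma isSimpliciallyHomotopic_of_endpoints {X Y : N}
    (h : (t.cosimplicial L).obj (SimplexCategory.mk 1) ⟶ (X ⟶[V] Y)) {f g : X ⟶ Y}
    (hf : (t.cosimplicial L).map (SimplexCategory.δ 1) ≫ h = (t.augmentation L).app _ ≫ eHomEquiv V f)
    (hg : (t.cosimplicial L).map (SimplexCategory.δ 0) ≫ h =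
      (t.augmentation L).app _ ≫ eHomEquiv V g) : IsSimpliciallyHomotopic L f g := by
  change L.map (simplexFunctor.map (t.map _)) ≫ h = _ at hf
  change L.map (simplexFunctor.map (t.map _)) ≫ h = _ at hg
  have h₁ : t.map (SimplexCategory.δ (0 : Fin 2)) ≠ t.map (SimplexCategory.δ 1) := by
    rw [Ne, EmbeddingLike.apply_eq_iff_eq]
    intro h
    have := congrArg (fun f => f.toOrderHom 0) h
    exact absurd this (by decide)
  rcases eq_δ_zero_or_one (t.map (SimplexCategory.δ 0)) with h0 | h0 <;>
  rcases eq_δ_zero_or_one (t.map (SimplexCategory.δ 1)) with h1 | h1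
  · exact absurd (h0.trans h1.symm) h₁
  · rw [h0] at hg
    rw [h1] at hf
    exact Relation.EqvGen.rel _ _ ⟨h, hf, hg⟩
  · rw [h0] at hg
    rw [h1] at hf
    exact (Relation.EqvGen.rel _ _ ⟨h, hg, hf⟩).symm
  · exact absurd (h0.trans h1.symm) h₁

/-- The homotopy relating the comparison map of the resolution with the augmentation. -/
lemma isSimpliciallyHomotopic_comparison_core :
    IsSimpliciallyHomotopic L
      ((barComparison (t.augmentation L)).app (G, barDiagram (t.cosimplicial L) F) ≫
        core (t.cosimplicial L) G F)
      ((bar (t.cosimplicial L) D N).map (X := (G, barDiagram (t.cosimplicial L) F)) (Y := (G, F))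
        (Prod.mkHom (𝟙 G) (barCounit (t.augmentation L) F))) := by
  obtain ⟨h, hh⟩ := exists_joinHomotopy t L G F
  have h₀ := joinHomotopy_endpoint t L G F hh _ _ (joinFamily_zero_elt t L G F)
  have h₁ := joinHomotopy_endpoint t L G F hh _ _ (joinFamily_one_elt t L G F)
  exact isSimpliciallyHomotopic_of_endpoints t L h h₀ h₁

end JoinEndpoints

/-! ### Simplicially homotopic maps and weak equivalences -/

section Cylinder

variable {V : Type u₁} [Category.{v} V] [MonoidalCategory V] [SymmetricCategory V]
  [MonoidalClosed V] {N : Type u₂} [Category.{v} N] [EnrichedOrdinaryCategory V N]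
  [EnrichedBicomplete V N] (L : SSet.{v} ⥤ V) [L.Monoidal] [L.IsLeftAdjoint]

/-- The minimum of two maps to `[1]`. -/
def intervalMeet {m : SimplexCategory} (f g : m ⟶ SimplexCategory.mk 1) :
    m ⟶ SimplexCategory.mk 1 :=
  SimplexCategory.Hom.mk ⟨fun i => min (f.toOrderHom i) (g.toOrderHom i),
    fun _ _ h => min_le_min (f.toOrderHom.monotone h) (g.toOrderHom.monotone h)⟩

lemma comp_intervalMeet {l m : SimplexCategory} (φ : l ⟶ m) (f g : m ⟶ SimplexCategory.mk 1) :
    intervalMeet (φ ≫ f) (φ ≫ g) = φ ≫ intervalMeet f g := rfl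

/-- The minimum with the vertex `1` changes nothing, and by `intervalMeet_δ_one` the minimum with
the vertex `0` is constant. So the minimum contracts `Δ[1]` onto its vertex `0`. -/
lemma intervalMeet_δ_zero {m : SimplexCategory} (f : m ⟶ SimplexCategory.mk 1)
    (τ : m ⟶ SimplexCategory.mk 0) : intervalMeet f (τ ≫ SimplexCategory.δ 0) = f ≫ 𝟙 _ := by
  ext i
  have h : τ.toOrderHom i = (0 : Fin 1) := Subsingleton.elim (α := Fin 1) _ _
  change (min (f.toOrderHom i) ((SimplexCategory.δ (0 : Fin 2)).toOrderHom (τ.toOrderHom i))).1 =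
    (f.toOrderHom i).1
  rw [h]
  generalize f.toOrderHom i = x
  change Fin 2 at x
  revert x
  decide

lemma intervalMeet_δ_one {m : SimplexCategory} (f : m ⟶ SimplexCategory.mk 1)
    (τ : m ⟶ SimplexCategory.mk 0) : intervalMeet f (τ ≫ SimplexCategory.δ 1) =
      f ≫ SimplexCategory.const _ (SimplexCategory.mk 0) 0 ≫ SimplexCategory.δ 1 := by
  ext i
  have h : τ.toOrderHom i = (0 : Fin 1) := Subsingleton.elim (α := Fin 1) _ _
  change (min (f.toOrderHom i) ((SimplexCategory.δ (1 : Fin 2)).toOrderHom (τ.toOrderHom i))).1 =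
    ((SimplexCategory.δ (1 : Fin 2)).toOrderHom (0 : Fin 1)).1
  rw [h]
  generalize f.toOrderHom i = x
  change Fin 2 at x
  revert x
  decide

open SemiCartesianMonoidalCategory (fst snd)

/-- The map `Δ[1] × Δ[1] ⟶ Δ[1]` given by the minimum. -/
def intervalMul : L.obj (simplexFunctor.obj (SimplexCategory.mk 1) ⊗
    simplexFunctor.obj (SimplexCategory.mk 1)) ⟶ L.obj (simplexFunctor.obj (SimplexCategory.mk 1)) :=
  simplexDesc L (fun m x => L.map (simplexFunctor.map (intervalMeet
    (simplexFunctor.preimage (x ≫ fst _ _)) (simplexFunctor.preimage (x ≫ snd _ _))))) (by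
    intro m n φ x
    rw [← L.map_comp, ← Functor.map_comp, ← comp_intervalMeet, Category.assoc, Category.assoc,
      Functor.preimage_comp, Functor.preimage_comp, Functor.preimage_map])

/-- A statement about operators to `[1]` becomes one about maps of simplicial sets by testing on
simplices. It treats both ends of the contraction at once, with `φ` the resulting endomorphism of
`[1]`. -/
lemma map_intervalMul (k : SimplexCategory.mk 0 ⟶ SimplexCategory.mk 1)
    (φ : SimplexCategory.mk 1 ⟶ SimplexCategory.mk 1)
    (hφ : ∀ (m : SimplexCategory) (f : m ⟶ SimplexCategory.mk 1) (τ : m ⟶ SimplexCategory.mk 0),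
      intervalMeet f (τ ≫ k) = f ≫ φ) :
    L.map (simplexFunctor.obj (SimplexCategory.mk 1) ◁ simplexFunctor.map k) ≫ intervalMul L =
      L.map (fst _ _) ≫ L.map (simplexFunctor.map φ) := by
  apply map_simplex_ext
  intro m x
  rw [← Category.assoc, ← L.map_comp, intervalMul, map_simplexDesc, ← L.map_comp, ← L.map_comp]
  congr 1
  have h : simplexFunctor.preimage ((x ≫ simplexFunctor.obj (SimplexCategory.mk 1) ◁
      simplexFunctor.map k) ≫ snd _ _) = simplexFunctor.preimage (x ≫ snd _ _) ≫ k := by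
    rw [Category.assoc, CartesianMonoidalCategory.whiskerLeft_snd, ← Category.assoc,
      Functor.preimage_comp, Functor.preimage_map]
  rw [h, hφ, Functor.map_comp, Functor.map_preimage, Category.assoc, Category.assoc,
    CartesianMonoidalCategory.whiskerLeft_fst_assoc]

variable (X : N)

/-- The homotopy contracting the cylinder `Δ[1] ⊙ X`. -/
def cylinderHomotopy : L.obj (simplexFunctor.obj (SimplexCategory.mk 1)) ⟶
    (ten (L.obj (simplexFunctor.obj (SimplexCategory.mk 1))) X ⟶[V]
      ten (L.obj (simplexFunctor.obj (SimplexCategory.mk 1))) X) :=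
  tenHom.symm (Functor.LaxMonoidal.μ L _ _ ≫ intervalMul L ≫ tenUnit _ X)

lemma map_cylinderHomotopy (k : SimplexCategory.mk 0 ⟶ SimplexCategory.mk 1)
    (φ : SimplexCategory.mk 1 ⟶ SimplexCategory.mk 1)
    (hφ : ∀ (m : SimplexCategory) (f : m ⟶ SimplexCategory.mk 1) (τ : m ⟶ SimplexCategory.mk 0),
      intervalMeet f (τ ≫ k) = f ≫ φ) :
    L.map (simplexFunctor.map k) ≫ cylinderHomotopy L X =
      toUnitObj L _ ≫ eHomEquiv V (tenMap (L.map (simplexFunctor.map φ)) (𝟙 X)) := by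
  apply ten_gext
  have h₁ := map_intervalMul L k φ hφ
  have h₂ := Functor.LaxMonoidal.μ_natural_right (F := L)
    (simplexFunctor.obj (SimplexCategory.mk 1)) (simplexFunctor.map k)
  have h₃ := whiskerLeft_toUnitObj L (simplexFunctor.obj (SimplexCategory.mk 1))
    (simplexFunctor.obj (SimplexCategory.mk 0))
  rw [comp_gcomp_right, ← tenHom_apply, cylinderHomotopy, Equiv.apply_symm_apply, comp_gcomp_right,
    gcomp_eHomEquiv]
  change _ = _ ≫ _ ≫ ad _
  rw [ad_tenMap, reassoc_of% h₃, reassoc_of% h₂, reassoc_of% h₁, eHomWhiskerRight_id,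
    Category.comp_id]

/-- The point of `L Δ[0]`. -/
def zeroPoint : 𝟙_ V ⟶ L.obj (simplexFunctor.obj (SimplexCategory.mk 0)) :=
  zeroVertex SimplexTwist.refl L

lemma zeroPoint_toUnitObj : zeroPoint L ≫ toUnitObj L _ = 𝟙 _ :=
  zeroVertex_augmentation SimplexTwist.refl L

lemma toUnitObj_zeroPoint (n : SimplexCategory) : toUnitObj L (simplexFunctor.obj n) ≫ zeroPoint L =
    L.map (simplexFunctor.map (SimplexCategory.const n (SimplexCategory.mk 0) 0)) :=
  augmentation_zeroVertex SimplexTwist.refl L n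

/-- The inclusion of an end of the cylinder. -/
def cylinderInj (k : SimplexCategory.mk 0 ⟶ SimplexCategory.mk 1) :
    X ⟶ ten (L.obj (simplexFunctor.obj (SimplexCategory.mk 1))) X :=
  tenPt (zeroPoint L ≫ L.map (simplexFunctor.map k)) X

lemma cylinderInj_tenCounit (k : SimplexCategory.mk 0 ⟶ SimplexCategory.mk 1) :
    cylinderInj L X k ≫ tenCounit (toUnitObj L _) X = 𝟙 X := by
  refine tenPt_tenCounit (zeroPoint L ≫ L.map (simplexFunctor.map k))
    (toUnitObj L (simplexFunctor.obj (SimplexCategory.mk 1))) ?_ X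
  rw [Category.assoc, map_toUnitObj, zeroPoint_toUnitObj]

lemma tenCounit_cylinderInj (k : SimplexCategory.mk 0 ⟶ SimplexCategory.mk 1) :
    tenCounit (toUnitObj L (simplexFunctor.obj (SimplexCategory.mk 1))) X ≫ cylinderInj L X k =
      tenMap (L.map (simplexFunctor.map (SimplexCategory.const (SimplexCategory.mk 1)
        (SimplexCategory.mk 0) 0 ≫ k))) (𝟙 X) := by
  rw [cylinderInj, tenCounit_tenPt, reassoc_of% (toUnitObj_zeroPoint L), Functor.map_comp,
    Functor.map_comp]

/-- The contraction of `Δ[1]` onto the vertex `0` contracts the cylinder onto its end at `δ 1`; in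
the other order the composite is the identity. -/
lemma tenCounit_mem_simplicialHomotopyEquivalences : simplicialHomotopyEquivalences L N
    (tenCounit (toUnitObj L (simplexFunctor.obj (SimplexCategory.mk 1))) X) := by
  refine ⟨cylinderInj L X (SimplexCategory.δ 1), ?_, ?_⟩
  · rw [tenCounit_cylinderInj]
    refine Relation.EqvGen.rel _ _ ⟨cylinderHomotopy L X,
      map_cylinderHomotopy L X _ _ fun m f τ => intervalMeet_δ_one f τ, ?_⟩
    have h := map_cylinderHomotopy L X (SimplexCategory.δ 0) (𝟙 _)
      fun m f τ => intervalMeet_δ_zero f τ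
    rw [CategoryTheory.Functor.map_id, CategoryTheory.Functor.map_id, tenMap_id] at h
    exact h
  · rw [cylinderInj_tenCounit]
    exact Relation.EqvGen.refl _

variable {L X} {Y : N}

lemma cylinderInj_tenDesc
    {h : L.obj (simplexFunctor.obj (SimplexCategory.mk 1)) ⟶ (X ⟶[V] Y)} {f : X ⟶ Y}
    {k : SimplexCategory.mk 0 ⟶ SimplexCategory.mk 1}
    (hf : L.map (simplexFunctor.map k) ≫ h = toUnitObj L _ ≫ eHomEquiv V f) :
    cylinderInj L X k ≫ tenDesc h = f := by
  apply (eHomEquiv V).injective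
  rw [cylinderInj, eHomEquiv_tenPt_comp, ad_tenDesc, Category.assoc, hf,
    reassoc_of% (zeroPoint_toUnitObj L)]

/-- Weak equivalences are invariant under simplicial homotopy. -/
lemma IsSimpliciallyHomotopic.mem_iff {W : MorphismProperty N} (hW : IsHomotopical W)
    (hL : simplicialHomotopyEquivalences L N ≤ W) {f g : X ⟶ Y} (h : IsSimpliciallyHomotopic L f g) :
    W f ↔ W g := by
  -- The ends of the cylinder are sections of its projection, which is a simplicial homotopy
  -- equivalence.
  have hk : ∀ k, W (cylinderInj L X k) := fun k =>
    hW.of_postcomp (hL _ (tenCounit_mem_simplicialHomotopyEquivalences L X))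
      (by rw [cylinderInj_tenCounit]; exact hW.id_mem X)
  -- Each end of a homotopy is the inclusion of an end of the cylinder followed by `tenDesc h`. So
  -- it is a weak equivalence exactly when `tenDesc h` is, whichever end is taken.
  have key : ∀ {h : L.obj (simplexFunctor.obj (SimplexCategory.mk 1)) ⟶ (X ⟶[V] Y)} {f : X ⟶ Y}
      {k : SimplexCategory.mk 0 ⟶ SimplexCategory.mk 1}
      (_ : L.map (simplexFunctor.map k) ≫ h = toUnitObj L _ ≫ eHomEquiv V f),
      W f ↔ W (tenDesc h) := by
    intro h f k hf
    rw [← cylinderInj_tenDesc hf]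
    exact ⟨fun h => hW.of_precomp (hk k) h, fun h => hW.comp (hk k) h⟩
  induction h with
  | rel f g h =>
    obtain ⟨u, h₁, h₂⟩ := h
    exact (key h₁).trans (key h₂).symm
  | refl f => exact Iff.rfl
  | symm _ _ _ h => exact h.symm
  | trans _ _ _ _ _ h h' => exact h.trans h'

end Cylinder

/-! ### The derived tensor and cotensor products -/

section Deformations

variable {V : Type u₁} [Category.{v} V] [MonoidalCategory V] [SymmetricCategory V]
  [MonoidalClosed V] {D : Type v} [EnrichedCategory V D]

lemma IsHomotopical.objectwise {N : Type u₂} [Category.{v} N] [EnrichedOrdinaryCategory V N]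
    {W : MorphismProperty N} (hW : IsHomotopical W) :
    IsHomotopical (EnrichedBar.objectwise V D W) where
  id_mem X d := hW.id_mem (X.obj d)
  two_out_of_six f g h h₁ h₂ := by
    have H := fun d => hW.two_out_of_six (f.app d) (g.app d) (h.app d) (h₁ d) (h₂ d)
    exact ⟨fun d => (H d).1, fun d => (H d).2.1, fun d => (H d).2.2.1, fun d => (H d).2.2.2⟩

section

variable {C : Type*} [Category* C] {E : Type*} [Category* E] {W : MorphismProperty C}
  {W' : MorphismProperty E} {P : ObjectProperty C} {P' : ObjectProperty E}

/-- The product of two left deformations. -/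
def LeftDeformation.prod (q : LeftDeformation W P) (q' : LeftDeformation W' P') :
    LeftDeformation (W.prod W') (prodProperty P P') where
  Q := q.Q.prod q'.Q
  q :=
    { app := fun X => Prod.mkHom (q.q.app X.1) (q'.q.app X.2)
      naturality := fun _ _ f => Prod.ext (q.q.naturality f.1) (q'.q.naturality f.2) }
  weq X := ⟨q.weq X.1, q'.weq X.2⟩
  mem X := ⟨q.mem X.1, q'.mem X.2⟩

/-- The product of the opposite of a left deformation and a right deformation. -/
def RightDeformation.prod (q : LeftDeformation W P) (r : RightDeformation W' P') :
    RightDeformation (W.op.prod W') (prodProperty (opProperty P) P') where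
  R := q.Q.op.prod r.R
  r :=
    { app := fun X => (Prod.mkHom (q.q.app X.1.unop).op (r.r.app X.2) :
        X ⟶ (Opposite.op (q.Q.obj X.1.unop), r.R.obj X.2))
      naturality := fun _ _ f => Prod.ext
        (congrArg Quiver.Hom.op (q.q.naturality f.1.unop)).symm (r.r.naturality f.2) }
  weq X := ⟨q.weq X.1.unop, r.weq X.2⟩
  mem X := ⟨q.mem X.1.unop, r.mem X.2⟩

/-- A left deformation followed by a left resolution. -/
def LeftDeformation.comp (hW : IsHomotopical W) (q : LeftDeformation W P) {P₁ : ObjectProperty C}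
    {K : C ⥤ C} (k : K ⟶ 𝟭 C) (hk : ∀ X, P X → W (k.app X)) (hK : ∀ X, P X → P₁ (K.obj X)) :
    LeftDeformation W P₁ where
  Q := q.Q ⋙ K
  q := Functor.whiskerLeft q.Q k ≫ q.q
  weq X := hW.comp (hk _ (q.mem X)) (q.weq X)
  mem X := hK _ (q.mem X)

/-- A right deformation followed by a right resolution. -/
def RightDeformation.comp (hW : IsHomotopical W) (r : RightDeformation W P) {P₁ : ObjectProperty C}
    {K : C ⥤ C} (k : 𝟭 C ⟶ K) (hk : ∀ X, P X → W (k.app X)) (hK : ∀ X, P X → P₁ (K.obj X)) :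
    RightDeformation W P₁ where
  R := r.R ⋙ K
  r := r.r ≫ Functor.whiskerLeft r.R k
  weq X := hW.comp (r.weq X) (hk _ (r.mem X))
  mem X := hK _ (r.mem X)

lemma IsHomotopicalOn.mono {T : C ⥤ E} {P P' : ObjectProperty C} (h : IsHomotopicalOn W W' T P')
    (hP : ∀ X, P X → P' X) : IsHomotopicalOn W W' T P :=
  fun _ _ f hX hY hf => h f (hP _ hX) (hP _ hY) hf

/-- The product of the identity functor and a left resolution. -/
def leftResolutionProd {K : E ⥤ E} (k : K ⟶ 𝟭 E) : (𝟭 C).prod K ⟶ 𝟭 (C × E) where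
  app X := Prod.mkHom (𝟙 X.1) (k.app X.2)
  naturality _ _ f := Prod.ext ((Category.comp_id _).trans (Category.id_comp _).symm)
    (k.naturality f.2)

/-- The product of the identity functor and a right resolution. -/
def rightResolutionProd {K : E ⥤ E} (k : 𝟭 E ⟶ K) : 𝟭 (C × E) ⟶ (𝟭 C).prod K where
  app X := Prod.mkHom (𝟙 X.1) (k.app X.2)
  naturality _ _ f := Prod.ext ((Category.comp_id _).trans (Category.id_comp _).symm)
    (k.naturality f.2)

end

variable (L : SSet.{v} ⥤ V) [L.Monoidal] [L.IsLeftAdjoint]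

/-- The comparison map of a resolution is a weak equivalence. -/
lemma barComparison_barDiagram_mem (t : SimplexTwist) {N : Type u₂} [Category.{v} N]
    [EnrichedOrdinaryCategory V N] [EnrichedBicomplete V N] {W : MorphismProperty N}
    (hW : IsHomotopical W) (hL : simplicialHomotopyEquivalences L N ≤ W) (G : RightModule V D)
    (F : VFun V D N)
    (h : W ((bar (t.cosimplicial L) D N).map (X := (G, barDiagram (t.cosimplicial L) F))
      (Y := (G, F)) (Prod.mkHom (𝟙 G) (barCounit (t.augmentation L) F)))) :
    W ((barComparison (t.augmentation L)).app (G, barDiagram (t.cosimplicial L) F)) :=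
  -- Homotopy invariance exchanges the comparison map followed by `core` for the map induced by the
  -- augmentation; the isomorphism `core` is then cancelled.
  hW.of_postcomp (hW.of_isIso (core (t.cosimplicial L) G F))
    (((isSimpliciallyHomotopic_comparison_core t L G F).mem_iff hW hL).2 h)

variable {M : Type u₂} [Category.{v} M] [EnrichedOrdinaryCategory V M] [EnrichedBicomplete V M]
  [HasLimits V] [HasColimits V]
  {WV : MorphismProperty V} {WM : MorphismProperty M}

/-! ### The derived tensor product of functors -/

section Tensor

variable (D M) in
/-- The resolution `B(D, D, F) ⟶ F` in the second variable. -/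
def barResolutionNat : (𝟭 (VFun V Dᵒᵖ V)).prod (barDiagramFunctor (D := D) (N := M) (cosimplicial L)) ⟶
    𝟭 (VFun V Dᵒᵖ V × VFun V D M) :=
  leftResolutionProd (barCounitNat (augmentation L))

variable {L} {VQ : ObjectProperty V} {MQ : ObjectProperty M}

lemma barCounit_objectwise (hM : simplicialHomotopyEquivalences L M ≤ WM) (F : VFun V D M) :
    objectwise V D WM (barCounit (augmentation L) F) := fun d =>
  hM _ (barCounit_mem_simplicialHomotopyEquivalences SimplexTwist.refl L F d)

/-- The augmentation of the resolution is a weak equivalence between good diagrams, by `bar_right`,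
so `B(G, D, -)` takes it to a weak equivalence; the join homotopy transfers this to the comparison
map. For the trivial twist the cosimplicial object is the canonical one by definition. -/
lemma GoodForTensor.barToTensor_mem (hg : GoodForTensor L D WV WM VQ MQ) (hWV : IsHomotopical WV)
    (hWM : IsHomotopical WM) (hM : simplicialHomotopyEquivalences L M ≤ WM)
    (X : VFun V Dᵒᵖ V × VFun V D M)
    (hX : prodProperty (diagramsIn V Dᵒᵖ VQ) (diagramsIn V D MQ) X) :
    WM ((barToTensor L D M).app (X.1, barResolution L X.2)) := by
  have h := hg.homotopical (X := (X.1, barResolution L X.2)) (Y := X)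
    (Prod.mkHom (𝟙 X.1) (barCounit (augmentation L) X.2)) ⟨hX.1, hg.bar_right _ hX.2⟩ hX
    ⟨hWV.objectwise.id_mem _, barCounit_objectwise hM X.2⟩
  exact barComparison_barDiagram_mem L SimplexTwist.refl hWM hM (presheafModule.obj X.1) X.2 h

/-- The deformation in the second variable is a good replacement followed by its bar resolution. The
pairs with second component in `barImage` are isomorphic to values of the resolution at good pairs,
where the formal criterion applies. -/
theorem GoodForTensor.isLeftDeformationRetractFor (hg : GoodForTensor L D WV WM VQ MQ)
    (hWV : IsHomotopical WV) (hWM : IsHomotopical WM)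
    (hM : simplicialHomotopyEquivalences L M ≤ WM)
    (QV : LeftDeformation (objectwise V Dᵒᵖ WV) (diagramsIn V Dᵒᵖ VQ))
    (QM : LeftDeformation (objectwise V D WM) (diagramsIn V D MQ)) :
    IsLeftDeformationRetractFor ((objectwise V Dᵒᵖ WV).prod (objectwise V D WM)) WM
      (tensorFunctor V D M) (prodProperty (diagramsIn V Dᵒᵖ VQ) (barImage L MQ)) := by
  refine ⟨⟨QV.prod (QM.comp hWM.objectwise (barCounitNat (augmentation L))
    (fun F _ => barCounit_objectwise hM F) fun F hF => ⟨F, hF, ⟨Iso.refl _⟩⟩)⟩, ?_⟩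
  refine (isHomotopicalOn_of_leftResolution (barToTensor L D M)
    (K := (𝟭 (VFun V Dᵒᵖ V)).prod (barDiagramFunctor (cosimplicial L)))
    (hWV.objectwise.prod hWM.objectwise) hWM hg.homotopical
    (fun X hX => ⟨hX.1, hg.bar_right _ hX.2⟩) (hg.barToTensor_mem hWV hWM hM)).mono ?_
  rintro X ⟨h₁, F, hF, ⟨i⟩⟩
  exact ⟨(X.1, F), ⟨h₁, hF⟩, ⟨Iso.prod (Iso.refl X.1) i⟩⟩

theorem GoodForTensor.isLeftDerived (hg : GoodForTensor L D WV WM VQ MQ)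
    (hWV : IsHomotopical WV) (hWM : IsHomotopical WM)
    (hM : simplicialHomotopyEquivalences L M ≤ WM)
    (QV : LeftDeformation (objectwise V Dᵒᵖ WV) (diagramsIn V Dᵒᵖ VQ))
    (QM : LeftDeformation (objectwise V D WM) (diagramsIn V D MQ)) :
    IsLeftDerived ((objectwise V Dᵒᵖ WV).prod (objectwise V D WM)) WM (tensorFunctor V D M)
      (QV.Q.prod QM.Q ⋙ barFunctor L D M) (correctedLeft (barToTensor L D M) QV QM) :=
  isLeftDerived_of_leftResolution (barToTensor L D M) (barResolutionNat D L M)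
    (hWV.objectwise.prod hWM.objectwise) hg.homotopical
    (fun X hX => ⟨hX.1, hg.bar_right _ hX.2⟩)
    (fun X _ => ⟨hWV.objectwise.id_mem _, barCounit_objectwise hM X.2⟩)
    (hg.barToTensor_mem hWV hWM hM) (QV.prod QM) _ (fun _ => rfl)

end Tensor

/-! ### The derived cotensor product, through opposite categories -/

section Cotensor

/-- The natural transformation opposite to one between opposite diagrams. -/
def unopDiagramMap {A B : VFun V Dᵒᵖ Mᵒᵖ} (f : A ⟶ B) : B.unop ⟶ A.unop where
  app d := (f.app (op d)).unop
  naturality a b := by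
    have h := f.naturality (op b) (op a)
    refine Eq.trans (congrArg (fun t => _ ≫ t) ?_) (h.symm.trans (congrArg (fun t => _ ≫ t) ?_))
    · exact (eHomWhiskerRight_op _ _).symm
    · exact eHomWhiskerLeft_op _ _

variable (D M) in
/-- The functor `F ↦ C(D, D, F)`. -/
def cobarDiagramFunctor : VFun V D M ⥤ VFun V D M where
  obj F := cobarResolution L F
  map f := unopDiagramMap ((barDiagramFunctor (cosimplicialRev L)).map (opDiagram.map f.op))
  map_id F := by
    ext d
    have h := (barDiagramFunctor (cosimplicialRev L)).map_id F.op
    exact congrArg (fun t => (t.app (op d)).unop) h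
  map_comp f g := by
    ext d
    have h := (barDiagramFunctor (cosimplicialRev L)).map_comp (opDiagram.map g.op)
      (opDiagram.map f.op)
    exact congrArg (fun t => (t.app (op d)).unop) h

/-- The map `F ⟶ C(D, D, F)`. -/
def cobarUnit (F : VFun V D M) : F ⟶ cobarResolution L F :=
  unopDiagramMap (barCounit (augmentationRev L) F.op)

variable (D M) in
/-- The natural map `F ⟶ C(D, D, F)`. -/
def cobarUnitNat : 𝟭 _ ⟶ cobarDiagramFunctor D L M where
  app F := cobarUnit L F
  naturality F F' f := by
    ext d
    have h := (barCounitNat (augmentationRev L)).naturality (opDiagram.map f.op)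
    exact congrArg (fun t => (t.app (op d)).unop) h.symm

variable (D M) in
/-- The resolution `F ⟶ C(D, D, F)` in the second variable. -/
def cobarResolutionNat : 𝟭 ((VFun V D V)ᵒᵖ × VFun V D M) ⟶
    (𝟭 (VFun V D V)ᵒᵖ).prod (cobarDiagramFunctor D L M) :=
  rightResolutionProd (cobarUnitNat D L M)

variable {L} {VQ : ObjectProperty V} {MR : ObjectProperty M}

lemma cobarUnit_objectwise (hM : simplicialHomotopyEquivalences L M ≤ WM) (F : VFun V D M) :
    objectwise V D WM (cobarUnit L F) := fun d =>
  hM _ (simplicialHomotopyEquivalences_unop L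
    (barCounit_mem_simplicialHomotopyEquivalences SimplexTwist.rev L F.op (op d)))

/-- In `Mᵒᵖ` over `Dᵒᵖ` the map `F ⟶ C(D, D, F)` is the augmentation of a bar resolution and a
covariant `G` is a presheaf. The statement is therefore `barComparison_barDiagram_mem` for the
opposite weak equivalences, with the reversing twist matching the reversed cosimplicial object of
the cobar construction. -/
lemma GoodForCotensor.cotensorToCobar_mem (hg : GoodForCotensor L D WV WM VQ MR)
    (hWV : IsHomotopical WV) (hWM : IsHomotopical WM)
    (hM : simplicialHomotopyEquivalences L M ≤ WM) (X : (VFun V D V)ᵒᵖ × VFun V D M)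
    (hX : prodProperty (opProperty (diagramsIn V D VQ)) (diagramsIn V D MR) X) :
    WM ((cotensorToCobar L D M).app (X.1, cobarResolution L X.2)) := by
  have h := hg.homotopical (X := X) (Y := (X.1, cobarResolution L X.2))
    (Prod.mkHom (𝟙 X.1) (cobarUnit L X.2)) hX ⟨hX.1, hg.cobar_right _ hX.2⟩
    ⟨hWV.objectwise.id_mem _, cobarUnit_objectwise hM X.2⟩
  exact barComparison_barDiagram_mem L SimplexTwist.rev hWM.op
    (fun _ _ f hf => hM _ (simplicialHomotopyEquivalences_unop L hf))
    (copresheafModule.obj X.1.unop) X.2.op h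

theorem GoodForCotensor.isRightDeformationRetractFor (hg : GoodForCotensor L D WV WM VQ MR)
    (hWV : IsHomotopical WV) (hWM : IsHomotopical WM)
    (hM : simplicialHomotopyEquivalences L M ≤ WM)
    (QV : LeftDeformation (objectwise V D WV) (diagramsIn V D VQ))
    (RM : RightDeformation (objectwise V D WM) (diagramsIn V D MR)) :
    IsRightDeformationRetractFor ((objectwise V D WV).op.prod (objectwise V D WM)) WM
      (cotensorFunctor V D M)
      (prodProperty (opProperty (diagramsIn V D VQ)) (cobarImage L MR)) := by
  refine ⟨⟨RightDeformation.prod QV (RM.comp hWM.objectwise (cobarUnitNat D L M)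
    (fun F _ => cobarUnit_objectwise hM F) fun F hF => ⟨F, hF, ⟨Iso.refl _⟩⟩)⟩, ?_⟩
  refine (isHomotopicalOn_of_rightResolution (cotensorToCobar L D M)
    (K := (𝟭 (VFun V D V)ᵒᵖ).prod (cobarDiagramFunctor D L M))
    (hWV.objectwise.op.prod hWM.objectwise) hWM hg.homotopical
    (fun X hX => ⟨hX.1, hg.cobar_right _ hX.2⟩) (hg.cotensorToCobar_mem hWV hWM hM)).mono ?_
  rintro X ⟨h₁, F, hF, ⟨i⟩⟩
  exact ⟨(X.1, F), ⟨h₁, hF⟩, ⟨Iso.prod (Iso.refl X.1) i⟩⟩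

theorem GoodForCotensor.isRightDerived (hg : GoodForCotensor L D WV WM VQ MR)
    (hWV : IsHomotopical WV) (hWM : IsHomotopical WM)
    (hM : simplicialHomotopyEquivalences L M ≤ WM)
    (QV : LeftDeformation (objectwise V D WV) (diagramsIn V D VQ))
    (RM : RightDeformation (objectwise V D WM) (diagramsIn V D MR)) :
    IsRightDerived ((objectwise V D WV).op.prod (objectwise V D WM)) WM (cotensorFunctor V D M)
      (QV.Q.op.prod RM.R ⋙ cobarFunctor L D M)
      (correctedRight (cotensorToCobar L D M) QV RM) :=
  isRightDerived_of_rightResolution (cotensorToCobar L D M) (cobarResolutionNat D L M)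
    (hWV.objectwise.op.prod hWM.objectwise) hg.homotopical
    (fun X hX => ⟨hX.1, hg.cobar_right _ hX.2⟩)
    (fun X _ => ⟨hWV.objectwise.id_mem _, cobarUnit_objectwise hM X.2⟩)
    (hg.cotensorToCobar_mem hWV hWM hM) (RightDeformation.prod QV RM) _ (fun _ => rfl)

end Cotensor

end Deformations

end EnrichedBar

end

theorem mainTheorem3 {V : Type u₁} [Category.{v} V] [MonoidalCategory V] [SymmetricCategory V]
    [MonoidalClosed V] [HasLimits V] [HasColimits V]
    (L : SSet.{v} ⥤ V) [L.Monoidal] [L.IsLeftAdjoint]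
    {M : Type u₂} [Category.{v} M] [EnrichedOrdinaryCategory V M]
    [EnrichedBar.EnrichedBicomplete V M]
    {D : Type v} [EnrichedCategory V D]
    (WV : MorphismProperty V) (hWV : EnrichedBar.IsHomotopical WV)
    (WM : MorphismProperty M) (hWM : EnrichedBar.IsHomotopical WM)
    (hV : EnrichedBar.simplicialHomotopyEquivalences L V ≤ WV)
    (hM : EnrichedBar.simplicialHomotopyEquivalences L M ≤ WM) :
    (∀ (VQ : ObjectProperty V) (MQ : ObjectProperty M),
      EnrichedBar.GoodForTensor L D WV WM VQ MQ →
      EnrichedBar.IsLeftDeformationRetract (EnrichedBar.objectwise V Dᵒᵖ WV)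
        (EnrichedBar.diagramsIn V Dᵒᵖ VQ) →
      EnrichedBar.IsLeftDeformationRetract (EnrichedBar.objectwise V D WM)
        (EnrichedBar.diagramsIn V D MQ) →
      EnrichedBar.IsLeftDeformationRetractFor
        ((EnrichedBar.objectwise V Dᵒᵖ WV).prod (EnrichedBar.objectwise V D WM)) WM
        (EnrichedBar.tensorFunctor V D M)
        (EnrichedBar.prodProperty (EnrichedBar.diagramsIn V Dᵒᵖ VQ) (EnrichedBar.barImage L MQ)) ∧
      ∀ (QV : EnrichedBar.LeftDeformation (EnrichedBar.objectwise V Dᵒᵖ WV)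
          (EnrichedBar.diagramsIn V Dᵒᵖ VQ))
        (QM : EnrichedBar.LeftDeformation (EnrichedBar.objectwise V D WM)
          (EnrichedBar.diagramsIn V D MQ)),
        EnrichedBar.IsLeftDerived
          ((EnrichedBar.objectwise V Dᵒᵖ WV).prod (EnrichedBar.objectwise V D WM)) WM
          (EnrichedBar.tensorFunctor V D M) (QV.Q.prod QM.Q ⋙ EnrichedBar.barFunctor L D M)
          (EnrichedBar.correctedLeft (EnrichedBar.barToTensor L D M) QV QM)) ∧
    (∀ (VQ : ObjectProperty V) (MR : ObjectProperty M),
      EnrichedBar.GoodForCotensor L D WV WM VQ MR →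
      EnrichedBar.IsLeftDeformationRetract (EnrichedBar.objectwise V D WV)
        (EnrichedBar.diagramsIn V D VQ) →
      EnrichedBar.IsRightDeformationRetract (EnrichedBar.objectwise V D WM)
        (EnrichedBar.diagramsIn V D MR) →
      EnrichedBar.IsRightDeformationRetractFor
        ((EnrichedBar.objectwise V D WV).op.prod (EnrichedBar.objectwise V D WM)) WM
        (EnrichedBar.cotensorFunctor V D M)
        (EnrichedBar.prodProperty (EnrichedBar.opProperty (EnrichedBar.diagramsIn V D VQ))
          (EnrichedBar.cobarImage L MR)) ∧
      ∀ (QV : EnrichedBar.LeftDeformation (EnrichedBar.objectwise V D WV)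
          (EnrichedBar.diagramsIn V D VQ))
        (RM : EnrichedBar.RightDeformation (EnrichedBar.objectwise V D WM)
          (EnrichedBar.diagramsIn V D MR)),
        EnrichedBar.IsRightDerived
          ((EnrichedBar.objectwise V D WV).op.prod (EnrichedBar.objectwise V D WM)) WM
          (EnrichedBar.cotensorFunctor V D M)
          (QV.Q.op.prod RM.R ⋙ EnrichedBar.cobarFunctor L D M)
          (EnrichedBar.correctedRight (EnrichedBar.cotensorToCobar L D M) QV RM)) :=
  -- The retract hypotheses provide one choice of deformations for the first assertion; the derived
  -- functor statement holds for arbitrary ones.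
  ⟨fun _ _ hg hV' hM' => ⟨hg.isLeftDeformationRetractFor hWV hWM hM hV'.some hM'.some,
      hg.isLeftDerived hWV hWM hM⟩,
    fun _ _ hg hV' hM' => ⟨hg.isRightDeformationRetractFor hWV hWM hM hV'.some hM'.some,
      hg.isRightDerived hWV hWM hM⟩⟩
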